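/- **Setting.** Let $M$ be a smooth (Hausdorff) manifold of dimension 4 without boundary, and let $\Delta=\mathrm{span}\{X_1,X_2\}$ be a rank-two distribution on $M$ spanned by smooth vector fields $X_1,X_2$. We say that $(X_1,X_2)$ defines a *regular Engel structure* if, at every point, $X_1,X_2,[X_1,X_2]$ are linearly independent, $[[X_1,X_2],X_2]\notin\mathrm{span}\{X_1,X_2,[X_1,X_2]\}$, and there are smooth functions $\beta,\alpha^0,\alpha^1$ on $M$ with $$[X_1,[X_1,X_2]]=\beta X_1+\alpha^0X_2+\alpha^1[X_1,X_2].$$ Endow $\Delta$ with the metric for which $X_1,X_2$ are orthonormal. Let $s>0$ and let $\gamma:[0,s]\to M$ be an integral curve of $X_1$. For $v=(v_1,v_2)\in L^2([0,s],\mathbb R^2)$ near $0$ let $F_s(v)=x(s)$, where $\dot x=(1+v_1)X_1(x)+v_2X_2(x)$ a.e. and $x(0)=\gamma(0)$; let $J_s(v)=\frac12\int_0^s(1+v_1)^2+v_2^2\,dt$ and $\mathcal F_s=(F_s,J_s)$. The curve $\gamma$ is *strictly singular* if every covector $(\lambda,\lambda_0)\in T^*_{\gamma(s)}M\times\mathbb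 R$ that annihilates the image of $d_0\mathcal F_s$ has $\lambda_0=0$. *Conjugate points.* Let $G$ be $F_s$ or $\mathcal F_s$, and let $\xi\neq0$ be a covector that annihilates the image of $d_0G$ (unique up to a factor in the cases below). Embed $L^2([0,s],\mathbb R^2)$ densely in $L^2([0,s])\oplus\mathbb R\oplus L^2([0,s])$ by $(v_1,v_2)\mapsto(v_1,w(s),w)$, $w(t)=\int_0^tv_2$. Let $d_0\mathring G$ be the continuous extension of $d_0G$ and let $\xi\mathrm{He}_0\mathring G$ be the continuous extension, to $\ker d_0\mathring G$, of the Hessian form $\xi\mathrm{He}_0G$ on $\ker d_0G$. Then $\gamma(s)$ is *conjugate along $\gamma$ for $G$* if $Z_1=\{(v,0,0):\int_0^sv\,dt=0\}$ is a proper subspace of the kernel of $\xi\mathrm{He}_0\mathring G$. Put $g_t^s=e^{(s-t)X_1}_*X_2$, $\beta_t=\beta(\gamma(t))$, $\alpha^1_t=\alpha^1(\gamma(t))$. **Theorem.** 1. Let $(X_1,X_2)$ define a regular Engel structure on $M$, let $s>0$, and let $\gamma:[0,s]\to M$ be an integral curve of $X_1$. Then $\gamma(s)$ is conjugate along $\gamma$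 for $F_s$ if and only if $$X_1(\gamma(s))\wedge X_2(\gamma(s))\wedge g_0^s(\gamma(s))=0.$$ If moreover $\gamma$ is strictly singular on $[0,s]$, then $\gamma(s)$ is conjugate along $\gamma$ for $\mathcal F_s$ if and only if $$X_2(\gamma(s))\wedge g_0^s(\gamma(s))\wedge\int_0^s\beta_t\,e^{-\int_0^t\alpha^1_\tau d\tau}\,g_t^s(\gamma(s))\,dt=0.$$ 2. Let $M=SO(3)\times\mathbb R$, let $T_1,T_2,T_3$ be the standard generators of $\mathfrak{so}(3)$ (so $[T_1,T_2]=T_3$ and cyclically), and let $X_1,X_2$ be the left-invariant vector fields on $M$ that extend $\frac1{\sqrt2}\big((T_1+T_2)\oplus2\big)$ and $\frac1{\sqrt2}(T_1\oplus1)$. They define a regular Engel structure with $[X_1,[X_1,X_2]]=\frac12X_1-X_2$. For every $s>0$ and every integral curve $\gamma:[0,s]\to M$ of $X_1$: $\gamma$ is strictly singular; $\gamma(s)$ is conjugate for $F_s$ if and only if $\sin s=0$; and $\gamma(s)$ is conjugate for $\mathcal F_s$ if and only if $s\sin s+2(\cos s-1)=0$. -/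

import Mathlib

open MeasureTheory Set Filter Asymptotics
open scoped Manifold ContDiff Topology

namespace RankTwo
noncomputable section

/-! ### Regular Engel structures, flows and push-forwards -/

section Geometry

variable {E : Type*} [NormedAddCommGroup E] [NormedSpace ℝ E]
  {H : Type*} [TopologicalSpace H] (I : ModelWithCorners ℝ E H)
  {M : Type*} [TopologicalSpace M] [ChartedSpace H M]

/-- The frame `X₁, X₂` of smooth vector fields spans a regular rank-two structure on the
four-dimensional manifold `M`: the fields `X₁, X₂, [X₁, X₂]` are pointwise independent,
`[X₁, [X₁, X₂]] = β X₁ + α⁰ X₂ + α¹ [X₁, X₂]` with smooth coefficients, and `[[X₁, X₂], X₂]` is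
nowhere in the span of `X₁, X₂, [X₁, X₂]`. -/
structure IsRegularEngel [IsManifold I ∞ M] (X₁ X₂ : (x : M) → TangentSpace I x)
    (β α₀ α₁ : M → ℝ) : Prop where
  dim : Module.finrank ℝ E = 4
  smooth_X₁ : ContMDiff I I.tangent ∞ fun x => (⟨x, X₁ x⟩ : TangentBundle I M)
  smooth_X₂ : ContMDiff I I.tangent ∞ fun x => (⟨x, X₂ x⟩ : TangentBundle I M)
  smooth_β : ContMDiff I 𝓘(ℝ, ℝ) ∞ β
  smooth_α₀ : ContMDiff I 𝓘(ℝ, ℝ) ∞ α₀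
  smooth_α₁ : ContMDiff I 𝓘(ℝ, ℝ) ∞ α₁
  independent : ∀ x, LinearIndependent ℝ
    ![X₁ x, X₂ x, VectorField.mlieBracket I X₁ X₂ x]
  structure_eq : ∀ x,
    VectorField.mlieBracket I X₁ (VectorField.mlieBracket I X₁ X₂) x =
      β x • X₁ x + α₀ x • X₂ x + α₁ x • VectorField.mlieBracket I X₁ X₂ x
  transversal : ∀ x,
    VectorField.mlieBracket I (VectorField.mlieBracket I X₁ X₂) X₂ x ∉
      Submodule.span ℝ {X₁ x, X₂ x, VectorField.mlieBracket I X₁ X₂ x}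

open Classical in
/-- The flow `e^{tX}` of the vector field `X`: the value at time `t` of the integral curve that
starts at `x`, and `x` itself where that curve does not exist up to time `t`. -/
def flow (X : (x : M) → TangentSpace I x) (t : ℝ) (x : M) : M :=
  if h : ∃ c : ℝ → M, c 0 = x ∧ IsMIntegralCurveOn (I := I) c X (uIcc 0 t) then h.choose t else x

/-- The push-forward `e^{tX}_* Y`, i.e. the pull-back of `Y` by the inverse flow `e^{-tX}`. -/
def pushforward (X : (x : M) → TangentSpace I x) (t : ℝ) (Y : (x : M) → TangentSpace I x) (x : M) :
    TangentSpace I x :=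
  VectorField.mpullback I I (flow I X (-t)) Y x

/-- The field `g_t^s = e^{(s-t)X₁}_* X₂`, evaluated at `x`. -/
def gField (X₁ X₂ : (x : M) → TangentSpace I x) (s t : ℝ) (x : M) : TangentSpace I x :=
  pushforward I X₁ (s - t) X₂ x

/-- The vector `∫₀ˢ β_t e^{-∫₀ᵗ α¹} g_t^s dt` of the tangent space at `γ(s)`. -/
def weightedIntegral (X₁ X₂ : (x : M) → TangentSpace I x) (β α₁ : M → ℝ) (γ : ℝ → M) (s : ℝ) :
    TangentSpace I (γ s) :=
  (∫ t in (0 : ℝ)..s, (β (γ t) * Real.exp (-∫ τ in (0 : ℝ)..t, α₁ (γ τ))) •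
    (gField I X₁ X₂ s t (γ s) : E) : E)

/-! ### The endpoint maps -/

/-- `L²([0,s], ℝ)`. -/
abbrev L2 (s : ℝ) : Type := Lp ℝ 2 ((volume : Measure ℝ).restrict (Icc 0 s))

/-- The derivative `Xf` of a function `f` along a vector field `X`. -/
def fieldDeriv (X : (x : M) → TangentSpace I x) (f : M → ℝ) (x : M) : ℝ :=
  mfderiv I 𝓘(ℝ, ℝ) f x (X x)

/-- `x` is the horizontal curve on `[0,s]` with control `v`: a solution of
`ẋ = (1 + v₁) X₁(x) + v₂ X₂(x)` a.e., `x(0) = x₀`. The equation is tested against smooth functions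
`f`: each `f ∘ x` is absolutely continuous with derivative `(1 + v₁) X₁f(x) + v₂ X₂f(x)`. -/
structure IsTrajectory (X₁ X₂ : (x : M) → TangentSpace I x) (x₀ : M) (s : ℝ) (v : L2 s × L2 s)
    (x : ℝ → M) : Prop where
  start : x 0 = x₀
  continuousOn : ContinuousOn x (Icc 0 s)
  equation : ∀ f : M → ℝ, ContMDiff I 𝓘(ℝ, ℝ) ∞ f → ∀ t ∈ Icc 0 s,
    f (x t) = f x₀ + ∫ τ in (0 : ℝ)..t,
      ((1 + v.1 τ) * fieldDeriv I X₁ f (x τ) + v.2 τ * fieldDeriv I X₂ f (x τ))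

open Classical in
/-- The endpoint map `F_s`, in the coordinates `v` on horizontal curves starting at `x₀` (the control
`0` is the integral curve of `X₁`); the value is `x₀` where the trajectory does not exist. -/
def endpointMap (X₁ X₂ : (x : M) → TangentSpace I x) (x₀ : M) (s : ℝ) (v : L2 s × L2 s) : M :=
  if h : ∃ x, IsTrajectory I X₁ X₂ x₀ s v x then h.choose s else x₀

/-- The energy `J_s` for the metric that makes `X₁, X₂` orthonormal. -/
def energy (s : ℝ) (v : L2 s × L2 s) : ℝ :=
  (1 / 2) * ∫ t in (0 : ℝ)..s, ((1 + v.1 t) ^ 2 + v.2 t ^ 2)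

/-- The extended endpoint map `𝓕_s = (F_s, J_s)`. -/
def extendedEndpointMap (X₁ X₂ : (x : M) → TangentSpace I x) (x₀ : M) (s : ℝ) (v : L2 s × L2 s) :
    M × ℝ :=
  (endpointMap I X₁ X₂ x₀ s v, energy s v)

/-- The integral curve of `X₁` on `[0,s]` is strictly singular: every covector `ξ` that annihilates
the image of `d₀𝓕_s` has vanishing `ℝ`-component. -/
def IsStrictlySingular (X₁ X₂ : (x : M) → TangentSpace I x) (x₀ : M) (s : ℝ) : Prop :=
  ∀ ξ : E × ℝ →L[ℝ] ℝ,
    (∀ v : L2 s × L2 s, ξ (mfderiv 𝓘(ℝ, L2 s × L2 s) (I.prod 𝓘(ℝ, ℝ))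
      (extendedEndpointMap I X₁ X₂ x₀ s) 0 v : E × ℝ) = 0) →
    ∀ r : ℝ, ξ (0, r) = 0

/-! ### Conjugate points -/

/-- `L` and `B` are the first and the second derivative of `G` at `0`, read in the preferred chart
at `G 0`: the second-order Taylor expansion holds. -/
structure HasTaylorExpansion {V : Type*} [NormedAddCommGroup V] [NormedSpace ℝ V]
    (G : V → M) (L : V →L[ℝ] E) (B : V →L[ℝ] V →L[ℝ] E) : Prop where
  continuousAt : ContinuousAt G 0
  symm : ∀ v v', B v v' = B v' v
  expansion : (fun v => extChartAt I (G 0) (G v) - extChartAt I (G 0) (G 0) - L v -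
    (1 / 2 : ℝ) • B v v) =o[𝓝 0] fun v => ‖v‖ ^ 2

/-- The completed space of controls `L² ⊕ ℝ ⊕ L²`, with elements `(v, c, w)`. -/
abbrev CompletedControl (s : ℝ) : Type := L2 s × ℝ × L2 s

/-- `z = (v₁, w(s), w)` with `w(t) = ∫₀ᵗ v₂`: the control `v = (v₁, v₂)` seen in the completion. -/
def Represents {s : ℝ} (v : L2 s × L2 s) (z : CompletedControl s) : Prop :=
  z.1 = v.1 ∧ z.2.1 = ∫ t in (0 : ℝ)..s, v.2 t ∧
    ∀ᵐ t ∂((volume : Measure ℝ).restrict (Icc 0 s)), z.2.2 t = ∫ τ in (0 : ℝ)..t, v.2 τ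

/-- The subspace `Z₁` of the elements `(v, 0, 0)` with `v` of mean zero. -/
def meanZero (s : ℝ) : Set (CompletedControl s) :=
  {z | ∫ t in (0 : ℝ)..s, z.1 t = 0 ∧ z.2.1 = 0 ∧ z.2.2 = 0}

/-- The kernel of a bilinear form `Q` that is defined on the subspace `ker D`. -/
def formKernel {s : ℝ} (D : CompletedControl s →L[ℝ] E)
    (Q : D.ker →L[ℝ] D.ker →L[ℝ] ℝ) : Set (CompletedControl s) :=
  {z | ∃ hz : z ∈ D.ker, ∀ y : D.ker, Q ⟨z, hz⟩ y = 0}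

/-- The end of the reference curve is a conjugate point for `G`, where `G` is the endpoint map or
the extended endpoint map. Here `L` and `B` are the first and second derivatives of `G` at the
reference control, `D` is the continuous extension of `L` to the completed space of controls,
`ξ` is a nonzero covector that annihilates the image of the differential (unique up to a factor
along a curve of corank one) and `Q` is the continuous extension to `ker D` of the Hessian
`ξ He₀G`, a form on `ker L`. The point is conjugate if `Z₁` is a proper subspace of `ker Q`. -/
def IsConjugate {s : ℝ} (G : L2 s × L2 s → M) : Prop :=
  ∃ (L : L2 s × L2 s →L[ℝ] E) (B : L2 s × L2 s →L[ℝ] L2 s × L2 s →L[ℝ] E)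
    (D : CompletedControl s →L[ℝ] E) (ξ : E →L[ℝ] ℝ) (Q : D.ker →L[ℝ] D.ker →L[ℝ] ℝ),
    HasTaylorExpansion I G L B ∧
    (∀ v z, Represents v z → D z = L v) ∧
    ξ ≠ 0 ∧ (∀ v, ξ (L v) = 0) ∧
    (∀ (v v' : L2 s × L2 s) (z z' : D.ker), Represents v z.1 → Represents v' z'.1 →
      Q z z' = ξ (B v v')) ∧
    meanZero s ⊂ formKernel D Q

end Geometry

/-! ### The manifold `SO(3) × ℝ` -/

/-- The skew-symmetric matrix of the cross product with `a`. -/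
def hat (a : Fin 3 → ℝ) : Matrix (Fin 3) (Fin 3) ℝ :=
  !![0, -a 2, a 1; a 2, 0, -a 0; -a 1, a 0, 0]

abbrev SO3 : Type := Matrix.specialOrthogonalGroup (Fin 3) ℝ

def cayleyDen (a : Fin 3 → ℝ) : ℝ := 1 + a 0 ^ 2 + a 1 ^ 2 + a 2 ^ 2

theorem cayleyDen_pos (a : Fin 3 → ℝ) : 0 < cayleyDen a := by
  unfold cayleyDen; positivity

def cayleyNum (a : Fin 3 → ℝ) : Matrix (Fin 3) (Fin 3) ℝ :=
  !![1 + a 0 ^ 2 - a 1 ^ 2 - a 2 ^ 2, 2 * (a 0 * a 1 - a 2), 2 * (a 0 * a 2 + a 1);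
     2 * (a 0 * a 1 + a 2), 1 - a 0 ^ 2 + a 1 ^ 2 - a 2 ^ 2, 2 * (a 1 * a 2 - a 0);
     2 * (a 0 * a 2 - a 1), 2 * (a 1 * a 2 + a 0), 1 - a 0 ^ 2 - a 1 ^ 2 + a 2 ^ 2]

def cayleyMatrix (a : Fin 3 → ℝ) : Matrix (Fin 3) (Fin 3) ℝ :=
  (cayleyDen a)⁻¹ • cayleyNum a

theorem cayleyMatrix_spec (a : Fin 3 → ℝ) : (1 - hat a) * cayleyMatrix a = 1 + hat a := by
  have h := (cayleyDen_pos a).ne'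
  rw [cayleyMatrix, Matrix.mul_smul, inv_smul_eq_iff₀ h]
  ext i j
  fin_cases i <;> fin_cases j <;>
    simp [hat, cayleyNum, cayleyDen, Matrix.mul_apply, Fin.sum_univ_three] <;> ring

theorem cayleyMatrix_mem (a : Fin 3 → ℝ) :
    cayleyMatrix a ∈ Matrix.specialOrthogonalGroup (Fin 3) ℝ := by
  have h := (cayleyDen_pos a).ne'
  rw [Matrix.mem_specialOrthogonalGroup_iff, Matrix.mem_orthogonalGroup_iff]
  constructor
  · rw [cayleyMatrix, Matrix.transpose_smul, Matrix.smul_mul, Matrix.mul_smul, inv_smul_eq_iff₀ h]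
    rw [inv_smul_eq_iff₀ h]
    ext i j
    fin_cases i <;> fin_cases j <;>
      simp [cayleyNum, cayleyDen, Matrix.mul_apply, Fin.sum_univ_three, Matrix.transpose_apply] <;> ring
  · rw [cayleyMatrix, Matrix.det_smul, Fintype.card_fin, Matrix.det_fin_three]
    rw [inv_pow, inv_mul_eq_iff_eq_mul₀ (pow_ne_zero 3 h)]
    simp [cayleyNum, cayleyDen]
    ring

def cayley (a : Fin 3 → ℝ) : SO3 := ⟨cayleyMatrix a, cayleyMatrix_mem a⟩

def cayleyInv (R : Matrix (Fin 3) (Fin 3) ℝ) : Fin 3 → ℝ :=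
  ![(R 2 1 - R 1 2) / (1 + R.trace), (R 0 2 - R 2 0) / (1 + R.trace),
    (R 1 0 - R 0 1) / (1 + R.trace)]

theorem one_add_trace_cayley (a : Fin 3 → ℝ) :
    1 + (cayleyMatrix a).trace = 4 * (cayleyDen a)⁻¹ := by
  have h := (cayleyDen_pos a).ne'
  simp only [cayleyMatrix, cayleyNum, Matrix.trace_smul, Matrix.trace_fin_three, smul_eq_mul]
  field_simp
  simp [cayleyDen]
  ring

theorem cayleyInv_cayley (a : Fin 3 → ℝ) : cayleyInv (cayleyMatrix a) = a := by
  have h := (cayleyDen_pos a).ne'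
  have h4 := one_add_trace_cayley a
  ext i
  fin_cases i <;> simp [cayleyInv, h4] <;> simp [cayleyMatrix, cayleyNum] <;> field_simp <;> ring

theorem cayley_cayleyInv (R : SO3) (hR : 1 + R.1.trace ≠ 0) : cayley (cayleyInv R.1) = R := by
  obtain ⟨R, hm⟩ := R
  rw [Matrix.mem_specialOrthogonalGroup_iff, Matrix.mem_orthogonalGroup_iff] at hm
  obtain ⟨ho, hd⟩ := hm
  apply Subtype.ext
  change cayleyMatrix (cayleyInv R) = R
  change 1 + R.trace ≠ 0 at hR
  have hadj : R.adjugate = Matrix.transpose R := by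
    have h1 : R.adjugate * R * Matrix.transpose R = R.adjugate := by rw [mul_assoc, ho, mul_one]
    rw [Matrix.adjugate_mul, hd, one_smul, one_mul] at h1
    exact h1.symm
  have hCH : R * R = R.adjugate + R.trace • R - R.adjugate.trace • (1 : Matrix _ _ ℝ) := by
    ext i j
    fin_cases i <;> fin_cases j <;>
      simp [Matrix.adjugate_fin_three, Matrix.mul_apply, Fin.sum_univ_three,
        Matrix.trace_fin_three] <;> ring
  rw [hadj, Matrix.trace_transpose] at hCH
  have hhat : (1 + R.trace) • hat (cayleyInv R) = R - Matrix.transpose R := by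
    ext i j
    fin_cases i <;> fin_cases j <;> simp [hat, cayleyInv] <;> field_simp <;> ring
  have key : hat (cayleyInv R) * (R + 1) = R - 1 := by
    have : (1 + R.trace) • (hat (cayleyInv R) * (R + 1)) = (1 + R.trace) • (R - 1) := by
      rw [← Matrix.smul_mul, hhat]
      have ho' : Matrix.transpose R * R = 1 := by
        have : R * Matrix.transpose R = 1 := ho
        exact mul_eq_one_comm.mp this
      rw [sub_mul, mul_add, mul_add, ho', hCH]
      simp only [mul_one, add_smul, smul_sub, one_smul]
      abel
    exact smul_right_injective _ hR this
  have h1 : (1 - hat (cayleyInv R)) * R = 1 + hat (cayleyInv R) := by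
    have h2 : hat (cayleyInv R) * R = R - 1 - hat (cayleyInv R) := by
      rw [← key]; noncomm_ring
    rw [sub_mul, h2]; noncomm_ring
  have hdet : IsUnit (1 - hat (cayleyInv R)) := by
    rw [Matrix.isUnit_iff_isUnit_det, isUnit_iff_ne_zero]
    have : (1 - hat (cayleyInv R)).det = cayleyDen (cayleyInv R) := by
      generalize cayleyInv R = a
      simp [Matrix.det_fin_three, hat, cayleyDen]; ring
    rw [this]; exact (cayleyDen_pos _).ne'
  exact hdet.mul_left_cancel ((cayleyMatrix_spec _).trans h1.symm)

theorem continuous_cayleyMatrix : Continuous cayleyMatrix := by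
  have h : ∀ a, cayleyDen a ≠ 0 := fun a => (cayleyDen_pos a).ne'
  have hd : Continuous cayleyDen := by unfold cayleyDen; fun_prop
  refine Continuous.smul (hd.inv₀ h) ?_
  refine continuous_matrix fun i j => ?_
  fin_cases i <;> fin_cases j <;> simp [cayleyNum] <;> fun_prop

/-- The Cayley chart of `SO(3)` centred at `Q`. -/
def so3Chart (Q : SO3) : OpenPartialHomeomorph SO3 (Fin 3 → ℝ) where
  toFun A := cayleyInv (Q⁻¹ * A : SO3).1
  invFun a := Q * cayley a
  source := {A | 1 + (Q⁻¹ * A : SO3).1.trace ≠ 0}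
  target := Set.univ
  map_source' _ _ := Set.mem_univ _
  map_target' a _ := by
    change 1 + (Q⁻¹ * (Q * cayley a) : SO3).1.trace ≠ 0
    rw [inv_mul_cancel_left]
    change 1 + (cayleyMatrix a).trace ≠ 0
    rw [one_add_trace_cayley]
    have := cayleyDen_pos a
    positivity
  left_inv' A hA := by
    rw [cayley_cayleyInv _ hA, mul_inv_cancel_left]
  right_inv' a _ := by
    rw [inv_mul_cancel_left]
    exact cayleyInv_cayley a
  open_source := by
    have : Continuous fun A : SO3 => 1 + (Q⁻¹ * A : SO3).1.trace := by
      have h : Continuous fun A : SO3 => (Q⁻¹).1 * A.1 :=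
        continuous_const.matrix_mul continuous_subtype_val
      exact continuous_const.add h.matrix_trace
    exact isOpen_ne_fun this continuous_const
  open_target := isOpen_univ
  continuousOn_toFun := by
    have h : Continuous fun A : SO3 => (Q⁻¹ * A : SO3).1 :=
      continuous_const.matrix_mul continuous_subtype_val
    have ht : Continuous fun A : SO3 => 1 + (Q⁻¹ * A : SO3).1.trace :=
      continuous_const.add h.matrix_trace
    refine continuousOn_pi.2 fun i => ?_
    fin_cases i <;>
      exact ContinuousOn.div
        ((h.matrix_elem _ _).sub (h.matrix_elem _ _)).continuousOn ht.continuousOn fun A hA => hA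
  continuousOn_invFun := by
    refine Continuous.continuousOn (Continuous.subtype_mk ?_ _)
    exact continuous_const.matrix_mul continuous_cayleyMatrix

instance : ChartedSpace (Fin 3 → ℝ) SO3 where
  atlas := Set.range so3Chart
  chartAt := so3Chart
  mem_chart_source A := by
    change 1 + (A⁻¹ * A : SO3).1.trace ≠ 0
    rw [inv_mul_cancel]
    change 1 + (1 : Matrix (Fin 3) (Fin 3) ℝ).trace ≠ 0
    rw [Matrix.trace_one]; norm_num
  chart_mem_atlas A := Set.mem_range_self A

theorem contDiff_cayleyMatrix (i j : Fin 3) :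
    ContDiff ℝ ∞ (fun a => cayleyMatrix a i j) := by
  have h : ∀ a, cayleyDen a ≠ 0 := fun a => (cayleyDen_pos a).ne'
  have hd : ContDiff ℝ ∞ cayleyDen := by unfold cayleyDen; fun_prop
  change ContDiff ℝ ∞ (fun a => (cayleyDen a)⁻¹ * cayleyNum a i j)
  refine (hd.inv h).mul ?_
  fin_cases i <;> fin_cases j <;> simp [cayleyNum] <;> fun_prop

instance : IsManifold 𝓘(ℝ, Fin 3 → ℝ) ∞ SO3 := by
  refine isManifold_of_contDiffOn _ _ _ ?_
  rintro _ _ ⟨P, rfl⟩ ⟨Q, rfl⟩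
  have hent : ∀ i j, ContDiff ℝ ∞ fun a => (Q⁻¹ * (P * cayley a) : SO3).1 i j := by
    intro i j
    have : (fun a => (Q⁻¹ * (P * cayley a) : SO3).1 i j) =
        fun a => ∑ k, (Q⁻¹ * P : SO3).1 i k * cayleyMatrix a k j := by
      funext a
      rw [← mul_assoc]
      exact Matrix.mul_apply
    rw [this]
    exact ContDiff.sum fun k _ => contDiff_const.mul (contDiff_cayleyMatrix k j)
  have htr : ContDiff ℝ ∞ fun a => 1 + (Q⁻¹ * (P * cayley a) : SO3).1.trace := by
    simp only [Matrix.trace_fin_three]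
    exact contDiff_const.add (((hent 0 0).add (hent 1 1)).add (hent 2 2))
  refine contDiffOn_pi.2 fun i => ?_
  fin_cases i <;>
    exact ContDiffOn.div ((hent _ _).sub (hent _ _)).contDiffOn htr.contDiffOn fun a ha => ha.1.2

/-- The element of the tangent space of `SO(3)` at the identity given by the skew-symmetric matrix
`hat a`; the factor `1/2` is the one of the Cayley chart, see `mfderiv_entry_so3Vec`. -/
def so3Vec (a : Fin 3 → ℝ) : TangentSpace 𝓘(ℝ, Fin 3 → ℝ) (1 : SO3) := (1 / 2 : ℝ) • a

theorem mfderiv_entry_so3Vec (a : Fin 3 → ℝ) (i j : Fin 3) :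
    mfderiv 𝓘(ℝ, Fin 3 → ℝ) 𝓘(ℝ, ℝ) (fun A : SO3 => A.1 i j) 1 (so3Vec a) = hat a i j := by
  have hcay : ∀ i j, HasFDerivAt (fun b => cayleyMatrix b i j)
      (fderiv ℝ (fun b => cayleyMatrix b i j) 0) 0 := fun i j =>
    ((contDiff_cayleyMatrix i j).differentiable (by simp)).differentiableAt.hasFDerivAt
  have hline : fderiv ℝ (fun b => cayleyMatrix b i j) 0 ((1 / 2 : ℝ) • a) = hat a i j := by
    have hl : HasDerivAt (fun t : ℝ => t • ((1 / 2 : ℝ) • a)) ((1 / 2 : ℝ) • a) 0 := by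
      simpa using (hasDerivAt_id (0 : ℝ)).smul_const ((1 / 2 : ℝ) • a)
    have h1 : HasDerivAt (fun t : ℝ => cayleyMatrix (t • ((1 / 2 : ℝ) • a)) i j)
        (fderiv ℝ (fun b => cayleyMatrix b i j) 0 ((1 / 2 : ℝ) • a)) 0 :=
      HasFDerivAt.comp_hasDerivAt (l := fun b => cayleyMatrix b i j) (0 : ℝ)
        (by simpa using hcay i j) hl
    refine h1.unique ?_
    have hp : ∀ c : ℝ → ℝ, ∀ c' : ℝ, HasDerivAt c c' 0 →
        HasDerivAt (fun t : ℝ => (cayleyDen (t • ((1 / 2 : ℝ) • a)))⁻¹ * c t) c' 0 := by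
      intro c c' hc
      have hden : HasDerivAt (fun t : ℝ => cayleyDen (t • ((1 / 2 : ℝ) • a))) 0 0 := by
        have : (fun t : ℝ => cayleyDen (t • ((1 / 2 : ℝ) • a))) =
            fun t : ℝ => 1 + t ^ 2 * ((a 0 ^ 2 + a 1 ^ 2 + a 2 ^ 2) / 4) := by
          funext t; simp [cayleyDen]; ring
        rw [this]
        exact ((((hasDerivAt_id (0 : ℝ)).pow 2).mul_const
          ((a 0 ^ 2 + a 1 ^ 2 + a 2 ^ 2) / 4)).const_add 1).congr_deriv (by simp)
      exact ((hden.inv (cayleyDen_pos _).ne').mul hc).congr_deriv (by simp [cayleyDen])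
    have hq : ∀ p q r : ℝ, HasDerivAt (fun t : ℝ => p + q * t + r * t ^ 2) q 0 := by
      intro p q r
      have h := (((hasDerivAt_id (0 : ℝ)).const_mul q).const_add p).add
        (((hasDerivAt_id (0 : ℝ)).pow 2).const_mul r)
      exact h.congr_deriv (by simp)
    refine hp _ _ ?_
    have hpoly : ∃ p r : ℝ, (fun t : ℝ => cayleyNum (t • ((1 / 2 : ℝ) • a)) i j) =
        fun t : ℝ => p + hat a i j * t + r * t ^ 2 := by
      refine ⟨(1 : Matrix (Fin 3) (Fin 3) ℝ) i j,
        cayleyNum ((1 / 2 : ℝ) • a) i j - (1 : Matrix (Fin 3) (Fin 3) ℝ) i j - hat a i j, ?_⟩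
      funext t
      fin_cases i <;> fin_cases j <;> simp [cayleyNum, hat] <;> ring
    obtain ⟨p, r, hpr⟩ := hpoly
    rw [hpr]
    exact hq p _ r
  have hmain : HasMFDerivAt 𝓘(ℝ, Fin 3 → ℝ) 𝓘(ℝ, ℝ) (fun A : SO3 => A.1 i j) 1
      (fderiv ℝ (fun b => cayleyMatrix b i j) 0) := by
    refine ⟨(continuous_subtype_val.matrix_elem i j).continuousAt, ?_⟩
    have h0 : extChartAt 𝓘(ℝ, Fin 3 → ℝ) (1 : SO3) 1 = 0 := by
      change cayleyInv ((1 : SO3)⁻¹ * 1 : SO3).1 = 0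
      rw [inv_mul_cancel]
      ext k
      fin_cases k <;> simp [cayleyInv]
    rw [h0]
    have hw : writtenInExtChartAt 𝓘(ℝ, Fin 3 → ℝ) 𝓘(ℝ, ℝ) (1 : SO3) (fun A : SO3 => A.1 i j) =
        fun b => cayleyMatrix b i j := by
      funext b
      change ((1 : SO3) * cayley b : SO3).1 i j = cayleyMatrix b i j
      rw [one_mul]; rfl
    rw [hw]
    exact (hcay i j).hasFDerivWithinAt
  rw [hmain.mfderiv]
  exact hline

/-- The left-invariant vector field on `SO(3) × ℝ` extending `hat a ⊕ r ∈ 𝔰𝔬(3) ⊕ ℝ`. -/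
def leftInvariant (a : Fin 3 → ℝ) (r : ℝ) (p : SO3 × ℝ) :
    TangentSpace (𝓘(ℝ, Fin 3 → ℝ).prod 𝓘(ℝ, ℝ)) p :=
  ((mulInvariantVectorField (I := 𝓘(ℝ, Fin 3 → ℝ)) (so3Vec a) p.1 : Fin 3 → ℝ), r)

/-- The field `((T₁ + T₂) ⊕ 2) / √2`, where `T₁, T₂, T₃` are the images of the standard basis of
`ℝ³` under `hat`. -/
def exampleX1 (p : SO3 × ℝ) : TangentSpace (𝓘(ℝ, Fin 3 → ℝ).prod 𝓘(ℝ, ℝ)) p :=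
  leftInvariant ((1 / √2) • ![1, 1, 0]) ((1 / √2) * 2) p

/-- The field `(T₁ ⊕ 1) / √2`. -/
def exampleX2 (p : SO3 × ℝ) : TangentSpace (𝓘(ℝ, Fin 3 → ℝ).prod 𝓘(ℝ, ℝ)) p :=
  leftInvariant ((1 / √2) • ![1, 0, 0]) ((1 / √2) * 1) p

end
end RankTwo

/-! Everything is pulled back to the endpoint by the flow of X₁. If ψ(t, ·) carries chart
coordinates at γ(s) to time t along X₁ (`exists_flowTube`), then trajectories have the form x(t) =
ψ(t, z(t)) with ż = v₁ X₁(z) + v₂ g_t(z). The pulled-back X₁ does not depend on t, g_t is the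
pull-back of X₂, and for v = 0 the point z stays at rest. Picard iteration gives the second-order
expansion: dF(v) = δ(s) with δ(t) = ∫₀ᵗ (v₁ X₁ + v₂ g), and half the second derivative is ∫ (v₁ DX₁
δ + v₂ Dg δ) (`IsEndTube.hasTaylorExpansion`).

The equation for [X₁,[X₁,X₂]] says g'' = β X₁ + α⁰ g + α¹ g'. Hence g_t = A X₁ + B X₂ + C [X₁,X₂] in
the frame at γ(s), where A, B, C are scalar Jacobi functions with derivatives a, b, c
(`IsEndTube.exists_jacobi`). The covectors that annihilate the image of dF are those that kill the
frame, a line. A covector on the image of d𝓕 may have an energy component only if a ≡ 0, so strict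
singularity means a ≢ 0. A covector ξ that kills the frame satisfies the same Jacobi relation for ξ
∘ Dg_t. Consequently the Hessian involves only the numbers ξ(DXᵢ Xⱼ) of the frame, with X₃ =
[X₁,X₂]. They are symmetric in i and j except for the defect κ = ξ([[X₁,X₂],X₂]), which is nonzero
in dimension four. Integration by parts then turns the Hessian on the kernel into −κ⟨Tw, w'⟩, where
w = ∫ v₂, Tw = Δ w + c ∫ b w − b ∫ c w and Δ = bC − cB (`IsJacobi.secondVariation_eq`,
`IsJacobi.hessian_eq`).

In the completed space, the kernel of the differential prescribes the mean of v₁ and the number w(s)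
in terms of w, and requires w ⟂ c, for 𝓕 also w ⟂ a. So γ(s) is conjugate exactly when some nonzero
w in this orthogonal complement has Tw in the span of c, for 𝓕 of c and a (`isConjugate_iff_form`,
`meanZero_ssubset_iff`). Differentiating Tw = l c + μ a shows w = w₀ + ν ∫ β e with e = exp(−∫ α¹)
and ν proportional to μ (`IsJacobi.eq_of_operator_eq`, with converse `IsJacobi.operator_solution`).
By parts the orthogonality conditions become w₀ C(0) + ν ∫ β e C = 0 and w₀ A(0) + ν ∫ β e A = 0.
For F one has ν = 0, and the condition is C(0) = 0. For 𝓕 it is the vanishing of a 2 × 2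
determinant. In frame coordinates these are the two wedge products.

In the example the Jacobi equation is y'' = 1/2 − y, which gives A = (1 − cos(t − s))/2 and C =
sin(t − s) and the two trigonometric conditions. -/

namespace RankTwo
set_option linter.unusedSectionVars false

/-! ### Superposition operators -/

section Superposition

variable {K : Type*} [TopologicalSpace K] [CompactSpace K]
  {E F : Type*} [NormedAddCommGroup E] [NormedSpace ℝ E] [NormedAddCommGroup F] [NormedSpace ℝ F]

/-- Pointwise evaluation of operator-valued functions, as a continuous bilinear map. -/
noncomputable def pointwiseApply (K E F : Type*) [TopologicalSpace K] [CompactSpace K]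
    [NormedAddCommGroup E] [NormedSpace ℝ E] [NormedAddCommGroup F] [NormedSpace ℝ F] :
    C(K, E →L[ℝ] F) →L[ℝ] C(K, E) →L[ℝ] C(K, F) :=
  LinearMap.mkContinuous₂
    (LinearMap.mk₂ ℝ (fun (A : C(K, E →L[ℝ] F)) (h : C(K, E)) =>
        (⟨fun k => A k (h k), by fun_prop⟩ : C(K, F)))
      (fun _ _ _ => by ext; simp) (fun _ _ _ => by ext; simp)
      (fun _ _ _ => by ext; simp) (fun _ _ _ => by ext; simp)) 1 (by
    intro A h
    rw [one_mul, ContinuousMap.norm_le _ (by positivity)]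
    intro k
    exact ((A k).le_opNorm _).trans (mul_le_mul (A.norm_coe_le_norm k) (h.norm_coe_le_norm k)
      (norm_nonneg _) (A.norm_coe_le_norm k |> (norm_nonneg _).trans)))

/-- The superposition operator `u ↦ f ∘ u`. -/
def superposition (f : E → F) (hf : Continuous f) (u : C(K, E)) : C(K, F) := (⟨f, hf⟩ : C(E, F)).comp u

/-- Compact support makes `fderiv ℝ f` uniformly continuous, so one radius serves the mean value
inequality at every value `u k`, and the pointwise remainder bound is a bound in the sup norm. -/
theorem hasFDerivAt_superposition {f : E → F} (hf : ContDiff ℝ 1 f) (hc : HasCompactSupport f)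
    (u : C(K, E)) :
    HasFDerivAt (superposition f hf.continuous : C(K, E) → C(K, F))
      (pointwiseApply K E F (superposition (fderiv ℝ f) (hf.continuous_fderiv one_ne_zero) u)) u := by
  have huc : UniformContinuous (fderiv ℝ f) :=
    (hc.fderiv ℝ).uniformContinuous_of_continuous (hf.continuous_fderiv one_ne_zero)
  rw [hasFDerivAt_iff_isLittleO_nhds_zero, isLittleO_iff]
  intro ε hε
  obtain ⟨δ, hδ, h⟩ := Metric.uniformContinuous_iff.1 huc ε hε
  filter_upwards [Metric.ball_mem_nhds (0 : C(K, E)) hδ] with v hv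
  rw [ContinuousMap.norm_le _ (by positivity)]
  intro k
  have hvk : ‖v k‖ ≤ ‖v‖ := v.norm_coe_le_norm k
  have hvδ : ‖v‖ < δ := by simpa using hv
  have key := (convex_ball (u k) δ).norm_image_sub_le_of_norm_fderiv_le' (𝕜 := ℝ) (f := f)
    (φ := fderiv ℝ f (u k)) (C := ε) (x := u k) (y := u k + v k)
    (fun x _ => (hf.differentiable one_ne_zero) x)
    (fun x hx => by rw [← dist_eq_norm]; exact (h hx).le) (Metric.mem_ball_self hδ)
    (by simpa using hvk.trans_lt hvδ)
  rw [add_sub_cancel_left] at key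
  exact key.trans (by gcongr)

/-- The derivative is again a superposition operator, by `fderiv ℝ f`, followed by a bounded
bilinear map; this drives the induction. The target `F` is quantified inside because it changes to
`E →L[ℝ] F`, which puts `E` and `F` in one universe. -/
theorem contDiff_superposition.{u} {E : Type u} [NormedAddCommGroup E] [NormedSpace ℝ E] (n : ℕ) :
    ∀ {F : Type u} [NormedAddCommGroup F] [NormedSpace ℝ F] {f : E → F} (hf : ContDiff ℝ ∞ f)
      (_ : HasCompactSupport f),
      ContDiff ℝ n (superposition f hf.continuous : C(K, E) → C(K, F)) := by
  induction n with
  | zero =>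
    intro F _ _ f hf _
    exact contDiff_zero.2 (ContinuousMap.continuous_postcomp _)
  | succ n ih =>
    intro F _ _ f hf hc
    have h1 : ContDiff ℝ 1 f := hf.of_le (by exact_mod_cast le_top)
    push_cast
    rw [contDiff_succ_iff_hasFDerivAt]
    refine ⟨_, ?_, fun u => hasFDerivAt_superposition h1 hc u⟩
    exact (pointwiseApply K E F).contDiff.comp
      (ih (contDiff_infty_iff_fderiv.1 hf).2 (hc.fderiv ℝ))

end Superposition

/-! ### Local flows in a vector space -/

section LocalFlow

variable {E : Type*} [NormedAddCommGroup E] [NormedSpace ℝ E]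

/-- The primitive `r ↦ ∫₀ʳ u` of a continuous function on the unit interval. -/
noncomputable def unitPrimitive (E : Type*) [NormedAddCommGroup E] [NormedSpace ℝ E] :
    C(Icc (0 : ℝ) 1, E) →L[ℝ] C(Icc (0 : ℝ) 1, E) :=
  LinearMap.mkContinuous
    { toFun := fun u => ⟨fun r => ∫ x in (0 : ℝ)..r, u.IccExtend zero_le_one x,
        (intervalIntegral.continuous_primitive
          (fun a b => (u.IccExtend zero_le_one).continuous.intervalIntegrable a b) 0).comp
            continuous_subtype_val⟩
      map_add' := fun u v => by
        ext r
        exact intervalIntegral.integral_add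
          ((u.IccExtend zero_le_one).continuous.intervalIntegrable _ _)
          ((v.IccExtend zero_le_one).continuous.intervalIntegrable _ _)
      map_smul' := fun c u => by
        ext r
        exact intervalIntegral.integral_smul c _ } 1 (by
    intro u
    rw [one_mul, ContinuousMap.norm_le _ (norm_nonneg _)]
    intro r
    refine (intervalIntegral.norm_integral_le_of_norm_le_const (C := ‖u‖)
      (fun x _ => u.norm_coe_le_norm _)).trans ?_
    rw [sub_zero, abs_of_nonneg r.2.1]
    exact mul_le_of_le_one_right (norm_nonneg _) r.2.2)

/-- The defect of the integral equation `u = x + τ ∫ f(u)`. -/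
noncomputable def flowDefect (f : E → E) (hf : Continuous f)
    (p : (ℝ × E) × C(Icc (0 : ℝ) 1, E)) : C(Icc (0 : ℝ) 1, E) :=
  p.2 - ContinuousLinearMap.const ℝ (Icc (0 : ℝ) 1) p.1.2 -
    p.1.1 • unitPrimitive E (superposition f hf p.2)

theorem flowDefect_eq_zero_iff {f : E → E} (hf : Continuous f) (τ : ℝ) (x : E)
    (u : C(Icc (0 : ℝ) 1, E)) :
    flowDefect f hf ((τ, x), u) = 0 ↔
      ∀ r : Icc (0 : ℝ) 1, u r = x + τ • ∫ y in (0 : ℝ)..r, f (u (projIcc 0 1 zero_le_one y)) := by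
  rw [flowDefect, sub_sub, sub_eq_zero, ContinuousMap.ext_iff]
  rfl

/-- Implicit function theorem in the space of curves. Rescaling to the unit interval makes time a
parameter, and at τ = 0 the defect at `x₀` is `u - c₀`, whose derivative in `u` is the identity. The
equivalence also records local uniqueness of the solution. -/
theorem exists_flowDefect_solution [CompleteSpace E] {f : E → E}
    (hf : ContDiff ℝ ∞ f) (hc : HasCompactSupport f) (x₀ : E) (n : ℕ) (hn : n ≠ 0) :
    ∃ φ : ℝ × E → C(Icc (0 : ℝ) 1, E),
      φ (0, x₀) = ContinuousLinearMap.const ℝ (Icc (0 : ℝ) 1) x₀ ∧ ContDiffAt ℝ n φ (0, x₀) ∧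
      ∀ᶠ p in 𝓝 (((0 : ℝ), x₀), ContinuousLinearMap.const ℝ (Icc (0 : ℝ) 1) x₀),
        flowDefect f hf.continuous p = 0 ↔ φ p.1 = p.2 := by
  set N := flowDefect f hf.continuous with hN
  set c₀ : C(Icc (0 : ℝ) 1, E) := ContinuousLinearMap.const ℝ (Icc (0 : ℝ) 1) x₀
  have hNd : ContDiff ℝ n N := by
    have h1 : ContDiff ℝ n fun p : (ℝ × E) × C(Icc (0 : ℝ) 1, E) =>
        (ContinuousLinearMap.const ℝ (Icc (0 : ℝ) 1) : E →L[ℝ] C(Icc (0 : ℝ) 1, E)) p.1.2 :=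
      (ContinuousLinearMap.contDiff _).comp contDiff_fst.snd
    refine ContDiff.sub (contDiff_snd.sub h1) ?_
    exact contDiff_fst.fst.smul ((unitPrimitive E).contDiff.comp
      ((contDiff_superposition n hf hc).comp contDiff_snd))
  have h0 : N ((0, x₀), c₀) = 0 := by
    rw [hN, flowDefect_eq_zero_iff]; intro r; simp [c₀]
  have hinv : (fderiv ℝ N ((0, x₀), c₀) ∘L .inr ℝ (ℝ × E) C(Icc (0 : ℝ) 1, E)).IsInvertible := by
    have h1 : HasFDerivAt (fun u => N ((0, x₀), u))
        (fderiv ℝ N ((0, x₀), c₀) ∘L .inr ℝ (ℝ × E) C(Icc (0 : ℝ) 1, E)) c₀ :=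
      HasFDerivAt.comp (g := N) c₀
        ((hNd.differentiable (by exact_mod_cast hn)) ((0, x₀), c₀)).hasFDerivAt
        (hasFDerivAt_prodMk_right (0, x₀) c₀)
    have h2 : HasFDerivAt (fun u => N ((0, x₀), u)) (.id ℝ _) c₀ := by
      have : (fun u => N ((0, x₀), u)) = fun u => u - c₀ := by
        funext u; simp [hN, flowDefect, c₀]
      rw [this]
      exact (hasFDerivAt_id c₀).sub_const c₀
    rw [h1.unique h2]
    exact ⟨ContinuousLinearEquiv.refl ℝ _, rfl⟩
  have hn' : (n : ℕ∞ω) ≠ 0 := by exact_mod_cast hn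
  have hat : ContDiffAt ℝ n N ((0, x₀), c₀) := hNd.contDiffAt
  have hiff := hat.eventually_apply_eq_iff_implicitFunction hn' hinv
  rw [h0] at hiff
  exact ⟨hat.implicitFunction hn' hinv, hat.implicitFunction_apply_self hn' hinv,
    hat.contDiffAt_implicitFunction hn' hinv, hiff⟩

/-- θ(t, x) is the value at 1 of the solution of u(r) = x + t ∫₀ʳ f(u), so its smoothness in both
variables is that of the implicit function. -/
theorem exists_localFlow_of_hasCompactSupport [CompleteSpace E] {f : E → E}
    (hf : ContDiff ℝ ∞ f) (hc : HasCompactSupport f) (x₀ : E) (n : ℕ) (hn : n ≠ 0) :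
    ∃ ε > 0, ∃ r > 0, ∃ θ : ℝ × E → E,
      ContDiffOn ℝ n θ (Ioo (-ε) ε ×ˢ Metric.ball x₀ r) ∧
      ∀ x ∈ Metric.ball x₀ r, θ (0, x) = x ∧
        ∀ t ∈ Ioo (-ε) ε, HasDerivAt (fun t => θ (t, x)) (f (θ (t, x))) t := by
  obtain ⟨φ, hφ0, hφd, hiff⟩ := exists_flowDefect_solution hf hc x₀ n hn
  set c₀ : C(Icc (0 : ℝ) 1, E) := ContinuousLinearMap.const ℝ (Icc (0 : ℝ) 1) x₀
  obtain ⟨S, hS, T, hT, hST⟩ := mem_nhds_prod_iff.1 hiff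
  obtain ⟨ρ, hρ, hTρ⟩ := Metric.mem_nhds_iff.1 hT
  have hev : ∀ᶠ p in 𝓝 ((0 : ℝ), x₀), p ∈ S ∧ φ p ∈ Metric.ball c₀ ρ ∧ ContDiffAt ℝ n φ p := by
    refine Filter.Eventually.and hS (Filter.Eventually.and ?_ (hφd.eventually (by simp)))
    exact hφd.continuousAt.eventually (by rw [hφ0]; exact Metric.ball_mem_nhds _ hρ)
  obtain ⟨S₁, hS₁, S₂, hS₂, hSS⟩ := mem_nhds_prod_iff.1 hev
  obtain ⟨ε, hε, hεS⟩ := Metric.mem_nhds_iff.1 hS₁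
  obtain ⟨r, hr, hrS⟩ := Metric.mem_nhds_iff.1 hS₂
  rw [Real.ball_eq_Ioo, zero_sub, zero_add] at hεS
  have hgood : ∀ t ∈ Ioo (-ε) ε, ∀ x ∈ Metric.ball x₀ r,
      (t, x) ∈ S ∧ φ (t, x) ∈ Metric.ball c₀ ρ ∧ ContDiffAt ℝ n φ (t, x) :=
    fun t ht x hx => hSS (mk_mem_prod (hεS ht) (hrS hx))
  have hiff' : ∀ t ∈ Ioo (-ε) ε, ∀ x ∈ Metric.ball x₀ r, ∀ u ∈ Metric.ball c₀ ρ,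
      flowDefect f hf.continuous ((t, x), u) = 0 ↔ φ (t, x) = u := fun t ht x hx u hu =>
    hST (mk_mem_prod (hgood t ht x hx).1 (hTρ hu))
  have heq : ∀ t ∈ Ioo (-ε) ε, ∀ x ∈ Metric.ball x₀ r, ∀ r : Icc (0 : ℝ) 1,
      φ (t, x) r = x + t • ∫ y in (0 : ℝ)..r, f (φ (t, x) (projIcc 0 1 zero_le_one y)) :=
    fun t ht x hx => (flowDefect_eq_zero_iff hf.continuous t x _).1
      ((hiff' t ht x hx _ (hgood t ht x hx).2.1).2 rfl)
  have hmul : ∀ t ∈ Ioo (-ε) ε, ∀ l ∈ Icc (0 : ℝ) 1, l * t ∈ Ioo (-ε) ε := by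
    rintro t ⟨h1, h2⟩ l ⟨h3, h4⟩
    constructor <;> nlinarith
  -- A solution restricted to `[0, l]` and rescaled solves the equation for the time `l * t`, and
  -- local uniqueness identifies it. This turns the equations on the unit interval into one integral
  -- equation in `t`.
  have hscale : ∀ t ∈ Ioo (-ε) ε, ∀ x ∈ Metric.ball x₀ r, ∀ l : Icc (0 : ℝ) 1,
      φ (l * t, x) 1 = φ (t, x) l := by
    intro t ht x hx l
    have hl : ∀ r : Icc (0 : ℝ) 1, (l * r : ℝ) ∈ Icc (0 : ℝ) 1 := fun r =>
      ⟨mul_nonneg l.2.1 r.2.1, mul_le_one₀ l.2.2 r.2.1 r.2.2⟩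
    let v : C(Icc (0 : ℝ) 1, E) := ⟨fun r => φ (t, x) ⟨l * r, hl r⟩,
      (φ (t, x)).continuous.comp
        ((continuous_const.mul continuous_subtype_val).subtype_mk hl)⟩
    have hv : ∀ r, v r = φ (t, x) ⟨l * r, hl r⟩ := fun r => rfl
    have hvb : v ∈ Metric.ball c₀ ρ := by
      rw [Metric.mem_ball, ContinuousMap.dist_lt_iff hρ]
      intro r
      rw [hv]
      exact (ContinuousMap.dist_apply_le_dist (g := c₀) _).trans_lt (hgood t ht x hx).2.1
    have hNv : flowDefect f hf.continuous ((l * t, x), v) = 0 := by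
      rw [flowDefect_eq_zero_iff]
      intro r
      have h1 := heq t ht x hx ⟨l * r, hl r⟩
      have h2 := intervalIntegral.smul_integral_comp_mul_left (a := 0) (b := (r : ℝ))
        (fun y => f (φ (t, x) (projIcc 0 1 zero_le_one y))) (l : ℝ)
      rw [mul_zero] at h2
      rw [hv, h1]
      simp only at h2 ⊢
      rw [← h2, mul_comm (l : ℝ) t, mul_smul]
      congr 3
      refine intervalIntegral.integral_congr fun y hy => ?_
      rw [uIcc_of_le r.2.1] at hy
      have hy1 : y ∈ Icc (0 : ℝ) 1 := ⟨hy.1, hy.2.trans r.2.2⟩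
      simp only [projIcc_of_mem zero_le_one hy1, hv]
      rw [projIcc_of_mem zero_le_one (hl ⟨y, hy1⟩)]
    rw [(hiff' (l * t) (hmul t ht l l.2) x hx v hvb).1 hNv, hv]
    congr 1
    exact Subtype.ext (mul_one _)
  refine ⟨ε, hε, r, hr, fun p => φ p 1, ?_, ?_⟩
  · rintro ⟨t, x⟩ ⟨ht, hx⟩
    exact ((ContinuousMap.evalCLM ℝ (1 : Icc (0 : ℝ) 1)).contDiff.contDiffAt.comp _
      (hgood t ht x hx).2.2).contDiffWithinAt
  · intro x hx
    have h0mem : (0 : ℝ) ∈ Ioo (-ε) ε := ⟨by linarith, hε⟩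
    have hint : ∀ t ∈ Ioo (-ε) ε, φ (t, x) 1 = x + ∫ σ in (0 : ℝ)..t, f (φ (σ, x) 1) := by
      intro t ht
      rw [heq t ht x hx 1]
      have h2 := intervalIntegral.smul_integral_comp_mul_right (a := 0) (b := 1)
        (fun σ => f (φ (σ, x) 1)) t
      rw [zero_mul, one_mul] at h2
      rw [← h2]
      congr 2
      refine intervalIntegral.integral_congr fun y hy => ?_
      simp only [Icc.coe_one, uIcc_of_le zero_le_one] at hy
      simp only [projIcc_of_mem zero_le_one hy]
      rw [← hscale t ht x hx ⟨y, hy⟩]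
    refine ⟨by simpa using hint 0 h0mem, fun t ht => ?_⟩
    have hcont : ContinuousOn (fun σ => f (φ (σ, x) 1)) (Ioo (-ε) ε) := by
      intro σ hσ
      have h1 : ContinuousAt (fun σ => φ (σ, x)) σ :=
        ContinuousAt.comp (g := φ) (hgood σ hσ x hx).2.2.continuousAt (by fun_prop)
      exact (hf.continuous.continuousAt.comp
        ((ContinuousMap.evalCLM ℝ (1 : Icc (0 : ℝ) 1)).continuous.continuousAt.comp
          h1)).continuousWithinAt
    have hsub : uIcc 0 t ⊆ Ioo (-ε) ε := (ordConnected_Ioo).uIcc_subset h0mem ht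
    have hd := intervalIntegral.integral_hasDerivAt_right
      ((hcont.mono hsub).intervalIntegrable)
      (hcont.stronglyMeasurableAtFilter isOpen_Ioo t ht)
      (hcont.continuousAt (isOpen_Ioo.mem_nhds ht))
    refine (hd.const_add x).congr_of_eventuallyEq ?_
    filter_upwards [isOpen_Ioo.mem_nhds ht] with σ hσ using hint σ hσ

/-- A local flow depends only on the germ of the field, so multiplication by a bump function reduces
to compact support. -/
theorem exists_contDiff_hasCompactSupport_eq [FiniteDimensional ℝ E] {F : Type*}
    [NormedAddCommGroup F] [NormedSpace ℝ F] {f : E → F} {U : Set E} (hU : IsOpen U)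
    (hf : ContDiffOn ℝ ∞ f U) {x₀ : E} (hx : x₀ ∈ U) :
    ∃ g : E → F, ContDiff ℝ ∞ g ∧ HasCompactSupport g ∧ g =ᶠ[𝓝 x₀] f := by
  obtain ⟨R, hR, hRU⟩ := Metric.isOpen_iff.1 hU x₀ hx
  let χ : ContDiffBump x₀ := ⟨R / 4, R / 2, by linarith, by linarith⟩
  have hsupp : tsupport χ ⊆ U := by
    rw [χ.tsupport_eq]
    exact (Metric.closedBall_subset_ball (by change R / 2 < R; linarith)).trans hRU
  refine ⟨fun x => χ x • f x, ?_, χ.hasCompactSupport.smul_right, ?_⟩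
  · rw [contDiff_iff_contDiffAt]
    intro x
    by_cases hxU : x ∈ U
    · exact χ.contDiff.contDiffAt.smul (hf.contDiffAt (hU.mem_nhds hxU))
    · have h0 : (fun x => χ x • f x) =ᶠ[𝓝 x] fun _ => 0 := by
        filter_upwards [notMem_tsupport_iff_eventuallyEq.1 fun h => hxU (hsupp h)] with y hy
        rw [hy]; simp
      exact contDiffAt_const.congr_of_eventuallyEq h0
  · filter_upwards [χ.eventuallyEq_one] with x hx
    rw [hx]; simp

/-- The local flow of a smooth vector field depends smoothly on time and the initial point, and its
space derivative is invertible. -/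
theorem exists_localFlow [FiniteDimensional ℝ E] {f : E → E} {U : Set E} (hU : IsOpen U)
    (hf : ContDiffOn ℝ ∞ f U) {x₀ : E} (hx : x₀ ∈ U) (n : ℕ) (hn : n ≠ 0) :
    ∃ ε > 0, ∃ V : Set E, IsOpen V ∧ x₀ ∈ V ∧ ∃ θ : ℝ × E → E,
      ContDiffOn ℝ n θ (Ioo (-ε) ε ×ˢ V) ∧
      ∀ x ∈ V, θ (0, x) = x ∧ ∀ t ∈ Ioo (-ε) ε, θ (t, x) ∈ U ∧
        HasDerivAt (fun t => θ (t, x)) (f (θ (t, x))) t ∧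
        (fderiv ℝ (fun x => θ (t, x)) x).IsInvertible := by
  have := FiniteDimensional.complete ℝ E
  obtain ⟨g, hg, hgc, hgf⟩ := exists_contDiff_hasCompactSupport_eq hU hf hx
  obtain ⟨ε, hε, r, hr, θ, hθ, hflow⟩ := exists_localFlow_of_hasCompactSupport hg hgc x₀ n hn
  have hopen : IsOpen (Ioo (-ε) ε ×ˢ Metric.ball x₀ r) := isOpen_Ioo.prod Metric.isOpen_ball
  have hbase : ((0 : ℝ), x₀) ∈ Ioo (-ε) ε ×ˢ Metric.ball x₀ r :=
    ⟨⟨by linarith, hε⟩, Metric.mem_ball_self hr⟩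
  have hn' : (n : ℕ∞ω) ≠ 0 := by exact_mod_cast hn
  have h00 : θ (0, x₀) = x₀ := (hflow x₀ hbase.2).1
  have hpart : ∀ p ∈ Ioo (-ε) ε ×ˢ Metric.ball x₀ r,
      HasFDerivAt (fun x => θ (p.1, x)) (fderiv ℝ θ p ∘L .inr ℝ ℝ E) p.2 := by
    intro p hp
    exact HasFDerivAt.comp (g := θ) p.2
      ((hθ.contDiffAt (hopen.mem_nhds hp)).differentiableAt hn').hasFDerivAt
      (hasFDerivAt_prodMk_right p.1 p.2)
  -- The flow at time 0 is the identity near `x₀`, so its space derivative there is the identity.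
  -- Invertible operators form an open set, which covers nearby times and points.
  have hid : fderiv ℝ θ (0, x₀) ∘L .inr ℝ ℝ E = .id ℝ E := by
    refine (hpart (0, x₀) hbase).unique ((hasFDerivAt_id x₀).congr_of_eventuallyEq ?_)
    filter_upwards [Metric.ball_mem_nhds x₀ hr] with x hx using (hflow x hx).1
  have hcont : ContinuousOn (fun p => fderiv ℝ θ p ∘L .inr ℝ ℝ E)
      (Ioo (-ε) ε ×ˢ Metric.ball x₀ r) :=
    (hθ.continuousOn_fderiv_of_isOpen hopen
      (by exact_mod_cast Nat.one_le_iff_ne_zero.2 hn)).clm_comp continuousOn_const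
  have hev : ∀ᶠ p in 𝓝 ((0 : ℝ), x₀), p ∈ Ioo (-ε) ε ×ˢ Metric.ball x₀ r ∧
      (θ p ∈ U ∧ g (θ p) = f (θ p)) ∧ (fderiv ℝ θ p ∘L .inr ℝ ℝ E).IsInvertible := by
    refine Filter.Eventually.and (hopen.mem_nhds hbase) (Filter.Eventually.and ?_ ?_)
    · refine (hθ.continuousOn.continuousAt (hopen.mem_nhds hbase)).eventually
        (p := fun y => y ∈ U ∧ g y = f y) ?_
      rw [h00]
      exact Filter.Eventually.and (hU.mem_nhds hx) hgf
    · refine (hcont.continuousAt (hopen.mem_nhds hbase)).eventually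
        (p := fun A : E →L[ℝ] E => A.IsInvertible) ?_
      simp only [hid]
      exact ContinuousLinearEquiv.nhds (ContinuousLinearEquiv.refl ℝ E)
  obtain ⟨S₁, hS₁, S₂, hS₂, hSS⟩ := mem_nhds_prod_iff.1 hev
  obtain ⟨δ, hδ, hδS⟩ := Metric.mem_nhds_iff.1 hS₁
  rw [Real.ball_eq_Ioo, zero_sub, zero_add] at hδS
  obtain ⟨V, hVS, hV, hxV⟩ := mem_nhds_iff.1 hS₂
  have hall : ∀ t ∈ Ioo (-δ) δ, ∀ x ∈ V, _ := fun t ht x hx =>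
    hSS (mk_mem_prod (hδS ht) (hVS hx))
  refine ⟨δ, hδ, V, hV, hxV, θ, hθ.mono fun p hp => (hall p.1 hp.1 p.2 hp.2).1, fun x hx => ?_⟩
  have h0mem : (0 : ℝ) ∈ Ioo (-δ) δ := ⟨by linarith, hδ⟩
  refine ⟨(hflow x (hall 0 h0mem x hx).1.2).1, fun t ht => ?_⟩
  obtain ⟨h1, h2, h3⟩ := hall t ht x hx
  refine ⟨h2.1, ?_, ?_⟩
  · rw [← h2.2]; exact (hflow x h1.2).2 t h1.1
  · rw [(hpart _ h1).fderiv]; exact h3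

end LocalFlow

/-! ### Vector fields in charts -/

section ChartField

variable {E : Type*} [NormedAddCommGroup E] [NormedSpace ℝ E]
  {H : Type*} [TopologicalSpace H] {I : ModelWithCorners ℝ E H}
  {M : Type*} [TopologicalSpace M] [ChartedSpace H M]

/-- The vector field `X` read in the preferred chart at `p`. -/
noncomputable def chartField (I : ModelWithCorners ℝ E H) (p : M)
    (X : (x : M) → TangentSpace I x) (y : E) : E :=
  VectorField.mpullback 𝓘(ℝ, E) I (extChartAt I p).symm X y

theorem two_le_infty : (2 : ℕ∞ω) ≤ ∞ := WithTop.coe_le_coe.2 (le_top : (2 : ℕ∞) ≤ ⊤)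

theorem three_le_infty : (3 : ℕ∞ω) ≤ ∞ := WithTop.coe_le_coe.2 (le_top : (3 : ℕ∞) ≤ ⊤)

theorem apply_inverse_apply {V W : Type*} [TopologicalSpace V] [AddCommGroup V] [Module ℝ V]
    [TopologicalSpace W] [AddCommGroup W] [Module ℝ W]
    {A : V →L[ℝ] W} (hA : A.IsInvertible) (w : W) : A (A.inverse w) = w := by
  obtain ⟨e, rfl⟩ := hA
  simp

theorem inverse_apply_apply {V W : Type*} [TopologicalSpace V] [AddCommGroup V] [Module ℝ V]
    [TopologicalSpace W] [AddCommGroup W] [Module ℝ W]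
    {A : V →L[ℝ] W} (hA : A.IsInvertible) (v : V) : A.inverse (A v) = v := by
  obtain ⟨e, rfl⟩ := hA
  simp

variable [IsManifold I ∞ M] [I.Boundaryless]

theorem contMDiffAt_extChartAt_symm (p : M) {y : E} (hy : y ∈ (extChartAt I p).target) :
    ContMDiffAt 𝓘(ℝ, E) I ∞ (extChartAt I p).symm y :=
  (contMDiffOn_extChartAt_symm p).contMDiffAt ((isOpen_extChartAt_target p).mem_nhds hy)

theorem contMDiffAt_extChartAt_of_mem (p : M) {x : M} (hx : x ∈ (extChartAt I p).source) :
    ContMDiffAt I 𝓘(ℝ, E) ∞ (extChartAt I p) x :=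
  contMDiffAt_extChartAt' (by rwa [extChartAt_source] at hx)

theorem isInvertible_mfderiv_symm (p : M) {y : E} (hy : y ∈ (extChartAt I p).target) :
    (mfderiv 𝓘(ℝ, E) I (extChartAt I p).symm y).IsInvertible := by
  have : IsManifold I 1 M := IsManifold.of_le (n := ∞) (by exact_mod_cast le_top)
  have h := isInvertible_mfderivWithin_extChartAt_symm (I := I) hy
  rwa [I.range_eq_univ, mfderivWithin_univ] at h

theorem mfderiv_symm_chartField (p : M) (X : (x : M) → TangentSpace I x) {y : E}
    (hy : y ∈ (extChartAt I p).target) :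
    mfderiv 𝓘(ℝ, E) I (extChartAt I p).symm y (chartField I p X y : E) =
      X ((extChartAt I p).symm y) :=
  apply_inverse_apply (isInvertible_mfderiv_symm p hy) _

theorem mfderiv_comp_mfderiv_symm (p : M) {y : E} (hy : y ∈ (extChartAt I p).target) (v : E) :
    mfderiv I 𝓘(ℝ, E) (extChartAt I p) ((extChartAt I p).symm y)
      (mfderiv 𝓘(ℝ, E) I (extChartAt I p).symm y v) = v := by
  have : IsManifold I 1 M := IsManifold.of_le (n := ∞) (by exact_mod_cast le_top)
  have h := mfderiv_extChartAt_comp_mfderivWithin_extChartAt_symm (I := I) hy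
  rw [I.range_eq_univ, mfderivWithin_univ] at h
  exact DFunLike.congr_fun h v

theorem mfderiv_extChartAt_apply (p : M) (X : (x : M) → TangentSpace I x) {x : M}
    (hx : x ∈ (extChartAt I p).source) :
    mfderiv I 𝓘(ℝ, E) (extChartAt I p) x (X x) = chartField I p X (extChartAt I p x) := by
  have hy := (extChartAt I p).map_source hx
  have h := mfderiv_comp_mfderiv_symm p hy (chartField I p X (extChartAt I p x))
  rw [mfderiv_symm_chartField p X hy, (extChartAt I p).left_inv hx] at h
  exact h

theorem contDiffOn_chartField [CompleteSpace E] (p : M) {X : (x : M) → TangentSpace I x}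
    (hX : ContMDiff I I.tangent ∞ fun x => (⟨x, X x⟩ : TangentBundle I M)) :
    ContDiffOn ℝ ∞ (chartField I p X) (extChartAt I p).target := by
  intro y hy
  have : IsManifold I 1 M := IsManifold.of_le (n := ∞) (by exact_mod_cast le_top)
  have : IsManifold I (∞ + 1) M := by rw [ENat.coe_top_add_one]; infer_instance
  have h := ContMDiffAt.mpullback_vectorField_preimage (m := ∞) (n := ∞) (hX _)
    (contMDiffAt_extChartAt_symm p hy) (isInvertible_mfderiv_symm p hy)
    (by rw [ENat.coe_top_add_one])
  exact (contMDiffAt_vectorSpace_iff_contDiffAt.1 h).contDiffWithinAt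

/-- Naturality of the bracket under pull-back by the inverse chart; it moves bracket computations
into `E`. -/
theorem chartField_mlieBracket [CompleteSpace E] (p : M) {X Y : (x : M) → TangentSpace I x}
    (hX : ContMDiff I I.tangent ∞ fun x => (⟨x, X x⟩ : TangentBundle I M))
    (hY : ContMDiff I I.tangent ∞ fun x => (⟨x, Y x⟩ : TangentBundle I M)) {y : E}
    (hy : y ∈ (extChartAt I p).target) :
    chartField I p (VectorField.mlieBracket I X Y) y =
      VectorField.lieBracket ℝ (chartField I p X) (chartField I p Y) y := by
  have : IsManifold I (minSmoothness ℝ 2) M := by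
    rw [minSmoothness_of_isRCLikeNormedField]
    exact IsManifold.of_le (n := ∞) two_le_infty
  have : IsManifold I (minSmoothness ℝ 3) M := by
    rw [minSmoothness_of_isRCLikeNormedField]
    exact IsManifold.of_le (n := ∞) three_le_infty
  have h := VectorField.mpullback_mlieBracket (n := ∞)
    ((hX _).mdifferentiableAt (by simp)) ((hY _).mdifferentiableAt (by simp))
    (contMDiffAt_extChartAt_symm (I := I) p hy)
    (by rw [minSmoothness_of_isRCLikeNormedField]; exact two_le_infty)
  refine h.trans ?_
  rw [← VectorField.mlieBracketWithin_univ, VectorField.mlieBracketWithin_eq_lieBracketWithin]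
  exact congrFun VectorField.lieBracketWithin_univ y

theorem contMDiff_mlieBracket [CompleteSpace E] {X Y : (x : M) → TangentSpace I x}
    (hX : ContMDiff I I.tangent ∞ fun x => (⟨x, X x⟩ : TangentBundle I M))
    (hY : ContMDiff I I.tangent ∞ fun x => (⟨x, Y x⟩ : TangentBundle I M)) :
    ContMDiff I I.tangent ∞
      fun x => (⟨x, VectorField.mlieBracket I X Y x⟩ : TangentBundle I M) := by
  have : IsManifold I (minSmoothness ℝ 3) M := by
    rw [minSmoothness_of_isRCLikeNormedField]
    exact IsManifold.of_le (n := ∞) three_le_infty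
  have : IsManifold I (((⊤ : ℕ∞) : ℕ∞ω) + 1) M := by
    rw [ENat.coe_top_add_one]; infer_instance
  intro x
  exact ContMDiffAt.mlieBracket_vectorField (m := ⊤) (n := ⊤) (hX x) (hY x)
    (by rw [minSmoothness_of_isRCLikeNormedField, ENat.coe_top_add_one])

/-- The chart at `p` has identity differential at `p`. -/
theorem mfderiv_extChartAt_symm_self (p : M) :
    mfderiv 𝓘(ℝ, E) I (extChartAt I p).symm (extChartAt I p p) = ContinuousLinearMap.id ℝ E := by
  have hy := mem_extChartAt_target (I := I) p
  have hp : (extChartAt I p).symm (extChartAt I p p) = p := extChartAt_to_inv p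
  have h : HasMFDerivAt 𝓘(ℝ, E) I (extChartAt I p).symm (extChartAt I p p)
      (ContinuousLinearMap.id ℝ E) := by
    refine ⟨(contMDiffAt_extChartAt_symm p hy).continuousAt, ?_⟩
    refine (((hasFDerivAt_id _).congr_of_eventuallyEq ?_).hasFDerivWithinAt)
    filter_upwards [(isOpen_extChartAt_target (I := I) p).mem_nhds hy] with y hy'
    have h1 := (extChartAt I p).right_inv hy'
    change extChartAt I ((extChartAt I p).symm (extChartAt I p p)) ((extChartAt I p).symm y) = y
    rw [hp, h1]
  exact h.mfderiv

theorem hasDerivAt_extChartAt_comp (p : M) {X : (x : M) → TangentSpace I x} {c : ℝ → M} {t : ℝ}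
    {S : Set ℝ}
    (hc : HasMFDerivWithinAt 𝓘(ℝ, ℝ) I c S t ((1 : ℝ →L[ℝ] ℝ).smulRight (X (c t))))
    (ht : c t ∈ (extChartAt I p).source) :
    HasDerivWithinAt (fun t => extChartAt I p (c t)) (chartField I p X (extChartAt I p (c t))) S t := by
  have h := ((contMDiffAt_extChartAt_of_mem (I := I) p ht).mdifferentiableAt
    (by simp)).hasMFDerivAt.comp_hasMFDerivWithinAt t hc
  have h1 : HasFDerivWithinAt (𝕜 := ℝ) (E := ℝ) (F := E) (extChartAt I p ∘ c) _ S t :=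
    hasMFDerivWithinAt_iff_hasFDerivWithinAt.1 h
  have h2 : HasDerivWithinAt (F := E) _ _ S t := h1.hasDerivWithinAt
  refine h2.congr_deriv ?_
  refine Eq.trans ?_ (mfderiv_extChartAt_apply p X ht)
  exact congrArg (mfderiv I 𝓘(ℝ, E) (extChartAt I p) (c t)) (one_smul ℝ (X (c t)))

theorem hasMFDerivAt_symm_comp (p : M) {X : (x : M) → TangentSpace I x} {u : ℝ → E} {t : ℝ}
    (hu : HasDerivAt u (chartField I p X (u t)) t) (ht : u t ∈ (extChartAt I p).target) :
    HasMFDerivAt 𝓘(ℝ, ℝ) I (fun t => (extChartAt I p).symm (u t)) t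
      ((1 : ℝ →L[ℝ] ℝ).smulRight (X ((extChartAt I p).symm (u t)))) := by
  have h := ((contMDiffAt_extChartAt_symm (I := I) p ht).mdifferentiableAt
    (by simp)).hasMFDerivAt.comp t hu.hasFDerivAt.hasMFDerivAt
  refine h.congr_mfderiv ?_
  refine ContinuousLinearMap.ext_ring ?_
  refine Eq.trans ?_ ((mfderiv_symm_chartField p X ht).trans (one_smul ℝ _).symm)
  exact congrArg (mfderiv 𝓘(ℝ, E) I (extChartAt I p).symm (u t))
    (one_smul ℝ (chartField I p X (u t)))

end ChartField

/-! ### Uniqueness of controlled curves -/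

section Uniqueness

variable {E : Type*} [NormedAddCommGroup E] [NormedSpace ℝ E]
  {H : Type*} [TopologicalSpace H] {I : ModelWithCorners ℝ E H}
  {M : Type*} [TopologicalSpace M] [ChartedSpace H M] [IsManifold I ∞ M] [I.Boundaryless]

theorem contDiffOn_comp_extChartAt_symm (p : M) {F : Type*} [NormedAddCommGroup F]
    [NormedSpace ℝ F] {f : M → F} (hf : ContMDiff I 𝓘(ℝ, F) ∞ f) :
    ContDiffOn ℝ ∞ (fun y => f ((extChartAt I p).symm y)) (extChartAt I p).target := fun y hy =>
  (ContMDiffAt.contDiffAt ((hf _).comp y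
    (contMDiffAt_extChartAt_symm p hy))).contDiffWithinAt

theorem fieldDeriv_eq_fderiv (p : M) (X : (x : M) → TangentSpace I x) {f : M → ℝ}
    (hf : ContMDiff I 𝓘(ℝ, ℝ) ∞ f) {x : M} (hx : x ∈ (extChartAt I p).source) :
    fieldDeriv I X f x = fderiv ℝ (fun y => f ((extChartAt I p).symm y)) (extChartAt I p x)
      (chartField I p X (extChartAt I p x)) := by
  have hy := (extChartAt I p).map_source hx
  have hfx : HasMFDerivAt I 𝓘(ℝ, ℝ) f ((extChartAt I p).symm (extChartAt I p x)) (mfderiv I 𝓘(ℝ, ℝ) f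
      ((extChartAt I p).symm (extChartAt I p x))) :=
    ((hf _).mdifferentiableAt (by simp)).hasMFDerivAt
  have h := hfx.comp (extChartAt I p x) ((contMDiffAt_extChartAt_symm (I := I) p hy).mdifferentiableAt
    (by simp)).hasMFDerivAt
  have h1 : HasFDerivAt (𝕜 := ℝ) (E := E) (F := ℝ) (fun y => f ((extChartAt I p).symm y)) _
    (extChartAt I p x) := hasMFDerivAt_iff_hasFDerivAt.1 h
  rw [h1.fderiv]
  refine Eq.trans ?_ (congrArg (mfderiv I 𝓘(ℝ, ℝ) f ((extChartAt I p).symm (extChartAt I p x)))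
    (mfderiv_symm_chartField p X hy)).symm
  rw [(extChartAt I p).left_inv hx]
  rfl

theorem continuous_fieldDeriv [CompleteSpace E] {X : (x : M) → TangentSpace I x}
    (hX : ContMDiff I I.tangent ∞ fun x => (⟨x, X x⟩ : TangentBundle I M)) {f : M → ℝ}
    (hf : ContMDiff I 𝓘(ℝ, ℝ) ∞ f) : Continuous (fieldDeriv I X f) := by
  rw [continuous_iff_continuousAt]
  intro p
  have ht := isOpen_extChartAt_target (I := I) p
  have h1 : ContinuousOn (fun y => fderiv ℝ (fun y => f ((extChartAt I p).symm y)) y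
      (chartField I p X y)) (extChartAt I p).target :=
    ((contDiffOn_comp_extChartAt_symm p hf).continuousOn_fderiv_of_isOpen ht (by simp)).clm_apply
      (contDiffOn_chartField p hX).continuousOn
  have h2 : ContinuousAt (fun x => fderiv ℝ (fun y => f ((extChartAt I p).symm y))
      (extChartAt I p x) (chartField I p X (extChartAt I p x))) p :=
    (h1.continuousAt (ht.mem_nhds (mem_extChartAt_target p))).comp (f := extChartAt I p)
      (continuousAt_extChartAt p)
  refine h2.congr ?_
  filter_upwards [extChartAt_source_mem_nhds (I := I) p] with x hx
  exact (fieldDeriv_eq_fderiv p X hf hx).symm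

/-- Near `p`, every linear coordinate of the chart at `p` is a globally defined smooth function. -/
theorem exists_coordinate [FiniteDimensional ℝ E] [T2Space M] (p : M) :
    ∃ N : Set M, IsOpen N ∧ p ∈ N ∧ N ⊆ (extChartAt I p).source ∧ ∀ l : E →L[ℝ] ℝ, ∃ f : M → ℝ,
      ContMDiff I 𝓘(ℝ, ℝ) ∞ f ∧ ∀ x ∈ N, f x = l (extChartAt I p x) ∧
        ∀ X : (x : M) → TangentSpace I x,
          fieldDeriv I X f x = l (chartField I p X (extChartAt I p x)) := by
  let χ : SmoothBumpFunction I p := Classical.choice inferInstance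
  obtain ⟨N, hN, hNo, hpN⟩ := mem_nhds_iff.1
    (Filter.inter_mem χ.eventuallyEq_one (extChartAt_source_mem_nhds (I := I) p))
  refine ⟨N, hNo, hpN, fun x hx => (hN hx).2, fun l => ?_⟩
  have hf : ContMDiff I 𝓘(ℝ, ℝ) ∞ fun x => χ x • l (extChartAt I p x) := by
    refine χ.contMDiff_smul ?_
    exact l.contDiff.contMDiff.comp_contMDiffOn contMDiffOn_extChartAt
  refine ⟨_, hf, fun x hx => ?_⟩
  have hev : ∀ y ∈ N, χ y • l (extChartAt I p y) = l (extChartAt I p y) := fun y hy => by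
    rw [show χ y = 1 from (hN hy).1, one_smul]
  refine ⟨hev x hx, fun X => ?_⟩
  have hxs := (hN hx).2
  rw [fieldDeriv_eq_fderiv p X hf hxs]
  have hopen : (extChartAt I p).target ∩ (extChartAt I p).symm ⁻¹' N ∈ 𝓝 (extChartAt I p x) := by
    refine (continuousOn_extChartAt_symm p).isOpen_inter_preimage
      (isOpen_extChartAt_target p) hNo |>.mem_nhds ⟨(extChartAt I p).map_source hxs, ?_⟩
    rw [mem_preimage, (extChartAt I p).left_inv hxs]
    exact hx
  have heq : (fun y => χ ((extChartAt I p).symm y) •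
      l (extChartAt I p ((extChartAt I p).symm y))) =ᶠ[𝓝 (extChartAt I p x)] l := by
    filter_upwards [hopen] with y hy
    rw [hev _ hy.2, (extChartAt I p).right_inv hy.1]
  rw [heq.fderiv_eq, l.fderiv]

/-- The coincidence set is closed because `Y` is Hausdorff, contains 0 and can always be prolonged
to the right. -/
theorem eq_of_forall_locally_eq {Y : Type*} [TopologicalSpace Y] [T2Space Y] {x y : ℝ → Y} {s : ℝ}
    (hx : ContinuousOn x (Icc 0 s)) (hy : ContinuousOn y (Icc 0 s)) (h0 : x 0 = y 0)
    (h : ∀ t ∈ Ico 0 s, x t = y t → ∃ t' ∈ Ioc t s, ∀ τ ∈ Icc t t', x τ = y τ) :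
    ∀ t ∈ Icc 0 s, x t = y t := by
  refine IsClosed.Icc_subset_of_forall_exists_gt (s := {t | x t = y t}) ?_ h0 ?_
  · have := (hx.prodMk hy).preimage_isClosed_of_isClosed isClosed_Icc isClosed_diagonal
    rwa [inter_comm] at this
  · rintro t ⟨hxy, ht⟩ τ hτ
    obtain ⟨t', ht', h'⟩ := h t ht hxy
    exact ⟨min t' τ, h' _ ⟨le_min ht'.1.le (le_of_lt hτ), min_le_left _ _⟩,
      lt_min ht'.1 hτ, min_le_right _ _⟩

variable (I) in
/-- `x` solves `ẋ = u₁ X₁(x) + u₂ X₂(x)` on `[0,s]`, tested against smooth functions. -/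
structure IsControlled (X₁ X₂ : (x : M) → TangentSpace I x) (u₁ u₂ : ℝ → ℝ) (s : ℝ)
    (x : ℝ → M) : Prop where
  continuousOn : ContinuousOn x (Icc 0 s)
  equation : ∀ f : M → ℝ, ContMDiff I 𝓘(ℝ, ℝ) ∞ f → ∀ t ∈ Icc 0 s,
    f (x t) = f (x 0) + ∫ τ in (0 : ℝ)..t,
      (u₁ τ * fieldDeriv I X₁ f (x τ) + u₂ τ * fieldDeriv I X₂ f (x τ))

variable {X₁ X₂ : (x : M) → TangentSpace I x} {u₁ u₂ : ℝ → ℝ} {s : ℝ} {x y : ℝ → M}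

theorem IsControlled.intervalIntegrable [CompleteSpace E] (hx : IsControlled I X₁ X₂ u₁ u₂ s x)
    (hX₁ : ContMDiff I I.tangent ∞ fun x => (⟨x, X₁ x⟩ : TangentBundle I M))
    (hX₂ : ContMDiff I I.tangent ∞ fun x => (⟨x, X₂ x⟩ : TangentBundle I M))
    (hu₁ : IntervalIntegrable u₁ volume 0 s) (hu₂ : IntervalIntegrable u₂ volume 0 s)
    {f : M → ℝ} (hf : ContMDiff I 𝓘(ℝ, ℝ) ∞ f) (hs : 0 ≤ s) :
    IntervalIntegrable (fun τ => u₁ τ * fieldDeriv I X₁ f (x τ) + u₂ τ * fieldDeriv I X₂ f (x τ))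
      volume 0 s := by
  have hc := hx.continuousOn
  rw [← uIcc_of_le hs] at hc
  exact (hu₁.mul_continuousOn ((continuous_fieldDeriv hX₁ hf).comp_continuousOn hc)).add
    (hu₂.mul_continuousOn ((continuous_fieldDeriv hX₂ hf).comp_continuousOn hc))

theorem IsControlled.sub_eq [CompleteSpace E] (hx : IsControlled I X₁ X₂ u₁ u₂ s x)
    (hX₁ : ContMDiff I I.tangent ∞ fun x => (⟨x, X₁ x⟩ : TangentBundle I M))
    (hX₂ : ContMDiff I I.tangent ∞ fun x => (⟨x, X₂ x⟩ : TangentBundle I M))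
    (hu₁ : IntervalIntegrable u₁ volume 0 s) (hu₂ : IntervalIntegrable u₂ volume 0 s)
    {f : M → ℝ} (hf : ContMDiff I 𝓘(ℝ, ℝ) ∞ f) {t t' : ℝ} (ht : t ∈ Icc 0 s) (ht' : t' ∈ Icc 0 s) :
    f (x t') - f (x t) = ∫ τ in t..t',
      (u₁ τ * fieldDeriv I X₁ f (x τ) + u₂ τ * fieldDeriv I X₂ f (x τ)) := by
  have hs : 0 ≤ s := ht.1.trans ht.2
  have hint := hx.intervalIntegrable hX₁ hX₂ hu₁ hu₂ hf hs
  rw [hx.equation f hf t' ht', hx.equation f hf t ht, add_sub_add_left_eq_sub]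
  refine intervalIntegral.integral_interval_sub_left (hint.mono_set ?_) (hint.mono_set ?_)
  · rw [uIcc_of_le hs, uIcc_of_le ht'.1]; exact Icc_subset_Icc_right ht'.2
  · rw [uIcc_of_le hs, uIcc_of_le ht.1]; exact Icc_subset_Icc_right ht.2

/-- Two controlled curves that agree at a time agree shortly afterwards. -/
theorem IsControlled.locally_eq [FiniteDimensional ℝ E] [T2Space M]
    (hX₁ : ContMDiff I I.tangent ∞ fun x => (⟨x, X₁ x⟩ : TangentBundle I M))
    (hX₂ : ContMDiff I I.tangent ∞ fun x => (⟨x, X₂ x⟩ : TangentBundle I M))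
    (hu₁ : IntervalIntegrable u₁ volume 0 s) (hu₂ : IntervalIntegrable u₂ volume 0 s)
    (hx : IsControlled I X₁ X₂ u₁ u₂ s x) (hy : IsControlled I X₁ X₂ u₁ u₂ s y)
    {t : ℝ} (ht : t ∈ Ico 0 s) (hxy : x t = y t) :
    ∃ t' ∈ Ioc t s, ∀ τ ∈ Icc t t', x τ = y τ := by
  have := FiniteDimensional.complete ℝ E
  set p := x t with hp
  set e := extChartAt I p with he
  obtain ⟨N, hNo, hpN, hNs, hN⟩ := exists_coordinate (I := I) p
  have hlip : ∀ X : (x : M) → TangentSpace I x,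
      (ContMDiff I I.tangent ∞ fun x => (⟨x, X x⟩ : TangentBundle I M)) →
      ∃ K : NNReal, ∃ W ∈ 𝓝 (e p), LipschitzOnWith K (chartField I p X) W := fun X hX =>
    (((contDiffOn_chartField p hX).contDiffAt ((isOpen_extChartAt_target p).mem_nhds
      (mem_extChartAt_target p))).of_le (by simp)).exists_lipschitzOnWith
  obtain ⟨K₁, W₁, hW₁, hK₁⟩ := hlip X₁ hX₁
  obtain ⟨K₂, W₂, hW₂, hK₂⟩ := hlip X₂ hX₂
  set K : ℝ := K₁ + K₂ with hK
  have hnb : N ∩ e ⁻¹' (W₁ ∩ W₂) ∈ 𝓝 p :=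
    Filter.inter_mem (hNo.mem_nhds hpN)
      ((continuousAt_extChartAt p).preimage_mem_nhds (Filter.inter_mem hW₁ hW₂))
  have htI : t ∈ Icc 0 s := ⟨ht.1, ht.2.le⟩
  have hxc : ContinuousWithinAt x (Icc t s) t :=
    (hx.continuousOn t htI).mono (Icc_subset_Icc_left ht.1)
  have hyc : ContinuousWithinAt y (Icc t s) t :=
    (hy.continuousOn t htI).mono (Icc_subset_Icc_left ht.1)
  have hsub : uIcc t s ⊆ uIcc 0 s := by
    rw [uIcc_of_le ht.2.le, uIcc_of_le (ht.1.trans ht.2.le)]; exact Icc_subset_Icc_left ht.1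
  have hu : IntervalIntegrable (fun τ => |u₁ τ| + |u₂ τ|) volume t s :=
    (hu₁.abs.add hu₂.abs).mono_set hsub
  have hprim : ContinuousWithinAt (fun τ => K * ∫ σ in t..τ, (|u₁ σ| + |u₂ σ|)) (Icc t s) t := by
    have := intervalIntegral.continuousOn_primitive_interval (μ := volume)
      (intervalIntegrable_iff_integrableOn_Icc_of_le ht.2.le |>.1 hu |> fun h => by
        rwa [← uIcc_of_le ht.2.le] at h)
    rw [uIcc_of_le ht.2.le] at this
    exact (this t (left_mem_Icc.2 ht.2.le)).const_smul K
  -- The controls are merely integrable, so the window is cut by the size of their integral: the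
  -- Lipschitz constant times the control mass stays below 1/2.
  have hev : ∀ᶠ τ in 𝓝[Icc t s] t, x τ ∈ N ∩ e ⁻¹' (W₁ ∩ W₂) ∧ y τ ∈ N ∩ e ⁻¹' (W₁ ∩ W₂) ∧
      K * ∫ σ in t..τ, (|u₁ σ| + |u₂ σ|) < 1 / 2 := by
    refine (hxc.eventually hnb).and (Filter.Eventually.and ?_ ?_)
    · exact hyc.eventually (by rw [← hxy]; exact hnb)
    · refine hprim.eventually (isOpen_Iio.mem_nhds ?_)
      simp
  obtain ⟨δ, hδ, hball⟩ := Metric.mem_nhdsWithin_iff.1 hev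
  set t' := min s (t + δ / 2) with ht'
  have htt' : t < t' := lt_min ht.2 (by linarith)
  have ht's : t' ≤ s := min_le_left _ _
  have hmem : ∀ τ ∈ Icc t t', x τ ∈ N ∩ e ⁻¹' (W₁ ∩ W₂) ∧ y τ ∈ N ∩ e ⁻¹' (W₁ ∩ W₂) ∧
      K * ∫ σ in t..τ, (|u₁ σ| + |u₂ σ|) < 1 / 2 := by
    intro τ hτ
    refine hball ⟨?_, hτ.1, hτ.2.trans ht's⟩
    rw [Metric.mem_ball, Real.dist_eq, abs_of_nonneg (by linarith [hτ.1])]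
    have := hτ.2.trans (min_le_right s (t + δ / 2))
    linarith
  have hIcc : Icc t t' ⊆ Icc 0 s := Icc_subset_Icc ht.1 ht's
  have hex : ∀ z : ℝ → M, ContinuousOn z (Icc 0 s) → (∀ τ ∈ Icc t t', z τ ∈ N) →
      ContinuousOn (fun τ => e (z τ)) (Icc t t') := fun z hz hzN =>
    (continuousOn_extChartAt p).comp (hz.mono hIcc) fun τ hτ => hNs (hzN τ hτ)
  have hDc : ContinuousOn (fun τ => ‖e (x τ) - e (y τ)‖) (Icc t t') :=
    ((hex x hx.continuousOn fun τ hτ => (hmem τ hτ).1.1).sub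
      (hex y hy.continuousOn fun τ hτ => (hmem τ hτ).2.1.1)).norm
  obtain ⟨σ, hσ, hmax⟩ := isCompact_Icc.exists_isMaxOn (nonempty_Icc.2 htt'.le) hDc
  set m := ‖e (x σ) - e (y σ)‖ with hm
  have hle : ∀ τ ∈ Icc t t', ‖e (x τ) - e (y τ)‖ ≤ m := fun τ hτ => hmax hτ
  have hm0 : m = 0 := by
    by_contra hne
    -- The equation is available only after testing with smooth functions, so the largest distance
    -- `m` is measured by a norming functional, realized near `p` by a global smooth function. The
    -- bound `m ≤ m * (K * ∫ …)` with a factor below 1/2 forces `m = 0`.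
    obtain ⟨l, hl1, hl2⟩ := exists_dual_vector ℝ (e (x σ) - e (y σ)) hne
    obtain ⟨f, hf, hfN⟩ := hN l
    have hσI := hIcc hσ
    have h1 := hx.sub_eq hX₁ hX₂ hu₁ hu₂ hf htI hσI
    have h2 := hy.sub_eq hX₁ hX₂ hu₁ hu₂ hf htI hσI
    have hsubσ : uIcc t σ ⊆ uIcc 0 s := by
      rw [uIcc_of_le hσ.1, uIcc_of_le (ht.1.trans ht.2.le)]
      exact (Icc_subset_Icc_right hσ.2).trans hIcc
    have h3 : l (e (x σ) - e (y σ)) = ∫ τ in t..σ,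
        ((u₁ τ * fieldDeriv I X₁ f (x τ) + u₂ τ * fieldDeriv I X₂ f (x τ)) -
        (u₁ τ * fieldDeriv I X₁ f (y τ) + u₂ τ * fieldDeriv I X₂ f (y τ))) := by
      rw [intervalIntegral.integral_sub
        ((hx.intervalIntegrable hX₁ hX₂ hu₁ hu₂ hf (ht.1.trans ht.2.le)).mono_set hsubσ)
        ((hy.intervalIntegrable hX₁ hX₂ hu₁ hu₂ hf (ht.1.trans ht.2.le)).mono_set hsubσ),
        ← h1, ← h2, ← hxy, map_sub, ← (hfN _ (hmem σ hσ).1.1).1, ← (hfN _ (hmem σ hσ).2.1.1).1]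
      ring
    have h4 : ‖∫ τ in t..σ,
        ((u₁ τ * fieldDeriv I X₁ f (x τ) + u₂ τ * fieldDeriv I X₂ f (x τ)) -
        (u₁ τ * fieldDeriv I X₁ f (y τ) + u₂ τ * fieldDeriv I X₂ f (y τ)))‖ ≤
        ∫ τ in t..σ, m * (K * (|u₁ τ| + |u₂ τ|)) := by
      refine intervalIntegral.norm_integral_le_of_norm_le hσ.1 (.of_forall fun τ hτ => ?_)
        (((hu.mono_set ?_).const_mul K).const_mul m)
      · have hτ' : τ ∈ Icc t t' := ⟨hτ.1.le, hτ.2.trans hσ.2⟩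
        have hxτ := hmem τ hτ'
        have hb : ∀ (X : (x : M) → TangentSpace I x) (K' : NNReal) (W : Set E),
            LipschitzOnWith K' (chartField I p X) W → e (x τ) ∈ W → e (y τ) ∈ W →
            |fieldDeriv I X f (x τ) - fieldDeriv I X f (y τ)| ≤ K' * m := by
          intro X K' W hK' hxW hyW
          rw [(hfN _ hxτ.1.1).2 X, (hfN _ hxτ.2.1.1).2 X, ← map_sub]
          refine (l.le_opNorm _).trans ?_
          rw [hl1, one_mul]
          exact (hK'.norm_sub_le hxW hyW).trans (by gcongr; exact hle τ hτ')
        have hb₁ := hb X₁ K₁ W₁ hK₁ hxτ.1.2.1 hxτ.2.1.2.1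
        have hb₂ := hb X₂ K₂ W₂ hK₂ hxτ.1.2.2 hxτ.2.1.2.2
        rw [show ∀ a b c d e f : ℝ, (a * b + c * d) - (a * e + c * f) =
          a * (b - e) + c * (d - f) by intros; ring]
        refine (norm_add_le _ _).trans ?_
        rw [Real.norm_eq_abs, Real.norm_eq_abs, abs_mul, abs_mul]
        have hm' : 0 ≤ m := norm_nonneg _
        calc |u₁ τ| * _ + |u₂ τ| * _ ≤ |u₁ τ| * (K₁ * m) + |u₂ τ| * (K₂ * m) := by gcongr
          _ ≤ |u₁ τ| * (K * m) + |u₂ τ| * (K * m) := by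
            gcongr
            · exact le_add_of_nonneg_right K₂.2
            · exact le_add_of_nonneg_left K₁.2
          _ = _ := by ring
      · rw [uIcc_of_le hσ.1, uIcc_of_le ht.2.le]
        exact Icc_subset_Icc_right (hσ.2.trans ht's)
    rw [← h3, intervalIntegral.integral_const_mul, intervalIntegral.integral_const_mul, hl2] at h4
    have h5 := (hmem σ hσ).2.2
    have hmpos : 0 < m := lt_of_le_of_ne (norm_nonneg _) (Ne.symm hne)
    have h6 : m ≤ m * (K * ∫ τ in t..σ, (|u₁ τ| + |u₂ τ|)) := (le_abs_self m).trans h4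
    nlinarith
  refine ⟨t', ⟨htt', ht's⟩, fun τ hτ => ?_⟩
  have h7 : e (x τ) = e (y τ) :=
    sub_eq_zero.1 (norm_le_zero_iff.1 ((hle τ hτ).trans hm0.le))
  exact e.injOn (hNs (hmem τ hτ).1.1) (hNs (hmem τ hτ).2.1.1) h7

theorem IsControlled.eqOn [FiniteDimensional ℝ E] [T2Space M]
    (hX₁ : ContMDiff I I.tangent ∞ fun x => (⟨x, X₁ x⟩ : TangentBundle I M))
    (hX₂ : ContMDiff I I.tangent ∞ fun x => (⟨x, X₂ x⟩ : TangentBundle I M))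
    (hu₁ : IntervalIntegrable u₁ volume 0 s) (hu₂ : IntervalIntegrable u₂ volume 0 s)
    (hx : IsControlled I X₁ X₂ u₁ u₂ s x) (hy : IsControlled I X₁ X₂ u₁ u₂ s y)
    (h0 : x 0 = y 0) : ∀ t ∈ Icc 0 s, x t = y t :=
  eq_of_forall_locally_eq hx.continuousOn hy.continuousOn h0 fun _ ht hxy =>
    hx.locally_eq hX₁ hX₂ hu₁ hu₂ hy ht hxy

/-- An integral curve, run at the constant speed `c`, is a controlled curve. -/
theorem isControlled_of_isMIntegralCurveOn [CompleteSpace E] (X₂ : (x : M) → TangentSpace I x)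
    (hX₁ : ContMDiff I I.tangent ∞ fun x => (⟨x, X₁ x⟩ : TangentBundle I M)) {c s : ℝ}
    (hγ : ∀ t ∈ Icc 0 s, ContinuousWithinAt x (Icc 0 s) t ∧
      HasMFDerivWithinAt 𝓘(ℝ, ℝ) I x (Icc 0 s) t ((1 : ℝ →L[ℝ] ℝ).smulRight (c • X₁ (x t)))) :
    IsControlled I X₁ X₂ (fun _ => c) (fun _ => 0) s x := by
  have hcont : ContinuousOn x (Icc 0 s) := fun t ht => (hγ t ht).1
  refine ⟨hcont, fun f hf t ht => ?_⟩
  have hst : Icc 0 t ⊆ Icc 0 s := Icc_subset_Icc_right ht.2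
  have hd : ∀ τ ∈ Icc 0 s, HasDerivWithinAt (fun τ => f (x τ)) (c * fieldDeriv I X₁ f (x τ))
      (Icc 0 s) τ := by
    intro τ hτ
    have h := ((hf (x τ)).mdifferentiableAt (by simp)).hasMFDerivAt.comp_hasMFDerivWithinAt τ
      (hγ τ hτ).2
    have h1 : HasFDerivWithinAt (𝕜 := ℝ) (E := ℝ) (F := ℝ) (f ∘ x) _ (Icc 0 s) τ :=
      hasMFDerivWithinAt_iff_hasFDerivWithinAt.1 h
    refine h1.hasDerivWithinAt.congr_deriv ?_
    refine Eq.trans (congrArg (mfderiv I 𝓘(ℝ, ℝ) f (x τ)) (one_smul ℝ (c • X₁ (x τ)))) ?_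
    exact map_smul (mfderiv I 𝓘(ℝ, ℝ) f (x τ)) c (X₁ (x τ))
  have hc : ContinuousOn (fun τ => c * fieldDeriv I X₁ f (x τ)) (Icc 0 t) :=
    continuousOn_const.mul ((continuous_fieldDeriv hX₁ hf).comp_continuousOn (hcont.mono hst))
  have h := intervalIntegral.integral_eq_sub_of_hasDeriv_right_of_le ht.1
    (f := fun τ => f (x τ)) (f' := fun τ => c * fieldDeriv I X₁ f (x τ))
    (hf.continuous.comp_continuousOn (hcont.mono hst))
    (fun τ hτ => by
      refine (hd τ (hst ⟨hτ.1.le, hτ.2.le⟩)).mono_of_mem_nhdsWithin ?_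
      refine mem_nhdsWithin_of_mem_nhds (Icc_mem_nhds hτ.1 (hτ.2.trans_le ht.2)))
    (by rw [← uIcc_of_le ht.1] at hc; exact hc.intervalIntegrable)
  simp only [zero_mul, add_zero]
  rw [h]; ring

end Uniqueness

/-! ### Flow tubes around an integral curve -/

section Tube

variable {E : Type*} [NormedAddCommGroup E] [NormedSpace ℝ E]
  {H : Type*} [TopologicalSpace H] {I : ModelWithCorners ℝ E H}
  {M : Type*} [TopologicalSpace M] [ChartedSpace H M] [IsManifold I ∞ M] [I.Boundaryless]
  {X : (x : M) → TangentSpace I x}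

/-- Uniqueness of controlled curves runs forward from time 0. Reversing time, with control −1, makes
it usable from the right end, where the reference chart sits. -/
theorem isControlled_reverse [CompleteSpace E]
    (hX : ContMDiff I I.tangent ∞ fun x => (⟨x, X x⟩ : TangentBundle I M)) {c : ℝ → M} {a b : ℝ}
    (hc : IsMIntegralCurveOn (I := I) c X (Icc a b)) :
    IsControlled I X X (fun _ => -1) (fun _ => 0) (b - a) fun τ => c (b - τ) := by
  refine isControlled_of_isMIntegralCurveOn (c := -1) X hX fun t ht => ?_
  have hmaps : MapsTo (fun τ => b - τ) (Icc 0 (b - a)) (Icc a b) := fun τ hτ =>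
    ⟨by linarith [hτ.2], by linarith [hτ.1]⟩
  have h1 : HasMFDerivWithinAt 𝓘(ℝ, ℝ) 𝓘(ℝ, ℝ) (fun τ : ℝ => b - τ) (Icc 0 (b - a)) t
      (ContinuousLinearMap.toSpanSingleton ℝ (-1 : ℝ)) :=
    hasMFDerivWithinAt_iff_hasFDerivWithinAt.2
      (((hasDerivAt_id t).const_sub b).hasFDerivAt.hasFDerivWithinAt)
  have h := (hc (b - t) (hmaps ht)).comp t h1 hmaps
  refine ⟨h.continuousWithinAt, h.congr_mfderiv ?_⟩
  refine ContinuousLinearMap.ext_ring ?_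
  refine Eq.trans ?_ (one_smul ℝ ((-1 : ℝ) • X (c (b - t)))).symm
  exact congrArg (fun r : ℝ => r • X (c (b - t))) (one_smul ℝ (-1 : ℝ))

/-- Two integral curves on `[a,b]` with the same end agree. -/
theorem integralCurve_eqOn_of_eq_right [FiniteDimensional ℝ E] [T2Space M]
    (hX : ContMDiff I I.tangent ∞ fun x => (⟨x, X x⟩ : TangentBundle I M)) {c c' : ℝ → M} {a b : ℝ}
    (hc : IsMIntegralCurveOn (I := I) c X (Icc a b))
    (hc' : IsMIntegralCurveOn (I := I) c' X (Icc a b)) (h : c b = c' b) :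
    ∀ t ∈ Icc a b, c t = c' t := by
  have := FiniteDimensional.complete ℝ E
  intro t ht
  have := (isControlled_reverse hX hc).eqOn hX hX (by simp) (by simp)
    (isControlled_reverse hX hc') (by simpa using h) (b - t)
    ⟨by linarith [ht.2], by linarith [ht.1]⟩
  simpa using this

/-- A family `ψ(t, ·)` of local parametrizations of `M`, smooth jointly in time, that moves along the
flow of `X`. -/
structure IsFlowTube (I : ModelWithCorners ℝ E H) (X : (x : M) → TangentSpace I x) (n : ℕ)
    (J : Set ℝ) (U : Set E) (ψ : ℝ × E → M) : Prop where
  smooth : ContMDiffOn 𝓘(ℝ, ℝ × E) I n ψ (J ×ˢ U)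
  velocity : ∀ t ∈ J, ∀ z ∈ U, HasMFDerivAt 𝓘(ℝ, ℝ) I (fun t => ψ (t, z)) t
    ((1 : ℝ →L[ℝ] ℝ).smulRight (X (ψ (t, z))))
  invertible : ∀ t ∈ J, ∀ z ∈ U, (mfderiv 𝓘(ℝ, E) I (fun z => ψ (t, z)) z).IsInvertible

theorem IsFlowTube.mono {n : ℕ} {J J' : Set ℝ} {U U' : Set E} {ψ : ℝ × E → M}
    (h : IsFlowTube I X n J U ψ) (hJ : J' ⊆ J) (hU : U' ⊆ U) : IsFlowTube I X n J' U' ψ :=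
  ⟨h.smooth.mono (prod_mono hJ hU), fun t ht z hz => h.velocity t (hJ ht) z (hU hz),
    fun t ht z hz => h.invertible t (hJ ht) z (hU hz)⟩

theorem IsFlowTube.isMIntegralCurveOn {n : ℕ} {J : Set ℝ} {U : Set E} {ψ : ℝ × E → M}
    (h : IsFlowTube I X n J U ψ) {z : E} (hz : z ∈ U) {S : Set ℝ} (hS : S ⊆ J) :
    IsMIntegralCurveOn (I := I) (fun t => ψ (t, z)) X S := fun t ht =>
  (h.velocity t (hS ht) z hz).hasMFDerivWithinAt

theorem IsInvertible.comp' {A B C : Type*} [TopologicalSpace A] [AddCommGroup A] [Module ℝ A]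
    [TopologicalSpace B] [AddCommGroup B] [Module ℝ B] [TopologicalSpace C] [AddCommGroup C]
    [Module ℝ C] {f : A →L[ℝ] B} {g : B →L[ℝ] C} (hg : g.IsInvertible) (hf : f.IsInvertible) :
    (g ∘L f).IsInvertible := by
  obtain ⟨e, rfl⟩ := hf
  obtain ⟨e', rfl⟩ := hg
  exact ⟨e.trans e', rfl⟩

/-- The time span `ε` and the neighbourhood `V` depend only on `p`, not on `h` or `r`; this
uniformity lets a tube be continued past a limit time. The new tube is `h` followed by the local
flow in the chart at `p`, and its space derivative is a composite of invertible maps. -/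
theorem exists_flowTube_step [FiniteDimensional ℝ E]
    (hX : ContMDiff I I.tangent ∞ fun x => (⟨x, X x⟩ : TangentBundle I M)) {n : ℕ} (hn : n ≠ 0)
    (p : M) :
    ∃ ε > 0, ∃ V : Set M, IsOpen V ∧ p ∈ V ∧ ∀ (h : E → M) (U₀ : Set E) (z₀ : E), IsOpen U₀ →
      z₀ ∈ U₀ → h z₀ ∈ V → ContMDiffOn 𝓘(ℝ, E) I n h U₀ →
      (∀ z ∈ U₀, (mfderiv 𝓘(ℝ, E) I h z).IsInvertible) → ∀ r : ℝ,
      ∃ U ⊆ U₀, IsOpen U ∧ z₀ ∈ U ∧ ∃ ψ : ℝ × E → M,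
        IsFlowTube I X n (Ioo (r - ε) (r + ε)) U ψ ∧ ∀ z ∈ U, ψ (r, z) = h z := by
  have := FiniteDimensional.complete ℝ E
  have hMn : IsManifold I n M := IsManifold.of_le (n := ∞) (by exact_mod_cast le_top)
  have hM1 : IsManifold I 1 M := IsManifold.of_le (n := ∞) (by exact_mod_cast le_top)
  have hn' : (n : ℕ∞ω) ≠ 0 := by exact_mod_cast hn
  have hnInf : (n : ℕ∞ω) ≤ ∞ := by exact_mod_cast le_top
  set e := extChartAt I p with he
  obtain ⟨ε, hε, VE, hVE, hpV, θ, hθ, hflow⟩ := exists_localFlow (isOpen_extChartAt_target (I := I) p)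
    (contDiffOn_chartField p hX) (mem_extChartAt_target p) n hn
  have hVo : IsOpen (e.source ∩ e ⁻¹' VE) :=
    (continuousOn_extChartAt p).isOpen_inter_preimage (isOpen_extChartAt_source p) hVE
  refine ⟨ε, hε, e.source ∩ e ⁻¹' VE, hVo, ⟨mem_extChartAt_source p, hpV⟩, ?_⟩
  intro h U₀ z₀ hU₀ hz₀ hhz hh hinv r
  refine ⟨U₀ ∩ h ⁻¹' (e.source ∩ e ⁻¹' VE), inter_subset_left,
    hh.continuousOn.isOpen_inter_preimage hU₀ hVo, ⟨hz₀, hhz⟩,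
    fun p => e.symm (θ (p.1 - r, e (h p.2))), ?_, ?_⟩
  · set U := U₀ ∩ h ⁻¹' (e.source ∩ e ⁻¹' VE) with hU
    have htr : ∀ t ∈ Ioo (r - ε) (r + ε), t - r ∈ Ioo (-ε) ε := fun t ht =>
      ⟨by linarith [ht.1], by linarith [ht.2]⟩
    have htar : ∀ t ∈ Ioo (r - ε) (r + ε), ∀ z ∈ U, θ (t - r, e (h z)) ∈ e.target :=
      fun t ht z hz => ((hflow _ hz.2.2).2 _ (htr t ht)).1
    have hopen : IsOpen (Ioo (-ε) ε ×ˢ VE) := isOpen_Ioo.prod hVE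
    have hθat : ∀ t ∈ Ioo (r - ε) (r + ε), ∀ z ∈ U, ContDiffAt ℝ n θ (t - r, e (h z)) :=
      fun t ht z hz => hθ.contDiffAt (hopen.mem_nhds ⟨htr t ht, hz.2.2⟩)
    have hhat : ∀ z ∈ U, ContMDiffAt 𝓘(ℝ, E) I n h z := fun z hz =>
      hh.contMDiffAt (hU₀.mem_nhds hz.1)
    have heh : ∀ z ∈ U, ContDiffAt ℝ n (fun z => e (h z)) z := fun z hz =>
      (((contMDiffAt_extChartAt_of_mem p hz.2.1).of_le hnInf).comp z (hhat z hz)).contDiffAt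
    refine ⟨?_, ?_, ?_⟩
    · rintro ⟨t, z⟩ ⟨ht, hz⟩
      have h1 : ContDiffAt ℝ n (fun p : ℝ × E => θ (p.1 - r, e (h p.2))) (t, z) := by
        refine ContDiffAt.comp (t, z) (g := θ) (f := fun p : ℝ × E => (p.1 - r, e (h p.2)))
          (hθat t ht z hz) ?_
        refine ContDiffAt.prodMk (contDiffAt_fst.sub contDiffAt_const) ?_
        exact ContDiffAt.comp (t, z) (g := fun z => e (h z)) (f := Prod.snd) (heh z hz)
          contDiffAt_snd
      exact (((contMDiffAt_extChartAt_symm p (htar t ht z hz)).of_le hnInf).comp (t, z)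
        h1.contMDiffAt).contMDiffWithinAt
    · intro t ht z hz
      refine hasMFDerivAt_symm_comp p (u := fun t => θ (t - r, e (h z))) ?_ (htar t ht z hz)
      have h1 := ((hflow _ hz.2.2).2 _ (htr t ht)).2.1
      have h2 := HasDerivAt.comp_sub_const t r h1
      exact h2
    · intro t ht z hz
      have h1 : MDifferentiableAt 𝓘(ℝ, E) I e.symm (θ (t - r, e (h z))) :=
        (contMDiffAt_extChartAt_symm p (htar t ht z hz)).mdifferentiableAt (by simp)
      have h2 : MDifferentiableAt 𝓘(ℝ, E) 𝓘(ℝ, E) (fun y => θ (t - r, y)) (e (h z)) := by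
        refine ((ContDiffAt.comp (e (h z)) (g := θ) (f := fun y => (t - r, y))
          (hθat t ht z hz) (contDiffAt_const.prodMk contDiffAt_id)).differentiableAt
            hn').mdifferentiableAt
      have h3 : MDifferentiableAt I 𝓘(ℝ, E) e (h z) :=
        (contMDiffAt_extChartAt_of_mem p hz.2.1).mdifferentiableAt (by simp)
      have h4 : MDifferentiableAt 𝓘(ℝ, E) I h z := (hhat z hz).mdifferentiableAt hn'
      have h5 := h1.hasMFDerivAt.comp (e (h z)) h2.hasMFDerivAt
      have h6 := h5.comp (h z) h3.hasMFDerivAt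
      have h7 := h6.comp z h4.hasMFDerivAt
      have h8 := h7.mfderiv
      rw [show (fun z => e.symm (θ ((t, z).1 - r, e (h (t, z).2)))) =
        ((e.symm ∘ fun y => θ (t - r, y)) ∘ e) ∘ h from rfl, h8]
      refine IsInvertible.comp' (IsInvertible.comp' (IsInvertible.comp' ?_ ?_) ?_) ?_
      · exact isInvertible_mfderiv_symm p (htar t ht z hz)
      · rw [mfderiv_eq_fderiv]
        exact ((hflow _ hz.2.2).2 _ (htr t ht)).2.2
      · exact isInvertible_mfderiv_extChartAt hz.2.1
      · exact hinv z hz.1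
  · intro z hz
    simp only [sub_self]
    rw [(hflow _ hz.2.2).1, e.left_inv hz.2.1]

/-- Both tubes consist of integral curves that agree at `r`, hence on the common time interval. Near
`r` the glued map therefore coincides with `ψ₁`, and the switch causes no break. -/
theorem IsFlowTube.glue [T2Space M] [CompleteSpace E]
    (hX : ContMDiff I I.tangent ∞ fun x => (⟨x, X x⟩ : TangentBundle I M)) {n : ℕ} 
    {a b c d r : ℝ} {U : Set E} {ψ₁ ψ₂ : ℝ × E → M} (hU : IsOpen U)
    (h₁ : IsFlowTube I X n (Ioo a b) U ψ₁) (h₂ : IsFlowTube I X n (Ioo c d) U ψ₂)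
    (hr₁ : r ∈ Ioo a b) (hr₂ : r ∈ Ioo c d) (h : ∀ z ∈ U, ψ₁ (r, z) = ψ₂ (r, z)) :
    IsFlowTube I X n (Ioo c b) U (fun p => if p.1 < r then ψ₂ p else ψ₁ p) := by
  have hX1 : ContMDiff I I.tangent 1 fun x => (⟨x, X x⟩ : TangentBundle I M) :=
    hX.of_le (by exact_mod_cast le_top)
  have hM1 : IsManifold I 1 M := IsManifold.of_le (n := ∞) (by exact_mod_cast le_top)
  have hagree : ∀ z ∈ U, ∀ t ∈ Ioo (max a c) (min b d), ψ₁ (t, z) = ψ₂ (t, z) := by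
    intro z hz
    refine isMIntegralCurveOn_Ioo_eqOn_of_contMDiff_boundaryless
      (t₀ := r) ⟨max_lt hr₁.1 hr₂.1, lt_min hr₁.2 hr₂.2⟩ hX1
      (h₁.isMIntegralCurveOn hz (Ioo_subset_Ioo (le_max_left _ _) (min_le_left _ _)))
      (h₂.isMIntegralCurveOn hz (Ioo_subset_Ioo (le_max_right _ _) (min_le_right _ _))) (h z hz)
  set ψ : ℝ × E → M := fun p => if p.1 < r then ψ₂ p else ψ₁ p with hψ
  have key : ∀ t ∈ Ioo c b, ∃ i : Bool, ∃ J : Set ℝ, IsOpen J ∧ t ∈ J ∧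
      J ⊆ (if i then Ioo a b else Ioo c d) ∧
      ∀ τ ∈ J, ∀ z ∈ U, ψ (τ, z) = (if i then ψ₁ else ψ₂) (τ, z) := by
    intro t ht
    rcases lt_or_ge t r with htr | htr
    · refine ⟨false, Ioo c r, isOpen_Ioo, ⟨ht.1, htr⟩, ?_, fun τ hτ z _ => ?_⟩
      · simpa using Ioo_subset_Ioo_right hr₂.2.le
      · simp [hψ, hτ.2]
    · refine ⟨true, Ioo (max a c) b, isOpen_Ioo, ⟨(max_lt hr₁.1 hr₂.1).trans_le htr, ht.2⟩, ?_,
        fun τ hτ z hz => ?_⟩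
      · simpa using Ioo_subset_Ioo_left (le_max_left a c)
      · by_cases hτr : τ < r
        · simp only [hψ, hτr, if_true]
          exact (hagree z hz τ ⟨hτ.1, lt_min hτ.2 (hτr.trans hr₂.2)⟩).symm
        · simp [hψ, hτr]
  have key' : ∀ t ∈ Ioo c b, ∃ ψ' : ℝ × E → M, ∃ J : Set ℝ, IsOpen J ∧ t ∈ J ∧
      IsFlowTube I X n J U ψ' ∧ ∀ τ ∈ J, ∀ z ∈ U, ψ (τ, z) = ψ' (τ, z) := by
    intro t ht
    obtain ⟨i, J, hJ, htJ, hJs, heq⟩ := key t ht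
    cases i with
    | false => exact ⟨ψ₂, J, hJ, htJ, h₂.mono (by simpa using hJs) subset_rfl, by simpa using heq⟩
    | true => exact ⟨ψ₁, J, hJ, htJ, h₁.mono (by simpa using hJs) subset_rfl, by simpa using heq⟩
  refine ⟨?_, ?_, ?_⟩
  · rintro ⟨t, z⟩ ⟨ht, hz⟩
    obtain ⟨ψ', J, hJ, htJ, htube, heq⟩ := key' t ht
    have hnb : J ×ˢ U ∈ 𝓝 (t, z) := (hJ.prod hU).mem_nhds ⟨htJ, hz⟩
    refine ((htube.smooth.contMDiffAt hnb).congr_of_eventuallyEq ?_).contMDiffWithinAt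
    filter_upwards [hnb] with p hp using heq p.1 hp.1 p.2 hp.2
  · intro t ht z hz
    obtain ⟨ψ', J, hJ, htJ, htube, heq⟩ := key' t ht
    have h1 := (htube.velocity t htJ z hz).congr_of_eventuallyEq
      (f₁ := fun t => ψ (t, z)) (by
        filter_upwards [hJ.mem_nhds htJ] with τ hτ using heq τ hτ z hz)
    have h2 : ψ' (t, z) = ψ (t, z) := (heq t htJ z hz).symm
    rw [h2] at h1
    exact h1
  · intro t ht z hz
    obtain ⟨ψ', J, hJ, htJ, htube, heq⟩ := key' t ht
    have h1 : (fun z => ψ (t, z)) =ᶠ[𝓝 z] fun z => ψ' (t, z) := by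
      filter_upwards [hU.mem_nhds hz] with y hy using heq t htJ y hy
    rw [h1.mfderiv_eq]
    exact htube.invertible t htJ z hz

/-- The flow of `X` around an integral curve on `[0,s]`, in the chart at its end. -/
theorem exists_flowTube [FiniteDimensional ℝ E] [T2Space M]
    (hX : ContMDiff I I.tangent ∞ fun x => (⟨x, X x⟩ : TangentBundle I M)) {n : ℕ} (hn : n ≠ 0)
    {s : ℝ} (hs : 0 ≤ s) {γ : ℝ → M} (hγ : IsMIntegralCurveOn (I := I) γ X (Icc 0 s)) :
    ∃ δ > 0, ∃ U ⊆ (extChartAt I (γ s)).target, IsOpen U ∧ extChartAt I (γ s) (γ s) ∈ U ∧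
      ∃ ψ : ℝ × E → M, IsFlowTube I X n (Ioo (-δ) (s + δ)) U ψ ∧
      (∀ z ∈ U, ψ (s, z) = (extChartAt I (γ s)).symm z) ∧
      ∀ t ∈ Icc 0 s, ψ (t, extChartAt I (γ s) (γ s)) = γ t := by
  have := FiniteDimensional.complete ℝ E
  have hn' : (n : ℕ∞ω) ≠ 0 := by exact_mod_cast hn
  have hnInf : (n : ℕ∞ω) ≤ ∞ := by exact_mod_cast le_top
  set e := extChartAt I (γ s) with he
  set z₀ := e (γ s) with hz₀
  -- `P r` says that some tube in the chart at `γ s` reaches back to time `r`; the infimum of these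
  -- times is shown not to be an obstacle.
  let P : ℝ → Prop := fun r => ∃ δ > 0, ∃ U ⊆ e.target, IsOpen U ∧ z₀ ∈ U ∧
    ∃ ψ : ℝ × E → M, IsFlowTube I X n (Ioo (r - δ) (s + δ)) U ψ ∧ ∀ z ∈ U, ψ (s, z) = e.symm z
  have hcurve : ∀ r ∈ Icc 0 s, ∀ δ > 0, ∀ U : Set E, z₀ ∈ U → ∀ ψ : ℝ × E → M,
      IsFlowTube I X n (Ioo (r - δ) (s + δ)) U ψ → (∀ z ∈ U, ψ (s, z) = e.symm z) →
      ∀ t ∈ Icc r s, ψ (t, z₀) = γ t := by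
    intro r hr δ hδ U hU ψ hψ hψs
    refine integralCurve_eqOn_of_eq_right hX
      (hψ.isMIntegralCurveOn hU (Icc_subset_Ioo (by linarith) (by linarith)))
      (hγ.mono (Icc_subset_Icc_left hr.1)) ?_
    rw [hψs z₀ hU]
    exact e.left_inv (mem_extChartAt_source (γ s))
  have hPs : P s := by
    obtain ⟨ε, hε, V, hV, hpV, hstep⟩ := exists_flowTube_step (n := n) hX hn (γ s)
    obtain ⟨U, hUs, hUo, hzU, ψ, hψ, hψr⟩ := hstep e.symm e.target z₀
      (isOpen_extChartAt_target (γ s)) (mem_extChartAt_target (γ s))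
      (by rw [hz₀, he, extChartAt_to_inv]; exact hpV)
      (fun z hz => ((contMDiffAt_extChartAt_symm (γ s) hz).of_le hnInf).contMDiffWithinAt)
      (fun z hz => isInvertible_mfderiv_symm (γ s) hz) s
    exact ⟨ε, hε, U, hUs, hUo, hzU, ψ, hψ, hψr⟩
  set R : Set ℝ := {r | r ∈ Icc 0 s ∧ P r} with hR
  have hRne : R.Nonempty := ⟨s, ⟨hs, le_rfl⟩, hPs⟩
  have hRbdd : BddBelow R := ⟨0, fun r hr => hr.1.1⟩
  set m := sInf R with hm
  have hm0 : 0 ≤ m := le_csInf hRne fun r hr => hr.1.1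
  have hms : m ≤ s := csInf_le hRbdd ⟨⟨hs, le_rfl⟩, hPs⟩
  -- The step at `γ m` has a fixed span `ε`. Started from a reached time `r < m + ε / 2`, it gives a
  -- tube back to `r - ε / 2 < m`, which contradicts the infimum unless 0 is reached.
  obtain ⟨ε, hε, V, hV, hpV, hstep⟩ := exists_flowTube_step (n := n) hX hn (γ m)
  have hcont : ContinuousWithinAt γ (Icc 0 s) m := (hγ.continuousOn) m ⟨hm0, hms⟩
  obtain ⟨η, hη, hball⟩ := Metric.mem_nhdsWithin_iff.1 (hcont (hV.mem_nhds hpV))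
  obtain ⟨r, hrR, hrm⟩ := exists_lt_of_csInf_lt hRne
    (show sInf R < m + min (ε / 2) η from lt_add_of_pos_right _ (lt_min (by linarith) hη))
  have hmr : m ≤ r := csInf_le hRbdd hrR
  obtain ⟨hrI, δ, hδ, U, hUt, hUo, hzU, ψ, hψ, hψs⟩ := hrR
  have hrV : γ r ∈ V := by
    refine hball ⟨?_, hrI⟩
    rw [Metric.mem_ball, Real.dist_eq, abs_of_nonneg (by linarith)]
    linarith [min_le_right (ε / 2) η]
  have hψr : ψ (r, z₀) = γ r := hcurve r hrI δ hδ U hzU ψ hψ hψs r ⟨le_rfl, hrI.2⟩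
  have hrmem : r ∈ Ioo (r - δ) (s + δ) := ⟨by linarith, by linarith [hrI.2]⟩
  obtain ⟨U', hU'U, hU'o, hzU', ψ', hψ', hψ'r⟩ := hstep (fun z => ψ (r, z)) U z₀ hUo hzU
    (by simpa [hψr] using hrV)
    (by
      intro z hz
      have h1 : ContMDiffAt 𝓘(ℝ, E) 𝓘(ℝ, ℝ × E) n (fun z : E => (r, z)) z :=
        (contDiffAt_const.prodMk contDiffAt_id).contMDiffAt
      exact ((hψ.smooth.contMDiffAt ((isOpen_Ioo.prod hUo).mem_nhds ⟨hrmem, hz⟩)).comp z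
        h1).contMDiffWithinAt)
    (fun z hz => hψ.invertible r hrmem z hz) r
  have hglue := (hψ.mono subset_rfl hU'U).glue hX hU'o hψ' hrmem ⟨by linarith, by linarith⟩
    (fun z hz => (hψ'r z hz).symm)
  have hglues : ∀ z ∈ U', (fun p : ℝ × E => if p.1 < r then ψ' p else ψ p) (s, z) = e.symm z := by
    intro z hz
    simp only [not_lt.2 hrI.2, if_false]
    exact hψs z (hU'U hz)
  have hP : ∀ r', r - ε / 2 ≤ r' → P r' := by
    intro r' hr'
    refine ⟨min (ε / 2) δ, lt_min (by linarith) hδ, U', hU'U.trans hUt, hU'o, hzU', _,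
      hglue.mono (Ioo_subset_Ioo ?_ ?_) subset_rfl, hglues⟩
    · linarith [min_le_left (ε / 2) δ]
    · linarith [min_le_right (ε / 2) δ]
  have h0 : P 0 := by
    by_contra hcon
    have hlt : 0 < r - ε / 2 := by
      by_contra hle
      exact hcon (hP 0 (not_lt.1 hle))
    have hmem : r - ε / 2 ∈ R := ⟨⟨hlt.le, by linarith [hrI.2]⟩, hP _ le_rfl⟩
    have := csInf_le hRbdd hmem
    linarith [min_le_left (ε / 2) η]
  obtain ⟨δ', hδ', U'', hU''t, hU''o, hzU'', ψ'', hψ'', hψ''s⟩ := h0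
  refine ⟨δ', hδ', U'', hU''t, hU''o, hzU'', ψ'', by simpa using hψ'', hψ''s, ?_⟩
  exact hcurve 0 ⟨le_rfl, hs⟩ δ' hδ' U'' hzU'' ψ'' hψ'' hψ''s

end Tube

/-! ### Time-dependent maps and pulled-back fields in a vector space -/

section Slices

variable {E F : Type*} [NormedAddCommGroup E] [NormedSpace ℝ E] [NormedAddCommGroup F]
  [NormedSpace ℝ F]

theorem hasFDerivAt_slice {h : ℝ × E → F} {t : ℝ} {z : E} (hh : DifferentiableAt ℝ h (t, z)) :
    HasFDerivAt (fun z => h (t, z)) ((fderiv ℝ h (t, z)).comp (ContinuousLinearMap.inr ℝ ℝ E)) z :=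
  hh.hasFDerivAt.comp z (hasFDerivAt_prodMk_right t z)

theorem hasDerivAt_slice {h : ℝ × E → F} {t : ℝ} {z : E} (hh : DifferentiableAt ℝ h (t, z)) :
    HasDerivAt (fun τ => h (τ, z)) (fderiv ℝ h (t, z) (1, 0)) t := by
  have := (hh.hasFDerivAt.comp t (hasFDerivAt_prodMk_left t z)).hasDerivAt
  simpa [Function.comp_def] using this

/-- Symmetry of the second derivative of `h` exchanges the time derivative with the space
derivative. -/
theorem hasDerivAt_fderiv_slice {h k : ℝ × E → F} {t : ℝ} {z : E} (hh : ContDiffAt ℝ 2 h (t, z))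
    (hk : ∀ᶠ p in 𝓝 (t, z), HasDerivAt (fun τ => h (τ, p.2)) (k p) p.1) :
    HasDerivAt (fun τ => fderiv ℝ (fun z => h (τ, z)) z) (fderiv ℝ (fun z => k (t, z)) z) t := by
  have hd : ∀ᶠ p in 𝓝 (t, z), DifferentiableAt ℝ h p := by
    filter_upwards [hh.eventually (by simp)] with p hp using hp.differentiableAt (by simp)
  have h2 : DifferentiableAt ℝ (fderiv ℝ h) (t, z) :=
    (hh.fderiv_right (m := 1) (by norm_num)).differentiableAt (by simp)
  have hsym := hh.isSymmSndFDerivAt (by simp)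
  have h3 := (ContinuousLinearMap.compL ℝ E (ℝ × E) F).flip (ContinuousLinearMap.inr ℝ ℝ E)
    |>.hasFDerivAt (x := fderiv ℝ h (t, z)) |>.comp_hasDerivAt t (hasDerivAt_slice h2)
  have h4 : (fun τ => fderiv ℝ (fun z => h (τ, z)) z) =ᶠ[𝓝 t]
      fun τ => (fderiv ℝ h (τ, z)).comp (ContinuousLinearMap.inr ℝ ℝ E) := by
    have hc : Tendsto (fun τ : ℝ => (τ, z)) (𝓝 t) (𝓝 (t, z)) :=
      (Continuous.prodMk_left z).tendsto t
    filter_upwards [hc.eventually hd] with τ hτ using (hasFDerivAt_slice hτ).fderiv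
  have h5 : (fun y => k (t, y)) =ᶠ[𝓝 z] fun y => fderiv ℝ h (t, y) (1, 0) := by
    have hc : Tendsto (fun y : E => (t, y)) (𝓝 z) (𝓝 (t, z)) :=
      (Continuous.prodMk_right t).tendsto z
    filter_upwards [hc.eventually hk, hc.eventually hd] with y hy hy'
    exact hy.unique (hasDerivAt_slice hy')
  refine (h3.congr_of_eventuallyEq h4).congr_deriv ?_
  rw [h5.fderiv_eq]
  have h6 := (hasFDerivAt_slice h2).clm_apply (hasFDerivAt_const ((1 : ℝ), (0 : E)) z)
  ext w
  rw [h6.fderiv]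
  simpa using hsym (1, 0) (0, w)

variable [CompleteSpace E] {f : ℝ × E → E} {W : Set (ℝ × E)} {T : Set E} {X Y : E → E} {n : ℕ}

/-- One order of smoothness is lost because the pulled-back field contains the inverse of the space
derivative of `f`; inversion of operators is itself smooth. -/
theorem contDiffOn_pulledField (hW : IsOpen W) (hf : ContDiffOn ℝ (n + 1) f W) (hT : IsOpen T)
    (hfT : MapsTo f W T) (hY : ContDiffOn ℝ ∞ Y T)
    (hinv : ∀ p ∈ W, (fderiv ℝ (fun z => f (p.1, z)) p.2).IsInvertible) :
    ContDiffOn ℝ n (fun p => (fderiv ℝ (fun z => f (p.1, z)) p.2).inverse (Y (f p))) W := by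
  rintro ⟨t, z⟩ hp
  have hfp : ContDiffAt ℝ (n + 1) f (t, z) := hf.contDiffAt (hW.mem_nhds hp)
  have h1 : (fun p : ℝ × E => fderiv ℝ (fun z => f (p.1, z)) p.2) =ᶠ[𝓝 (t, z)]
      fun p => (fderiv ℝ f p).comp (ContinuousLinearMap.inr ℝ ℝ E) := by
    filter_upwards [hW.mem_nhds hp] with p hp
    exact (hasFDerivAt_slice ((hf.contDiffAt (hW.mem_nhds hp)).differentiableAt (by simp))).fderiv
  have h2 : ContDiffAt ℝ n (fun p : ℝ × E => fderiv ℝ (fun z => f (p.1, z)) p.2) (t, z) :=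
    ((hfp.fderiv_right (m := n) le_rfl).clm_comp contDiffAt_const).congr_of_eventuallyEq h1
  have h3 : ContDiffAt ℝ n ContinuousLinearMap.inverse (fderiv ℝ (fun z => f (t, z)) z) := by
    obtain ⟨e, he⟩ := hinv _ hp
    simp only at he
    rw [← he]
    exact contDiffAt_map_inverse e
  have h4 : ContDiffAt ℝ n (fun p => (fderiv ℝ (fun z => f (p.1, z)) p.2).inverse) (t, z) :=
    ContDiffAt.comp (t, z) (g := ContinuousLinearMap.inverse)
      (f := fun p : ℝ × E => fderiv ℝ (fun z => f (p.1, z)) p.2) h3 h2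
  have h5 : ContDiffAt ℝ n Y (f (t, z)) :=
    (hY.contDiffAt (hT.mem_nhds (hfT hp))).of_le (by exact_mod_cast le_top)
  exact (h4.clm_apply (h5.comp (t, z) (hfp.of_le (by exact_mod_cast n.le_succ)))).contDiffWithinAt

/-- Let A be the space derivative of f and k the pulled-back field, and differentiate A k = Y ∘ f in
time. Since the slices move along X, A' = DX · A, and what remains is A k' = DY(X) − DX(Y) = [X, Y].
-/
theorem hasDerivAt_pulledField (hW : IsOpen W) (hf : ContDiffOn ℝ 2 f W) (hT : IsOpen T)
    (hfT : MapsTo f W T) (hX : ContDiffOn ℝ ∞ X T) (hY : ContDiffOn ℝ ∞ Y T)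
    (hinv : ∀ p ∈ W, (fderiv ℝ (fun z => f (p.1, z)) p.2).IsInvertible)
    (hvel : ∀ p ∈ W, HasDerivAt (fun τ => f (τ, p.2)) (X (f p)) p.1) {t : ℝ} {z : E}
    (hp : (t, z) ∈ W) :
    HasDerivAt (fun τ => (fderiv ℝ (fun z => f (τ, z)) z).inverse (Y (f (τ, z))))
      ((fderiv ℝ (fun z => f (t, z)) z).inverse (VectorField.lieBracket ℝ X Y (f (t, z)))) t := by
  set k : ℝ × E → E := fun p => (fderiv ℝ (fun z => f (p.1, z)) p.2).inverse (Y (f p)) with hk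
  have hkC : ContDiffOn ℝ 1 k W :=
    contDiffOn_pulledField (n := 1) hW (by norm_num; exact hf) hT hfT hY hinv
  have hkd := hasDerivAt_slice ((hkC.contDiffAt (hW.mem_nhds hp)).differentiableAt (by simp))
  set k' := fderiv ℝ k (t, z) (1, 0)
  have hfp := hf.contDiffAt (hW.mem_nhds hp)
  have hXd : DifferentiableAt ℝ X (f (t, z)) :=
    (hX.contDiffAt (hT.mem_nhds (hfT hp))).differentiableAt (by simp)
  have hYd : DifferentiableAt ℝ Y (f (t, z)) :=
    (hY.contDiffAt (hT.mem_nhds (hfT hp))).differentiableAt (by simp)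
  have hA := hasDerivAt_fderiv_slice (k := fun p => X (f p)) hfp
    (by filter_upwards [hW.mem_nhds hp] with p hp using hvel p hp)
  have hsl := hasFDerivAt_slice (hfp.differentiableAt (by simp))
  have hA' : fderiv ℝ (fun z => X (f (t, z))) z =
      (fderiv ℝ X (f (t, z))).comp (fderiv ℝ (fun z => f (t, z)) z) :=
    fderiv_comp z (g := X) (f := fun z => f (t, z)) hXd hsl.differentiableAt
  have hprod := hA.clm_apply hkd
  have heq : (fun τ => fderiv ℝ (fun z => f (τ, z)) z (k (τ, z))) =ᶠ[𝓝 t]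
      fun τ => Y (f (τ, z)) := by
    have hc : Tendsto (fun τ : ℝ => (τ, z)) (𝓝 t) (𝓝 (t, z)) :=
      (Continuous.prodMk_left z).tendsto t
    filter_upwards [hc.eventually (hW.mem_nhds hp)] with τ hτ
    exact apply_inverse_apply (hinv _ hτ) _
  have hYt : HasDerivAt (fun τ => Y (f (τ, z))) (fderiv ℝ Y (f (t, z)) (X (f (t, z)))) t :=
    hYd.hasFDerivAt.comp_hasDerivAt t (hvel _ hp)
  have hmain := (hprod.congr_of_eventuallyEq heq.symm).unique hYt
  refine hkd.congr_deriv ?_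
  rw [VectorField.lieBracket_eq]
  beta_reduce
  rw [← hmain, hA']
  simp only [ContinuousLinearMap.comp_apply]
  rw [show k (t, z) = (fderiv ℝ (fun z => f (t, z)) z).inverse (Y (f (t, z))) from rfl,
    apply_inverse_apply (hinv _ hp), add_sub_cancel_left]
  exact (inverse_apply_apply (hinv _ hp) _).symm

end Slices

/-! ### Fields pulled back to a flow tube -/

section PullField

variable {E : Type*} [NormedAddCommGroup E] [NormedSpace ℝ E]
  {H : Type*} [TopologicalSpace H] {I : ModelWithCorners ℝ E H}
  {M : Type*} [TopologicalSpace M] [ChartedSpace H M]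

/-- The field `Y` pulled back by the parametrizations `ψ(t, ·)`. -/
noncomputable def pullField (I : ModelWithCorners ℝ E H) (ψ : ℝ × E → M)
    (Y : (x : M) → TangentSpace I x) (p : ℝ × E) : E :=
  (mfderiv 𝓘(ℝ, E) I (fun z => ψ (p.1, z)) p.2).inverse (Y (ψ p))

theorem pullField_add (ψ : ℝ × E → M) (Y Z : (x : M) → TangentSpace I x) (p : ℝ × E) :
    pullField I ψ (fun x => Y x + Z x) p = pullField I ψ Y p + pullField I ψ Z p :=
  map_add _ _ _

theorem pullField_smul (ψ : ℝ × E → M) (f : M → ℝ) (Y : (x : M) → TangentSpace I x) (p : ℝ × E) :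
    pullField I ψ (fun x => f x • Y x) p = f (ψ p) • pullField I ψ Y p :=
  map_smul _ _ _

variable [IsManifold I ∞ M] [I.Boundaryless] {X Y : (x : M) → TangentSpace I x} {n : ℕ} {J : Set ℝ}
  {U : Set E} {ψ : ℝ × E → M}

theorem IsFlowTube.mfderiv_pullField (hψ : IsFlowTube I X n J U ψ) (Y : (x : M) → TangentSpace I x)
    {t : ℝ} {z : E} (ht : t ∈ J) (hz : z ∈ U) :
    mfderiv 𝓘(ℝ, E) I (fun z => ψ (t, z)) z (pullField I ψ Y (t, z) : E) = Y (ψ (t, z)) :=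
  apply_inverse_apply (hψ.invertible t ht z hz) _

/-- The tube read in a chart: its properties and the formula for pulled-back fields. -/
theorem IsFlowTube.exists_chart (hψ : IsFlowTube I X n J U ψ) (hn : n ≠ 0) (hJ : IsOpen J)
    (hU : IsOpen U) {t : ℝ} {z : E} (ht : t ∈ J) (hz : z ∈ U) :
    ∃ (p : M) (W : Set (ℝ × E)), IsOpen W ∧ (t, z) ∈ W ∧ W ⊆ J ×ˢ U ∧
      ContDiffOn ℝ n (fun q => extChartAt I p (ψ q)) W ∧
      (∀ q ∈ W, ψ q ∈ (extChartAt I p).source) ∧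
      (∀ q ∈ W, (fderiv ℝ (fun z => extChartAt I p (ψ (q.1, z))) q.2).IsInvertible) ∧
      (∀ q ∈ W, HasDerivAt (fun τ => extChartAt I p (ψ (τ, q.2)))
        (chartField I p X (extChartAt I p (ψ q))) q.1) ∧
      ∀ (Y : (x : M) → TangentSpace I x), ∀ q ∈ W, pullField I ψ Y q =
        (fderiv ℝ (fun z => extChartAt I p (ψ (q.1, z))) q.2).inverse
          (chartField I p Y (extChartAt I p (ψ q))) := by
  have hM1 : IsManifold I 1 M := IsManifold.of_le (n := ∞) (by exact_mod_cast le_top)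
  have hn' : (n : ℕ∞ω) ≠ 0 := by exact_mod_cast hn
  have hnInf : (n : ℕ∞ω) ≤ ∞ := by exact_mod_cast le_top
  set p := ψ (t, z)
  have hJU := hJ.prod hU
  set W := (J ×ˢ U) ∩ ψ ⁻¹' (extChartAt I p).source with hW
  have hWo : IsOpen W :=
    hψ.smooth.continuousOn.isOpen_inter_preimage hJU (isOpen_extChartAt_source p)
  have hsl : ∀ q ∈ W, MDifferentiableAt 𝓘(ℝ, E) I (fun z => ψ (q.1, z)) q.2 := by
    intro q hq
    have h1 : ContMDiffAt 𝓘(ℝ, E) 𝓘(ℝ, ℝ × E) n (fun z : E => (q.1, z)) q.2 :=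
      (contDiffAt_const.prodMk contDiffAt_id).contMDiffAt
    exact ((hψ.smooth.contMDiffAt (hJU.mem_nhds hq.1)).comp q.2 h1).mdifferentiableAt hn'
  have he : ∀ q ∈ W, HasMFDerivAt I 𝓘(ℝ, E) (extChartAt I p) (ψ q)
      (mfderiv I 𝓘(ℝ, E) (extChartAt I p) (ψ q)) := fun q hq =>
    ((contMDiffAt_extChartAt_of_mem p hq.2).mdifferentiableAt (by simp)).hasMFDerivAt
  have hcomp : ∀ q ∈ W, fderiv ℝ (fun z => extChartAt I p (ψ (q.1, z))) q.2 =
      ((mfderiv I 𝓘(ℝ, E) (extChartAt I p) (ψ q)).comp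
        (mfderiv 𝓘(ℝ, E) I (fun z => ψ (q.1, z)) q.2)) := by
    intro q hq
    have h1 := (he q hq).comp q.2 (hsl q hq).hasMFDerivAt
    exact HasFDerivAt.fderiv (𝕜 := ℝ) (E := E) (F := E) (hasMFDerivAt_iff_hasFDerivAt.1 h1)
  have hinv1 : ∀ q ∈ W, (mfderiv I 𝓘(ℝ, E) (extChartAt I p) (ψ q)).IsInvertible := fun q hq =>
    isInvertible_mfderiv_extChartAt hq.2
  refine ⟨p, W, hWo, ⟨⟨ht, hz⟩, mem_extChartAt_source p⟩, inter_subset_left, ?_, fun q hq => hq.2,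
    ?_, ?_, ?_⟩
  · intro q hq
    exact (((contMDiffAt_extChartAt_of_mem p hq.2).of_le hnInf).comp q
      (hψ.smooth.contMDiffAt (hJU.mem_nhds hq.1))).contDiffAt.contDiffWithinAt
  · intro q hq
    rw [hcomp q hq]
    exact IsInvertible.comp' (hinv1 q hq) (hψ.invertible q.1 hq.1.1 q.2 hq.1.2)
  · intro q hq
    have h1 := hasDerivAt_extChartAt_comp p
      (hψ.velocity q.1 hq.1.1 q.2 hq.1.2).hasMFDerivWithinAt (S := univ) hq.2
    exact hasDerivWithinAt_univ.1 h1
  · intro Y q hq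
    have h1 : (fderiv ℝ (fun z => extChartAt I p (ψ (q.1, z))) q.2) (pullField I ψ Y q) =
        chartField I p Y (extChartAt I p (ψ q)) := by
      rw [hcomp q hq, ← mfderiv_extChartAt_apply p Y hq.2]
      refine congrArg (mfderiv I 𝓘(ℝ, E) (extChartAt I p) (ψ q)) ?_
      exact hψ.mfderiv_pullField Y hq.1.1 hq.1.2
    rw [← h1, inverse_apply_apply]
    rw [hcomp q hq]
    exact IsInvertible.comp' (hinv1 q hq) (hψ.invertible q.1 hq.1.1 q.2 hq.1.2)

theorem IsFlowTube.contDiffOn_pullField [CompleteSpace E] (hψ : IsFlowTube I X (n + 1) J U ψ)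
    (hJ : IsOpen J) (hU : IsOpen U)
    (hY : ContMDiff I I.tangent ∞ fun x => (⟨x, Y x⟩ : TangentBundle I M)) :
    ContDiffOn ℝ n (pullField I ψ Y) (J ×ˢ U) := by
  rintro ⟨t, z⟩ ⟨ht, hz⟩
  obtain ⟨p, W, hW, htz, hWs, hC, hsrc, hinv, hvel, hpull⟩ :=
    hψ.exists_chart n.succ_ne_zero hJ hU ht hz
  have h1 := contDiffOn_pulledField hW (by exact_mod_cast hC)
    (isOpen_extChartAt_target (I := I) p) (fun q hq => (extChartAt I p).map_source (hsrc q hq))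
    (contDiffOn_chartField p hY) hinv
  refine ((h1.contDiffAt (hW.mem_nhds htz)).congr_of_eventuallyEq ?_).contDiffWithinAt
  filter_upwards [hW.mem_nhds htz] with q hq using hpull Y q hq

theorem IsFlowTube.hasDerivAt_pullField [CompleteSpace E] (hψ : IsFlowTube I X n J U ψ)
    (hn : 2 ≤ n) (hJ : IsOpen J) (hU : IsOpen U)
    (hX : ContMDiff I I.tangent ∞ fun x => (⟨x, X x⟩ : TangentBundle I M))
    (hY : ContMDiff I I.tangent ∞ fun x => (⟨x, Y x⟩ : TangentBundle I M)) {t : ℝ} {z : E}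
    (ht : t ∈ J) (hz : z ∈ U) :
    HasDerivAt (fun τ => pullField I ψ Y (τ, z))
      (pullField I ψ (VectorField.mlieBracket I X Y) (t, z)) t := by
  obtain ⟨p, W, hW, htz, hWs, hC, hsrc, hinv, hvel, hpull⟩ :=
    hψ.exists_chart (by omega) hJ hU ht hz
  have hmaps : MapsTo (fun q => extChartAt I p (ψ q)) W (extChartAt I p).target := fun q hq =>
    (extChartAt I p).map_source (hsrc q hq)
  have h1 := hasDerivAt_pulledField hW (hC.of_le (by exact_mod_cast hn))
    (isOpen_extChartAt_target (I := I) p) hmaps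
    (contDiffOn_chartField p hX) (contDiffOn_chartField p hY) hinv hvel htz
  rw [hpull _ _ htz, chartField_mlieBracket p hX hY (hmaps htz)]
  refine h1.congr_of_eventuallyEq ?_
  have hc : Tendsto (fun τ : ℝ => (τ, z)) (𝓝 t) (𝓝 (t, z)) :=
    (Continuous.prodMk_left z).tendsto t
  filter_upwards [hc.eventually (hW.mem_nhds htz)] with τ hτ using hpull Y _ hτ

end PullField

/-! ### The Jacobi equation along the reference curve -/

/-- Backward uniqueness for the first-order system of `(y, w)`; continuity of the coefficients on a
compact interval supplies a uniform Lipschitz constant. -/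
theorem secondOrder_eq_zero {F : Type*} [NormedAddCommGroup F] [NormedSpace ℝ F] {y w : ℝ → F}
    {α₀ α₁ : ℝ → ℝ} {s : ℝ} (h₀ : ContinuousOn α₀ (Icc 0 s)) (h₁ : ContinuousOn α₁ (Icc 0 s))
    (hy : ∀ t ∈ Icc 0 s, HasDerivAt y (w t) t)
    (hw : ∀ t ∈ Icc 0 s, HasDerivAt w (α₀ t • y t + α₁ t • w t) t) (hys : y s = 0) (hws : w s = 0) :
    ∀ t ∈ Icc 0 s, y t = 0 ∧ w t = 0 := by
  obtain ⟨K₀, hK₀⟩ := isCompact_Icc.exists_bound_of_continuousOn h₀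
  obtain ⟨K₁, hK₁⟩ := isCompact_Icc.exists_bound_of_continuousOn h₁
  set v : ℝ → F × F → F × F := fun t p => (p.2, α₀ t • p.1 + α₁ t • p.2) with hv
  have hlip : ∀ t ∈ Ioc 0 s, LipschitzOnWith (Real.toNNReal (1 + |K₀| + |K₁|)) (v t) univ := by
    intro t ht
    refine LipschitzOnWith.of_dist_le_mul fun p _ q _ => ?_
    rw [Real.coe_toNNReal _ (by positivity), dist_eq_norm, dist_eq_norm]
    have ht' : t ∈ Icc 0 s := Ioc_subset_Icc_self ht
    have e : v t p - v t q = ((p - q).2, α₀ t • (p - q).1 + α₁ t • (p - q).2) := by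
      simp only [hv, Prod.mk_sub_mk, Prod.fst_sub, Prod.snd_sub, smul_sub]
      congr 1
      abel
    rw [e, Prod.norm_def]
    have n1 := norm_fst_le (p - q)
    have n2 := norm_snd_le (p - q)
    have hn := norm_nonneg (p - q)
    have a0 : ‖α₀ t‖ ≤ |K₀| := (hK₀ t ht').trans (le_abs_self _)
    have a1 : ‖α₁ t‖ ≤ |K₁| := (hK₁ t ht').trans (le_abs_self _)
    refine max_le ?_ ?_
    · have : 0 ≤ (|K₀| + |K₁|) * ‖p - q‖ := by positivity
      simp only
      linarith
    · refine (norm_add_le _ _).trans ?_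
      rw [norm_smul, norm_smul]
      have b0 := mul_le_mul a0 n1 (norm_nonneg _) (abs_nonneg _)
      have b1 := mul_le_mul a1 n2 (norm_nonneg _) (abs_nonneg _)
      linarith
  have h := ODE_solution_unique_of_mem_Icc_left (f := fun t => (y t, w t)) (g := fun _ => 0)
    (v := v) (s := fun _ => univ) (a := 0) (b := s) hlip
    (fun t ht => ((hy t ht).continuousAt.prodMk (hw t ht).continuousAt).continuousWithinAt)
    (fun t ht => ((hy t (Ioc_subset_Icc_self ht)).prodMk
      (hw t (Ioc_subset_Icc_self ht))).hasDerivWithinAt) (fun _ _ => trivial) continuousOn_const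
    (fun t ht => (hasDerivWithinAt_const t (Iic t) (0 : F × F)).congr_deriv (by simp [hv]; rfl))
    (fun _ _ => trivial) (by simp [hys, hws])
  intro t ht
  have := h ht
  simpa using this

/-- `A, B, C` are the coefficients of `g_t^s` in the frame `X₁, X₂, [X₁, X₂]` at the end of the
curve; `a, b, c` are their derivatives. -/
structure IsJacobi (s : ℝ) (β α₀ α₁ A B C a b c : ℝ → ℝ) : Prop where
  cont_β : ContinuousOn β (Icc 0 s)
  cont_α₀ : ContinuousOn α₀ (Icc 0 s)
  cont_α₁ : ContinuousOn α₁ (Icc 0 s)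
  deriv_A : ∀ t ∈ Icc 0 s, HasDerivAt A (a t) t
  deriv_B : ∀ t ∈ Icc 0 s, HasDerivAt B (b t) t
  deriv_C : ∀ t ∈ Icc 0 s, HasDerivAt C (c t) t
  deriv_a : ∀ t ∈ Icc 0 s, HasDerivAt a (β t + α₀ t * A t + α₁ t * a t) t
  deriv_b : ∀ t ∈ Icc 0 s, HasDerivAt b (α₀ t * B t + α₁ t * b t) t
  deriv_c : ∀ t ∈ Icc 0 s, HasDerivAt c (α₀ t * C t + α₁ t * c t) t
  A_end : A s = 0
  a_end : a s = 0
  B_end : B s = 1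
  b_end : b s = 0
  C_end : C s = 0
  c_end : c s = 1

/-- A solution of the inhomogeneous equation is the combination of the fundamental solutions. -/
theorem IsJacobi.eq_combination {s : ℝ} {β α₀ α₁ A B C a b c : ℝ → ℝ}
    (h : IsJacobi s β α₀ α₁ A B C a b c) {F : Type*} [NormedAddCommGroup F] [NormedSpace ℝ F]
    {y w : ℝ → F} {x : F} (hy : ∀ t ∈ Icc 0 s, HasDerivAt y (w t) t)
    (hw : ∀ t ∈ Icc 0 s, HasDerivAt w (β t • x + α₀ t • y t + α₁ t • w t) t) :
    ∀ t ∈ Icc 0 s, y t = A t • x + B t • y s + C t • w s ∧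
      w t = a t • x + b t • y s + c t • w s := by
  intro t ht
  have := secondOrder_eq_zero (y := fun t => y t - (A t • x + B t • y s + C t • w s))
    (w := fun t => w t - (a t • x + b t • y s + c t • w s)) h.cont_α₀ h.cont_α₁
    (fun t ht => (hy t ht).sub ((((h.deriv_A t ht).smul_const x).add
      ((h.deriv_B t ht).smul_const (y s))).add ((h.deriv_C t ht).smul_const (w s))))
    (fun t ht => ((hw t ht).sub ((((h.deriv_a t ht).smul_const x).add
      ((h.deriv_b t ht).smul_const (y s))).add ((h.deriv_c t ht).smul_const (w s)))).congr_deriv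
      (by module))
    (by simp [h.A_end, h.B_end, h.C_end]) (by simp [h.a_end, h.b_end, h.c_end]) t ht
  exact ⟨sub_eq_zero.1 this.1, sub_eq_zero.1 this.2⟩

/-- A linearly independent triple has dual functionals. -/
theorem exists_dual_triple {E : Type*} [NormedAddCommGroup E] [NormedSpace ℝ E]
    [FiniteDimensional ℝ E] {x : Fin 3 → E} (hx : LinearIndependent ℝ x) :
    ∃ φ : Fin 3 → E →L[ℝ] ℝ, ∀ i j, φ i (x j) = if i = j then 1 else 0 := by
  classical
  let b := Module.Basis.extend hx.linearIndepOn_id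
  have hmem : ∀ j, x j ∈ hx.linearIndepOn_id.extend (subset_univ (range x)) := fun j =>
    hx.linearIndepOn_id.subset_extend (subset_univ _) (mem_range_self j)
  refine ⟨fun i => (b.coord ⟨x i, hmem i⟩).toContinuousLinearMap, fun i j => ?_⟩
  have hb : b ⟨x j, hmem j⟩ = x j := Module.Basis.extend_apply_self _ _
  rw [LinearMap.coe_toContinuousLinearMap', ← hb, Module.Basis.coord_apply,
    Module.Basis.repr_self, Finsupp.single_apply]
  by_cases hij : i = j
  · simp [hij]
  · have hne : x j ≠ x i := fun h => hij (hx.injective h.symm)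
    simp [hij, hne]

/-! ### The frame pulled back along the reference curve, and its Jacobi coefficients. -/

section EndTube

variable {E : Type*} [NormedAddCommGroup E] [NormedSpace ℝ E]
  {H : Type*} [TopologicalSpace H] {I : ModelWithCorners ℝ E H}
  {M : Type*} [TopologicalSpace M] [ChartedSpace H M]

/-- The preferred chart at `p` has identity differential at `p`, so reading a field at the centre of
the chart does not change it. -/
theorem chartField_self [IsManifold I ∞ M] [I.Boundaryless] (p : M)
    (Y : (x : M) → TangentSpace I x) : chartField I p Y (extChartAt I p p) = Y p := by
  have h1 : chartField I p Y (extChartAt I p p) =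
      (mfderiv 𝓘(ℝ, E) I (extChartAt I p).symm (extChartAt I p p)).inverse
        (Y ((extChartAt I p).symm (extChartAt I p p))) := rfl
  rw [h1]
  have h2 := mfderiv_extChartAt_symm_self (I := I) p
  have h3 : (Y ((extChartAt I p).symm (extChartAt I p p)) : E) = Y p :=
    congrArg (fun x => (Y x : E)) (extChartAt_to_inv p)
  refine (congrArg₂ (fun (L : E →L[ℝ] E) (v : E) => L.inverse v) h2 h3).trans ?_
  exact congrArg (fun L : E →L[ℝ] E => L (Y p)) ContinuousLinearMap.inverse_id

/-- The flow tube of `X` along the integral curve `γ` in the chart at its end. -/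
structure IsEndTube (I : ModelWithCorners ℝ E H) (X : (x : M) → TangentSpace I x) (γ : ℝ → M)
    (s δ : ℝ) (U : Set E) (ψ : ℝ × E → M) : Prop where
  s_pos : 0 < s
  δ_pos : 0 < δ
  isOpen : IsOpen U
  subset : U ⊆ (extChartAt I (γ s)).target
  mem : extChartAt I (γ s) (γ s) ∈ U
  tube : IsFlowTube I X 3 (Ioo (-δ) (s + δ)) U ψ
  at_end : ∀ z ∈ U, ψ (s, z) = (extChartAt I (γ s)).symm z
  curve : ∀ t ∈ Icc 0 s, ψ (t, extChartAt I (γ s) (γ s)) = γ t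

variable [IsManifold I ∞ M] [I.Boundaryless] {X₁ X₂ Y : (x : M) → TangentSpace I x} {γ : ℝ → M}
  {s δ : ℝ} {U : Set E} {ψ : ℝ × E → M} {β α₀ α₁ : M → ℝ}

theorem IsEndTube.Icc_subset (h : IsEndTube I X₁ γ s δ U ψ) : Icc 0 s ⊆ Ioo (-δ) (s + δ) :=
  Icc_subset_Ioo (by linarith [h.δ_pos]) (by linarith [h.δ_pos])

theorem IsEndTube.end_mem (h : IsEndTube I X₁ γ s δ U ψ) : s ∈ Ioo (-δ) (s + δ) :=
  h.Icc_subset ⟨h.s_pos.le, le_rfl⟩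

theorem IsEndTube.pullField_end (h : IsEndTube I X₁ γ s δ U ψ) (Y : (x : M) → TangentSpace I x)
    {z : E} (hz : z ∈ U) : pullField I ψ Y (s, z) = chartField I (γ s) Y z := by
  have h1 : (fun z => ψ (s, z)) =ᶠ[𝓝 z] (extChartAt I (γ s)).symm := by
    filter_upwards [h.isOpen.mem_nhds hz] with y hy using h.at_end y hy
  have h2 : (Y (ψ (s, z)) : E) = Y ((extChartAt I (γ s)).symm z) :=
    congrArg (fun x => (Y x : E)) (h.at_end z hz)
  exact congrArg₂ (fun (L : E →L[ℝ] E) (v : E) => L.inverse v) h1.mfderiv_eq h2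

theorem IsEndTube.pullField_end_self (h : IsEndTube I X₁ γ s δ U ψ)
    (Y : (x : M) → TangentSpace I x) :
    pullField I ψ Y (s, extChartAt I (γ s) (γ s)) = Y (γ s) := by
  rw [h.pullField_end Y h.mem, chartField_self]

/-- Its time derivative is the pull-back of `[X₁, X₁] = 0`. -/
theorem IsEndTube.pullField_self [CompleteSpace E] (h : IsEndTube I X₁ γ s δ U ψ)
    (hX : ContMDiff I I.tangent ∞ fun x => (⟨x, X₁ x⟩ : TangentBundle I M)) {t : ℝ}
    (ht : t ∈ Ioo (-δ) (s + δ)) {z : E} (hz : z ∈ U) :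
    pullField I ψ X₁ (t, z) = pullField I ψ X₁ (s, z) := by
  have hzero : ∀ τ ∈ Ioo (-δ) (s + δ), HasDerivAt (fun τ => pullField I ψ X₁ (τ, z)) 0 τ := by
    intro τ hτ
    refine (h.tube.hasDerivAt_pullField (by norm_num) isOpen_Ioo h.isOpen hX hX hτ hz).congr_deriv ?_
    rw [VectorField.mlieBracket_self]
    exact map_zero _
  exact isOpen_Ioo.is_const_of_deriv_eq_zero isPreconnected_Ioo
    (fun τ hτ => (hzero τ hτ).differentiableAt.differentiableWithinAt)
    (fun τ hτ => (hzero τ hτ).deriv) ht h.end_mem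

/-- Near `γ s` the flow for the time `-(s - t)` is `ψ (t, ·)` read in the chart, by uniqueness of
integral curves, and the chart has identity differential at its centre. This links the geometric
field to the tube. -/
theorem IsEndTube.gField_eq [FiniteDimensional ℝ E] [T2Space M] (h : IsEndTube I X₁ γ s δ U ψ)
    (hX : ContMDiff I I.tangent ∞ fun x => (⟨x, X₁ x⟩ : TangentBundle I M)) {t : ℝ}
    (ht : t ∈ Icc 0 s) :
    gField I X₁ X₂ s t (γ s) = pullField I ψ X₂ (t, extChartAt I (γ s) (γ s)) := by
  have hM1 : IsManifold I 1 M := IsManifold.of_le (n := ∞) (by exact_mod_cast le_top)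
  set e := extChartAt I (γ s) with he
  have htJ := h.Icc_subset ht
  have hflow : flow I X₁ (-(s - t)) =ᶠ[𝓝 (γ s)] fun x => ψ (t, e x) := by
    have hU : ∀ᶠ x in 𝓝 (γ s), e x ∈ U :=
      (continuousAt_extChartAt (γ s)).eventually (h.isOpen.mem_nhds h.mem)
    filter_upwards [hU, extChartAt_source_mem_nhds (I := I) (γ s)] with x hx hxs
    have hc : IsMIntegralCurveOn (I := I) (fun τ => ψ (τ + s, e x)) X₁ (Icc (-(s - t)) 0) :=
      ((h.tube.isMIntegralCurveOn hx h.Icc_subset).comp_add s).mono fun τ hτ =>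
        ⟨by linarith [hτ.1, ht.1], by linarith [hτ.2]⟩
    have hc0 : ψ (0 + s, e x) = x := by
      rw [zero_add, h.at_end _ hx]
      exact e.left_inv hxs
    have huI : uIcc 0 (-(s - t)) = Icc (-(s - t)) 0 :=
      uIcc_of_ge (by linarith [ht.2])
    have hex : ∃ c : ℝ → M, c 0 = x ∧
        IsMIntegralCurveOn (I := I) c X₁ (uIcc 0 (-(s - t))) :=
      ⟨fun τ => ψ (τ + s, e x), hc0, by rw [huI]; exact hc⟩
    rw [flow, dif_pos hex]
    have h2 := hex.choose_spec.2.mono huI.ge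
    -- `flow` selects some integral curve. Both curves pass through `x` at time 0, the right end of
    -- the interval because `t ≤ s`, and hence agree.
    have h3 := integralCurve_eqOn_of_eq_right hX h2 hc (hex.choose_spec.1.trans hc0.symm)
      (-(s - t))
      ⟨le_rfl, by linarith [ht.2]⟩
    rw [h3]
    simp
  have h1 : (mfderiv I I (flow I X₁ (-(s - t))) (γ s) : E →L[ℝ] E) =
      mfderiv 𝓘(ℝ, E) I (fun z => ψ (t, z)) (e (γ s)) := by
    have h2 : HasMFDerivAt I 𝓘(ℝ, E) e (γ s) (mfderiv I 𝓘(ℝ, E) e (γ s)) :=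
      ((contMDiffAt_extChartAt_of_mem (γ s) (mem_extChartAt_source (γ s))).mdifferentiableAt
        (by simp)).hasMFDerivAt
    have h3 : MDifferentiableAt 𝓘(ℝ, E) I (fun z => ψ (t, z)) (e (γ s)) := by
      have h4 : ContMDiffAt 𝓘(ℝ, E) 𝓘(ℝ, ℝ × E) 3 (fun z : E => (t, z)) (e (γ s)) :=
        (contDiffAt_const.prodMk contDiffAt_id).contMDiffAt
      exact ((h.tube.smooth.contMDiffAt ((isOpen_Ioo.prod h.isOpen).mem_nhds
        ⟨htJ, h.mem⟩)).comp (e (γ s)) h4).mdifferentiableAt (by norm_num)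
    have h5 := (h3.hasMFDerivAt.comp (γ s) h2).mfderiv
    refine (hflow.mfderiv_eq.trans h5).trans ?_
    ext v
    refine congrArg (mfderiv 𝓘(ℝ, E) I (fun z => ψ (t, z)) (e (γ s))) ?_
    have h6 := mfderiv_extChartAt_apply (γ s) (fun _ => (v : E)) (mem_extChartAt_source (I := I) (γ s))
    have h7 : chartField I (γ s) (fun _ => (v : E)) (extChartAt I (γ s) (γ s)) = (v : E) :=
      chartField_self (I := I) (γ s) (fun _ => (v : E))
    exact Eq.trans (α := E) h6 h7
  have h2 : (X₂ (flow I X₁ (-(s - t)) (γ s)) : E) = X₂ (ψ (t, e (γ s))) :=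
    congrArg (fun x => (X₂ x : E)) hflow.self_of_nhds
  exact congrArg₂ (fun (L : E →L[ℝ] E) (v : E) => L.inverse v) h1 h2

theorem IsEndTube.continuousOn_comp (h : IsEndTube I X₁ γ s δ U ψ) {f : M → ℝ}
    (hf : ContMDiff I 𝓘(ℝ, ℝ) ∞ f) : ContinuousOn (fun t => f (γ t)) (Icc 0 s) := by
  have h1 : ContinuousOn (fun t => ψ (t, extChartAt I (γ s) (γ s))) (Icc 0 s) :=
    h.tube.smooth.continuousOn.comp (by fun_prop) fun t ht => ⟨h.Icc_subset ht, h.mem⟩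
  exact hf.continuous.comp_continuousOn (h1.congr fun t ht => (h.curve t ht).symm)

/-- The derivatives of `g` and of `[X₁, X₂]` pulled back to the tube. -/
theorem IsEndTube.hasDerivAt_pullField_engel [CompleteSpace E]
    (hE : IsRegularEngel I X₁ X₂ β α₀ α₁) (h : IsEndTube I X₁ γ s δ U ψ) {t : ℝ}
    (ht : t ∈ Ioo (-δ) (s + δ)) {z : E} (hz : z ∈ U) :
    HasDerivAt (fun τ => pullField I ψ X₂ (τ, z))
      (pullField I ψ (VectorField.mlieBracket I X₁ X₂) (t, z)) t ∧
    HasDerivAt (fun τ => pullField I ψ (VectorField.mlieBracket I X₁ X₂) (τ, z))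
      (β (ψ (t, z)) • pullField I ψ X₁ (s, z) + α₀ (ψ (t, z)) • pullField I ψ X₂ (t, z) +
        α₁ (ψ (t, z)) • pullField I ψ (VectorField.mlieBracket I X₁ X₂) (t, z)) t := by
  refine ⟨h.tube.hasDerivAt_pullField (by norm_num) isOpen_Ioo h.isOpen hE.smooth_X₁ hE.smooth_X₂
    ht hz, ?_⟩
  refine (h.tube.hasDerivAt_pullField (by norm_num) isOpen_Ioo h.isOpen hE.smooth_X₁
    (contMDiff_mlieBracket hE.smooth_X₁ hE.smooth_X₂) ht hz).congr_deriv ?_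
  have h1 : VectorField.mlieBracket I X₁ (VectorField.mlieBracket I X₁ X₂) = fun x =>
      (β x • X₁ x + α₀ x • X₂ x) + α₁ x • VectorField.mlieBracket I X₁ X₂ x :=
    funext hE.structure_eq
  rw [h1, pullField_add, pullField_add, pullField_smul, pullField_smul, pullField_smul,
    h.pullField_self hE.smooth_X₁ ht hz]

/-- A functional that vanishes on the frame sees the derivatives of the pulled-back fields evolve by
the Jacobi equation. -/
theorem IsEndTube.hasDerivAt_fderiv_pullField [CompleteSpace E]
    (hE : IsRegularEngel I X₁ X₂ β α₀ α₁) (h : IsEndTube I X₁ γ s δ U ψ) (ξ : E →L[ℝ] ℝ)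
    {t : ℝ} (ht : t ∈ Icc 0 s)
    (h₁ : ξ (pullField I ψ X₁ (s, extChartAt I (γ s) (γ s))) = 0)
    (h₂ : ξ (pullField I ψ X₂ (t, extChartAt I (γ s) (γ s))) = 0)
    (h₁₂ : ξ (pullField I ψ (VectorField.mlieBracket I X₁ X₂) (t, extChartAt I (γ s) (γ s))) = 0)
    (w : E) :
    HasDerivAt
      (fun τ => ξ (fderiv ℝ (fun z => pullField I ψ X₂ (τ, z)) (extChartAt I (γ s) (γ s)) w))
      (ξ (fderiv ℝ (fun z => pullField I ψ (VectorField.mlieBracket I X₁ X₂) (t, z))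
        (extChartAt I (γ s) (γ s)) w)) t ∧
    HasDerivAt
      (fun τ => ξ (fderiv ℝ (fun z => pullField I ψ (VectorField.mlieBracket I X₁ X₂) (τ, z))
        (extChartAt I (γ s) (γ s)) w))
      (β (γ t) * ξ (fderiv ℝ (fun z => pullField I ψ X₁ (s, z)) (extChartAt I (γ s) (γ s)) w) +
        α₀ (γ t) * ξ (fderiv ℝ (fun z => pullField I ψ X₂ (t, z)) (extChartAt I (γ s) (γ s)) w) +
        α₁ (γ t) * ξ (fderiv ℝ (fun z => pullField I ψ (VectorField.mlieBracket I X₁ X₂) (t, z))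
          (extChartAt I (γ s) (γ s)) w)) t := by
  set z₀ := extChartAt I (γ s) (γ s) with hz₀
  set X₁₂ := VectorField.mlieBracket I X₁ X₂
  have htJ := h.Icc_subset ht
  have hnb : Ioo (-δ) (s + δ) ×ˢ U ∈ 𝓝 (t, z₀) := (isOpen_Ioo.prod h.isOpen).mem_nhds ⟨htJ, h.mem⟩
  have hC : ∀ Y : (x : M) → TangentSpace I x,
      ContMDiff I I.tangent ∞ (fun x => (⟨x, Y x⟩ : TangentBundle I M)) →
      ContDiffOn ℝ 2 (pullField I ψ Y) (Ioo (-δ) (s + δ) ×ˢ U) := fun Y hY =>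
    h.tube.contDiffOn_pullField (n := 2) isOpen_Ioo h.isOpen hY
  have hY12 := contMDiff_mlieBracket hE.smooth_X₁ hE.smooth_X₂
  have hev : ∀ {p : ℝ → E →L[ℝ] E} {q : E →L[ℝ] E}, HasDerivAt p q t →
      HasDerivAt (fun τ => ξ (p τ w)) (ξ (q w)) t := fun hpq =>
    (ξ.hasFDerivAt.comp_hasDerivAt t (hpq.clm_apply (hasDerivAt_const t w))).congr_deriv (by simp)
  refine ⟨hev (hasDerivAt_fderiv_slice ((hC X₂ hE.smooth_X₂).contDiffAt hnb) ?_), ?_⟩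
  · filter_upwards [hnb] with p hp using (h.hasDerivAt_pullField_engel hE hp.1 hp.2).1
  have hrhs := hev (hasDerivAt_fderiv_slice (k := fun p => β (ψ p) • pullField I ψ X₁ (s, p.2) +
    α₀ (ψ p) • pullField I ψ X₂ p + α₁ (ψ p) • pullField I ψ X₁₂ p)
    ((hC X₁₂ hY12).contDiffAt hnb) (by
      filter_upwards [hnb] with p hp using (h.hasDerivAt_pullField_engel hE hp.1 hp.2).2))
  refine hrhs.congr_deriv ?_
  have hsl : ∀ (τ : ℝ), τ ∈ Icc 0 s → ∀ Y : (x : M) → TangentSpace I x,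
      ContMDiff I I.tangent ∞ (fun x => (⟨x, Y x⟩ : TangentBundle I M)) →
      HasFDerivAt (fun z => pullField I ψ Y (τ, z))
        (fderiv ℝ (fun z => pullField I ψ Y (τ, z)) z₀) z₀ := by
    intro τ hτ Y hY
    have hnb' : Ioo (-δ) (s + δ) ×ˢ U ∈ 𝓝 (τ, z₀) :=
      (isOpen_Ioo.prod h.isOpen).mem_nhds ⟨h.Icc_subset hτ, h.mem⟩
    have hd := ((hC Y hY).contDiffAt hnb').differentiableAt (by simp)
    exact (hasFDerivAt_slice hd).differentiableAt.hasFDerivAt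
  have hcoef : ∀ f : M → ℝ, ContMDiff I 𝓘(ℝ, ℝ) ∞ f →
      HasFDerivAt (fun z => f (ψ (t, z))) (fderiv ℝ (fun z => f (ψ (t, z))) z₀) z₀ := by
    intro f hf
    have h4 : ContMDiffAt 𝓘(ℝ, E) 𝓘(ℝ, ℝ × E) 3 (fun z : E => (t, z)) z₀ :=
      (contDiffAt_const.prodMk contDiffAt_id).contMDiffAt
    have h5 := (h.tube.smooth.contMDiffAt hnb).comp z₀ h4
    have h6 := (((hf _).of_le three_le_infty).comp z₀ h5).contDiffAt
    exact (h6.differentiableAt (by norm_num)).hasFDerivAt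
  have hs : s ∈ Icc 0 s := ⟨h.s_pos.le, le_rfl⟩
  -- In the product rule, each term that differentiates `β`, `α₀` or `α₁` carries `ξ` of a
  -- pulled-back field at the base point, and vanishes by `h₁`, `h₂`, `h₁₂`.
  have hsum := (((hcoef β hE.smooth_β).smul (hsl s hs X₁ hE.smooth_X₁)).add
    ((hcoef α₀ hE.smooth_α₀).smul (hsl t ht X₂ hE.smooth_X₂))).add
    ((hcoef α₁ hE.smooth_α₁).smul (hsl t ht X₁₂ hY12))
  refine (congrArg (fun L : E →L[ℝ] E => ξ (L w)) (HasFDerivAt.fderiv hsum)).trans ?_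
  rw [← h.curve t ht, ← hz₀]
  simp only [_root_.add_apply, _root_.smul_apply, map_add, map_smul,
    ContinuousLinearMap.smulRight_apply, h₁, h₂, h₁₂, smul_eq_mul, mul_zero, add_zero]

/-- Along the curve the pull-back of `X₂` solves g'' = β X₁ + α₀ g + α₁ g', so it never leaves the
span of the frame at `γ s`. A covector that kills the frame then kills g and g' at all times, so its
values on the space derivatives obey the same equation and have the same coefficients `A`, `B`, `C`.
This reduces the second variation to data at the endpoint. -/
theorem IsEndTube.exists_jacobi (hE : IsRegularEngel I X₁ X₂ β α₀ α₁)
    (h : IsEndTube I X₁ γ s δ U ψ) :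
    ∃ A B C a b c : ℝ → ℝ,
      IsJacobi s (fun t => β (γ t)) (fun t => α₀ (γ t)) (fun t => α₁ (γ t)) A B C a b c ∧
      (∀ t ∈ Icc 0 s, pullField I ψ X₂ (t, extChartAt I (γ s) (γ s)) =
        A t • (X₁ (γ s) : E) + B t • (X₂ (γ s) : E) +
          C t • (VectorField.mlieBracket I X₁ X₂ (γ s) : E)) ∧
      ∀ ξ : E →L[ℝ] ℝ, ξ (X₁ (γ s)) = 0 → ξ (X₂ (γ s)) = 0 →
        ξ (VectorField.mlieBracket I X₁ X₂ (γ s)) = 0 → ∀ t ∈ Icc 0 s, ∀ w : E,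
        ξ (fderiv ℝ (fun z => pullField I ψ X₂ (t, z)) (extChartAt I (γ s) (γ s)) w) =
          A t * ξ (fderiv ℝ (chartField I (γ s) X₁) (extChartAt I (γ s) (γ s)) w) +
          B t * ξ (fderiv ℝ (chartField I (γ s) X₂) (extChartAt I (γ s) (γ s)) w) +
          C t * ξ (fderiv ℝ (chartField I (γ s) (VectorField.mlieBracket I X₁ X₂))
            (extChartAt I (γ s) (γ s)) w) := by
  have hfin : FiniteDimensional ℝ E :=
    FiniteDimensional.of_finrank_pos (by rw [hE.dim]; norm_num)
  have := FiniteDimensional.complete ℝ E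
  set z₀ := extChartAt I (γ s) (γ s) with hz₀
  set X₁₂ := VectorField.mlieBracket I X₁ X₂ with hX₁₂
  set g : ℝ → E := fun t => pullField I ψ X₂ (t, z₀) with hg
  set G : ℝ → E := fun t => pullField I ψ X₁₂ (t, z₀) with hG
  obtain ⟨x₁, hx₁'⟩ : ∃ x : E, x = X₁ (γ s) := ⟨_, rfl⟩
  obtain ⟨x₂, hx₂'⟩ : ∃ x : E, x = X₂ (γ s) := ⟨_, rfl⟩
  obtain ⟨x₃, hx₃'⟩ : ∃ x : E, x = X₁₂ (γ s) := ⟨_, rfl⟩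
  have hx₁ : pullField I ψ X₁ (s, z₀) = x₁ := (h.pullField_end_self X₁).trans hx₁'.symm
  have hgs : g s = x₂ := (h.pullField_end_self X₂).trans hx₂'.symm
  have hGs : G s = x₃ := (h.pullField_end_self X₁₂).trans hx₃'.symm
  have dg : ∀ t ∈ Icc 0 s, HasDerivAt g (G t) t := fun t ht =>
    (h.hasDerivAt_pullField_engel hE (h.Icc_subset ht) h.mem).1
  have dG : ∀ t ∈ Icc 0 s, HasDerivAt G
      (β (γ t) • x₁ + α₀ (γ t) • g t + α₁ (γ t) • G t) t := by
    intro t ht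
    have h1 := (h.hasDerivAt_pullField_engel hE (h.Icc_subset ht) h.mem).2
    rw [h.curve t ht] at h1
    rw [← hx₁]
    exact h1
  obtain ⟨φ, hφ⟩ : ∃ φ : Fin 3 → E →L[ℝ] ℝ, ∀ i j, φ i (![x₁, x₂, x₃] j) = if i = j then 1 else 0 := by
    rw [hx₁', hx₂', hx₃']
    exact exists_dual_triple (E := E) (hE.independent (γ s))
  have hφ1 : ∀ i, φ i x₁ = if i = 0 then 1 else 0 := fun i => hφ i 0
  have hφ2 : ∀ i, φ i x₂ = if i = 1 then 1 else 0 := fun i => hφ i 1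
  have hφ3 : ∀ i, φ i x₃ = if i = 2 then 1 else 0 := fun i => hφ i 2
  have dφ : ∀ i, ∀ t ∈ Icc 0 s, HasDerivAt (fun t => φ i (g t)) (φ i (G t)) t := fun i t ht =>
    (φ i).hasFDerivAt.comp_hasDerivAt t (dg t ht)
  have dφ' : ∀ i, ∀ t ∈ Icc 0 s, HasDerivAt (fun t => φ i (G t))
      (β (γ t) * φ i x₁ + α₀ (γ t) * φ i (g t) + α₁ (γ t) * φ i (G t)) t := fun i t ht =>
    ((φ i).hasFDerivAt.comp_hasDerivAt t (dG t ht)).congr_deriv (by simp)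
  have hJ : IsJacobi s (fun t => β (γ t)) (fun t => α₀ (γ t)) (fun t => α₁ (γ t))
      (fun t => φ 0 (g t)) (fun t => φ 1 (g t)) (fun t => φ 2 (g t))
      (fun t => φ 0 (G t)) (fun t => φ 1 (G t)) (fun t => φ 2 (G t)) :=
    { cont_β := h.continuousOn_comp hE.smooth_β
      cont_α₀ := h.continuousOn_comp hE.smooth_α₀
      cont_α₁ := h.continuousOn_comp hE.smooth_α₁
      deriv_A := dφ 0
      deriv_B := dφ 1
      deriv_C := dφ 2
      deriv_a := fun t ht => (dφ' 0 t ht).congr_deriv (by simp [hφ1])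
      deriv_b := fun t ht => (dφ' 1 t ht).congr_deriv (by simp [hφ1])
      deriv_c := fun t ht => (dφ' 2 t ht).congr_deriv (by simp [hφ1])
      A_end := by simp [hgs, hφ2]
      a_end := by simp [hGs, hφ3]
      B_end := by simp [hgs, hφ2]
      b_end := by simp [hGs, hφ3]
      C_end := by simp [hgs, hφ2]
      c_end := by simp [hGs, hφ3] }
  -- The coefficients were defined by functionals dual to the frame, which by itself says nothing
  -- about a component outside the span; uniqueness for the vector equation excludes one.
  have hcomb := hJ.eq_combination dg dG
  rw [hgs, hGs] at hcomb
  refine ⟨_, _, _, _, _, _, hJ, fun t ht => ?_, ?_⟩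
  · have h1 := (hcomb t ht).1
    rw [hx₁', hx₂', hx₃'] at h1
    exact h1
  intro ξ h1 h2 h3 t ht w
  replace h1 : ξ x₁ = 0 := (congrArg ξ hx₁').trans h1
  replace h2 : ξ x₂ = 0 := (congrArg ξ hx₂').trans h2
  replace h3 : ξ x₃ = 0 := (congrArg ξ hx₃').trans h3
  have hd := fun τ (hτ : τ ∈ Icc 0 s) => h.hasDerivAt_fderiv_pullField hE ξ hτ
    (by rw [← hz₀, hx₁, h1])
    (by rw [show pullField I ψ X₂ (τ, extChartAt I (γ s) (γ s)) = _ from (hcomb τ hτ).1]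
        simp [h1, h2, h3])
    (by rw [show pullField I ψ (VectorField.mlieBracket I X₁ X₂) (τ, extChartAt I (γ s) (γ s)) = _
          from (hcomb τ hτ).2]
        simp [h1, h2, h3]) w
  have h4 := (hJ.eq_combination (fun τ hτ => (hd τ hτ).1)
    (fun τ hτ => by simpa only [smul_eq_mul] using (hd τ hτ).2) t ht).1
  have hend : ∀ Y : (x : M) → TangentSpace I x,
      fderiv ℝ (fun z => pullField I ψ Y (s, z)) z₀ = fderiv ℝ (chartField I (γ s) Y) z₀ := by
    intro Y
    refine Filter.EventuallyEq.fderiv_eq ?_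
    filter_upwards [h.isOpen.mem_nhds h.mem] with z hz using h.pullField_end Y hz
  rw [← hz₀, hend, hend, hend] at h4
  simpa only [smul_eq_mul] using h4

end EndTube

/-! ### Integrals against controls -/

section ControlIntegral

variable {s : ℝ}

theorem L2.intervalIntegrable (hs : 0 ≤ s) (u : L2 s) : IntervalIntegrable u volume 0 s := by
  rw [intervalIntegrable_iff_integrableOn_Icc_of_le hs]
  exact (Lp.memLp u).integrable (by norm_num)

theorem L2.intervalIntegrable_left {t : ℝ} (ht : t ∈ Icc 0 s) (u : L2 s) :
    IntervalIntegrable u volume 0 t :=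
  (L2.intervalIntegrable (ht.1.trans ht.2) u).mono_set (by
    rw [uIcc_of_le ht.1, uIcc_of_le (ht.1.trans ht.2)]
    exact Icc_subset_Icc_right ht.2)

/-- An almost everywhere statement on `[0,s]` holds almost everywhere on `[0,t]`. -/
theorem ae_of_ae_restrict_Icc {p : ℝ → Prop} {t : ℝ} (ht : t ∈ Icc 0 s)
    (h : ∀ᵐ τ ∂((volume : Measure ℝ).restrict (Icc 0 s)), p τ) :
    ∀ᵐ τ, τ ∈ uIoc 0 t → p τ := by
  rw [ae_restrict_iff' measurableSet_Icc] at h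
  filter_upwards [h] with τ hτ h'
  rw [uIoc_of_le ht.1] at h'
  exact hτ ⟨h'.1.le, h'.2.trans ht.2⟩

/-- The total mass of the control `v`. -/
noncomputable def mass (v : L2 s × L2 s) : ℝ := ∫ τ in (0 : ℝ)..s, (|v.1 τ| + |v.2 τ|)

/-- Cauchy–Schwarz against the constant 1. Estimates of trajectories are made in the `L¹` mass and
converted to the `L²` norm only at the end. -/
theorem integral_abs_le (hs : 0 ≤ s) (u : L2 s) :
    ∫ τ in (0 : ℝ)..s, |u τ| ≤ ‖Lp.const 2 ((volume : Measure ℝ).restrict (Icc 0 s)) (1 : ℝ)‖ * ‖u‖ := by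
  set o := Lp.const 2 ((volume : Measure ℝ).restrict (Icc 0 s)) (1 : ℝ)
  have h : inner ℝ o |u| = ∫ τ in (0 : ℝ)..s, |u τ| := by
    rw [L2.inner_def, intervalIntegral.integral_of_le hs, ← integral_Icc_eq_integral_Ioc]
    refine integral_congr_ae ?_
    filter_upwards [Lp.coeFn_const (p := 2) (μ := (volume : Measure ℝ).restrict (Icc 0 s)) (1 : ℝ),
      Lp.coeFn_abs u] with τ h1 h2
    rw [h1, h2]
    simp
  rw [← h, ← norm_abs_eq_norm u]
  exact real_inner_le_norm _ _

theorem intervalIntegrable_abs (hs : 0 ≤ s) (v : L2 s × L2 s) :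
    IntervalIntegrable (fun τ => |v.1 τ| + |v.2 τ|) volume 0 s :=
  (L2.intervalIntegrable hs v.1).abs.add (L2.intervalIntegrable hs v.2).abs

theorem mass_nonneg (hs : 0 ≤ s) (v : L2 s × L2 s) : 0 ≤ mass v :=
  intervalIntegral.integral_nonneg hs fun _ _ => by positivity

theorem exists_mass_le (hs : 0 ≤ s) : ∃ c > 0, ∀ v : L2 s × L2 s, mass v ≤ c * ‖v‖ := by
  set o := ‖Lp.const 2 ((volume : Measure ℝ).restrict (Icc 0 s)) (1 : ℝ)‖ with ho
  refine ⟨2 * o + 1, by positivity, fun v => ?_⟩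
  rw [mass, intervalIntegral.integral_add (L2.intervalIntegrable hs v.1).abs
    (L2.intervalIntegrable hs v.2).abs]
  have h1 := integral_abs_le hs v.1
  have h2 := integral_abs_le hs v.2
  have h3 := mul_le_mul_of_nonneg_left (norm_fst_le v) (norm_nonneg _ : 0 ≤ o)
  have h4 := mul_le_mul_of_nonneg_left (norm_snd_le v) (norm_nonneg _ : 0 ≤ o)
  nlinarith [norm_nonneg v]

variable {E : Type*} [NormedAddCommGroup E] [NormedSpace ℝ E]

/-- The primitive `∫₀ᵗ (v₁ f₁ + v₂ f₂)`. -/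
noncomputable def controlIntegral (v : L2 s × L2 s) (f₁ f₂ : ℝ → E) (t : ℝ) : E :=
  ∫ τ in (0 : ℝ)..t, (v.1 τ • f₁ τ + v.2 τ • f₂ τ)

variable {f₁ f₂ g₁ g₂ : ℝ → E} {t : ℝ}

theorem controlIntegral_zero_right (v : L2 s × L2 s) (f₁ f₂ : ℝ → E) :
    controlIntegral v f₁ f₂ 0 = 0 := by simp [controlIntegral]

theorem controlIntegrable (hf₁ : ContinuousOn f₁ (Icc 0 s)) (hf₂ : ContinuousOn f₂ (Icc 0 s))
    (ht : t ∈ Icc 0 s) (v : L2 s × L2 s) :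
    IntervalIntegrable (fun τ => v.1 τ • f₁ τ + v.2 τ • f₂ τ) volume 0 t := by
  have hst : uIcc 0 t ⊆ Icc 0 s := by
    rw [uIcc_of_le ht.1]; exact Icc_subset_Icc_right ht.2
  exact ((L2.intervalIntegrable_left ht v.1).smul_continuousOn (hf₁.mono hst)).add
    ((L2.intervalIntegrable_left ht v.2).smul_continuousOn (hf₂.mono hst))

theorem continuousOn_controlIntegral (hf₁ : ContinuousOn f₁ (Icc 0 s))
    (hf₂ : ContinuousOn f₂ (Icc 0 s)) (v : L2 s × L2 s) :
    ContinuousOn (controlIntegral v f₁ f₂) (Icc 0 s) := by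
  by_cases hs : 0 ≤ s
  · have h := intervalIntegral.continuousOn_primitive_interval'
      (controlIntegrable hf₁ hf₂ ⟨hs, le_rfl⟩ v) (left_mem_uIcc)
    rwa [uIcc_of_le hs] at h
  · rw [Icc_eq_empty hs]; exact continuousOn_empty _

theorem norm_controlIntegral_le (ht : t ∈ Icc 0 s) (v : L2 s × L2 s) {b : ℝ}
    (hb : 0 ≤ b) (h₁ : ∀ τ ∈ Icc 0 s, ‖f₁ τ‖ ≤ b) (h₂ : ∀ τ ∈ Icc 0 s, ‖f₂ τ‖ ≤ b) :
    ‖controlIntegral v f₁ f₂ t‖ ≤ b * mass v := by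
  have hs := ht.1.trans ht.2
  have hint := (intervalIntegrable_abs hs v).const_mul b
  have hint' : IntervalIntegrable (fun τ => b * (|v.1 τ| + |v.2 τ|)) volume 0 t :=
    hint.mono_set (by
      rw [uIcc_of_le ht.1, uIcc_of_le hs]
      exact Icc_subset_Icc_right ht.2)
  have h := intervalIntegral.norm_integral_le_of_norm_le (μ := volume) (a := 0) (b := t)
    (f := fun τ => v.1 τ • f₁ τ + v.2 τ • f₂ τ) ht.1 (Eventually.of_forall fun τ hτ => by
      have hτ' : τ ∈ Icc 0 s := ⟨hτ.1.le, hτ.2.trans ht.2⟩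
      refine (norm_add_le _ _).trans ?_
      rw [norm_smul, norm_smul, Real.norm_eq_abs, Real.norm_eq_abs]
      have e1 := mul_le_mul_of_nonneg_left (h₁ τ hτ') (abs_nonneg (v.1 τ))
      have e2 := mul_le_mul_of_nonneg_left (h₂ τ hτ') (abs_nonneg (v.2 τ))
      show _ ≤ b * (|v.1 τ| + |v.2 τ|)
      linarith) hint'
  refine h.trans ?_
  rw [mass, ← intervalIntegral.integral_const_mul]
  refine intervalIntegral.integral_mono_interval le_rfl ht.1 ht.2 ?_ hint
  exact Eventually.of_forall fun τ => by positivity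

theorem controlIntegral_congr (v : L2 s × L2 s) (ht : t ∈ Icc 0 s)
    (h₁ : ∀ τ ∈ Icc 0 s, f₁ τ = g₁ τ) (h₂ : ∀ τ ∈ Icc 0 s, f₂ τ = g₂ τ) :
    controlIntegral v f₁ f₂ t = controlIntegral v g₁ g₂ t := by
  refine intervalIntegral.integral_congr fun τ hτ => ?_
  rw [uIcc_of_le ht.1] at hτ
  have hτ' : τ ∈ Icc 0 s := ⟨hτ.1, hτ.2.trans ht.2⟩
  simp only [h₁ τ hτ', h₂ τ hτ']

theorem controlIntegral_sub (hf₁ : ContinuousOn f₁ (Icc 0 s)) (hf₂ : ContinuousOn f₂ (Icc 0 s))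
    (hg₁ : ContinuousOn g₁ (Icc 0 s)) (hg₂ : ContinuousOn g₂ (Icc 0 s)) (ht : t ∈ Icc 0 s)
    (v : L2 s × L2 s) :
    controlIntegral v (fun τ => f₁ τ - g₁ τ) (fun τ => f₂ τ - g₂ τ) t =
      controlIntegral v f₁ f₂ t - controlIntegral v g₁ g₂ t := by
  rw [controlIntegral, controlIntegral, controlIntegral, ← intervalIntegral.integral_sub
    (controlIntegrable hf₁ hf₂ ht v) (controlIntegrable hg₁ hg₂ ht v)]
  refine intervalIntegral.integral_congr fun τ _ => ?_
  simp only [smul_sub]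
  abel

theorem controlIntegral_add (hf₁ : ContinuousOn f₁ (Icc 0 s)) (hf₂ : ContinuousOn f₂ (Icc 0 s))
    (hg₁ : ContinuousOn g₁ (Icc 0 s)) (hg₂ : ContinuousOn g₂ (Icc 0 s)) (ht : t ∈ Icc 0 s)
    (v : L2 s × L2 s) :
    controlIntegral v (fun τ => f₁ τ + g₁ τ) (fun τ => f₂ τ + g₂ τ) t =
      controlIntegral v f₁ f₂ t + controlIntegral v g₁ g₂ t := by
  rw [controlIntegral, controlIntegral, controlIntegral, ← intervalIntegral.integral_add
    (controlIntegrable hf₁ hf₂ ht v) (controlIntegrable hg₁ hg₂ ht v)]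
  refine intervalIntegral.integral_congr fun τ _ => ?_
  simp only [smul_add]
  abel

theorem controlIntegral_const_smul (v : L2 s × L2 s) (r : ℝ) :
    controlIntegral v (fun τ => r • f₁ τ) (fun τ => r • f₂ τ) t = r • controlIntegral v f₁ f₂ t := by
  rw [controlIntegral, controlIntegral, ← intervalIntegral.integral_smul]
  refine intervalIntegral.integral_congr fun τ _ => ?_
  simp only [smul_add, smul_comm r]

theorem controlIntegral_add_left (hf₁ : ContinuousOn f₁ (Icc 0 s))
    (hf₂ : ContinuousOn f₂ (Icc 0 s)) (ht : t ∈ Icc 0 s) (v v' : L2 s × L2 s) :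
    controlIntegral (v + v') f₁ f₂ t = controlIntegral v f₁ f₂ t + controlIntegral v' f₁ f₂ t := by
  rw [controlIntegral, controlIntegral, controlIntegral, ← intervalIntegral.integral_add
    (controlIntegrable hf₁ hf₂ ht v) (controlIntegrable hf₁ hf₂ ht v')]
  refine intervalIntegral.integral_congr_ae ?_
  filter_upwards [ae_of_ae_restrict_Icc ht (Lp.coeFn_add v.1 v'.1),
    ae_of_ae_restrict_Icc ht (Lp.coeFn_add v.2 v'.2)] with τ h1 h2 hτ
  rw [Prod.fst_add, Prod.snd_add, h1 hτ, h2 hτ]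
  simp only [Pi.add_apply, add_smul]
  abel

theorem controlIntegral_smul_left (ht : t ∈ Icc 0 s) (r : ℝ) (v : L2 s × L2 s) :
    controlIntegral (r • v) f₁ f₂ t = r • controlIntegral v f₁ f₂ t := by
  rw [controlIntegral, controlIntegral, ← intervalIntegral.integral_smul]
  refine intervalIntegral.integral_congr_ae ?_
  filter_upwards [ae_of_ae_restrict_Icc ht (Lp.coeFn_smul r v.1),
    ae_of_ae_restrict_Icc ht (Lp.coeFn_smul r v.2)] with τ h1 h2 hτ
  rw [Prod.smul_fst, Prod.smul_snd, h1 hτ, h2 hτ]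
  simp only [Pi.smul_apply, smul_add, smul_smul, smul_eq_mul]

theorem controlIntegral_clm_comp [CompleteSpace E] {F : Type*} [NormedAddCommGroup F]
    [NormedSpace ℝ F] [CompleteSpace F]
    (hf₁ : ContinuousOn f₁ (Icc 0 s)) (hf₂ : ContinuousOn f₂ (Icc 0 s)) (ht : t ∈ Icc 0 s)
    (v : L2 s × L2 s) (ξ : E →L[ℝ] F) :
    ξ (controlIntegral v f₁ f₂ t) = controlIntegral v (fun τ => ξ (f₁ τ)) (fun τ => ξ (f₂ τ)) t := by
  rw [controlIntegral, ← ξ.intervalIntegral_comp_comm (controlIntegrable hf₁ hf₂ ht v)]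
  refine intervalIntegral.integral_congr fun τ _ => ?_
  simp

/-- The first variation `v ↦ ∫₀ˢ (v₁ f₁ + v₂ f₂)`. -/
theorem exists_firstVariation (hs : 0 ≤ s) (hf₁ : ContinuousOn f₁ (Icc 0 s))
    (hf₂ : ContinuousOn f₂ (Icc 0 s)) :
    ∃ L : L2 s × L2 s →L[ℝ] E, ∀ v, L v = controlIntegral v f₁ f₂ s := by
  have hss : s ∈ Icc 0 s := ⟨hs, le_rfl⟩
  obtain ⟨b₁, hb₁⟩ := isCompact_Icc.exists_bound_of_continuousOn hf₁
  obtain ⟨b₂, hb₂⟩ := isCompact_Icc.exists_bound_of_continuousOn hf₂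
  obtain ⟨c, hc, hmass⟩ := exists_mass_le hs
  set b := max 0 (max b₁ b₂)
  refine ⟨LinearMap.mkContinuous
    { toFun := fun v => controlIntegral v f₁ f₂ s
      map_add' := fun v v' => controlIntegral_add_left hf₁ hf₂ hss v v'
      map_smul' := fun r v => controlIntegral_smul_left hss r v } (b * c) fun v => ?_, fun v => rfl⟩
  refine (norm_controlIntegral_le hss v (b := b) (le_max_left _ _)
    (fun τ hτ => (hb₁ τ hτ).trans ((le_max_left _ _).trans (le_max_right _ _)))
    (fun τ hτ => (hb₂ τ hτ).trans ((le_max_right _ _).trans (le_max_right _ _)))).trans ?_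
  rw [mul_assoc]
  exact mul_le_mul_of_nonneg_left (hmass v) (le_max_left _ _)

/-- The second variation, twice the polarization of
`v ↦ ∫₀ˢ (v₁ D₁ δ + v₂ D₂ δ)` with `δ = ∫₀ᵗ (v₁ f₁ + v₂ f₂)`. -/
theorem exists_secondVariation (hs : 0 ≤ s) (hf₁ : ContinuousOn f₁ (Icc 0 s))
    (hf₂ : ContinuousOn f₂ (Icc 0 s)) {D₁ D₂ : ℝ → E →L[ℝ] E} (hD₁ : ContinuousOn D₁ (Icc 0 s))
    (hD₂ : ContinuousOn D₂ (Icc 0 s)) :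
    ∃ B : L2 s × L2 s →L[ℝ] L2 s × L2 s →L[ℝ] E, ∀ v v', B v v' =
      controlIntegral v (fun τ => D₁ τ (controlIntegral v' f₁ f₂ τ))
        (fun τ => D₂ τ (controlIntegral v' f₁ f₂ τ)) s +
      controlIntegral v' (fun τ => D₁ τ (controlIntegral v f₁ f₂ τ))
        (fun τ => D₂ τ (controlIntegral v f₁ f₂ τ)) s := by
  have hss : s ∈ Icc 0 s := ⟨hs, le_rfl⟩
  obtain ⟨b₁, hb₁⟩ := isCompact_Icc.exists_bound_of_continuousOn hf₁
  obtain ⟨b₂, hb₂⟩ := isCompact_Icc.exists_bound_of_continuousOn hf₂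
  obtain ⟨d₁, hd₁⟩ := isCompact_Icc.exists_bound_of_continuousOn hD₁
  obtain ⟨d₂, hd₂⟩ := isCompact_Icc.exists_bound_of_continuousOn hD₂
  obtain ⟨c, hc, hmass⟩ := exists_mass_le hs
  set b := max 0 (max b₁ b₂)
  set d := max 0 (max d₁ d₂)
  have hb0 : 0 ≤ b := le_max_left _ _
  have hd0 : 0 ≤ d := le_max_left _ _
  have hδ : ∀ v : L2 s × L2 s, ∀ τ ∈ Icc 0 s, ‖controlIntegral v f₁ f₂ τ‖ ≤ b * (c * ‖v‖) :=
    fun v τ hτ => (norm_controlIntegral_le hτ v hb0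
      (fun τ hτ => (hb₁ τ hτ).trans ((le_max_left _ _).trans (le_max_right _ _)))
      (fun τ hτ => (hb₂ τ hτ).trans ((le_max_right _ _).trans (le_max_right _ _)))).trans
      (mul_le_mul_of_nonneg_left (hmass v) hb0)
  have hcont : ∀ {D : ℝ → E →L[ℝ] E}, ContinuousOn D (Icc 0 s) → ∀ v : L2 s × L2 s,
      ContinuousOn (fun τ => D τ (controlIntegral v f₁ f₂ τ)) (Icc 0 s) := fun hD v =>
    hD.clm_apply (continuousOn_controlIntegral hf₁ hf₂ v)
  set P : L2 s × L2 s → L2 s × L2 s → E := fun v v' =>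
    controlIntegral v (fun τ => D₁ τ (controlIntegral v' f₁ f₂ τ))
      (fun τ => D₂ τ (controlIntegral v' f₁ f₂ τ)) s with hP
  have hP1 : ∀ v₁ v₂ v', P (v₁ + v₂) v' = P v₁ v' + P v₂ v' := fun v₁ v₂ v' =>
    controlIntegral_add_left (hcont hD₁ v') (hcont hD₂ v') hss v₁ v₂
  have hP2 : ∀ (r : ℝ) v v', P (r • v) v' = r • P v v' := fun r v v' =>
    controlIntegral_smul_left hss r v
  have hP3 : ∀ v v₁ v₂, P v (v₁ + v₂) = P v v₁ + P v v₂ := by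
    intro v v₁ v₂
    rw [hP]
    simp only
    rw [← controlIntegral_add (hcont hD₁ v₁) (hcont hD₂ v₁) (hcont hD₁ v₂) (hcont hD₂ v₂) hss]
    refine controlIntegral_congr v hss (fun τ hτ => ?_) (fun τ hτ => ?_) <;>
      rw [controlIntegral_add_left hf₁ hf₂ hτ, map_add]
  have hP4 : ∀ (r : ℝ) v v', P v (r • v') = r • P v v' := by
    intro r v v'
    rw [hP]
    simp only
    rw [← controlIntegral_const_smul]
    refine controlIntegral_congr v hss (fun τ hτ => ?_) (fun τ hτ => ?_) <;>
      rw [controlIntegral_smul_left hτ, map_smul]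
  have hPn : ∀ v v', ‖P v v'‖ ≤ d * (b * (c * ‖v'‖)) * (c * ‖v‖) := by
    intro v v'
    have hn : 0 ≤ d * (b * (c * ‖v'‖)) := by positivity
    refine (norm_controlIntegral_le hss v hn (fun τ hτ => ?_) (fun τ hτ => ?_)).trans
      (mul_le_mul_of_nonneg_left (hmass v) hn)
    · exact (ContinuousLinearMap.le_opNorm _ _).trans (mul_le_mul
        ((hd₁ τ hτ).trans ((le_max_left _ _).trans (le_max_right _ _))) (hδ v' τ hτ)
        (norm_nonneg _) hd0)
    · exact (ContinuousLinearMap.le_opNorm _ _).trans (mul_le_mul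
        ((hd₂ τ hτ).trans ((le_max_right _ _).trans (le_max_right _ _))) (hδ v' τ hτ)
        (norm_nonneg _) hd0)
  refine ⟨LinearMap.mkContinuous₂ (LinearMap.mk₂ ℝ (fun v v' => P v v' + P v' v) ?_ ?_ ?_ ?_)
    (2 * (d * b * c * c)) fun v v' => ?_, fun v v' => rfl⟩
  · intro v₁ v₂ v'; rw [hP1, hP3]; abel
  · intro r v v'; rw [hP2, hP4, smul_add]
  · intro v v₁ v₂; rw [hP1, hP3]; abel
  · intro r v v'; rw [hP2, hP4, smul_add]
  · refine (norm_add_le _ _).trans ?_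
    have h1 := hPn v v'
    have h2 := hPn v' v
    have e1 : d * (b * (c * ‖v'‖)) * (c * ‖v‖) = d * b * c * c * ‖v‖ * ‖v'‖ := by ring
    have e2 : d * (b * (c * ‖v‖)) * (c * ‖v'‖) = d * b * c * c * ‖v‖ * ‖v'‖ := by ring
    rw [e1] at h1
    rw [e2] at h2
    calc ‖P v v'‖ + ‖P v' v‖ ≤ d * b * c * c * ‖v‖ * ‖v'‖ + d * b * c * c * ‖v‖ * ‖v'‖ :=
          add_le_add h1 h2
      _ = 2 * (d * b * c * c) * ‖v‖ * ‖v'‖ := by ring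

end ControlIntegral

/-! ### Controlled equations near an equilibrium -/

section ControlledEquation

variable {E : Type*} [NormedAddCommGroup E] [NormedSpace ℝ E] {s R : ℝ} {z₀ : E}

/-- The time-dependent field `G` is strictly differentiable at `z₀`, uniformly in time. -/
structure IsUniformlyDifferentiable (s R : ℝ) (z₀ : E) (G : ℝ × E → E) (D : ℝ → E →L[ℝ] E) :
    Prop where
  R_pos : 0 < R
  continuousOn : ContinuousOn G (Icc 0 s ×ˢ Metric.closedBall z₀ R)
  continuousOn_deriv : ContinuousOn D (Icc 0 s)
  approx : ∀ ε > 0, ∃ r > 0, r ≤ R ∧ ∀ t ∈ Icc 0 s, ∀ z ∈ Metric.closedBall z₀ r,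
    ∀ z' ∈ Metric.closedBall z₀ r, ‖G (t, z) - G (t, z') - D t (z - z')‖ ≤ ε * ‖z - z'‖

/-- Compactness of `[0, s]` makes the space derivative near `z₀` close to the one at `z₀` uniformly
in time; the mean value inequality on a ball does the rest. -/
theorem isUniformlyDifferentiable_of_contDiffOn {G : ℝ × E → E} {J : Set ℝ} {U : Set E}
    (hJ : IsOpen J) (hU : IsOpen U) (hG : ContDiffOn ℝ 1 G (J ×ˢ U)) (hsJ : Icc 0 s ⊆ J)
    (hR : 0 < R) (hRU : Metric.closedBall z₀ R ⊆ U) :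
    IsUniformlyDifferentiable s R z₀ G (fun t => fderiv ℝ (fun z => G (t, z)) z₀) := by
  have hJU := hJ.prod hU
  have hz₀ : z₀ ∈ U := hRU (Metric.mem_closedBall_self hR.le)
  have hd : ∀ t ∈ J, ∀ z ∈ U, DifferentiableAt ℝ G (t, z) := fun t ht z hz =>
    (hG.contDiffAt (hJU.mem_nhds ⟨ht, hz⟩)).differentiableAt (by simp)
  have hslice : ∀ t ∈ J, ∀ z ∈ U, fderiv ℝ (fun z => G (t, z)) z =
      (fderiv ℝ G (t, z)).comp (ContinuousLinearMap.inr ℝ ℝ E) := fun t ht z hz =>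
    (hasFDerivAt_slice (hd t ht z hz)).fderiv
  have hDc : ContinuousOn (fun p : ℝ × E => fderiv ℝ (fun z => G (p.1, z)) p.2) (J ×ˢ U) := by
    have h1 : ContinuousOn (fun p => (fderiv ℝ G p).comp (ContinuousLinearMap.inr ℝ ℝ E)) (J ×ˢ U) :=
      (hG.continuousOn_fderiv_of_isOpen hJU (by simp)).clm_comp continuousOn_const
    exact h1.congr fun p hp => hslice p.1 hp.1 p.2 hp.2
  refine ⟨hR, hG.continuousOn.mono (prod_mono hsJ hRU), ?_, ?_⟩
  · exact hDc.comp (f := fun t => (t, z₀)) (by fun_prop) fun t ht => ⟨hsJ ht, hz₀⟩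
  · intro ε hε
    have hev : ∀ᶠ z in 𝓝 z₀, ∀ t ∈ Icc 0 s,
        ‖fderiv ℝ (fun z => G (t, z)) z - fderiv ℝ (fun z => G (t, z)) z₀‖ < ε := by
      refine isCompact_Icc.eventually_forall_of_forall_eventually
        (P := fun z t => ‖fderiv ℝ (fun z => G (t, z)) z - fderiv ℝ (fun z => G (t, z)) z₀‖ < ε) ?_
      intro t ht
      have h1 : ContinuousAt (fun q : E × ℝ => fderiv ℝ (fun z => G (q.2, z)) q.1 -
          fderiv ℝ (fun z => G (q.2, z)) z₀) (z₀, t) := by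
        have h2 : ContinuousAt (fun p : ℝ × E => fderiv ℝ (fun z => G (p.1, z)) p.2) (t, z₀) :=
          hDc.continuousAt (hJU.mem_nhds ⟨hsJ ht, hz₀⟩)
        refine ContinuousAt.sub ?_ ?_
        · exact ContinuousAt.comp (x := (z₀, t)) (f := fun q : E × ℝ => (q.2, q.1)) h2 (by fun_prop)
        · exact ContinuousAt.comp (x := (z₀, t)) (f := fun q : E × ℝ => (q.2, z₀)) h2 (by fun_prop)
      have h3 := h1.norm
      refine h3.eventually_lt continuousAt_const ?_
      simpa using hε
    obtain ⟨r, hr, hball⟩ := Metric.eventually_nhds_iff_ball.1 hev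
    refine ⟨min (r / 2) R, lt_min (by linarith) hR, min_le_right _ _, ?_⟩
    intro t ht z hz z' hz'
    have hsub : Metric.closedBall z₀ (min (r / 2) R) ⊆ Metric.ball z₀ r :=
      Metric.closedBall_subset_ball ((min_le_left _ _).trans_lt (by linarith))
    have hsubU : Metric.closedBall z₀ (min (r / 2) R) ⊆ U :=
      (Metric.closedBall_subset_closedBall (min_le_right _ _)).trans hRU
    exact Convex.norm_image_sub_le_of_norm_hasFDerivWithin_le' (𝕜 := ℝ)
      (f := fun z => G (t, z)) (f' := fun z => fderiv ℝ (fun z => G (t, z)) z)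
      (fun y hy => (hasFDerivAt_slice (hd t (hsJ ht) y
        (hsubU hy))).differentiableAt.hasFDerivAt.hasFDerivWithinAt)
      (fun y hy => (hball y (hsub hy) t ht).le) (convex_closedBall _ _) hz' hz

variable {G₁ G₂ : ℝ × E → E} {D₁ D₂ : ℝ → E →L[ℝ] E}

/-- `z` solves `ż = v₁ G₁(t,z) + v₂ G₂(t,z)`, `z(0) = z₀` and stays in a ball. -/
structure IsControlledSolution (R : ℝ) (z₀ : E) (G₁ G₂ : ℝ × E → E) (v : L2 s × L2 s) (z : ℝ → E) :
    Prop where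
  continuousOn : ContinuousOn z (Icc 0 s)
  mem : ∀ t ∈ Icc 0 s, z t ∈ Metric.closedBall z₀ R
  eq : ∀ t ∈ Icc 0 s, z t = z₀ +
    controlIntegral v (fun τ => G₁ (τ, z τ)) (fun τ => G₂ (τ, z τ)) t

theorem IsUniformlyDifferentiable.continuousOn_along (h : IsUniformlyDifferentiable s R z₀ G₁ D₁)
    {z : ℝ → E} (hz : ContinuousOn z (Icc 0 s)) (hm : ∀ t ∈ Icc 0 s, z t ∈ Metric.closedBall z₀ R) :
    ContinuousOn (fun τ => G₁ (τ, z τ)) (Icc 0 s) :=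
  h.continuousOn.comp (f := fun τ => (τ, z τ)) (continuousOn_id.prodMk hz) fun t ht => ⟨ht, hm t ht⟩

theorem IsUniformlyDifferentiable.exists_bound (h : IsUniformlyDifferentiable s R z₀ G₁ D₁) :
    ∃ K > 0, (∀ t ∈ Icc 0 s, ‖D₁ t‖ ≤ K) ∧ (∀ t ∈ Icc 0 s, ‖G₁ (t, z₀)‖ ≤ K) := by
  obtain ⟨K, hK⟩ := isCompact_Icc.exists_bound_of_continuousOn h.continuousOn_deriv
  obtain ⟨K', hK'⟩ := isCompact_Icc.exists_bound_of_continuousOn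
    (h.continuousOn_along (z := fun _ => z₀) continuousOn_const
      fun _ _ => Metric.mem_closedBall_self h.R_pos.le)
  refine ⟨max 1 (max K K'), lt_max_of_lt_left one_pos, fun t ht => (hK t ht).trans ?_,
    fun t ht => (hK' t ht).trans ?_⟩
  · exact (le_max_left _ _).trans (le_max_right _ _)
  · exact (le_max_right _ _).trans (le_max_right _ _)

/-- Lipschitz bound near `z₀`. -/
theorem IsUniformlyDifferentiable.exists_lipschitz (h : IsUniformlyDifferentiable s R z₀ G₁ D₁) :
    ∃ r > 0, r ≤ R ∧ ∃ K > 0, ∀ t ∈ Icc 0 s, ‖G₁ (t, z₀)‖ ≤ K ∧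
      ∀ z ∈ Metric.closedBall z₀ r, ∀ z' ∈ Metric.closedBall z₀ r,
        ‖G₁ (t, z) - G₁ (t, z')‖ ≤ K * ‖z - z'‖ := by
  obtain ⟨K, hK, hKD, hKG⟩ := h.exists_bound
  obtain ⟨r, hr, hrR, hr1⟩ := h.approx 1 one_pos
  refine ⟨r, hr, hrR, K + 1, by positivity, fun t ht => ⟨(hKG t ht).trans (by linarith), ?_⟩⟩
  intro z hz z' hz'
  have h1 := hr1 t ht z hz z' hz'
  have h2 := ((D₁ t).le_opNorm (z - z')).trans
    (mul_le_mul_of_nonneg_right (hKD t ht) (norm_nonneg _))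
  have h3 := norm_add_le (G₁ (t, z) - G₁ (t, z') - D₁ t (z - z')) (D₁ t (z - z'))
  rw [sub_add_cancel] at h3
  linarith

/-- Picard iteration on curves in a closed ball. Smallness is required of the mass of the control
and not of the length of the interval, so the solution exists on all of `[0, s]`. -/
theorem exists_controlledSolution [CompleteSpace E] (hs : 0 ≤ s)
    (h₁ : IsUniformlyDifferentiable s R z₀ G₁ D₁) (h₂ : IsUniformlyDifferentiable s R z₀ G₂ D₂) :
    ∃ K ≥ 0, ∃ ρ > 0, ∀ v : L2 s × L2 s, mass v ≤ ρ → ∃ z, IsControlledSolution R z₀ G₁ G₂ v z ∧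
      ∀ t ∈ Icc 0 s, ‖z t - z₀‖ ≤ K * mass v := by
  obtain ⟨r₁, hr₁, hr₁R, K₁, hK₁, hL₁⟩ := h₁.exists_lipschitz
  obtain ⟨r₂, hr₂, hr₂R, K₂, hK₂, hL₂⟩ := h₂.exists_lipschitz
  set r := min r₁ r₂ with hr
  have hr0 : 0 < r := lt_min hr₁ hr₂
  set K := max K₁ K₂ with hK
  have hK0 : 0 < K := lt_max_of_lt_left hK₁
  have hrR : r ≤ R := (min_le_left _ _).trans hr₁R
  have hlip : ∀ t ∈ Icc 0 s, ∀ z ∈ Metric.closedBall z₀ r, ∀ z' ∈ Metric.closedBall z₀ r,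
      ‖G₁ (t, z) - G₁ (t, z')‖ ≤ K * ‖z - z'‖ ∧ ‖G₂ (t, z) - G₂ (t, z')‖ ≤ K * ‖z - z'‖ := by
    intro t ht z hz z' hz'
    have m₁ := Metric.closedBall_subset_closedBall (x := z₀) (min_le_left r₁ r₂)
    have m₂ := Metric.closedBall_subset_closedBall (x := z₀) (min_le_right r₁ r₂)
    exact ⟨((hL₁ t ht).2 z (m₁ hz) z' (m₁ hz')).trans
        (mul_le_mul_of_nonneg_right (le_max_left _ _) (norm_nonneg _)),
      ((hL₂ t ht).2 z (m₂ hz) z' (m₂ hz')).trans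
        (mul_le_mul_of_nonneg_right (le_max_right _ _) (norm_nonneg _))⟩
  have hz₀ : z₀ ∈ Metric.closedBall z₀ r := Metric.mem_closedBall_self hr0.le
  have hbd : ∀ t ∈ Icc 0 s, ∀ z ∈ Metric.closedBall z₀ r,
      ‖G₁ (t, z)‖ ≤ K * (1 + r) ∧ ‖G₂ (t, z)‖ ≤ K * (1 + r) := by
    intro t ht z hz
    have e := hlip t ht z hz z₀ hz₀
    have hzr : ‖z - z₀‖ ≤ r := by simpa [dist_eq_norm] using hz
    have e' := mul_le_mul_of_nonneg_left hzr hK0.le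
    have k₁ := (hL₁ t ht).1.trans (le_max_left K₁ K₂)
    have k₂ := (hL₂ t ht).1.trans (le_max_right K₁ K₂)
    have t₁ := norm_add_le (G₁ (t, z) - G₁ (t, z₀)) (G₁ (t, z₀))
    have t₂ := norm_add_le (G₂ (t, z) - G₂ (t, z₀)) (G₂ (t, z₀))
    rw [sub_add_cancel] at t₁ t₂
    rw [mul_add, mul_one]
    exact ⟨by linarith [e.1], by linarith [e.2]⟩
  set K' := K * (1 + r) with hK'
  have hK'0 : 0 < K' := by positivity
  -- The bound `r / K'` keeps the iterates in the ball of radius `r`, and `1 / (2 * K)` makes the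
  -- iteration a contraction with constant 1/2.
  refine ⟨K', hK'0.le, min (r / K') (1 / (2 * K)), by positivity, fun v hv => ?_⟩
  have hm0 := mass_nonneg hs v
  have hm1 : K' * mass v ≤ r := by
    have := mul_le_mul_of_nonneg_left (hv.trans (min_le_left _ _)) hK'0.le
    rwa [mul_div_cancel₀ _ hK'0.ne'] at this
  have hm2 : K * mass v ≤ 1 / 2 := by
    have := mul_le_mul_of_nonneg_left (hv.trans (min_le_right _ _)) hK0.le
    have e : K * (1 / (2 * K)) = 1 / 2 := by field_simp
    rwa [e] at this
  set S : Set C(Icc (0 : ℝ) s, E) := {u | ∀ t, u t ∈ Metric.closedBall z₀ r} with hS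
  have hSc : IsClosed S := by
    rw [hS, ofPred_forall]
    exact isClosed_iInter fun t => Metric.isClosed_closedBall.preimage
      (continuous_eval_const t)
  have : CompleteSpace S := hSc.completeSpace_coe
  have : Nonempty S := ⟨⟨ContinuousMap.const _ z₀, fun _ => hz₀⟩⟩
  let ext : S → ℝ → E := fun u τ => u.1 (projIcc 0 s hs τ)
  have hextc : ∀ u : S, Continuous (ext u) := fun u => u.1.continuous.comp continuous_projIcc
  have hextm : ∀ (u : S) (τ : ℝ), ext u τ ∈ Metric.closedBall z₀ r := fun u τ => u.2 _
  have hextR : ∀ (u : S) (τ : ℝ), ext u τ ∈ Metric.closedBall z₀ R := fun u τ =>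
    Metric.closedBall_subset_closedBall hrR (hextm u τ)
  have hc₁ : ∀ u : S, ContinuousOn (fun τ => G₁ (τ, ext u τ)) (Icc 0 s) := fun u =>
    h₁.continuousOn_along (hextc u).continuousOn fun t _ => hextR u t
  have hc₂ : ∀ u : S, ContinuousOn (fun τ => G₂ (τ, ext u τ)) (Icc 0 s) := fun u =>
    h₂.continuousOn_along (hextc u).continuousOn fun t _ => hextR u t
  have hbound : ∀ (u : S), ∀ t ∈ Icc 0 s,
      ‖controlIntegral v (fun τ => G₁ (τ, ext u τ)) (fun τ => G₂ (τ, ext u τ)) t‖ ≤ K' * mass v :=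
    fun u t ht => norm_controlIntegral_le ht v hK'0.le
      (fun τ hτ => (hbd τ hτ _ (hextm u τ)).1) (fun τ hτ => (hbd τ hτ _ (hextm u τ)).2)
  let Φ : S → S := fun u => ⟨⟨fun t => z₀ +
      controlIntegral v (fun τ => G₁ (τ, ext u τ)) (fun τ => G₂ (τ, ext u τ)) t,
      continuous_const.add
        (continuousOn_iff_continuous_domRestrict.1 (continuousOn_controlIntegral (hc₁ u) (hc₂ u) v))⟩,
    fun t => by
      simpa [dist_eq_norm] using (hbound u t t.2).trans hm1⟩
  have hΦ : ContractingWith (1 / 2) Φ := by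
    refine ⟨by rw [← NNReal.coe_lt_coe]; norm_num, LipschitzWith.of_dist_le_mul fun u u' => ?_⟩
    have hd0 : (0 : ℝ) ≤ dist u u' := dist_nonneg
    rw [Subtype.dist_eq, ContinuousMap.dist_le (by positivity)]
    intro t
    have hdist : ∀ τ ∈ Icc 0 s, ‖ext u τ - ext u' τ‖ ≤ dist u u' := fun τ _ => by
      rw [← dist_eq_norm]; exact ContinuousMap.dist_apply_le_dist _
    have e : dist ((Φ u).1 t) ((Φ u').1 t) = ‖controlIntegral v
        (fun τ => G₁ (τ, ext u τ) - G₁ (τ, ext u' τ))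
        (fun τ => G₂ (τ, ext u τ) - G₂ (τ, ext u' τ)) t‖ := by
      rw [controlIntegral_sub (hc₁ u) (hc₂ u) (hc₁ u') (hc₂ u') t.2, dist_eq_norm]
      congr 1
      exact add_sub_add_left_eq_sub _ _ _
    rw [e]
    refine (norm_controlIntegral_le t.2 v (b := K * dist u u') (by positivity) (fun τ hτ => ?_)
      (fun τ hτ => ?_)).trans ?_
    · exact ((hlip τ hτ _ (hextm u τ) _ (hextm u' τ)).1).trans
        (mul_le_mul_of_nonneg_left (hdist τ hτ) hK0.le)
    · exact ((hlip τ hτ _ (hextm u τ) _ (hextm u' τ)).2).trans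
        (mul_le_mul_of_nonneg_left (hdist τ hτ) hK0.le)
    · have := mul_le_mul_of_nonneg_right hm2 hd0
      calc K * dist u u' * mass v = K * mass v * dist u u' := by ring
        _ ≤ 1 / 2 * dist u u' := this
        _ = _ := by norm_num
  set u := hΦ.fixedPoint Φ with hu
  have hfix : Φ u = u := hΦ.fixedPoint_isFixedPt
  have heq : ∀ t ∈ Icc 0 s, ext u t = z₀ +
      controlIntegral v (fun τ => G₁ (τ, ext u τ)) (fun τ => G₂ (τ, ext u τ)) t := by
    intro t ht
    have h1 : (Φ u).1 ⟨t, ht⟩ = u.1 ⟨t, ht⟩ := by rw [hfix]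
    have h2 : ext u t = u.1 ⟨t, ht⟩ := by simp only [ext, projIcc_of_mem hs ht]
    rw [h2, ← h1]
    rfl
  refine ⟨ext u, ⟨(hextc u).continuousOn, fun t _ => hextR u t, heq⟩, fun t ht => ?_⟩
  rw [heq t ht, add_sub_cancel_left]
  exact hbound u t ht

/-- With m the mass of v and δ the first variation, z − z₀ = O(m), hence z − z₀ − δ = O(m²). So the
integrands G(z) − G(z₀) − Dδ are a small multiple of m plus O(m²), and integration against v
supplies one more factor m. -/
theorem controlledSolution_expansion [CompleteSpace E] (hs : 0 ≤ s)
    (h₁ : IsUniformlyDifferentiable s R z₀ G₁ D₁) (h₂ : IsUniformlyDifferentiable s R z₀ G₂ D₂)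
    {K : ℝ} (hK : 0 ≤ K) {η : ℝ} (hη : 0 < η) :
    ∃ ρ > 0, ∀ (v : L2 s × L2 s) (z : ℝ → E), mass v ≤ ρ → IsControlledSolution R z₀ G₁ G₂ v z →
      (∀ t ∈ Icc 0 s, ‖z t - z₀‖ ≤ K * mass v) →
      ‖z s - z₀ - controlIntegral v (fun τ => G₁ (τ, z₀)) (fun τ => G₂ (τ, z₀)) s -
        controlIntegral v
          (fun τ => D₁ τ (controlIntegral v (fun τ => G₁ (τ, z₀)) (fun τ => G₂ (τ, z₀)) τ))
          (fun τ => D₂ τ (controlIntegral v (fun τ => G₁ (τ, z₀)) (fun τ => G₂ (τ, z₀)) τ)) s‖ ≤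
        η * mass v ^ 2 := by
  obtain ⟨r₁, hr₁, hr₁R, k₁, hk₁, hL₁⟩ := h₁.exists_lipschitz
  obtain ⟨r₂, hr₂, hr₂R, k₂, hk₂, hL₂⟩ := h₂.exists_lipschitz
  obtain ⟨d₁, hd₁, hD₁, -⟩ := h₁.exists_bound
  obtain ⟨d₂, hd₂, hD₂, -⟩ := h₂.exists_bound
  set k := max k₁ k₂ with hk
  set d := max d₁ d₂ with hd
  have hk0 : 0 < k := lt_max_of_lt_left hk₁
  have hd0 : 0 < d := lt_max_of_lt_left hd₁
  -- This `ε` lets the linearization error take up half of `η`. In the bound on the mass chosen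
  -- below, the first entry keeps `z` in the ball where that holds, and the second limits to the
  -- other half the error from replacing `z - z₀` by `δ`.
  set ε := η / (2 * (K + 1)) with hε
  have hε0 : 0 < ε := by positivity
  obtain ⟨q₁, hq₁, hq₁R, ha₁⟩ := h₁.approx ε hε0
  obtain ⟨q₂, hq₂, hq₂R, ha₂⟩ := h₂.approx ε hε0
  set q := min (min r₁ r₂) (min q₁ q₂) with hq
  have hq0 : 0 < q := lt_min (lt_min hr₁ hr₂) (lt_min hq₁ hq₂)
  refine ⟨min (q / (K + 1)) (η / (2 * (d * (k * K) + 1))), by positivity, ?_⟩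
  intro v z hv hz hzK
  have hss : s ∈ Icc 0 s := ⟨hs, le_rfl⟩
  have hm0 := mass_nonneg hs v
  have hzq : ∀ t ∈ Icc 0 s, z t ∈ Metric.closedBall z₀ q := by
    intro t ht
    rw [Metric.mem_closedBall, dist_eq_norm]
    have e1 := mul_le_mul_of_nonneg_left (hv.trans (min_le_left _ _))
      (by positivity : (0 : ℝ) ≤ K + 1)
    rw [mul_div_cancel₀ _ (by positivity)] at e1
    linarith [hzK t ht]
  have hz₀q : z₀ ∈ Metric.closedBall z₀ q := Metric.mem_closedBall_self hq0.le
  have hz₀R : ∀ t ∈ Icc 0 s, z₀ ∈ Metric.closedBall z₀ R := fun _ _ =>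
    Metric.mem_closedBall_self h₁.R_pos.le
  have sub : ∀ {q' : ℝ}, q ≤ q' → ∀ {y : E}, y ∈ Metric.closedBall z₀ q →
      y ∈ Metric.closedBall z₀ q' := fun h _ hy => Metric.closedBall_subset_closedBall h hy
  have lr₁ : q ≤ r₁ := (min_le_left _ _).trans (min_le_left _ _)
  have lr₂ : q ≤ r₂ := (min_le_left _ _).trans (min_le_right _ _)
  have lq₁ : q ≤ q₁ := (min_le_right _ _).trans (min_le_left _ _)
  have lq₂ : q ≤ q₂ := (min_le_right _ _).trans (min_le_right _ _)
  have c₁ := h₁.continuousOn_along hz.continuousOn hz.mem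
  have c₂ := h₂.continuousOn_along hz.continuousOn hz.mem
  have e₁ := h₁.continuousOn_along (z := fun _ => z₀) continuousOn_const hz₀R
  have e₂ := h₂.continuousOn_along (z := fun _ => z₀) continuousOn_const hz₀R
  set m := mass v with hm
  set δ := controlIntegral v (fun τ => G₁ (τ, z₀)) (fun τ => G₂ (τ, z₀)) with hδ
  have hδc : ContinuousOn δ (Icc 0 s) := continuousOn_controlIntegral e₁ e₂ v
  have hdiff : ∀ t ∈ Icc 0 s, ‖z t - z₀ - δ t‖ ≤ k * (K * m) * m := by
    intro t ht
    have h1 : z t - z₀ - δ t = controlIntegral v (fun τ => G₁ (τ, z τ) - G₁ (τ, z₀))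
        (fun τ => G₂ (τ, z τ) - G₂ (τ, z₀)) t := by
      rw [controlIntegral_sub c₁ c₂ e₁ e₂ ht, hz.eq t ht, add_sub_cancel_left]
    rw [h1]
    refine norm_controlIntegral_le ht v (by positivity) (fun τ hτ => ?_) (fun τ hτ => ?_)
    · exact ((hL₁ τ hτ).2 _ (sub lr₁ (hzq τ hτ)) _ (sub lr₁ hz₀q)).trans
        (mul_le_mul (le_max_left _ _) (hzK τ hτ) (norm_nonneg _) hk0.le)
    · exact ((hL₂ τ hτ).2 _ (sub lr₂ (hzq τ hτ)) _ (sub lr₂ hz₀q)).trans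
        (mul_le_mul (le_max_right _ _) (hzK τ hτ) (norm_nonneg _) hk0.le)
  have hfin : z s - z₀ - δ s - controlIntegral v (fun τ => D₁ τ (δ τ)) (fun τ => D₂ τ (δ τ)) s =
      controlIntegral v (fun τ => G₁ (τ, z τ) - G₁ (τ, z₀) - D₁ τ (δ τ))
        (fun τ => G₂ (τ, z τ) - G₂ (τ, z₀) - D₂ τ (δ τ)) s := by
    have s₁ : ContinuousOn (fun τ => G₁ (τ, z τ) - G₁ (τ, z₀)) (Icc 0 s) := c₁.sub e₁
    have s₂ : ContinuousOn (fun τ => G₂ (τ, z τ) - G₂ (τ, z₀)) (Icc 0 s) := c₂.sub e₂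
    rw [controlIntegral_sub s₁ s₂ (h₁.continuousOn_deriv.clm_apply hδc)
      (h₂.continuousOn_deriv.clm_apply hδc) hss, controlIntegral_sub c₁ c₂ e₁ e₂ hss, hz.eq s hss,
      add_sub_cancel_left]
  rw [hfin]
  have hpt : ∀ {G : ℝ × E → E} {D : ℝ → E →L[ℝ] E}, (∀ t ∈ Icc 0 s, ‖D t‖ ≤ d) →
      (∀ t ∈ Icc 0 s, ‖G (t, z t) - G (t, z₀) - D t (z t - z₀)‖ ≤ ε * ‖z t - z₀‖) →
      ∀ t ∈ Icc 0 s, ‖G (t, z t) - G (t, z₀) - D t (δ t)‖ ≤ ε * (K * m) + d * (k * (K * m) * m) := by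
    intro G D hD ha t ht
    have h1 : G (t, z t) - G (t, z₀) - D t (δ t) =
        (G (t, z t) - G (t, z₀) - D t (z t - z₀)) + D t (z t - z₀ - δ t) := by
      rw [map_sub (D t) (z t - z₀) (δ t)]
      abel
    rw [h1]
    refine (norm_add_le _ _).trans (add_le_add ((ha t ht).trans
      (mul_le_mul_of_nonneg_left (hzK t ht) hε0.le)) (((D t).le_opNorm _).trans ?_))
    exact mul_le_mul (hD t ht) (hdiff t ht) (norm_nonneg _) hd0.le
  refine (norm_controlIntegral_le hss v (b := ε * (K * m) + d * (k * (K * m) * m)) (by positivity)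
    (hpt (fun t ht => (hD₁ t ht).trans (le_max_left _ _)) fun t ht =>
      ha₁ t ht _ (sub lq₁ (hzq t ht)) _ (sub lq₁ hz₀q))
    (hpt (fun t ht => (hD₂ t ht).trans (le_max_right _ _)) fun t ht =>
      ha₂ t ht _ (sub lq₂ (hzq t ht)) _ (sub lq₂ hz₀q))).trans ?_
  have b1 : ε * K ≤ η / 2 := by
    rw [hε, div_mul_eq_mul_div, div_le_div_iff₀ (by positivity) (by norm_num)]
    nlinarith
  have b2 : (d * (k * K)) * m ≤ η / 2 := by
    have h1 : m ≤ η / (2 * (d * (k * K) + 1)) := hv.trans (min_le_right _ _)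
    have hp : 0 ≤ d * (k * K) := by positivity
    have h2 := mul_le_mul_of_nonneg_left h1 (by positivity : (0 : ℝ) ≤ d * (k * K) + 1)
    have h3 : (d * (k * K) + 1) * (η / (2 * (d * (k * K) + 1))) = η / 2 := by field_simp
    rw [h3] at h2
    linarith
  calc (ε * (K * m) + d * (k * (K * m) * m)) * m = (ε * K + d * (k * K) * m) * m ^ 2 := by ring
    _ ≤ η * m ^ 2 := mul_le_mul_of_nonneg_right (by linarith) (by positivity)

end ControlledEquation

/-! ### Absolutely continuous functions and their derivatives -/

section AEDeriv

/-- `F` is absolutely continuous on `[0,s]` with derivative `f`. -/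
structure HasAEDeriv (F f : ℝ → ℝ) (s : ℝ) : Prop where
  ac : AbsolutelyContinuousOnInterval F 0 s
  deriv : ∀ᵐ t, t ∈ Ioo 0 s → HasDerivAt F (f t) t

variable {F G f g : ℝ → ℝ} {s : ℝ}

theorem ae_ne_pair (a b : ℝ) : ∀ᵐ t : ℝ, t ≠ a ∧ t ≠ b := by
  have h : ∀ c : ℝ, ∀ᵐ t : ℝ, t ≠ c := fun c => by simp [ae_iff, measure_singleton]
  filter_upwards [h a, h b] with t h1 h2 using ⟨h1, h2⟩

theorem HasAEDeriv.ae_deriv_eq (h : HasAEDeriv F f s) {t : ℝ} (ht : t ∈ Icc 0 s) :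
    ∀ᵐ τ, τ ∈ uIoc 0 t → _root_.deriv F τ = f τ := by
  filter_upwards [h.deriv, ae_ne_pair 0 s] with τ h1 h2 hτ
  rw [uIoc_of_le ht.1] at hτ
  exact (h1 ⟨hτ.1, lt_of_le_of_ne (hτ.2.trans ht.2) h2.2⟩).deriv

theorem HasAEDeriv.integral_eq (h : HasAEDeriv F f s) {t : ℝ} (ht : t ∈ Icc 0 s) :
    ∫ τ in (0 : ℝ)..t, f τ = F t - F 0 := by
  have h1 : AbsolutelyContinuousOnInterval F 0 t := h.ac.mono (by
    rw [uIcc_of_le ht.1, uIcc_of_le (ht.1.trans ht.2)]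
    exact Icc_subset_Icc_right ht.2)
  rw [← h1.integral_deriv_eq_sub]
  refine intervalIntegral.integral_congr_ae ?_
  filter_upwards [h.ae_deriv_eq ht] with τ hτ hτ' using (hτ hτ').symm

theorem HasAEDeriv.mul (hF : HasAEDeriv F f s) (hG : HasAEDeriv G g s) :
    HasAEDeriv (fun t => F t * G t) (fun t => f t * G t + F t * g t) s :=
  ⟨hF.ac.mul hG.ac, by
    filter_upwards [hF.deriv, hG.deriv] with t h1 h2 ht using (h1 ht).mul (h2 ht)⟩

theorem HasAEDeriv.sub (hF : HasAEDeriv F f s) (hG : HasAEDeriv G g s) :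
    HasAEDeriv (fun t => F t - G t) (fun t => f t - g t) s :=
  ⟨hF.ac.sub hG.ac, by
    filter_upwards [hF.deriv, hG.deriv] with t h1 h2 ht using (h1 ht).sub (h2 ht)⟩

theorem HasAEDeriv.add (hF : HasAEDeriv F f s) (hG : HasAEDeriv G g s) :
    HasAEDeriv (fun t => F t + G t) (fun t => f t + g t) s :=
  ⟨hF.ac.add hG.ac, by
    filter_upwards [hF.deriv, hG.deriv] with t h1 h2 ht using (h1 ht).add (h2 ht)⟩

theorem hasAEDeriv_integral (hs : 0 ≤ s) (hf : IntervalIntegrable f volume 0 s) :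
    HasAEDeriv (fun t => ∫ τ in (0 : ℝ)..t, f τ) f s := by
  refine ⟨hf.absolutelyContinuousOnInterval_intervalIntegral left_mem_uIcc, ?_⟩
  filter_upwards [hf.ae_hasDerivAt_integral] with t h ht
  have hmem : t ∈ uIcc 0 s := by rw [uIcc_of_le hs]; exact Ioo_subset_Icc_self ht
  exact h hmem 0 left_mem_uIcc

theorem hasAEDeriv_of_hasDerivAt (hs : 0 ≤ s) (hf : ContinuousOn f (Icc 0 s))
    (hF : ∀ t ∈ Icc 0 s, HasDerivAt F (f t) t) : HasAEDeriv F f s := by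
  refine ⟨?_, Eventually.of_forall fun t ht => hF t (Ioo_subset_Icc_self ht)⟩
  obtain ⟨K, hK⟩ := isCompact_Icc.exists_bound_of_continuousOn hf
  have h := Convex.lipschitzOnWith_of_nnnorm_hasDerivWithin_le (C := Real.toNNReal K) (f := F)
    (f' := f) (convex_Icc 0 s) (fun t ht => (hF t ht).hasDerivWithinAt) fun t ht => by
      rw [← norm_toNNReal]; exact Real.toNNReal_le_toNNReal (hK t ht)
  rw [← uIcc_of_le hs] at h
  exact h.absolutelyContinuousOnInterval

/-- The oscillation sums of `x` are dominated by those of `G`. -/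
theorem absolutelyContinuous_of_dist_le {X : Type*} [PseudoMetricSpace X] {x : ℝ → X} {a b K : ℝ}
    (hG : AbsolutelyContinuousOnInterval G a b)
    (h : ∀ t ∈ uIcc a b, ∀ t' ∈ uIcc a b, dist (x t) (x t') ≤ K * dist (G t) (G t')) :
    AbsolutelyContinuousOnInterval x a b := by
  have hG' := hG.const_mul K
  unfold AbsolutelyContinuousOnInterval at hG ⊢
  have h0 := hG.const_mul K
  rw [mul_zero] at h0
  refine squeeze_zero' (Eventually.of_forall fun E => Finset.sum_nonneg fun _ _ => dist_nonneg) ?_ h0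
  refine Filter.eventually_inf_principal.2 (Eventually.of_forall fun E hE => ?_)
  rw [Finset.mul_sum]
  exact Finset.sum_le_sum fun i hi => h _ (hE.1 i hi).1 _ (hE.1 i hi).2

/-- The chain rule along the primitive of an integrable function. -/
theorem hasAEDeriv_comp {E : Type*} [NormedAddCommGroup E] [NormedSpace ℝ E] [CompleteSpace E]
    {φ : ℝ × E → ℝ} {Ω : Set (ℝ × E)} (hΩ : IsOpen Ω) (hφ : ContDiffOn ℝ 1 φ Ω) (hs : 0 ≤ s)
    {z h : ℝ → E} {z₀ : E} (hz : ContinuousOn z (Icc 0 s)) (hh : IntervalIntegrable h volume 0 s)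
    (heq : ∀ t ∈ Icc 0 s, z t = z₀ + ∫ τ in (0 : ℝ)..t, h τ)
    (hmem : ∀ t ∈ Icc 0 s, (t, z t) ∈ Ω) :
    HasAEDeriv (fun t => φ (t, z t)) (fun t => fderiv ℝ φ (t, z t) (1, h t)) s := by
  have hgc : ContinuousOn (fun t => (t, z t)) (Icc 0 s) := continuousOn_id.prodMk hz
  constructor
  -- The graph of `z` is compact, so `φ` has one Lipschitz constant on it. Increments of the
  -- composite are thus dominated by those of the absolutely continuous function `∫ (1 + ‖h‖)`.
  · have hK : IsCompact ((fun t => (t, z t)) '' Icc 0 s) := isCompact_Icc.image_of_continuousOn hgc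
    have hloc : LocallyLipschitzOn ((fun t => (t, z t)) '' Icc 0 s) φ := by
      rintro _ ⟨t, ht, rfl⟩
      obtain ⟨K, N, hN, hL⟩ := (hφ.contDiffAt (hΩ.mem_nhds (hmem t ht))).exists_lipschitzOnWith
      exact ⟨K, N, mem_nhdsWithin_of_mem_nhds hN, hL⟩
    obtain ⟨K, hL⟩ := hloc.exists_lipschitzOnWith_of_compact hK
    have hone : IntervalIntegrable (fun τ => 1 + ‖h τ‖) volume 0 s :=
      intervalIntegrable_const.add hh.norm
    refine absolutelyContinuous_of_dist_le (K := K)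
      (hone.absolutelyContinuousOnInterval_intervalIntegral left_mem_uIcc) ?_
    have hkey : ∀ t ∈ Icc 0 s, ∀ t' ∈ Icc 0 s, t ≤ t' → dist (φ (t, z t)) (φ (t', z t')) ≤
        K * dist (∫ τ in (0 : ℝ)..t, (1 + ‖h τ‖)) (∫ τ in (0 : ℝ)..t', (1 + ‖h τ‖)) := by
      intro t ht t' ht' htt
      refine (hL.dist_le_mul _ (mem_image_of_mem _ ht) _ (mem_image_of_mem _ ht')).trans ?_
      refine mul_le_mul_of_nonneg_left ?_ K.2
      have hsub : ∀ {a : ℝ}, a ∈ Icc 0 s → uIcc 0 a ⊆ uIcc 0 s := fun {a} ha => by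
        rw [uIcc_of_le ha.1, uIcc_of_le hs]; exact Icc_subset_Icc_right ha.2
      have hsub' : uIcc t t' ⊆ uIcc 0 s := by
        rw [uIcc_of_le htt, uIcc_of_le hs]; exact Icc_subset_Icc ht.1 ht'.2
      have d1 : dist (∫ τ in (0 : ℝ)..t, (1 + ‖h τ‖)) (∫ τ in (0 : ℝ)..t', (1 + ‖h τ‖)) =
          ∫ τ in t..t', (1 + ‖h τ‖) := by
        rw [dist_comm, Real.dist_eq, intervalIntegral.integral_interval_sub_left
          (hone.mono_set (hsub ht')) (hone.mono_set (hsub ht)), abs_of_nonneg]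
        exact intervalIntegral.integral_nonneg htt fun _ _ => by positivity
      have d2 : dist (z t) (z t') ≤ ∫ τ in t..t', ‖h τ‖ := by
        rw [dist_comm, dist_eq_norm, heq t ht, heq t' ht', add_sub_add_left_eq_sub,
          intervalIntegral.integral_interval_sub_left
            (hh.mono_set (hsub ht')) (hh.mono_set (hsub ht))]
        exact intervalIntegral.norm_integral_le_integral_norm htt
      rw [d1, intervalIntegral.integral_add intervalIntegrable_const (hh.mono_set hsub').norm,
        intervalIntegral.integral_const, smul_eq_mul, mul_one, Prod.dist_eq]
      have n1 : 0 ≤ ∫ τ in t..t', ‖h τ‖ :=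
        intervalIntegral.integral_nonneg htt fun _ _ => norm_nonneg _
      refine max_le ?_ (by linarith)
      simp only
      rw [dist_comm, Real.dist_eq, abs_of_nonneg (by linarith)]
      linarith
    intro t ht t' ht'
    rw [uIcc_of_le hs] at ht ht'
    rcases le_total t t' with htt | htt
    · exact hkey t ht t' ht' htt
    · rw [dist_comm, dist_comm (∫ τ in (0 : ℝ)..t, (1 + ‖h τ‖))]
      exact hkey t' ht' t ht htt
  · filter_upwards [hh.ae_hasDerivAt_integral] with t h1 ht
    have ht' := Ioo_subset_Icc_self ht
    have hmem' : t ∈ uIcc 0 s := by rwa [uIcc_of_le hs]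
    have h2 : HasDerivAt z (h t) t := by
      refine ((h1 hmem' 0 left_mem_uIcc).const_add z₀).congr_of_eventuallyEq ?_
      filter_upwards [isOpen_Ioo.mem_nhds ht] with τ hτ using heq τ (Ioo_subset_Icc_self hτ)
    exact ((hφ.contDiffAt (hΩ.mem_nhds (hmem t ht'))).differentiableAt
      (by simp)).hasFDerivAt.comp_hasDerivAt t ((hasDerivAt_id t).prodMk h2)

end AEDeriv

/-! ### The endpoint map in a flow tube -/

section Endpoint

variable {E : Type*} [NormedAddCommGroup E] [NormedSpace ℝ E]
  {H : Type*} [TopologicalSpace H] {I : ModelWithCorners ℝ E H}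
  {M : Type*} [TopologicalSpace M] [ChartedSpace H M] [IsManifold I ∞ M]
  {X₁ X₂ : (x : M) → TangentSpace I x} {γ : ℝ → M} {s δ : ℝ} {U : Set E} {ψ : ℝ × E → M}

/-- `endpointMap` selects some trajectory; uniqueness makes the selection irrelevant. -/
theorem endpointMap_eq [I.Boundaryless] [FiniteDimensional ℝ E] [T2Space M] (hs : 0 ≤ s)
    (hX₁ : ContMDiff I I.tangent ∞ fun x => (⟨x, X₁ x⟩ : TangentBundle I M))
    (hX₂ : ContMDiff I I.tangent ∞ fun x => (⟨x, X₂ x⟩ : TangentBundle I M))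
    {x₀ : M} {v : L2 s × L2 s} {x : ℝ → M} (hx : IsTrajectory I X₁ X₂ x₀ s v x) :
    endpointMap I X₁ X₂ x₀ s v = x s := by
  have hex : ∃ x, IsTrajectory I X₁ X₂ x₀ s v x := ⟨x, hx⟩
  have hc : ∀ {y : ℝ → M}, IsTrajectory I X₁ X₂ x₀ s v y →
      IsControlled I X₁ X₂ (fun τ => 1 + v.1 τ) v.2 s y := fun hy =>
    ⟨hy.continuousOn, fun f hf t ht => by rw [hy.start]; exact hy.equation f hf t ht⟩
  rw [endpointMap, dif_pos hex]
  exact (hc hex.choose_spec).eqOn hX₁ hX₂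
    (intervalIntegrable_const.add (L2.intervalIntegrable hs v.1)) (L2.intervalIntegrable hs v.2)
    (hc hx) (hex.choose_spec.start.trans hx.start.symm) s ⟨hs, le_rfl⟩

/-- The time derivative of `ψ` is `X₁`, and its space derivative carries pulled-back fields to the
fields themselves, so this direction is pushed forward to (1 + r₁) X₁ + r₂ X₂. -/
theorem IsEndTube.fderiv_comp [I.Boundaryless] (h : IsEndTube I X₁ γ s δ U ψ) {f : M → ℝ}
    (hf : ContMDiff I 𝓘(ℝ, ℝ) ∞ f) {t : ℝ} (ht : t ∈ Ioo (-δ) (s + δ)) {z : E} (hz : z ∈ U)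
    (r₁ r₂ : ℝ) :
    fderiv ℝ (fun p => f (ψ p)) (t, z)
      (1, r₁ • pullField I ψ X₁ (t, z) + r₂ • pullField I ψ X₂ (t, z)) =
      (1 + r₁) * fieldDeriv I X₁ f (ψ (t, z)) + r₂ * fieldDeriv I X₂ f (ψ (t, z)) := by
  have hnb : Ioo (-δ) (s + δ) ×ˢ U ∈ 𝓝 (t, z) := (isOpen_Ioo.prod h.isOpen).mem_nhds ⟨ht, hz⟩
  have hψ := h.tube.smooth.contMDiffAt hnb
  have hd : DifferentiableAt ℝ (fun p => f (ψ p)) (t, z) :=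
    ((((hf _).of_le three_le_infty).comp (t, z) hψ).contDiffAt).differentiableAt (by norm_num)
  have hfd : ∀ x, HasMFDerivAt I 𝓘(ℝ, ℝ) f x (mfderiv I 𝓘(ℝ, ℝ) f x) := fun x =>
    ((hf x).mdifferentiableAt (by simp)).hasMFDerivAt
  have h1 : fderiv ℝ (fun p => f (ψ p)) (t, z) (1, 0) = fieldDeriv I X₁ f (ψ (t, z)) := by
    have e := (hfd (ψ (t, z))).comp t (h.tube.velocity t ht z hz)
    have e' := HasFDerivAt.hasDerivAt (𝕜 := ℝ) (F := ℝ) (hasMFDerivAt_iff_hasFDerivAt.1 e)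
    refine (hasDerivAt_slice hd).unique (e'.congr_deriv ?_)
    exact congrArg (mfderiv I 𝓘(ℝ, ℝ) f (ψ (t, z))) (one_smul ℝ (X₁ (ψ (t, z))))
  have h2 : ∀ Y : (x : M) → TangentSpace I x,
      fderiv ℝ (fun p => f (ψ p)) (t, z) (0, pullField I ψ Y (t, z)) =
        fieldDeriv I Y f (ψ (t, z)) := by
    intro Y
    have h4 : ContMDiffAt 𝓘(ℝ, E) 𝓘(ℝ, ℝ × E) 3 (fun z : E => (t, z)) z :=
      (contDiffAt_const.prodMk contDiffAt_id).contMDiffAt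
    have h5 : HasMFDerivAt 𝓘(ℝ, E) I (fun z => ψ (t, z)) z
        (mfderiv 𝓘(ℝ, E) I (fun z => ψ (t, z)) z) :=
      ((hψ.comp z h4).mdifferentiableAt (by norm_num)).hasMFDerivAt
    have e := (hfd (ψ (t, z))).comp z h5
    have e' := HasFDerivAt.unique (𝕜 := ℝ) (E := E) (F := ℝ) (hasFDerivAt_slice hd)
      (hasMFDerivAt_iff_hasFDerivAt.1 e)
    have e'' := DFunLike.congr_fun e' (pullField I ψ Y (t, z))
    have e3 : fderiv ℝ (fun p => f (ψ p)) (t, z) (0, pullField I ψ Y (t, z)) =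
        ((fderiv ℝ (fun p => f (ψ p)) (t, z)).comp (ContinuousLinearMap.inr ℝ ℝ E))
          (pullField I ψ Y (t, z)) := by simp
    rw [e3, e'']
    exact congrArg (mfderiv I 𝓘(ℝ, ℝ) f (ψ (t, z))) (h.tube.mfderiv_pullField Y ht hz)
  have h3 : ((1 : ℝ), r₁ • pullField I ψ X₁ (t, z) + r₂ • pullField I ψ X₂ (t, z)) =
      ((1, 0) : ℝ × E) + (r₁ • (0, pullField I ψ X₁ (t, z)) + r₂ • (0, pullField I ψ X₂ (t, z))) := by
    simp
  rw [h3, map_add, map_add, map_smul, map_smul, h1, h2, h2, smul_eq_mul, smul_eq_mul]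
  ring

/-- Variation of constants: the tube supplies the drift `X₁`, and the equation for `z` contains only
the controls. -/
theorem IsEndTube.isTrajectory [I.Boundaryless] [CompleteSpace E] (h : IsEndTube I X₁ γ s δ U ψ)
    {R : ℝ} (hRU : Metric.closedBall (extChartAt I (γ s) (γ s)) R ⊆ U)
    {D₁ D₂ : ℝ → E →L[ℝ] E}
    (h₁ : IsUniformlyDifferentiable s R (extChartAt I (γ s) (γ s)) (pullField I ψ X₁) D₁)
    (h₂ : IsUniformlyDifferentiable s R (extChartAt I (γ s) (γ s)) (pullField I ψ X₂) D₂)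
    {v : L2 s × L2 s} {z : ℝ → E}
    (hz : IsControlledSolution R (extChartAt I (γ s) (γ s)) (pullField I ψ X₁) (pullField I ψ X₂) v z) :
    IsTrajectory I X₁ X₂ (γ 0) s v fun t => ψ (t, z t) := by
  have hs := h.s_pos.le
  have hmem : ∀ t ∈ Icc 0 s, (t, z t) ∈ Ioo (-δ) (s + δ) ×ˢ U := fun t ht =>
    ⟨h.Icc_subset ht, hRU (hz.mem t ht)⟩
  have hgraph : ContinuousOn (fun t => (t, z t)) (Icc 0 s) := continuousOn_id.prodMk hz.continuousOn
  have h0 : ψ (0, z 0) = γ 0 := by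
    have e := hz.eq 0 ⟨le_rfl, hs⟩
    rw [controlIntegral_zero_right, add_zero] at e
    rw [e]
    exact h.curve 0 ⟨le_rfl, hs⟩
  refine ⟨h0, h.tube.smooth.continuousOn.comp hgraph hmem, fun f hf t ht => ?_⟩
  have hc₁ := h₁.continuousOn_along hz.continuousOn hz.mem
  have hc₂ := h₂.continuousOn_along hz.continuousOn hz.mem
  have hφ : ContDiffOn ℝ 1 (fun p => f (ψ p)) (Ioo (-δ) (s + δ) ×ˢ U) := by
    intro p hp
    have e := ((hf _).of_le three_le_infty).comp p
      (h.tube.smooth.contMDiffAt ((isOpen_Ioo.prod h.isOpen).mem_nhds hp))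
    exact (e.contDiffAt.of_le (by norm_num)).contDiffWithinAt
  have hmain := hasAEDeriv_comp (isOpen_Ioo.prod h.isOpen) hφ hs hz.continuousOn
    (controlIntegrable hc₁ hc₂ ⟨hs, le_rfl⟩ v) (fun t ht => hz.eq t ht) hmem
  have hint := hmain.integral_eq ht
  rw [eq_comm, sub_eq_iff_eq_add', h0] at hint
  rw [hint]
  congr 1
  refine intervalIntegral.integral_congr fun τ hτ => ?_
  rw [uIcc_of_le ht.1] at hτ
  have hτ' : τ ∈ Icc 0 s := ⟨hτ.1, hτ.2.trans ht.2⟩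
  exact h.fderiv_comp hf (hmem τ hτ').1 (hmem τ hτ').2 _ _

/-- The second-order expansion of the endpoint map. -/
theorem IsEndTube.hasTaylorExpansion [I.Boundaryless] [FiniteDimensional ℝ E] [T2Space M]
    (hX₁ : ContMDiff I I.tangent ∞ fun x => (⟨x, X₁ x⟩ : TangentBundle I M))
    (hX₂ : ContMDiff I I.tangent ∞ fun x => (⟨x, X₂ x⟩ : TangentBundle I M))
    (h : IsEndTube I X₁ γ s δ U ψ) {L : L2 s × L2 s →L[ℝ] E}
    {B : L2 s × L2 s →L[ℝ] L2 s × L2 s →L[ℝ] E} {z₀ : E} (hz₀ : z₀ = extChartAt I (γ s) (γ s))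
    {f₁ f₂ : ℝ → E} (hf₁ : f₁ = fun t => pullField I ψ X₁ (t, z₀))
    (hf₂ : f₂ = fun t => pullField I ψ X₂ (t, z₀)) {D₁ D₂ : ℝ → E →L[ℝ] E}
    (hD₁ : D₁ = fun t => fderiv ℝ (fun z => pullField I ψ X₁ (t, z)) z₀)
    (hD₂ : D₂ = fun t => fderiv ℝ (fun z => pullField I ψ X₂ (t, z)) z₀)
    (hL : ∀ v, L v = controlIntegral v f₁ f₂ s)
    (hB : ∀ v v', B v v' =
      controlIntegral v (fun τ => D₁ τ (controlIntegral v' f₁ f₂ τ))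
        (fun τ => D₂ τ (controlIntegral v' f₁ f₂ τ)) s +
      controlIntegral v' (fun τ => D₁ τ (controlIntegral v f₁ f₂ τ))
        (fun τ => D₂ τ (controlIntegral v f₁ f₂ τ)) s) :
    endpointMap I X₁ X₂ (γ 0) s 0 = γ s ∧
      HasTaylorExpansion I (endpointMap I X₁ X₂ (γ 0) s) L B := by
  have := FiniteDimensional.complete ℝ E
  have hs := h.s_pos.le
  have hss : s ∈ Icc 0 s := ⟨hs, le_rfl⟩
  set e := extChartAt I (γ s) with he
  obtain ⟨R, hR, hRU⟩ := Metric.nhds_basis_closedBall.mem_iff.1 (h.isOpen.mem_nhds h.mem)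
  rw [← he, ← hz₀] at hRU
  have hu : ∀ Y : (x : M) → TangentSpace I x,
      ContMDiff I I.tangent ∞ (fun x => (⟨x, Y x⟩ : TangentBundle I M)) →
      IsUniformlyDifferentiable s R z₀ (pullField I ψ Y)
        (fun t => fderiv ℝ (fun z => pullField I ψ Y (t, z)) z₀) := fun Y hY =>
    isUniformlyDifferentiable_of_contDiffOn isOpen_Ioo h.isOpen
      ((h.tube.contDiffOn_pullField (n := 2) isOpen_Ioo h.isOpen hY).of_le (by norm_num))
      h.Icc_subset hR hRU
  have h₁ := hu X₁ hX₁
  have h₂ := hu X₂ hX₂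
  rw [← hD₁] at h₁
  rw [← hD₂] at h₂
  obtain ⟨K, hK, ρ, hρ, hsol⟩ := exists_controlledSolution hs h₁ h₂
  obtain ⟨c, hc, hmass⟩ := exists_mass_le hs
  set G := endpointMap I X₁ X₂ (γ 0) s with hG
  have hend : ∀ {v : L2 s × L2 s} {z : ℝ → E},
      IsControlledSolution R z₀ (pullField I ψ X₁) (pullField I ψ X₂) v z → G v = e.symm (z s) ∧
        e (G v) = z s := by
    intro v z hz
    have hzU : z s ∈ U := hRU (hz.mem s hss)
    have h3 : G v = e.symm (z s) := by
      rw [hz₀] at h₁ h₂ hz hRU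
      rw [hG, endpointMap_eq hs hX₁ hX₂ (h.isTrajectory hRU h₁ h₂ hz)]
      exact h.at_end _ hzU
    exact ⟨h3, by rw [h3]; exact e.right_inv (h.subset hzU)⟩
  have hsmall : ∀ ρ' > 0, ∀ᶠ v : L2 s × L2 s in 𝓝 0, mass v ≤ ρ' := by
    intro ρ' hρ'
    filter_upwards [Metric.ball_mem_nhds (0 : L2 s × L2 s) (div_pos hρ' hc)] with v hv
    rw [mem_ball_zero_iff, lt_div_iff₀ hc] at hv
    exact (hmass v).trans (by linarith)
  have hG0 : G 0 = γ s := by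
    have hm0 : mass (0 : L2 s × L2 s) = 0 :=
      le_antisymm (by simpa using hmass 0) (mass_nonneg hs _)
    obtain ⟨z, hz, hzK⟩ := hsol 0 (by rw [hm0]; exact hρ.le)
    have h3 := hzK s hss
    rw [hm0, mul_zero, norm_le_zero_iff, sub_eq_zero] at h3
    rw [(hend hz).1, h3, hz₀]
    exact e.left_inv (mem_extChartAt_source (γ s))
  refine ⟨hG0, ?_, fun v v' => by rw [hB, hB, add_comm], ?_⟩
  · have ht : Tendsto (fun v => e (G v)) (𝓝 0) (𝓝 z₀) := by
      rw [tendsto_iff_norm_sub_tendsto_zero]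
      refine squeeze_zero' (Eventually.of_forall fun _ => norm_nonneg _)
        (g := fun v => K * (c * ‖v‖)) ?_ ?_
      · filter_upwards [hsmall ρ hρ] with v hv
        obtain ⟨z, hz, hzK⟩ := hsol v hv
        rw [(hend hz).2]
        exact (hzK s hss).trans (mul_le_mul_of_nonneg_left (hmass v) hK)
      · have : Continuous fun v : L2 s × L2 s => K * (c * ‖v‖) := by fun_prop
        simpa using this.tendsto 0
    have hsymm : ContinuousAt e.symm z₀ := by
      rw [hz₀]; exact continuousAt_extChartAt_symm (γ s)
    have h3 : Tendsto (fun v => e.symm (e (G v))) (𝓝 0) (𝓝 (G 0)) := by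
      have h4 : e.symm z₀ = G 0 := by
        rw [hG0, hz₀]; exact e.left_inv (mem_extChartAt_source (γ s))
      rw [← h4]
      exact hsymm.tendsto.comp ht
    refine h3.congr' ?_
    filter_upwards [hsmall ρ hρ] with v hv
    obtain ⟨z, hz, -⟩ := hsol v hv
    rw [(hend hz).2, (hend hz).1]
  · rw [hG0, ← he, ← hz₀, isLittleO_iff]
    intro η hη
    -- Division by `c ^ 2` compensates for `mass v ≤ c * ‖v‖`.
    obtain ⟨ρ', hρ', hexp⟩ := controlledSolution_expansion hs h₁ h₂ hK
      (div_pos hη (pow_pos hc 2))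
    filter_upwards [hsmall ρ hρ, hsmall ρ' hρ'] with v hv hv'
    obtain ⟨z, hz, hzK⟩ := hsol v hv
    have h3 := hexp v z hv' hz hzK
    -- On the diagonal `B v v` is twice the integral in the expansion, which the Taylor factor 1/2
    -- cancels.
    rw [(hend hz).2, hL, hB, hf₁, hf₂, ← two_smul ℝ, smul_smul]
    norm_num
    refine h3.trans ?_
    have h4 : mass v ^ 2 ≤ c ^ 2 * ‖v‖ ^ 2 := by
      rw [← mul_pow]; exact pow_le_pow_left₀ (mass_nonneg hs v) (hmass v) 2
    calc η / c ^ 2 * mass v ^ 2 ≤ η / c ^ 2 * (c ^ 2 * ‖v‖ ^ 2) :=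
          mul_le_mul_of_nonneg_left h4 (by positivity)
      _ = η * ‖v‖ ^ 2 := by field_simp

end Endpoint

/-! ### Multiplication and primitives as operators on `L²` -/

section Operators

variable {s : ℝ} {f g : ℝ → ℝ}

theorem aestronglyMeasurable_of_continuousOn (hf : ContinuousOn f (Icc 0 s)) :
    AEStronglyMeasurable f ((volume : Measure ℝ).restrict (Icc 0 s)) :=
  hf.aestronglyMeasurable measurableSet_Icc

theorem memLp_of_continuousOn (hf : ContinuousOn f (Icc 0 s)) :
    MemLp f 2 ((volume : Measure ℝ).restrict (Icc 0 s)) := by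
  obtain ⟨K, hK⟩ := isCompact_Icc.exists_bound_of_continuousOn hf
  exact MemLp.of_bound (aestronglyMeasurable_of_continuousOn hf) K
    ((ae_restrict_iff' measurableSet_Icc).2 (Eventually.of_forall hK))

/-- A continuous function on `[0,s]` as an element of `L²`. -/
noncomputable def toL2 (f : ℝ → ℝ) (hf : ContinuousOn f (Icc 0 s)) : L2 s :=
  (memLp_of_continuousOn hf).toLp f

theorem coeFn_toL2 (hf : ContinuousOn f (Icc 0 s)) :
    toL2 f hf =ᵐ[(volume : Measure ℝ).restrict (Icc 0 s)] f :=
  (memLp_of_continuousOn hf).coeFn_toLp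

theorem integral_congr_L2 {F G : ℝ → ℝ} {t : ℝ} (ht : t ∈ Icc 0 s)
    (h : ∀ᵐ τ ∂((volume : Measure ℝ).restrict (Icc 0 s)), F τ = G τ) :
    ∫ τ in (0 : ℝ)..t, F τ = ∫ τ in (0 : ℝ)..t, G τ :=
  intervalIntegral.integral_congr_ae (ae_of_ae_restrict_Icc ht h)

theorem inner_eq_intervalIntegral (hs : 0 ≤ s) (u w : L2 s) :
    inner ℝ u w = ∫ t in (0 : ℝ)..s, u t * w t := by
  rw [L2.inner_def, intervalIntegral.integral_of_le hs, ← integral_Icc_eq_integral_Ioc]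
  refine integral_congr_ae (Eventually.of_forall fun t => ?_)
  simp [mul_comm]

theorem inner_toL2 (hs : 0 ≤ s) (hf : ContinuousOn f (Icc 0 s)) (w : L2 s) :
    inner ℝ (toL2 f hf) w = ∫ t in (0 : ℝ)..s, f t * w t := by
  rw [inner_eq_intervalIntegral hs]
  refine integral_congr_L2 ⟨hs, le_rfl⟩ ?_
  filter_upwards [coeFn_toL2 hf] with t ht
  rw [ht]

theorem intervalIntegrable_mul (hf : ContinuousOn f (Icc 0 s)) (w : L2 s) {t : ℝ}
    (ht : t ∈ Icc 0 s) : IntervalIntegrable (fun τ => f τ * w τ) volume 0 t :=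
  (L2.intervalIntegrable_left ht w).continuousOn_mul (hf.mono (by
    rw [uIcc_of_le ht.1]; exact Icc_subset_Icc_right ht.2))

theorem continuousOn_primitive (hs : 0 ≤ s) {F : ℝ → ℝ} (hF : IntervalIntegrable F volume 0 s) :
    ContinuousOn (fun t => ∫ τ in (0 : ℝ)..t, F τ) (Icc 0 s) := by
  have h := intervalIntegral.continuousOn_primitive_interval' hF left_mem_uIcc
  rwa [uIcc_of_le hs] at h

/-- Multiplication by a continuous function. -/
theorem exists_multiplication (hf : ContinuousOn f (Icc 0 s)) :
    ∃ T : L2 s →L[ℝ] L2 s, ∀ w,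
      ∀ᵐ t ∂((volume : Measure ℝ).restrict (Icc 0 s)), T w t = f t * w t := by
  obtain ⟨K, hK⟩ := isCompact_Icc.exists_bound_of_continuousOn hf
  have hle : ∀ w : L2 s, ∀ᵐ t ∂((volume : Measure ℝ).restrict (Icc 0 s)),
      ‖f t * w t‖ ≤ K * ‖w t‖ := by
    intro w
    rw [ae_restrict_iff' measurableSet_Icc]
    refine Eventually.of_forall fun t ht => ?_
    rw [norm_mul]
    exact mul_le_mul_of_nonneg_right (hK t ht) (norm_nonneg _)
  have hm : ∀ w : L2 s, MemLp (fun t => f t * w t) 2 ((volume : Measure ℝ).restrict (Icc 0 s)) :=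
    fun w => MemLp.of_le_mul (Lp.memLp w)
      ((aestronglyMeasurable_of_continuousOn hf).mul (Lp.aestronglyMeasurable w)) (hle w)
  refine ⟨LinearMap.mkContinuous
    { toFun := fun w => (hm w).toLp _
      map_add' := fun w w' => ?_
      map_smul' := fun r w => ?_ } K fun w => ?_, fun w => (hm w).coeFn_toLp⟩
  · refine Lp.ext ?_
    filter_upwards [(hm (w + w')).coeFn_toLp, (hm w).coeFn_toLp, (hm w').coeFn_toLp,
      Lp.coeFn_add w w', Lp.coeFn_add ((hm w).toLp _) ((hm w').toLp _)] with t h1 h2 h3 h4 h5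
    rw [h1, h5, h4, Pi.add_apply, Pi.add_apply, h2, h3, mul_add]
  · refine Lp.ext ?_
    filter_upwards [(hm (r • w)).coeFn_toLp, (hm w).coeFn_toLp,
      Lp.coeFn_smul r w, Lp.coeFn_smul r ((hm w).toLp _)] with t h1 h2 h4 h5
    rw [h1, RingHom.id_apply, h5, h4, Pi.smul_apply, Pi.smul_apply, h2, smul_eq_mul, smul_eq_mul]
    ring
  · refine Lp.norm_le_mul_norm_of_ae_le_mul ?_
    filter_upwards [(hm w).coeFn_toLp, hle w] with t h1 h2
    exact (congrArg norm h1).le.trans h2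

/-- The Volterra operator `w ↦ ∫₀ᵗ w`. -/
theorem exists_volterra (hs : 0 ≤ s) :
    ∃ T : L2 s →L[ℝ] L2 s, ∀ w,
      ∀ᵐ t ∂((volume : Measure ℝ).restrict (Icc 0 s)), T w t = ∫ τ in (0 : ℝ)..t, w τ := by
  have hm : ∀ w : L2 s, MemLp (fun t => ∫ τ in (0 : ℝ)..t, w τ) 2
      ((volume : Measure ℝ).restrict (Icc 0 s)) := fun w =>
    memLp_of_continuousOn (continuousOn_primitive hs (L2.intervalIntegrable hs w))
  set o := ‖Lp.const 2 ((volume : Measure ℝ).restrict (Icc 0 s)) (1 : ℝ)‖ with ho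
  refine ⟨LinearMap.mkContinuousOfExistsBound
    { toFun := fun w => (hm w).toLp _
      map_add' := fun w w' => ?_
      map_smul' := fun r w => ?_ } ?_, fun w => (hm w).coeFn_toLp⟩
  · refine Lp.ext ?_
    filter_upwards [(hm (w + w')).coeFn_toLp, (hm w).coeFn_toLp, (hm w').coeFn_toLp,
      Lp.coeFn_add ((hm w).toLp _) ((hm w').toLp _), ae_restrict_mem measurableSet_Icc]
      with t h1 h2 h3 h5 ht
    rw [h1, h5, Pi.add_apply, h2, h3, ← intervalIntegral.integral_add
      (L2.intervalIntegrable_left ht w) (L2.intervalIntegrable_left ht w')]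
    exact integral_congr_L2 ht (Lp.coeFn_add w w')
  · refine Lp.ext ?_
    filter_upwards [(hm (r • w)).coeFn_toLp, (hm w).coeFn_toLp,
      Lp.coeFn_smul r ((hm w).toLp _), ae_restrict_mem measurableSet_Icc] with t h1 h2 h5 ht
    rw [h1, RingHom.id_apply, h5, Pi.smul_apply, h2, ← intervalIntegral.integral_smul]
    exact integral_congr_L2 ht (Lp.coeFn_smul r w)
  · refine ⟨(((volume : Measure ℝ).restrict (Icc 0 s)) univ).toReal ^ (2 : ENNReal).toReal⁻¹ * o,
      fun w => ?_⟩
    rw [mul_assoc]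
    refine Lp.norm_le_of_ae_bound (by positivity) ?_
    filter_upwards [(hm w).coeFn_toLp, ae_restrict_mem measurableSet_Icc] with t h1 ht
    refine (congrArg norm h1).le.trans ?_
    refine (intervalIntegral.norm_integral_le_integral_norm ht.1).trans ?_
    refine le_trans ?_ (integral_abs_le hs w)
    exact intervalIntegral.integral_mono_interval le_rfl ht.1 ht.2
      (Eventually.of_forall fun τ => abs_nonneg _) (L2.intervalIntegrable hs w).abs

/-- A square integrable function with vanishing primitive vanishes. -/
theorem eq_zero_of_primitive_eq_zero (hs : 0 ≤ s) {h : L2 s}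
    (hh : ∀ t ∈ Icc 0 s, ∫ τ in (0 : ℝ)..t, h τ = 0) : h = 0 := by
  refine Lp.ext ?_
  have h1 := (hasAEDeriv_integral hs (L2.intervalIntegrable hs h)).deriv
  rw [Filter.EventuallyEq, ae_restrict_iff' measurableSet_Icc]
  filter_upwards [h1, ae_ne_pair 0 s, (ae_restrict_iff' measurableSet_Icc).1
    (Lp.coeFn_zero ℝ 2 ((volume : Measure ℝ).restrict (Icc 0 s)))] with t h2 h3 h4 ht
  have ht' : t ∈ Ioo 0 s := ⟨lt_of_le_of_ne ht.1 (Ne.symm h3.1), lt_of_le_of_ne ht.2 h3.2⟩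
  rw [h4 ht, Pi.zero_apply]
  refine (h2 ht').unique ((hasDerivAt_const t (0 : ℝ)).congr_of_eventuallyEq ?_)
  filter_upwards [isOpen_Ioo.mem_nhds ht'] with τ hτ using hh τ (Ioo_subset_Icc_self hτ)

theorem eqOn_zero_of_integral_sq (hs : 0 < s) {k : ℝ → ℝ} (hk : ContinuousOn k (Icc 0 s))
    (h : ∫ t in (0 : ℝ)..s, k t * k t = 0) : ∀ t ∈ Icc 0 s, k t = 0 := by
  have h1 : toL2 k hk = 0 := by
    rw [← inner_self_eq_zero (𝕜 := ℝ), inner_toL2 hs.le]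
    refine Eq.trans ?_ h
    refine integral_congr_L2 ⟨hs.le, le_rfl⟩ ?_
    filter_upwards [coeFn_toL2 hk] with t ht
    rw [ht]
  have h2 : k =ᵐ[(volume : Measure ℝ).restrict (Icc 0 s)] fun _ => 0 := by
    refine (coeFn_toL2 hk).symm.trans ?_
    rw [h1]
    exact Lp.coeFn_zero ..
  exact Measure.eqOn_Icc_of_ae_eq _ hs.ne h2 hk continuousOn_const

/-- The embedding of the controls in their completion has dense range. -/
theorem exists_denseRange_represents (hs : 0 < s) :
    ∃ j : L2 s × L2 s →L[ℝ] CompletedControl s, (∀ v z, Represents v z ↔ z = j v) ∧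
      DenseRange j := by
  obtain ⟨V, hV⟩ := exists_volterra hs.le
  obtain ⟨m, hm⟩ : ∃ m : L2 s →L[ℝ] ℝ, ∀ u, m u = ∫ t in (0 : ℝ)..s, u t :=
    ⟨innerSL ℝ (toL2 (fun _ => 1) continuousOn_const), fun u => by
      rw [innerSL_apply_apply, inner_toL2 hs.le]; simp⟩
  let π₂ := ContinuousLinearMap.snd ℝ (L2 s) (L2 s)
  refine ⟨(ContinuousLinearMap.fst ℝ (L2 s) (L2 s)).prod ((m.comp π₂).prod (V.comp π₂)),
    fun v z => ?_, ?_⟩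
  · constructor
    · rintro ⟨h1, h2, h3⟩
      refine Prod.ext h1 (Prod.ext (h2.trans (hm _).symm) (Lp.ext ?_))
      filter_upwards [h3, hV v.2] with t h4 h5 using h4.trans h5.symm
    · rintro rfl
      exact ⟨rfl, hm _, hV v.2⟩
  -- The first component of the embedding is the identity, so only `u ↦ (∫ u, V u)` matters. A
  -- functional separating a point from the closure of its range is bounded above on a subspace,
  -- hence vanishes there.
  · have key : DenseRange (m.prod V) := by
      let R : Submodule ℝ (ℝ × L2 s) := (LinearMap.range (m.prod V).toLinearMap).topologicalClosure
      intro x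
      by_contra hx
      obtain ⟨φ, r, h1, h2⟩ := geometric_hahn_banach_closed_point (s := (R : Set (ℝ × L2 s)))
        (x := x) R.convex (Submodule.isClosed_topologicalClosure _) hx
      have h3 : ∀ u, φ (m u, V u) = 0 := by
        intro u
        by_contra hne
        have h4 : ∀ c : ℝ, (c • (m u, V u) : ℝ × L2 s) ∈ R := fun c =>
          R.smul_mem c (Submodule.le_topologicalClosure _ ⟨u, rfl⟩)
        have h5 := h1 _ (h4 (r / φ (m u, V u)))
        rw [map_smul, smul_eq_mul, div_mul_cancel₀ _ hne] at h5
        exact lt_irrefl _ h5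
      obtain ⟨α, hα⟩ : ∃ α : ℝ, φ (1, 0) = α := ⟨_, rfl⟩
      obtain ⟨h, hh⟩ : ∃ h : L2 s, ∀ w, φ (0, w) = inner ℝ h w :=
        ⟨(InnerProductSpace.toDual ℝ (L2 s)).symm (φ.comp (ContinuousLinearMap.inr ℝ ℝ (L2 s))),
          fun w => by simp⟩
      have hφ : ∀ p : ℝ × L2 s, φ p = p.1 * α + inner ℝ h p.2 := by
        intro p
        rw [← hh, ← hα, ← smul_eq_mul, ← map_smul, ← map_add]
        simp
      set N : ℝ → ℝ := fun t => ∫ τ in (0 : ℝ)..t, h τ with hN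
      have hNd := hasAEDeriv_integral hs.le (L2.intervalIntegrable hs.le h)
      have hNc : ContinuousOn N (Icc 0 s) :=
        continuousOn_primitive hs.le (L2.intervalIntegrable hs.le h)
      -- With φ(c, w) = α c + ⟨h, w⟩ and N = ∫ h, integration by parts rewrites φ(∫ u, V u) = 0 as ∫
      -- k u = 0 for all u. So k ≡ 0: its value at s gives α = 0, its value at 0 gives N(s) = 0, and
      -- then N ≡ 0 and h = 0.
      set k : ℝ → ℝ := fun t => α + N s - N t with hk
      have hkc : ContinuousOn k (Icc 0 s) := continuousOn_const.sub hNc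
      have hss : s ∈ Icc 0 s := ⟨hs.le, le_rfl⟩
      have hint : ∀ u : L2 s, ∫ t in (0 : ℝ)..s, k t * u t = 0 := by
        intro u
        have e1 := h3 u
        rw [hφ, hm, inner_eq_intervalIntegral hs.le] at e1
        simp only at e1
        have e2 : ∫ t in (0 : ℝ)..s, h t * V u t =
            ∫ t in (0 : ℝ)..s, (∫ τ in (0 : ℝ)..t, u τ) * h t := by
          refine integral_congr_L2 hss ?_
          filter_upwards [hV u] with t ht
          rw [ht, mul_comm]
        have hU := hasAEDeriv_integral hs.le (L2.intervalIntegrable hs.le u)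
        have e3 := (hNd.mul hU).integral_eq hss
        have hUc := continuousOn_primitive hs.le (L2.intervalIntegrable hs.le u)
        have i1 := intervalIntegrable_mul hUc h hss
        have i2 := intervalIntegrable_mul hNc u hss
        have e4 : ∫ t in (0 : ℝ)..s, (h t * (∫ τ in (0 : ℝ)..t, u τ) + N t * u t) =
            (∫ t in (0 : ℝ)..s, (∫ τ in (0 : ℝ)..t, u τ) * h t) + ∫ t in (0 : ℝ)..s, N t * u t := by
          rw [← intervalIntegral.integral_add i1 i2]
          exact intervalIntegral.integral_congr fun t _ => by ring
        rw [e2] at e1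
        have e5 : ∫ t in (0 : ℝ)..s, k t * u t =
            (α + N s) * (∫ t in (0 : ℝ)..s, u t) - ∫ t in (0 : ℝ)..s, N t * u t := by
          rw [← intervalIntegral.integral_const_mul, ← intervalIntegral.integral_sub
            ((L2.intervalIntegrable hs.le u).const_mul _) i2]
          exact intervalIntegral.integral_congr fun t _ => by simp only [hk]; ring
        have e6 : N s * (∫ τ in (0 : ℝ)..s, u τ) - N 0 * (∫ τ in (0 : ℝ)..0, u τ) =
          N s * (∫ τ in (0 : ℝ)..s, u τ) := by simp
        rw [e5]
        have e7 := e4.symm.trans (e3.trans e6)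
        linarith
      have hk0 := eqOn_zero_of_integral_sq hs hkc (by
        refine Eq.trans ?_ (hint (toL2 k hkc))
        refine integral_congr_L2 hss ?_
        filter_upwards [coeFn_toL2 hkc] with t ht
        rw [ht])
      have hN0 : N 0 = 0 := by simp [hN]
      have hα0 : α = 0 := by have := hk0 s hss; simp only [hk] at this; linarith
      have hNs : N s = 0 := by
        have := hk0 0 ⟨le_rfl, hs.le⟩; simp only [hk] at this; linarith
      have hh0 : h = 0 := eq_zero_of_primitive_eq_zero hs.le fun t ht => by
        have := hk0 t ht
        simp only [hk] at this
        show N t = 0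
        linarith
      have h6 : ∀ p, φ p = 0 := fun p => by rw [hφ, hα0, hh0]; simp
      have h7 := h1 0 R.zero_mem
      rw [h6] at h7 h2
      exact lt_irrefl _ (h7.trans h2)
    have h8 := Function.surjective_id.denseRange (X := L2 s) |>.prodMap key
    exact h8

end Operators

/-! ### Uniqueness of Taylor expansions -/

section Taylor

variable {V E : Type*} [NormedAddCommGroup V] [NormedSpace ℝ V] [NormedAddCommGroup E]
  [NormedSpace ℝ E]

/-- Restrict to a line t v. Adding the estimates at t and −t cancels the linear term and shows that
the quadratic one vanishes; the linear term is then o(t). -/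
theorem eq_zero_of_quadratic_isLittleO {L : V →L[ℝ] E} {B : V →L[ℝ] V →L[ℝ] E}
    (h : (fun v => L v + (1 / 2 : ℝ) • B v v) =o[𝓝 0] fun v => ‖v‖ ^ 2) :
    L = 0 ∧ ∀ v, B v v = 0 := by
  have key : ∀ v, ∀ η > 0, ∀ᶠ t : ℝ in 𝓝 0,
      ‖t • L v + t ^ 2 • (1 / 2 : ℝ) • B v v‖ ≤ η * ‖v‖ ^ 2 * t ^ 2 := by
    intro v η hη
    have hc : Tendsto (fun t : ℝ => t • v) (𝓝 0) (𝓝 0) := by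
      have : Continuous fun t : ℝ => t • v := by fun_prop
      simpa using this.tendsto 0
    filter_upwards [hc.eventually ((isLittleO_iff.1 h) hη)] with t ht
    have e : L (t • v) + (1 / 2 : ℝ) • B (t • v) (t • v) =
        t • L v + t ^ 2 • (1 / 2 : ℝ) • B v v := by
      simp only [map_smul, _root_.smul_apply]
      module
    rw [e, norm_pow, norm_norm, norm_smul, mul_pow, Real.norm_eq_abs, sq_abs] at ht
    linarith
  have hne : ∀ {p : ℝ → Prop}, (∀ᶠ t in 𝓝 0, p t) → ∃ t, t ≠ 0 ∧ p t := fun hp =>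
    (Filter.Eventually.and (self_mem_nhdsWithin (a := (0 : ℝ)) (s := {(0 : ℝ)}ᶜ))
      (hp.filter_mono nhdsWithin_le_nhds)).exists
  have hB : ∀ v, (1 / 2 : ℝ) • B v v = 0 := by
    intro v
    obtain ⟨y, hy⟩ : ∃ y, y = (1 / 2 : ℝ) • B v v := ⟨_, rfl⟩
    rw [← hy]
    have hk := key v
    rw [← hy] at hk
    have hlim : Tendsto (fun η : ℝ => η * ‖v‖ ^ 2) (𝓝[>] 0) (𝓝 0) := by
      have : Continuous fun η : ℝ => η * ‖v‖ ^ 2 := by fun_prop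
      simpa using (this.tendsto 0).mono_left nhdsWithin_le_nhds
    refine norm_le_zero_iff.1 (ge_of_tendsto hlim ?_)
    filter_upwards [self_mem_nhdsWithin] with η hη
    have hneg : Tendsto (fun t : ℝ => -t) (𝓝 0) (𝓝 0) := by simpa using (continuous_neg.tendsto (0 : ℝ))
    obtain ⟨t, ht0, h1, h2⟩ := hne ((hk η hη).and (hneg.eventually (hk η hη)))
    have e : (2 * t ^ 2) • y = (t • L v + t ^ 2 • y) + (-t • L v + (-t) ^ 2 • y) := by module
    have h3 := (norm_add_le (t • L v + t ^ 2 • y) (-t • L v + (-t) ^ 2 • y)).trans (add_le_add h1 h2)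
    rw [← e, norm_smul, Real.norm_of_nonneg (by positivity)] at h3
    have ht2 : 0 < t ^ 2 := by positivity
    rw [neg_sq] at h3
    refine le_of_mul_le_mul_left ?_ ht2
    linarith
  refine ⟨ContinuousLinearMap.ext fun v => ?_, fun v => (smul_eq_zero.1 (hB v)).resolve_left
    (by norm_num)⟩
  have hk := key v 1 one_pos
  simp only [hB, smul_zero, add_zero] at hk
  have hlim : Tendsto (fun t : ℝ => ‖v‖ ^ 2 * |t|) (𝓝[≠] 0) (𝓝 0) := by
    have : Continuous fun t : ℝ => ‖v‖ ^ 2 * |t| := by fun_prop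
    simpa using (this.tendsto 0).mono_left nhdsWithin_le_nhds
  refine norm_le_zero_iff.1 (ge_of_tendsto hlim ?_)
  filter_upwards [self_mem_nhdsWithin, hk.filter_mono nhdsWithin_le_nhds] with t ht0 ht
  have ht' : 0 < |t| := abs_pos.2 ht0
  rw [norm_smul, Real.norm_eq_abs, ← sq_abs t] at ht
  refine le_of_mul_le_mul_left ?_ ht'
  linarith

variable {H : Type*} [TopologicalSpace H] {I : ModelWithCorners ℝ E H}
  {M : Type*} [TopologicalSpace M] [ChartedSpace H M] {G : V → M} {L L' : V →L[ℝ] E}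
  {B B' : V →L[ℝ] V →L[ℝ] E}

/-- The difference of two expansions is a negligible polynomial of degree two; the symmetry built
into the structure lets the second derivatives be recovered by polarization. -/
theorem HasTaylorExpansion.unique (h : HasTaylorExpansion I G L B)
    (h' : HasTaylorExpansion I G L' B') : L = L' ∧ ∀ v v', B v v' = B' v v' := by
  have hd := (h'.expansion.sub h.expansion).congr_left
    (f₂ := fun v => (L - L') v + (1 / 2 : ℝ) • (B - B') v v) fun v => by
      simp only [_root_.sub_apply, smul_sub]; abel
  obtain ⟨h1, h2⟩ := eq_zero_of_quadratic_isLittleO hd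
  refine ⟨sub_eq_zero.1 h1, fun v v' => sub_eq_zero.1 ?_⟩
  have h3 := h2 (v + v')
  have h4 := h2 v
  have h5 := h2 v'
  simp only [_root_.sub_apply, map_add, _root_.add_apply] at h3 h4 h5
  have h6 := h.symm v v'
  have h7 := h'.symm v v'
  have h8 : (2 : ℝ) • (B v v' - B' v v') = 0 := by
    rw [← h3, two_smul]
    nth_rewrite 2 [h6, h7]
    rw [sub_eq_zero] at h4 h5
    rw [h4, h5]
    abel
  exact (smul_eq_zero.1 h8).resolve_left two_ne_zero

/-- The quadratic term is o(‖v‖). This identifies the `mfderiv` in the definition of strict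
singularity with the first variation. -/
theorem HasTaylorExpansion.hasMFDerivAt (h : HasTaylorExpansion I G L B) :
    HasMFDerivAt 𝓘(ℝ, V) I G 0 L := by
  refine ⟨h.continuousAt, ?_⟩
  have hq : (fun v => (1 / 2 : ℝ) • B v v) =O[𝓝 0] fun v => ‖v‖ ^ 2 := by
    refine IsBigO.of_bound (1 / 2 * ‖B‖) (Eventually.of_forall fun v => ?_)
    rw [norm_smul, Real.norm_of_nonneg (by norm_num), Real.norm_of_nonneg (by positivity), mul_assoc,
      sq, ← mul_assoc ‖B‖]
    exact mul_le_mul_of_nonneg_left (B.le_opNorm₂ v v) (by norm_num)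
  have h2 : (fun v : V => ‖v‖ ^ 2) =o[𝓝 0] fun v => v := by
    have := (isLittleO_norm_pow_id (E' := V) (n := 2) (by norm_num))
    exact this
  have h3 := ((h.expansion.isBigO.add hq).trans_isLittleO h2)
  have h4 : HasFDerivAt (fun v => extChartAt I (G 0) (G v)) L 0 := by
    rw [hasFDerivAt_iff_isLittleO]
    refine (h3.congr_left fun v => ?_).congr_right fun v => (sub_zero v).symm
    rw [sub_zero]
    abel
  have h5 := h4.hasFDerivWithinAt (s := range 𝓘(ℝ, V))
  exact h5

end Taylor

/-! ### Conjugate points through a form on the completed space -/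

section Conjugate

variable {E : Type*} [NormedAddCommGroup E] [NormedSpace ℝ E] {s : ℝ}

/-- A continuous map that projects onto the kernel of `D` and preserves the range of `j`, which is
dense. -/
theorem exists_projection_ker [FiniteDimensional ℝ E] {Z V : Type*} [NormedAddCommGroup Z]
    [NormedSpace ℝ Z] [NormedAddCommGroup V] [NormedSpace ℝ V] {j : V →L[ℝ] Z} (hj : DenseRange j)
    (D : Z →L[ℝ] E) :
    ∃ Φ : Z →L[ℝ] Z, (∀ z, D (Φ z) = 0) ∧ (∀ z, D z = 0 → Φ z = z) ∧
      ∀ v, ∃ v', Φ (j v) = j v' := by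
  set f : V →ₗ[ℝ] E := (D.comp j).toLinearMap with hf
  -- The section takes values in `V`, so the correction subtracted from the identity stays in the
  -- range of `j`. The range of `D ∘ j` is finite-dimensional, hence closed, and by density it
  -- contains the values of `D`.
  obtain ⟨σ, hσ⟩ := f.rangeRestrict.exists_rightInverse_of_surjective f.range_rangeRestrict
  have hmem : ∀ z, D z ∈ LinearMap.range f := by
    have hcl : IsClosed {z | D z ∈ LinearMap.range f} :=
      (Submodule.closed_of_finiteDimensional (LinearMap.range f)).preimage D.continuous
    intro z
    exact hj.induction_on (p := fun z => D z ∈ LinearMap.range f) z hcl fun v => ⟨v, rfl⟩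
  set Dr : Z →L[ℝ] LinearMap.range f := D.codRestrict (LinearMap.range f) hmem with hDr
  refine ⟨ContinuousLinearMap.id ℝ Z - j.comp ((LinearMap.toContinuousLinearMap σ).comp Dr),
    fun z => ?_, fun z hz => ?_, fun v => ⟨v - σ (Dr (j v)), ?_⟩⟩
  · have h1 := congrArg Subtype.val (LinearMap.congr_fun hσ (Dr z))
    have h2 : D (j (σ (Dr z))) = D z := h1
    simp [h2]
  · have h1 : Dr z = 0 := Subtype.ext hz
    simp [h1]
  · simp

variable {H : Type*} [TopologicalSpace H] {I : ModelWithCorners ℝ E H}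
  {M : Type*} [TopologicalSpace M] [ChartedSpace H M] {G : L2 s × L2 s → M}
  {L : L2 s × L2 s →L[ℝ] E} {B : L2 s × L2 s →L[ℝ] L2 s × L2 s →L[ℝ] E}
  {D : CompletedControl s →L[ℝ] E}
  {q : CompletedControl s →L[ℝ] CompletedControl s →L[ℝ] ℝ}

/-- `IsConjugate` asks for the existence of its data, but they are rigid: `L` and `B` by uniqueness
of Taylor expansions, `D` by density of the controls, `Q` by its values on represented elements of
the kernel. The covector enters only through the nonzero factor `κ`, which does not change the
kernel of the form. -/
theorem isConjugate_iff_form [FiniteDimensional ℝ E] (hs : 0 < s) (hT : HasTaylorExpansion I G L B)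
    (hD : ∀ v z, Represents v z → D z = L v)
    (hq : ∀ ξ : E →L[ℝ] ℝ, ξ ≠ 0 → (∀ v, ξ (L v) = 0) → ∃ κ : ℝ, κ ≠ 0 ∧
      ∀ v v' z z', Represents v z → Represents v' z' → D z = 0 → D z' = 0 →
        ξ (B v v') = κ * q z z')
    (hξ : ∃ ξ : E →L[ℝ] ℝ, ξ ≠ 0 ∧ ∀ v, ξ (L v) = 0) :
    IsConjugate I G ↔ meanZero s ⊂ {z | D z = 0 ∧ ∀ y, D y = 0 → q z y = 0} := by
  obtain ⟨j, hj, hjd⟩ := exists_denseRange_represents hs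
  have hjr : ∀ v, Represents v (j v) := fun v => (hj v _).2 rfl
  constructor
  · rintro ⟨L', B', D', ξ, Q, hT', hD', hξ0, hξL, hQ, hsub⟩
    obtain ⟨rfl, hBB⟩ := hT'.unique hT
    have hDD : D' = D := by
      refine DFunLike.coe_injective (hjd.equalizer D'.continuous D.continuous (funext fun v => ?_))
      exact (hD' v _ (hjr v)).trans (hD v _ (hjr v)).symm
    subst hDD
    obtain ⟨κ, hκ, hκq⟩ := hq ξ hξ0 hξL
    obtain ⟨Φ, hΦ0, hΦ1, hΦj⟩ := exists_projection_ker hjd D'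
    -- Density of the controls in the completed space does not at once give density in `ker D'`. The
    -- projection `Φ` maps controls to controls, so both forms composed with it can be compared on
    -- the whole space.
    have hQq : ∀ z z' : D'.ker, Q z z' = κ * q z z' := by
      set P : CompletedControl s →L[ℝ] D'.ker := Φ.codRestrict D'.ker hΦ0 with hP
      have hPz : ∀ z : D'.ker, P z = z := fun z => Subtype.ext (hΦ1 z z.2)
      have hc : Continuous fun p : CompletedControl s × CompletedControl s =>
          Q (P p.1) (P p.2) := by
        exact (Q.continuous.comp (P.continuous.comp continuous_fst)).clm_apply
          (P.continuous.comp continuous_snd)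
      have hc' : Continuous fun p : CompletedControl s × CompletedControl s =>
          κ * q (Φ p.1) (Φ p.2) := by
        exact continuous_const.mul ((q.continuous.comp (Φ.continuous.comp continuous_fst)).clm_apply
          (Φ.continuous.comp continuous_snd))
      have he := (hjd.prodMap hjd).equalizer hc hc' (funext fun p => by
        obtain ⟨v, hv⟩ := hΦj p.1
        obtain ⟨v', hv'⟩ := hΦj p.2
        have r1 : Represents v (P (j p.1)).1 := (hj _ _).2 hv
        have r2 : Represents v' (P (j p.2)).1 := (hj _ _).2 hv'
        have e1 := hQ v v' (P (j p.1)) (P (j p.2)) r1 r2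
        have e2 := hκq v v' _ _ r1 r2 (hΦ0 _) (hΦ0 _)
        rw [← hBB] at e2
        exact e1.trans e2)
      intro z z'
      have h1 := congrFun he (z.1, z'.1)
      simp only at h1
      rwa [hPz, hPz, hΦ1 z z.2, hΦ1 z' z'.2] at h1
    convert hsub using 1
    ext z
    constructor
    · rintro ⟨hz, h⟩
      exact ⟨hz, fun y => by rw [hQq, h y y.2, mul_zero]⟩
    · rintro ⟨hz, h⟩
      refine ⟨hz, fun y hy => ?_⟩
      have h1 := h ⟨y, hy⟩
      rw [hQq] at h1
      exact (mul_eq_zero.1 h1).resolve_left hκ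
  · intro hsub
    obtain ⟨ξ, hξ0, hξL⟩ := hξ
    obtain ⟨κ, hκ, hκq⟩ := hq ξ hξ0 hξL
    refine ⟨L, B, D, ξ, κ • q.bilinearComp D.ker.subtypeL D.ker.subtypeL, hT, hD, hξ0, hξL,
      fun v v' z z' hz hz' => (hκq v v' z z' hz hz' z.2 z'.2).symm, ?_⟩
    convert hsub using 1
    ext z
    constructor
    · rintro ⟨hz, h⟩
      refine ⟨hz, fun y hy => ?_⟩
      exact (mul_eq_zero.1 (h ⟨y, hy⟩)).resolve_left hκ
    · rintro ⟨hz, h⟩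
      exact ⟨hz, fun y => by
        show κ * q z y = 0
        rw [h y y.2, mul_zero]⟩

/-- The conjugate point condition as an equation for the third component. -/
theorem meanZero_ssubset_iff (hs : 0 < s) {T : L2 s →L[ℝ] L2 s} {φ ψ : L2 s →L[ℝ] ℝ}
    {W : Submodule ℝ (L2 s)}
    (hD : ∀ z, D z = 0 ↔ ∫ t in (0 : ℝ)..s, z.1 t = φ z.2.2 ∧ z.2.1 = ψ z.2.2 ∧ z.2.2 ∈ W)
    (hq : ∀ z z', q z z' = inner ℝ (T z.2.2) z'.2.2) :
    meanZero s ⊂ {z | D z = 0 ∧ ∀ y, D y = 0 → q z y = 0} ↔ ∃ w ∈ W, w ≠ 0 ∧ T w ∈ Wᗮ := by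
  have hlift : ∀ w ∈ W, ∃ z : CompletedControl s, D z = 0 ∧ z.2.2 = w := by
    intro w hw
    -- Only the mean of the first component is prescribed, so a constant realizes it.
    refine ⟨((φ w / s) • toL2 (fun _ => 1) continuousOn_const, ψ w, w), (hD _).2 ⟨?_, rfl, hw⟩, rfl⟩
    have h1 : ∫ t in (0 : ℝ)..s, ((φ w / s) • toL2 (s := s) (fun _ => 1) continuousOn_const) t =
        ∫ t in (0 : ℝ)..s, φ w / s := by
      refine integral_congr_L2 ⟨hs.le, le_rfl⟩ ?_
      filter_upwards [Lp.coeFn_smul (φ w / s) (toL2 (s := s) (fun _ => 1) continuousOn_const),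
        coeFn_toL2 (s := s) (f := fun _ => 1) continuousOn_const] with t h1 h2
      rw [h1, Pi.smul_apply, h2, smul_eq_mul, mul_one]
    rw [h1, intervalIntegral.integral_const, smul_eq_mul, sub_zero]
    field_simp
  have hsub : meanZero s ⊆ {z | D z = 0 ∧ ∀ y, D y = 0 → q z y = 0} := by
    rintro z ⟨h1, h2, h3⟩
    refine ⟨(hD z).2 ⟨?_, ?_, ?_⟩, fun y _ => ?_⟩
    · rw [h3, map_zero]; exact h1
    · rw [h3, map_zero]; exact h2
    · rw [h3]; exact W.zero_mem
    · rw [hq, h3, map_zero, inner_zero_left]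
  constructor
  · intro h
    obtain ⟨z, ⟨hz, hzq⟩, hzm⟩ := exists_of_ssubset h
    obtain ⟨h1, h2, h3⟩ := (hD z).1 hz
    refine ⟨z.2.2, h3, fun h0 => hzm ⟨?_, ?_, h0⟩, ?_⟩
    · rw [h1, h0, map_zero]
    · rw [h2, h0, map_zero]
    · rw [Submodule.mem_orthogonal']
      intro w hw
      obtain ⟨y, hy, rfl⟩ := hlift w hw
      rw [← hq]
      exact hzq y hy
  · rintro ⟨w, hw, hw0, hT⟩
    obtain ⟨z, hz, rfl⟩ := hlift w hw
    refine (ssubset_iff_of_subset hsub).2 ⟨z, ⟨hz, fun y hy => ?_⟩, fun hm => hw0 hm.2.2⟩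
    rw [hq]
    exact (Submodule.mem_orthogonal' _ _).1 hT _ ((hD y).1 hy).2.2

end Conjugate

/-! ### The kernel of the second variation -/

section Kernel

variable {s : ℝ} {β α₀ α₁ A B C a b c e : ℝ → ℝ}

/-- Extending `f` by constants beyond the ends gives two-sided derivatives at 0 and `s` as well. -/
theorem exists_antiderivative (hs : 0 ≤ s) {f : ℝ → ℝ} (hf : ContinuousOn f (Icc 0 s)) :
    ∃ F : ℝ → ℝ, ∀ t ∈ Icc 0 s, HasDerivAt F (f t) t ∧ F t = ∫ τ in (0 : ℝ)..t, f τ := by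
  have hext : ∀ t ∈ Icc 0 s, IccExtend hs (domRestrict (Icc 0 s) f) t = f t := fun t ht =>
    IccExtend_of_mem hs _ ht
  have hc : Continuous (IccExtend hs (domRestrict (Icc 0 s) f)) := hf.domRestrict.Icc_extend'
  refine ⟨fun t => ∫ τ in (0 : ℝ)..t, IccExtend hs (domRestrict (Icc 0 s) f) τ, fun t ht => ⟨?_, ?_⟩⟩
  · rw [← hext t ht]
    exact (hc.integral_hasStrictDerivAt 0 t).hasDerivAt
  · refine intervalIntegral.integral_congr fun τ hτ => ?_
    rw [uIcc_of_le ht.1] at hτ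
    exact hext τ ⟨hτ.1, hτ.2.trans ht.2⟩

theorem continuousOn_of_hasDerivAt {F f : ℝ → ℝ} (h : ∀ t ∈ Icc 0 s, HasDerivAt F (f t) t) :
    ContinuousOn F (Icc 0 s) := fun t ht => (h t ht).continuousAt.continuousWithinAt

theorem hasAEDeriv_const (hs : 0 ≤ s) (r : ℝ) : HasAEDeriv (fun _ => r) (fun _ => 0) s :=
  hasAEDeriv_of_hasDerivAt hs continuousOn_const fun t _ => hasDerivAt_const t r

/-- The Wronskian `b C - c B`. -/
def wronskian (B C b c : ℝ → ℝ) (t : ℝ) : ℝ := b t * C t - c t * B t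

variable (h : IsJacobi s β α₀ α₁ A B C a b c) (hs : 0 < s)
  (he : ∀ t ∈ Icc 0 s, HasDerivAt e (-α₁ t * e t) t) (he₀ : ∀ t, e t ≠ 0)

include h

theorem IsJacobi.continuousOn_wronskian : ContinuousOn (wronskian B C b c) (Icc 0 s) :=
  ((continuousOn_of_hasDerivAt h.deriv_b).mul (continuousOn_of_hasDerivAt h.deriv_C)).sub
    ((continuousOn_of_hasDerivAt h.deriv_c).mul (continuousOn_of_hasDerivAt h.deriv_B))

theorem IsJacobi.hasDerivAt_wronskian {t : ℝ} (ht : t ∈ Icc 0 s) :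
    HasDerivAt (wronskian B C b c) (α₁ t * wronskian B C b c t) t := by
  refine (((h.deriv_b t ht).mul (h.deriv_C t ht)).sub
    ((h.deriv_c t ht).mul (h.deriv_B t ht))).congr_deriv ?_
  rw [wronskian]
  ring

include hs he in
-- The Wronskian grows at rate α₁ and `e` decays at the same rate, so the product is constant; at
-- `s` the Wronskian is −1.
theorem IsJacobi.wronskian_mul {t : ℝ} (ht : t ∈ Icc 0 s) :
    wronskian B C b c t * e t = -e s := by
  have hd : ∀ t ∈ Icc 0 s, HasDerivAt (fun t => wronskian B C b c t * e t) 0 t := fun t ht =>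
    ((h.hasDerivAt_wronskian ht).mul (he t ht)).congr_deriv (by ring)
  have hc := constant_of_has_deriv_right_zero (continuousOn_of_hasDerivAt (f := fun _ => 0) hd)
    fun t ht => (hd t (Ico_subset_Icc_self ht)).hasDerivWithinAt
  have h1 := hc t ht
  have h2 := hc s ⟨hs.le, le_rfl⟩
  rw [h1, ← h2]
  simp [wronskian, h.b_end, h.c_end, h.B_end]

include hs in
/-- The operator of the second variation in the variable `w = ∫₀ᵗ v₂`. -/
theorem IsJacobi.exists_operator : ∃ T : L2 s →L[ℝ] L2 s, ∀ w,
    ∀ᵐ t ∂((volume : Measure ℝ).restrict (Icc 0 s)), T w t = wronskian B C b c t * w t +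
      c t * (∫ τ in (0 : ℝ)..t, b τ * w τ) - b t * ∫ τ in (0 : ℝ)..t, c τ * w τ := by
  obtain ⟨V, hV⟩ := exists_volterra hs.le
  obtain ⟨mΔ, hΔ⟩ := exists_multiplication h.continuousOn_wronskian
  obtain ⟨mb, hb⟩ := exists_multiplication (continuousOn_of_hasDerivAt h.deriv_b)
  obtain ⟨mc, hc⟩ := exists_multiplication (continuousOn_of_hasDerivAt h.deriv_c)
  refine ⟨mΔ + mc.comp (V.comp mb) - mb.comp (V.comp mc), fun w => ?_⟩
  have h1 : (mΔ + mc.comp (V.comp mb) - mb.comp (V.comp mc)) w =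
      mΔ w + mc (V (mb w)) - mb (V (mc w)) := rfl
  rw [h1]
  filter_upwards [Lp.coeFn_sub (mΔ w + mc (V (mb w))) (mb (V (mc w))),
    Lp.coeFn_add (mΔ w) (mc (V (mb w))), hΔ w, hc (V (mb w)), hb (V (mc w)), hV (mb w), hV (mc w),
    ae_restrict_mem measurableSet_Icc] with t e1 e2 e3 e4 e5 e6 e7 ht
  rw [e1, Pi.sub_apply, e2, Pi.add_apply, e3, e4, e5, e6, e7, integral_congr_L2 ht (hb w),
    integral_congr_L2 ht (hc w)]

include hs he he₀ in
-- Put P = ∫ b w and R = ∫ c w. The hypothesis says that (l − P) C + R B + μ A has zero derivative;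
-- it vanishes at s because R(s) = 0, hence identically. The combination (l − P) c + R b + μ a
-- equals Δ w, and after multiplication by e its derivative is μ β e, by the Jacobi equations and
-- the first identity. Since Δ e = −e(s), this determines w.
theorem IsJacobi.eq_of_operator_eq {w : L2 s} {l μ : ℝ}
    (hw : ∀ᵐ t ∂((volume : Measure ℝ).restrict (Icc 0 s)), wronskian B C b c t * w t +
      c t * (∫ τ in (0 : ℝ)..t, b τ * w τ) - b t * (∫ τ in (0 : ℝ)..t, c τ * w τ) =
      l * c t + μ * a t)
    (hcw : ∫ τ in (0 : ℝ)..s, c τ * w τ = 0) :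
    ∃ w₀ : ℝ, ∀ᵐ t ∂((volume : Measure ℝ).restrict (Icc 0 s)),
      w t = w₀ + -(μ / e s) * ∫ τ in (0 : ℝ)..t, β τ * e τ := by
  have hss : s ∈ Icc 0 s := ⟨hs.le, le_rfl⟩
  have ca := continuousOn_of_hasDerivAt h.deriv_a
  have cb := continuousOn_of_hasDerivAt h.deriv_b
  have cc := continuousOn_of_hasDerivAt h.deriv_c
  have cA := continuousOn_of_hasDerivAt h.deriv_A
  have cB := continuousOn_of_hasDerivAt h.deriv_B
  have cC := continuousOn_of_hasDerivAt h.deriv_C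
  have ce := continuousOn_of_hasDerivAt he
  have dA := hasAEDeriv_of_hasDerivAt hs.le ca h.deriv_A
  have dB := hasAEDeriv_of_hasDerivAt hs.le cb h.deriv_B
  have dC := hasAEDeriv_of_hasDerivAt hs.le cc h.deriv_C
  have da := hasAEDeriv_of_hasDerivAt hs.le
    ((h.cont_β.add (h.cont_α₀.mul cA)).add (h.cont_α₁.mul ca)) h.deriv_a
  have db := hasAEDeriv_of_hasDerivAt hs.le ((h.cont_α₀.mul cB).add (h.cont_α₁.mul cb)) h.deriv_b
  have dc := hasAEDeriv_of_hasDerivAt hs.le ((h.cont_α₀.mul cC).add (h.cont_α₁.mul cc)) h.deriv_c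
  have de := hasAEDeriv_of_hasDerivAt hs.le ((h.cont_α₁.neg).mul ce) he
  have dP := hasAEDeriv_integral hs.le (intervalIntegrable_mul cb w hss)
  have dR := hasAEDeriv_integral hs.le (intervalIntegrable_mul cc w hss)
  set P : ℝ → ℝ := fun t => ∫ τ in (0 : ℝ)..t, b τ * w τ with hP
  set R : ℝ → ℝ := fun t => ∫ τ in (0 : ℝ)..t, c τ * w τ with hR
  have dm := (hasAEDeriv_const hs.le l).sub dP
  have dE₀ := ((dm.mul dC).add (dR.mul dB)).add ((hasAEDeriv_const hs.le μ).mul dA)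
  have hE₀ : ∀ t ∈ Icc 0 s, (l - P t) * C t + R t * B t + μ * A t = 0 := by
    have hconst : ∀ t ∈ Icc 0 s, (l - P t) * C t + R t * B t + μ * A t =
        (l - P 0) * C 0 + R 0 * B 0 + μ * A 0 := by
      intro t ht
      rw [← sub_eq_zero]
      refine (dE₀.integral_eq ht).symm.trans ?_
      refine Eq.trans (intervalIntegral.integral_congr_ae (g := fun _ => (0 : ℝ)) ?_)
        intervalIntegral.integral_zero
      filter_upwards [ae_of_ae_restrict_Icc ht hw] with τ hτ hτ'
      have := hτ hτ'
      simp only [wronskian] at this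
      linear_combination -this
    intro t ht
    rw [hconst t ht, ← hconst s hss, h.C_end, h.A_end, show R s = 0 from hcw]
    ring
  have dE₁ := (((dm.mul dc).add (dR.mul db)).add ((hasAEDeriv_const hs.le μ).mul da)).mul de
  have hE₁ : ∀ t ∈ Icc 0 s, ((l - P t) * c t + R t * b t + μ * a t) * e t =
      ((l - P 0) * c 0 + R 0 * b 0 + μ * a 0) * e 0 + μ * ∫ τ in (0 : ℝ)..t, β τ * e τ := by
    intro t ht
    rw [← sub_eq_iff_eq_add', ← intervalIntegral.integral_const_mul]
    refine (dE₁.integral_eq ht).symm.trans (intervalIntegral.integral_congr fun τ hτ => ?_)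
    rw [uIcc_of_le ht.1] at hτ
    have := hE₀ τ ⟨hτ.1, hτ.2.trans ht.2⟩
    simp only [Pi.add_apply, Pi.mul_apply, Pi.neg_apply]
    linear_combination e τ * α₀ τ * this
  refine ⟨-(((l - P 0) * c 0 + R 0 * b 0 + μ * a 0) * e 0) / e s, ?_⟩
  filter_upwards [hw, ae_restrict_mem measurableSet_Icc] with t h1 ht
  have h2 := hE₁ t ht
  have h3 := h.wronskian_mul hs he ht
  have h4 : wronskian B C b c t * w t = (l - P t) * c t + R t * b t + μ * a t := by
    linear_combination h1
  rw [← h4] at h2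
  have h5 := he₀ s
  field_simp
  linear_combination (-1) * h2 + w t * h3

include hs he in
-- Integration by parts, where F(s) = 0 removes the boundary term at s. It makes the orthogonality
-- conditions linear in w₀ and ν.
theorem IsJacobi.integral_eq_neg {F f : ℝ → ℝ} (hF : ∀ t ∈ Icc 0 s, HasDerivAt F (f t) t)
    (hf : ContinuousOn f (Icc 0 s)) (hFs : F s = 0) (w₀ ν : ℝ) :
    ∫ t in (0 : ℝ)..s, f t * (w₀ + ν * ∫ τ in (0 : ℝ)..t, β τ * e τ) =
      -(w₀ * F 0 + ν * ∫ t in (0 : ℝ)..s, β t * e t * F t) := by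
  have hss : s ∈ Icc 0 s := ⟨hs.le, le_rfl⟩
  have hse : uIcc 0 s = Icc 0 s := uIcc_of_le hs.le
  have cβ := h.cont_β.mul (continuousOn_of_hasDerivAt he)
  have cF := continuousOn_of_hasDerivAt hF
  have iβ : IntervalIntegrable (fun t => β t * e t) volume 0 s :=
    ContinuousOn.intervalIntegrable (by rw [hse]; exact cβ)
  have dF := hasAEDeriv_of_hasDerivAt hs.le hf hF
  have dW := (hasAEDeriv_const hs.le w₀).add
    ((hasAEDeriv_const hs.le ν).mul (hasAEDeriv_integral hs.le iβ))
  have cW : ContinuousOn (fun t => w₀ + ν * ∫ τ in (0 : ℝ)..t, β τ * e τ) (Icc 0 s) :=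
    continuousOn_const.add (continuousOn_const.mul (continuousOn_primitive hs.le iβ))
  have e1 := (dF.mul dW).integral_eq hss
  have i1 : IntervalIntegrable (fun t => f t * (w₀ + ν * ∫ τ in (0 : ℝ)..t, β τ * e τ)) volume 0 s :=
    ContinuousOn.intervalIntegrable (by rw [hse]; exact hf.mul cW)
  have i2 : IntervalIntegrable (fun t => ν * (β t * e t * F t)) volume 0 s :=
    ContinuousOn.intervalIntegrable (by rw [hse]; exact continuousOn_const.mul (cβ.mul cF))
  have e2 := intervalIntegral.integral_add i1 i2
  rw [intervalIntegral.integral_const_mul] at e2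
  have e3 : F s * (w₀ + ν * ∫ τ in (0 : ℝ)..s, β τ * e τ) -
      F 0 * (w₀ + ν * ∫ τ in (0 : ℝ)..0, β τ * e τ) = -(w₀ * F 0) := by
    rw [hFs, intervalIntegral.integral_same]; ring
  have e4 : ∫ t in (0 : ℝ)..s, (f t * (w₀ + ν * ∫ τ in (0 : ℝ)..t, β τ * e τ) +
      ν * (β t * e t * F t)) = -(w₀ * F 0) := by
    refine Eq.trans (intervalIntegral.integral_congr fun t _ => ?_) (e1.trans e3)
    ring
  linarith

include hs he in
theorem IsJacobi.continuousOn_solution (w₀ ν : ℝ) :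
    ContinuousOn (fun t => w₀ + ν * ∫ τ in (0 : ℝ)..t, β τ * e τ) (Icc 0 s) := by
  have iβ : IntervalIntegrable (fun t => β t * e t) volume 0 s :=
    ContinuousOn.intervalIntegrable (by
      rw [uIcc_of_le hs.le]; exact h.cont_β.mul (continuousOn_of_hasDerivAt he))
  exact continuousOn_const.add (continuousOn_const.mul (continuousOn_primitive hs.le iβ))

include hs he in
-- By parts the hypothesis means R(s) = 0. The combination (l − P) C + R B − ν e(s) A then solves
-- the homogeneous Jacobi equation with zero data at s. Hence it and its derivative vanish, and the
-- latter is the claim.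
theorem IsJacobi.operator_solution {w₀ ν : ℝ}
    (hC : w₀ * C 0 + ν * ∫ t in (0 : ℝ)..s, β t * e t * C t = 0) {w : ℝ → ℝ}
    (hw : w = fun t => w₀ + ν * ∫ τ in (0 : ℝ)..t, β τ * e τ) :
    ∃ l : ℝ, ∀ t ∈ Icc 0 s, wronskian B C b c t * w t +
      c t * (∫ τ in (0 : ℝ)..t, b τ * w τ) - b t * (∫ τ in (0 : ℝ)..t, c τ * w τ) =
      l * c t + -(ν * e s) * a t := by
  have hss : s ∈ Icc 0 s := ⟨hs.le, le_rfl⟩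
  have cb := continuousOn_of_hasDerivAt h.deriv_b
  have cc := continuousOn_of_hasDerivAt h.deriv_c
  obtain ⟨Φ, hΦ⟩ := exists_antiderivative hs.le (h.cont_β.mul (continuousOn_of_hasDerivAt he))
  set y : ℝ → ℝ := fun t => w₀ + ν * Φ t with hy
  have hyw : ∀ t ∈ Icc 0 s, w t = y t := fun t ht => by
    rw [hw, hy]
    simp only [(hΦ t ht).2, Pi.mul_apply]
  have dy : ∀ t ∈ Icc 0 s, HasDerivAt y (ν * (β t * e t)) t := fun t ht =>
    (((hΦ t ht).1.const_mul ν).const_add w₀)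
  have cy := continuousOn_of_hasDerivAt dy
  obtain ⟨P, hP⟩ := exists_antiderivative hs.le (cb.mul cy)
  obtain ⟨R, hR⟩ := exists_antiderivative hs.le (cc.mul cy)
  have hint : ∀ (f : ℝ → ℝ), ∀ t ∈ Icc 0 s,
      ∫ τ in (0 : ℝ)..t, f τ * w τ = ∫ τ in (0 : ℝ)..t, f τ * y τ := by
    intro f t ht
    refine intervalIntegral.integral_congr fun τ hτ => ?_
    rw [uIcc_of_le ht.1] at hτ
    simp only [hyw τ ⟨hτ.1, hτ.2.trans ht.2⟩]
  have hRs : R s = 0 := by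
    have h1 := h.integral_eq_neg hs he h.deriv_C cc h.C_end w₀ ν
    rw [hC, neg_zero] at h1
    refine ((hR s hss).2.trans (hint c s hss).symm).trans ?_
    rw [hw]
    exact h1
  -- This `l` makes the derivative of the combination vanish at `s`, where `c = 1` and the Wronskian
  -- is −1.
  refine ⟨P s - y s, fun t ht => ?_⟩
  rw [hint b t ht, hint c t ht, hyw t ht]
  have hPt : ∫ τ in (0 : ℝ)..t, b τ * y τ = P t := (hP t ht).2.symm
  have hRt : ∫ τ in (0 : ℝ)..t, c τ * y τ = R t := (hR t ht).2.symm
  rw [hPt, hRt]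
  have key := secondOrder_eq_zero (s := s)
    (y := fun t => (P s - y s - P t) * C t + R t * B t + -(ν * e s) * A t)
    (w := fun t => (P s - y s - P t) * c t + R t * b t + -(ν * e s) * a t -
      wronskian B C b c t * y t) h.cont_α₀ h.cont_α₁ (fun t ht => ?_) (fun t ht => ?_) ?_ ?_ t ht
  · have := key.2
    linear_combination -this
  · refine ((((((hP t ht).1.const_sub (P s - y s))).mul (h.deriv_C t ht)).add
      ((hR t ht).1.mul (h.deriv_B t ht))).add ((h.deriv_A t ht).const_mul _)).congr_deriv ?_
    simp only [wronskian, Pi.mul_apply]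
    ring
  · refine (((((((hP t ht).1.const_sub (P s - y s))).mul (h.deriv_c t ht)).add
      ((hR t ht).1.mul (h.deriv_b t ht))).add ((h.deriv_a t ht).const_mul _)).sub
      ((h.hasDerivAt_wronskian ht).mul (dy t ht))).congr_deriv ?_
    have h1 := h.wronskian_mul hs he ht
    simp only [smul_eq_mul, Pi.mul_apply]
    linear_combination (-ν * β t) * h1
  · simp [h.C_end, h.A_end, hRs]
  · simp [wronskian, h.b_end, h.c_end, h.B_end, h.a_end, hRs]

include hs he he₀ in
-- If ν ≠ 0, then β e ≡ 0, so β ≡ 0. The equation of `A` would be homogeneous with zero end data,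
-- and a ≡ 0. This is how strict singularity makes the two-parameter family of solutions
-- nondegenerate.
theorem IsJacobi.solution_ne_zero (ha : ∃ t ∈ Icc 0 s, a t ≠ 0) {w₀ ν : ℝ}
    (hw : ∀ t ∈ Icc 0 s, w₀ + ν * (∫ τ in (0 : ℝ)..t, β τ * e τ) = 0) : w₀ = 0 ∧ ν = 0 := by
  have h0 : w₀ = 0 := by simpa using hw 0 ⟨le_rfl, hs.le⟩
  refine ⟨h0, ?_⟩
  by_contra hν
  have cβ : ContinuousOn (fun t => β t * e t) (Icc 0 s) :=
    h.cont_β.mul (continuousOn_of_hasDerivAt he)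
  have h1 : toL2 _ cβ = 0 := eq_zero_of_primitive_eq_zero hs.le fun t ht => by
    have h2 := hw t ht
    rw [h0, zero_add] at h2
    refine Eq.trans ?_ ((mul_eq_zero.1 h2).resolve_left hν)
    exact integral_congr_L2 ht (coeFn_toL2 cβ)
  have h2 : (fun t => β t * e t) =ᵐ[(volume : Measure ℝ).restrict (Icc 0 s)] fun _ => 0 := by
    refine (coeFn_toL2 cβ).symm.trans ?_
    rw [h1]
    exact Lp.coeFn_zero ..
  have h3 := Measure.eqOn_Icc_of_ae_eq _ hs.ne h2 cβ continuousOn_const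
  have h4 : ∀ t ∈ Icc 0 s, β t = 0 := fun t ht => (mul_eq_zero.1 (h3 ht)).resolve_right (he₀ t)
  obtain ⟨t, ht, hat⟩ := ha
  refine hat (secondOrder_eq_zero (y := A) (w := a) h.cont_α₀ h.cont_α₁ h.deriv_A (fun t ht => ?_)
    h.A_end h.a_end t ht).2
  refine (h.deriv_a t ht).congr_deriv ?_
  rw [h4 t ht, zero_add]
  rfl

theorem IsJacobi.continuousOn_a : ContinuousOn a (Icc 0 s) := continuousOn_of_hasDerivAt h.deriv_a

theorem IsJacobi.continuousOn_b : ContinuousOn b (Icc 0 s) := continuousOn_of_hasDerivAt h.deriv_b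

theorem IsJacobi.continuousOn_c : ContinuousOn c (Icc 0 s) := continuousOn_of_hasDerivAt h.deriv_c

omit h in
theorem coeFn_combination {u v : L2 s} (l μ : ℝ) :
    ∀ᵐ t ∂((volume : Measure ℝ).restrict (Icc 0 s)), (l • u + μ • v) t = l * u t + μ * v t := by
  filter_upwards [Lp.coeFn_add (l • u) (μ • v), Lp.coeFn_smul l u, Lp.coeFn_smul μ v] with t h1 h2 h3
  rw [h1, Pi.add_apply, h2, h3]
  rfl

/-- The solutions `w₀ + ν ∫₀ᵗ β e`. -/
noncomputable def IsJacobi.solution (w₀ ν : ℝ) : L2 s :=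
  toL2 _ (h.continuousOn_solution hs he w₀ ν)

include hs he he₀ in
theorem IsJacobi.solution_eq_zero (ha : ∃ t ∈ Icc 0 s, a t ≠ 0) {w₀ ν : ℝ}
    (hw : h.solution hs he w₀ ν = 0) : w₀ = 0 ∧ ν = 0 := by
  refine h.solution_ne_zero hs he he₀ ha ?_
  have h2 : (fun t => w₀ + ν * ∫ τ in (0 : ℝ)..t, β τ * e τ)
      =ᵐ[(volume : Measure ℝ).restrict (Icc 0 s)] fun _ => 0 := by
    refine (coeFn_toL2 (h.continuousOn_solution hs he w₀ ν)).symm.trans ?_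
    rw [IsJacobi.solution] at hw
    rw [hw]
    exact Lp.coeFn_zero ..
  exact Measure.eqOn_Icc_of_ae_eq _ hs.ne h2 (h.continuousOn_solution hs he w₀ ν) continuousOn_const

theorem IsJacobi.inner_solution {F f : ℝ → ℝ} (hF : ∀ t ∈ Icc 0 s, HasDerivAt F (f t) t)
    (hf : ContinuousOn f (Icc 0 s)) (hFs : F s = 0) (w₀ ν : ℝ) :
    inner ℝ (toL2 f hf) (h.solution hs he w₀ ν) =
      -(w₀ * F 0 + ν * ∫ t in (0 : ℝ)..s, β t * e t * F t) := by
  rw [inner_toL2 hs.le, ← h.integral_eq_neg hs he hF hf hFs]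
  refine integral_congr_L2 ⟨hs.le, le_rfl⟩ ?_
  filter_upwards [coeFn_toL2 (h.continuousOn_solution hs he w₀ ν)] with t ht
  rw [IsJacobi.solution, ht]

variable {T : L2 s →L[ℝ] L2 s} (hT : ∀ w,
    ∀ᵐ t ∂((volume : Measure ℝ).restrict (Icc 0 s)), T w t = wronskian B C b c t * w t +
      c t * (∫ τ in (0 : ℝ)..t, b τ * w τ) - b t * ∫ τ in (0 : ℝ)..t, c τ * w τ)

include he₀ hT in
theorem IsJacobi.eq_solution {w : L2 s} {l μ : ℝ}
    (hw : T w = l • toL2 c h.continuousOn_c + μ • toL2 a h.continuousOn_a)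
    (hcw : inner ℝ (toL2 c h.continuousOn_c) w = 0) :
    ∃ w₀, w = h.solution hs he w₀ (-(μ / e s)) := by
  rw [inner_toL2 hs.le] at hcw
  have hw' := hT w
  rw [hw] at hw'
  obtain ⟨w₀, h₀⟩ := h.eq_of_operator_eq hs he he₀ (w := w) (l := l) (μ := μ) (by
    filter_upwards [hw', coeFn_combination (u := toL2 c h.continuousOn_c)
      (v := toL2 a h.continuousOn_a) l μ, coeFn_toL2 h.continuousOn_c,
      coeFn_toL2 h.continuousOn_a] with t h1 h2 h3 h4
    rw [← h1, h2, h3, h4]) hcw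
  exact ⟨w₀, Lp.ext (Filter.EventuallyEq.trans h₀
    (coeFn_toL2 (h.continuousOn_solution hs he _ _)).symm)⟩

include hT in
theorem IsJacobi.operator_solution_mem {w₀ ν : ℝ}
    (hC : w₀ * C 0 + ν * ∫ t in (0 : ℝ)..s, β t * e t * C t = 0) :
    ∃ l : ℝ, T (h.solution hs he w₀ ν) =
      l • toL2 c h.continuousOn_c + -(ν * e s) • toL2 a h.continuousOn_a := by
  obtain ⟨l, hl⟩ := h.operator_solution hs he hC rfl
  have hsol := coeFn_toL2 (h.continuousOn_solution hs he w₀ ν)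
  refine ⟨l, Lp.ext ?_⟩
  have hmul : ∀ f : ℝ → ℝ, ∀ᵐ t ∂((volume : Measure ℝ).restrict (Icc 0 s)),
      f t * h.solution hs he w₀ ν t = f t * (w₀ + ν * ∫ τ in (0 : ℝ)..t, β τ * e τ) := fun f => by
    filter_upwards [hsol] with t ht
    rw [IsJacobi.solution, ht]
  filter_upwards [hT (h.solution hs he w₀ ν), hmul (wronskian B C b c),
    coeFn_combination (u := toL2 c h.continuousOn_c) (v := toL2 a h.continuousOn_a) l (-(ν * e s)),
    coeFn_toL2 h.continuousOn_c, coeFn_toL2 h.continuousOn_a,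
    ae_restrict_mem measurableSet_Icc] with t h1 h2 h3 h4 h5 ht
  rw [h1, h3, h4, h5, h2, integral_congr_L2 ht (hmul b), integral_congr_L2 ht (hmul c)]
  exact hl t ht

include hs he he₀ hT in
/-- The degeneracy of the second variation of the endpoint map. -/
theorem IsJacobi.exists_kernel_iff :
    (∃ w ∈ (Submodule.span ℝ {toL2 c h.continuousOn_c})ᗮ, w ≠ 0 ∧
      T w ∈ (Submodule.span ℝ {toL2 c h.continuousOn_c})ᗮᗮ) ↔ C 0 = 0 := by
  simp only [Submodule.orthogonal_orthogonal, Submodule.mem_orthogonal_singleton_iff_inner_right,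
    Submodule.mem_span_singleton]
  constructor
  · rintro ⟨w, hcw, hw0, l, hl⟩
    -- Without the direction `a` one has μ = 0, so `w` is the constant w₀, and orthogonality to `c`
    -- reads w₀ C(0) = 0.
    obtain ⟨w₀, rfl⟩ := h.eq_solution hs he he₀ hT (l := l) (μ := 0) (by rw [← hl, zero_smul, add_zero])
      hcw
    rw [h.inner_solution hs he h.deriv_C h.continuousOn_c h.C_end, zero_div, neg_zero, zero_mul,
      add_zero, neg_eq_zero] at hcw
    refine (mul_eq_zero.1 hcw).resolve_left fun h0 => hw0 ?_
    refine Lp.ext ((coeFn_toL2 (h.continuousOn_solution hs he _ _)).trans ?_)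
    filter_upwards [Lp.coeFn_zero ℝ 2 ((volume : Measure ℝ).restrict (Icc 0 s))] with t ht
    rw [ht, h0]
    simp
  · intro hC
    have h1 : (1 : ℝ) * C 0 + 0 * ∫ t in (0 : ℝ)..s, β t * e t * C t = 0 := by simp [hC]
    obtain ⟨l, hl⟩ := h.operator_solution_mem hs he hT h1
    refine ⟨h.solution hs he 1 0, ?_, fun h0 => ?_, l, ?_⟩
    · rw [h.inner_solution hs he h.deriv_C h.continuousOn_c h.C_end, h1, neg_zero]
    · have h2 : (fun t => (1 : ℝ) + 0 * ∫ τ in (0 : ℝ)..t, β τ * e τ)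
          =ᵐ[(volume : Measure ℝ).restrict (Icc 0 s)] fun _ => 0 := by
        refine (coeFn_toL2 (h.continuousOn_solution hs he 1 0)).symm.trans ?_
        rw [IsJacobi.solution] at h0
        rw [h0]
        exact Lp.coeFn_zero ..
      have h3 := Measure.eqOn_Icc_of_ae_eq _ hs.ne h2 (h.continuousOn_solution hs he 1 0)
        continuousOn_const ⟨le_rfl, hs.le⟩
      simp at h3
    · rw [hl]; simp

include hs he he₀ hT in
/-- The degeneracy of the second variation of the extended endpoint map. -/
theorem IsJacobi.exists_extended_kernel_iff (ha : ∃ t ∈ Icc 0 s, a t ≠ 0) :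
    (∃ w ∈ (Submodule.span ℝ {toL2 c h.continuousOn_c} ⊔
        Submodule.span ℝ {toL2 a h.continuousOn_a})ᗮ, w ≠ 0 ∧
      T w ∈ (Submodule.span ℝ {toL2 c h.continuousOn_c} ⊔
        Submodule.span ℝ {toL2 a h.continuousOn_a})ᗮᗮ) ↔
    C 0 * (∫ t in (0 : ℝ)..s, β t * e t * A t) - A 0 * (∫ t in (0 : ℝ)..s, β t * e t * C t) = 0 := by
  rw [Submodule.orthogonal_orthogonal, ← Submodule.inf_orthogonal]
  simp only [Submodule.mem_inf, Submodule.mem_orthogonal_singleton_iff_inner_right,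
    Submodule.mem_sup, Submodule.mem_span_singleton]
  set u := ∫ t in (0 : ℝ)..s, β t * e t * A t with hu
  set v := ∫ t in (0 : ℝ)..s, β t * e t * C t with hv
  constructor
  · rintro ⟨w, ⟨hcw, haw⟩, hw0, _, ⟨l, rfl⟩, _, ⟨μ, rfl⟩, hl⟩
    obtain ⟨w₀, rfl⟩ := h.eq_solution hs he he₀ hT hl.symm hcw
    set ν := -(μ / e s)
    rw [h.inner_solution hs he h.deriv_C h.continuousOn_c h.C_end, ← hv, neg_eq_zero] at hcw
    rw [h.inner_solution hs he h.deriv_A h.continuousOn_a h.A_end, ← hu, neg_eq_zero] at haw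
    by_cases h0 : w₀ = 0
    · have hν : ν ≠ 0 := by
        intro hν
        refine hw0 (Lp.ext ((coeFn_toL2 (h.continuousOn_solution hs he _ _)).trans ?_))
        filter_upwards [Lp.coeFn_zero ℝ 2 ((volume : Measure ℝ).restrict (Icc 0 s))] with t ht
        rw [ht, h0, hν]
        simp
      refine (mul_eq_zero.1 (?_ : ν * _ = 0)).resolve_left hν
      linear_combination C 0 * haw - A 0 * hcw
    · refine (mul_eq_zero.1 (?_ : w₀ * _ = 0)).resolve_left h0
      linear_combination u * hcw - v * haw
  · intro hdet
    obtain ⟨w₀, ν, hne, h1, h2⟩ : ∃ w₀ ν : ℝ, ¬(w₀ = 0 ∧ ν = 0) ∧ w₀ * C 0 + ν * v = 0 ∧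
        w₀ * A 0 + ν * u = 0 := by
      -- A kernel vector of the singular 2 × 2 system: perpendicular to a nonzero row if there is
      -- one, arbitrary otherwise.
      by_cases hC : v = 0 ∧ C 0 = 0
      · by_cases hA : u = 0 ∧ A 0 = 0
        · exact ⟨1, 0, by simp, by simp [hC.2], by simp [hA.2]⟩
        · exact ⟨u, -A 0, by simpa using hA, by simp [hC.1, hC.2], by ring⟩
      · exact ⟨v, -C 0, by simpa using hC, by ring, by linear_combination -hdet⟩
    obtain ⟨l, hl⟩ := h.operator_solution_mem hs he hT h1
    refine ⟨h.solution hs he w₀ ν, ⟨?_, ?_⟩, fun h0 => hne (h.solution_eq_zero hs he he₀ ha h0),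
      _, ⟨l, rfl⟩, _, ⟨_, rfl⟩, hl.symm⟩
    · rw [h.inner_solution hs he h.deriv_C h.continuousOn_c h.C_end, h1, neg_zero]
    · rw [h.inner_solution hs he h.deriv_A h.continuousOn_a h.A_end, h2, neg_zero]

end Kernel

/-! ### The second variation on the kernel of the first -/

section SecondVariation

variable {s : ℝ} {β α₀ α₁ A B C a b c : ℝ → ℝ}

theorem intervalIntegrable_mul' {f : ℝ → ℝ} (hs : 0 ≤ s) (hf : ContinuousOn f (Icc 0 s)) (w : L2 s) :
    IntervalIntegrable (fun τ => w τ * f τ) volume 0 s :=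
  (intervalIntegrable_mul hf w ⟨hs, le_rfl⟩).congr (fun _ _ => mul_comm _ _)

theorem hasAEDeriv_primitive_mul {f : ℝ → ℝ} (hs : 0 ≤ s) (hf : ContinuousOn f (Icc 0 s)) (w : L2 s) :
    HasAEDeriv (fun t => ∫ τ in (0 : ℝ)..t, w τ * f τ) (fun t => w t * f t) s :=
  hasAEDeriv_integral hs (intervalIntegrable_mul' hs hf w)

/-- Integration by parts against the primitive of a control. -/
theorem integral_control_mul (hs : 0 ≤ s) {F f : ℝ → ℝ} (hF : ∀ t ∈ Icc 0 s, HasDerivAt F (f t) t)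
    (hf : ContinuousOn f (Icc 0 s)) (u : L2 s) {t : ℝ} (ht : t ∈ Icc 0 s) :
    ∫ τ in (0 : ℝ)..t, u τ * F τ = F t * (∫ τ in (0 : ℝ)..t, u τ) -
      ∫ τ in (0 : ℝ)..t, f τ * ∫ σ in (0 : ℝ)..τ, u σ := by
  have hU := hasAEDeriv_integral hs (L2.intervalIntegrable hs u)
  have hUc := continuousOn_primitive hs (L2.intervalIntegrable hs u)
  have hd := hasAEDeriv_of_hasDerivAt hs hf hF
  have hi : IntervalIntegrable (fun t => f t * ∫ σ in (0 : ℝ)..t, u σ) volume 0 s :=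
    ContinuousOn.intervalIntegrable (by rw [uIcc_of_le hs]; exact hf.mul hUc)
  have e := ((hd.mul hU).sub (hasAEDeriv_integral hs hi)).integral_eq ht
  refine Eq.trans (intervalIntegral.integral_congr fun τ _ => ?_) (e.trans ?_)
  · ring
  · simp

theorem Represents.integral_mul (hs : 0 ≤ s) {v : L2 s × L2 s} {z : CompletedControl s}
    (h : Represents v z) {F f : ℝ → ℝ} (hF : ∀ t ∈ Icc 0 s, HasDerivAt F (f t) t)
    (hf : ContinuousOn f (Icc 0 s)) :
    ∫ t in (0 : ℝ)..s, v.2 t * F t = F s * z.2.1 - inner ℝ (toL2 f hf) z.2.2 := by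
  rw [integral_control_mul hs hF hf v.2 ⟨hs, le_rfl⟩, h.2.1, inner_toL2 hs]
  congr 1
  refine integral_congr_L2 ⟨hs, le_rfl⟩ ?_
  filter_upwards [h.2.2] with t ht
  rw [ht]

/-- Were κ = 0, the left integrand would be the derivative of a symmetric bilinear expression in (u,
p, r) and (u', p', r'), which vanishes at both ends. Only the first control need lie in the kernel
for that. The defect κ is what survives; with p = B w − P and r = C w − R, where P = ∫ b w and R = ∫
c w, its contribution is expressed by w and w' alone. -/
theorem IsJacobi.secondVariation_eq (h : IsJacobi s β α₀ α₁ A B C a b c) (hs : 0 < s)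
    (n₁₁ n₁₂ n₁₃ n₂₂ n₂₃ n₃₃ κ : ℝ) {v v' : L2 s × L2 s} {u p r u' p' r' : ℝ → ℝ}
    (hu : u = fun t => ∫ τ in (0 : ℝ)..t, (v.1 τ + v.2 τ * A τ))
    (hp : p = fun t => ∫ τ in (0 : ℝ)..t, v.2 τ * B τ)
    (hr : r = fun t => ∫ τ in (0 : ℝ)..t, v.2 τ * C τ)
    (hu' : u' = fun t => ∫ τ in (0 : ℝ)..t, (v'.1 τ + v'.2 τ * A τ))
    (hp' : p' = fun t => ∫ τ in (0 : ℝ)..t, v'.2 τ * B τ)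
    (hr' : r' = fun t => ∫ τ in (0 : ℝ)..t, v'.2 τ * C τ)
    (hus : u s = 0) (hps : p s = 0) (hrs : r s = 0) {w w' : ℝ → ℝ} (hw : w = fun t => ∫ τ in (0 : ℝ)..t, v.2 τ)
    (hw' : w' = fun t => ∫ τ in (0 : ℝ)..t, v'.2 τ) :
    ∫ t in (0 : ℝ)..s,
      ((v.1 t * (n₁₁ * u' t + n₁₂ * p' t + n₁₃ * r' t) +
        v.2 t * (A t * (n₁₁ * u' t + n₁₂ * p' t + n₁₃ * r' t) +
          B t * (n₁₂ * u' t + n₂₂ * p' t + (n₂₃ + κ) * r' t) +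
          C t * (n₁₃ * u' t + n₂₃ * p' t + n₃₃ * r' t))) +
      (v'.1 t * (n₁₁ * u t + n₁₂ * p t + n₁₃ * r t) +
        v'.2 t * (A t * (n₁₁ * u t + n₁₂ * p t + n₁₃ * r t) +
          B t * (n₁₂ * u t + n₂₂ * p t + (n₂₃ + κ) * r t) +
          C t * (n₁₃ * u t + n₂₃ * p t + n₃₃ * r t)))) =
    -κ * ∫ t in (0 : ℝ)..s, (wronskian B C b c t * w t + c t * (∫ τ in (0 : ℝ)..t, b τ * w τ) -
      b t * ∫ τ in (0 : ℝ)..t, c τ * w τ) * w' t := by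
  have hss : s ∈ Icc 0 s := ⟨hs.le, le_rfl⟩
  have hse : uIcc 0 s = Icc 0 s := uIcc_of_le hs.le
  have cA := continuousOn_of_hasDerivAt h.deriv_A
  have cB := continuousOn_of_hasDerivAt h.deriv_B
  have cC := continuousOn_of_hasDerivAt h.deriv_C
  have cb := h.continuousOn_b
  have cc := h.continuousOn_c
  have dB := hasAEDeriv_of_hasDerivAt hs.le cb h.deriv_B
  have dC := hasAEDeriv_of_hasDerivAt hs.le cc h.deriv_C
  have dprim := fun (v : L2 s × L2 s) => hasAEDeriv_integral hs.le
    ((L2.intervalIntegrable hs.le v.1).add (intervalIntegrable_mul' hs.le cA v.2))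
  have du := dprim v
  have du' := dprim v'
  have dp := hasAEDeriv_primitive_mul hs.le cB v.2
  have dp' := hasAEDeriv_primitive_mul hs.le cB v'.2
  have dr := hasAEDeriv_primitive_mul hs.le cC v.2
  have dr' := hasAEDeriv_primitive_mul hs.le cC v'.2
  have dw := hasAEDeriv_integral hs.le (L2.intervalIntegrable hs.le v.2)
  have dw' := hasAEDeriv_integral hs.le (L2.intervalIntegrable hs.le v'.2)
  have cw : ContinuousOn w (Icc 0 s) := by
    rw [hw]; exact continuousOn_primitive hs.le (L2.intervalIntegrable hs.le v.2)
  have cw' : ContinuousOn w' (Icc 0 s) := by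
    rw [hw']; exact continuousOn_primitive hs.le (L2.intervalIntegrable hs.le v'.2)
  have ibw : IntervalIntegrable (fun t => b t * w t) volume 0 s :=
    ContinuousOn.intervalIntegrable (by rw [hse]; exact cb.mul cw)
  have icw : IntervalIntegrable (fun t => c t * w t) volume 0 s :=
    ContinuousOn.intervalIntegrable (by rw [hse]; exact cc.mul cw)
  obtain ⟨P, hP⟩ : ∃ P : ℝ → ℝ, P = fun t => ∫ τ in (0 : ℝ)..t, b τ * w τ := ⟨_, rfl⟩
  obtain ⟨R, hR⟩ : ∃ R : ℝ → ℝ, R = fun t => ∫ τ in (0 : ℝ)..t, c τ * w τ := ⟨_, rfl⟩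
  have dP := hasAEDeriv_integral hs.le ibw
  have dR := hasAEDeriv_integral hs.le icw
  have cP := continuousOn_primitive hs.le ibw
  have cR := continuousOn_primitive hs.le icw
  have hpw : ∀ t ∈ Icc 0 s, p t = B t * w t - P t := fun t ht => by
    rw [hp, hP, hw]; exact integral_control_mul hs.le h.deriv_B cb v.2 ht
  have hrw : ∀ t ∈ Icc 0 s, r t = C t * w t - R t := fun t ht => by
    rw [hr, hR, hw]; exact integral_control_mul hs.le h.deriv_C cc v.2 ht
  have hRs : R s = 0 := by
    have := hrw s hss
    rw [hrs, h.C_end] at this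
    linarith
  have hPt : ∀ t, ∫ τ in (0 : ℝ)..t, b τ * w τ = P t := fun t => by rw [hP]
  have hRt : ∀ t, ∫ τ in (0 : ℝ)..t, c τ * w τ = R t := fun t => by rw [hR]
  simp only [hPt, hRt]
  rw [← hP] at dP cP
  rw [← hR] at dR cR
  rw [← hu] at du
  rw [← hu'] at du'
  rw [← hp] at dp
  rw [← hp'] at dp'
  rw [← hr] at dr
  rw [← hr'] at dr'
  rw [← hw'] at dw'
  have hzero : u 0 = 0 ∧ p 0 = 0 ∧ w' 0 = 0 ∧ r 0 = 0 := by
    rw [hu, hp, hw', hr]; simp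
  have iK : IntervalIntegrable (fun t => (wronskian B C b c t * w t + c t * P t - b t * R t) * w' t)
      volume 0 s :=
    ContinuousOn.intervalIntegrable (by
      rw [hse]
      exact (((h.continuousOn_wronskian.mul cw).add (cc.mul cP)).sub (cb.mul cR)).mul cw')
  have dK := hasAEDeriv_integral hs.le iK
  have k := fun n : ℝ => hasAEDeriv_const hs.le n
  -- The primitive consists of the symmetric products and, for κ, of p r' + w' (C P − B R) minus the
  -- integral on the right. The boundary values vanish because u, p, r, C and R are zero at s, and
  -- u, p, r and w' at 0.
  have dΨ := ((((((k n₁₁).mul (du.mul du')).add ((k n₁₂).mul ((du.mul dp').add (dp.mul du')))).add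
    ((k n₁₃).mul ((du.mul dr').add (dr.mul du')))).add
    (((k n₂₂).mul (dp.mul dp')).add ((k n₃₃).mul (dr.mul dr')))).add
    (((k n₂₃).mul ((dp.mul dr').add (dr.mul dp'))).add
    ((k κ).mul ((dp.mul dr').add (dw'.mul ((dC.mul dP).sub (dB.mul dR))))))).sub
    ((k κ).mul dK)
  refine Eq.trans (intervalIntegral.integral_congr fun t ht => ?_) ((dΨ.integral_eq hss).trans ?_)
  · rw [hse] at ht
    have e1 := hpw t ht
    have e2 := hrw t ht
    simp only [wronskian]
    linear_combination κ * v'.2 t * (B t * e2 - C t * e1)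
  · rw [hus, hps, hrs, h.C_end, hRs, hzero.1, hzero.2.1, hzero.2.2.1, hzero.2.2.2]
    simp

/-- The covectors that annihilate the first variation. -/
theorem IsJacobi.annihilator (h : IsJacobi s β α₀ α₁ A B C a b c) (hs : 0 < s) {ρ ξ₁ ξ₂ ξ₃ : ℝ}
    (hξ : ∀ v : L2 s × L2 s, ρ * (∫ t in (0 : ℝ)..s, v.1 t) +
      ∫ t in (0 : ℝ)..s, v.2 t * (A t * ξ₁ + B t * ξ₂ + C t * ξ₃) = 0) :
    ρ = 0 ∧ ξ₂ = 0 ∧ ξ₃ = 0 ∧ ∀ t ∈ Icc 0 s, a t * ξ₁ = 0 := by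
  have hss : s ∈ Icc 0 s := ⟨hs.le, le_rfl⟩
  have hzero : ∀ f : ℝ → ℝ, ∫ t in (0 : ℝ)..s, (0 : L2 s) t * f t = 0 := by
    intro f
    refine Eq.trans (integral_congr_L2 (G := fun _ => 0) hss ?_) intervalIntegral.integral_zero
    filter_upwards [Lp.coeFn_zero ℝ 2 ((volume : Measure ℝ).restrict (Icc 0 s))] with t ht
    rw [ht, Pi.zero_apply, zero_mul]
  have hρ : ρ = 0 := by
    have h1 := hξ (toL2 (fun _ => 1) continuousOn_const, 0)
    simp only [hzero, add_zero] at h1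
    have h2 : ∫ t in (0 : ℝ)..s, toL2 (s := s) (fun _ => 1) continuousOn_const t = s := by
      rw [integral_congr_L2 hss (coeFn_toL2 (s := s) (f := fun _ => 1) continuousOn_const)]
      simp
    rw [h2] at h1
    exact (mul_eq_zero.1 h1).resolve_right hs.ne'
  set k : ℝ → ℝ := fun t => A t * ξ₁ + B t * ξ₂ + C t * ξ₃ with hk
  have dk : ∀ t ∈ Icc 0 s, HasDerivAt k (a t * ξ₁ + b t * ξ₂ + c t * ξ₃) t := fun t ht =>
    (((h.deriv_A t ht).mul_const ξ₁).add ((h.deriv_B t ht).mul_const ξ₂)).add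
      ((h.deriv_C t ht).mul_const ξ₃)
  have ck := continuousOn_of_hasDerivAt dk
  -- Once `ρ = 0`, the choice `v₂ = k` gives ∫ k² = 0.
  have hk0 := eqOn_zero_of_integral_sq hs ck (by
    have h1 := hξ (0, toL2 k ck)
    rw [hρ, zero_mul, zero_add] at h1
    refine Eq.trans (integral_congr_L2 hss ?_) h1
    filter_upwards [coeFn_toL2 ck] with t ht
    show k t * k t = toL2 k ck t * k t
    rw [ht])
  have hd0 : ∀ t ∈ Icc 0 s, a t * ξ₁ + b t * ξ₂ + c t * ξ₃ = 0 := by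
    intro t ht
    exact (uniqueDiffOn_Icc hs t ht).eq_deriv _ (dk t ht).hasDerivWithinAt
      ((hasDerivWithinAt_const t _ (0 : ℝ)).congr (fun τ hτ => hk0 τ hτ) (hk0 t ht))
  -- At `s` the coefficients of g are (0, 1, 0) and those of its derivative (0, 0, 1), so `k` and
  -- its derivative isolate ξ₂ and ξ₃ there.
  have h2 : ξ₂ = 0 := by
    have := hk0 s hss
    simpa [hk, h.A_end, h.B_end, h.C_end] using this
  have h3 : ξ₃ = 0 := by
    have := hd0 s hss
    simpa [h.a_end, h.b_end, h.c_end] using this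
  exact ⟨hρ, h2, h3, fun t ht => by simpa [h2, h3] using hd0 t ht⟩

theorem IsJacobi.A_eq_zero (h : IsJacobi s β α₀ α₁ A B C a b c) (hs : 0 < s)
    (ha : ∀ t ∈ Icc 0 s, a t = 0) : ∀ t ∈ Icc 0 s, A t = 0 := by
  have hc := constant_of_has_deriv_right_zero (continuousOn_of_hasDerivAt h.deriv_A)
    fun t ht => by
      have h1 := h.deriv_A t (Ico_subset_Icc_self ht)
      rw [ha t (Ico_subset_Icc_self ht)] at h1
      exact h1.hasDerivWithinAt
  intro t ht
  rw [hc t ht, ← hc s ⟨hs.le, le_rfl⟩, h.A_end]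

end SecondVariation

/-! ### Linear algebra of the Engel frame -/

section Frame

variable {E : Type*} [NormedAddCommGroup E] [NormedSpace ℝ E] {x₁ x₂ x₃ y : E}

theorem eq_zero_of_triple (hx : LinearIndependent ℝ ![x₁, x₂, x₃]) {p q r : ℝ}
    (h : p • x₁ + q • x₂ + r • x₃ = 0) : p = 0 ∧ q = 0 ∧ r = 0 := by
  have h1 := Fintype.linearIndependent_iff.1 hx ![p, q, r] (by simpa [Fin.sum_univ_three] using h)
  exact ⟨h1 0, h1 1, h1 2⟩

/-- In dimension four the frame and `y` form a basis, so a covector that kills the frame is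
determined by its value on `y`. This makes the defect of the Hessian nonzero. -/
theorem exists_annihilator [FiniteDimensional ℝ E] (hdim : Module.finrank ℝ E = 4)
    (hx : LinearIndependent ℝ ![x₁, x₂, x₃]) (hy : y ∉ Submodule.span ℝ {x₁, x₂, x₃}) :
    (∃ ξ : E →L[ℝ] ℝ, ξ ≠ 0 ∧ ξ x₁ = 0 ∧ ξ x₂ = 0 ∧ ξ x₃ = 0) ∧
      ∀ ξ : E →L[ℝ] ℝ, ξ ≠ 0 → ξ x₁ = 0 → ξ x₂ = 0 → ξ x₃ = 0 → ξ y ≠ 0 := by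
  have hr : range ![x₁, x₂, x₃] = {x₁, x₂, x₃} := by
    ext v
    simp [eq_comm]
    tauto
  have hli : LinearIndependent ℝ (Fin.cons y ![x₁, x₂, x₃] : Fin 4 → E) :=
    linearIndependent_finCons.2 ⟨hx, by rwa [hr]⟩
  set bs := basisOfLinearIndependentOfCardEqFinrank hli (by simp [hdim]) with hbs
  have hb : ∀ i, bs i = (Fin.cons y ![x₁, x₂, x₃] : Fin 4 → E) i := fun i => by
    rw [hbs, coe_basisOfLinearIndependentOfCardEqFinrank]
  have h0 : y = bs 0 := (hb 0).symm
  have h1 : x₁ = bs 1 := (hb 1).symm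
  have h2 : x₂ = bs 2 := (hb 2).symm
  have h3 : x₃ = bs 3 := (hb 3).symm
  refine ⟨⟨(bs.coord 0).toContinuousLinearMap, fun h => ?_, ?_, ?_, ?_⟩, fun ξ hξ e1 e2 e3 e0 => hξ ?_⟩
  · have := DFunLike.congr_fun h y
    rw [LinearMap.coe_toContinuousLinearMap', h0] at this
    simp at this
  · rw [LinearMap.coe_toContinuousLinearMap', h1]; simp
  · rw [LinearMap.coe_toContinuousLinearMap', h2]; simp
  · rw [LinearMap.coe_toContinuousLinearMap', h3]; simp
  · have : (ξ : E →ₗ[ℝ] ℝ) = 0 := bs.ext fun i => by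
      rw [hb]
      fin_cases i
      · exact e0
      · exact e1
      · exact e2
      · exact e3
    exact ContinuousLinearMap.ext fun v => LinearMap.congr_fun this v

variable {s : ℝ} {β α₀ α₁ A B C a b c : ℝ → ℝ}

theorem IsJacobi.controlIntegral_eq (h : IsJacobi s β α₀ α₁ A B C a b c) [CompleteSpace E]
    {g : ℝ → E} (hg : ∀ t ∈ Icc 0 s, g t = A t • x₁ + B t • x₂ + C t • x₃) (v : L2 s × L2 s) {t : ℝ}
    (ht : t ∈ Icc 0 s) :
    controlIntegral v (fun _ => x₁) g t = (∫ τ in (0 : ℝ)..t, (v.1 τ + v.2 τ * A τ)) • x₁ +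
      (∫ τ in (0 : ℝ)..t, v.2 τ * B τ) • x₂ + (∫ τ in (0 : ℝ)..t, v.2 τ * C τ) • x₃ := by
  have hs := ht.1.trans ht.2
  have hsub : uIcc 0 t ⊆ uIcc 0 s := by
    rw [uIcc_of_le ht.1, uIcc_of_le hs]; exact Icc_subset_Icc_right ht.2
  have iA := (L2.intervalIntegrable_left ht v.1).add ((intervalIntegrable_mul' hs
    (continuousOn_of_hasDerivAt h.deriv_A) v.2).mono_set hsub)
  have iB := (intervalIntegrable_mul' hs (continuousOn_of_hasDerivAt h.deriv_B) v.2).mono_set hsub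
  have iC := (intervalIntegrable_mul' hs (continuousOn_of_hasDerivAt h.deriv_C) v.2).mono_set hsub
  have hi : ∀ {f : ℝ → ℝ} (x : E), IntervalIntegrable f volume 0 t →
      IntervalIntegrable (fun τ => f τ • x) volume 0 t := fun x hf =>
    hf.smul_continuousOn continuousOn_const
  rw [← intervalIntegral.integral_smul_const, ← intervalIntegral.integral_smul_const,
    ← intervalIntegral.integral_smul_const, ← intervalIntegral.integral_add (hi x₁ iA) (hi x₂ iB),
    ← intervalIntegral.integral_add ((hi x₁ iA).add (hi x₂ iB)) (hi x₃ iC), controlIntegral]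
  refine intervalIntegral.integral_congr fun τ hτ => ?_
  rw [uIcc_of_le ht.1] at hτ
  simp only [hg τ ⟨hτ.1, hτ.2.trans ht.2⟩]
  module

/-- The Hessian of the endpoint map on the kernel of the differential. -/
theorem IsJacobi.hessian_eq (h : IsJacobi s β α₀ α₁ A B C a b c) [CompleteSpace E] (hs : 0 < s)
    (hx : LinearIndependent ℝ ![x₁, x₂, x₃]) {g : ℝ → E} {M₁ M₂ M₃ : E →L[ℝ] E}
    {D₂ : ℝ → E →L[ℝ] E} (hg : ∀ t ∈ Icc 0 s, g t = A t • x₁ + B t • x₂ + C t • x₃)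
    (hD₂c : ContinuousOn D₂ (Icc 0 s)) {ξ : E →L[ℝ] ℝ}
    (h₁ : ξ x₁ = 0) (h₂ : ξ x₂ = 0) (h₃ : ξ x₃ = 0)
    (hD₂ : ∀ t ∈ Icc 0 s, ∀ w, ξ (D₂ t w) = A t * ξ (M₁ w) + B t * ξ (M₂ w) + C t * ξ (M₃ w))
    (h₁₂ : M₂ x₁ - M₁ x₂ = x₃) {r₁ r₂ r₃ : ℝ}
    (h₁₃ : M₃ x₁ - M₁ x₃ = r₁ • x₁ + r₂ • x₂ + r₃ • x₃) (h₃₂ : M₂ x₃ - M₃ x₂ = y)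
    {T : L2 s →L[ℝ] L2 s} (hT : ∀ w,
      ∀ᵐ t ∂((volume : Measure ℝ).restrict (Icc 0 s)), T w t = wronskian B C b c t * w t +
        c t * (∫ τ in (0 : ℝ)..t, b τ * w τ) - b t * ∫ τ in (0 : ℝ)..t, c τ * w τ)
    {v v' : L2 s × L2 s} {z z' : CompletedControl s} (hz : Represents v z) (hz' : Represents v' z')
    (hv : controlIntegral v (fun _ => x₁) g s = 0) :
    ξ (controlIntegral v (fun τ => M₁ (controlIntegral v' (fun _ => x₁) g τ))
        (fun τ => D₂ τ (controlIntegral v' (fun _ => x₁) g τ)) s +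
      controlIntegral v' (fun τ => M₁ (controlIntegral v (fun _ => x₁) g τ))
        (fun τ => D₂ τ (controlIntegral v (fun _ => x₁) g τ)) s) =
      -ξ y * inner ℝ (T z.2.2) z'.2.2 := by
  have hss : s ∈ Icc 0 s := ⟨hs.le, le_rfl⟩
  have cg : ContinuousOn g (Icc 0 s) := by
    refine ContinuousOn.congr (f := fun t => A t • x₁ + B t • x₂ + C t • x₃) ?_ hg
    exact (((continuousOn_of_hasDerivAt h.deriv_A).smul continuousOn_const).add
      ((continuousOn_of_hasDerivAt h.deriv_B).smul continuousOn_const)).add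
      ((continuousOn_of_hasDerivAt h.deriv_C).smul continuousOn_const)
  have cδ := fun v : L2 s × L2 s =>
    continuousOn_controlIntegral (f₁ := fun _ => x₁) continuousOn_const cg v
  have cM : ∀ v : L2 s × L2 s, ContinuousOn
      (fun τ => M₁ (controlIntegral v (fun _ => x₁) g τ)) (Icc 0 s) := fun v =>
    M₁.continuous.comp_continuousOn (cδ v)
  have cD : ∀ v : L2 s × L2 s, ContinuousOn
      (fun τ => D₂ τ (controlIntegral v (fun _ => x₁) g τ)) (Icc 0 s) := fun v =>
    hD₂c.clm_apply (cδ v)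
  have cM' : ∀ v : L2 s × L2 s, ContinuousOn
      (fun τ => ξ (M₁ (controlIntegral v (fun _ => x₁) g τ))) (Icc 0 s) := fun v =>
    ξ.continuous.comp_continuousOn (cM v)
  have cD' : ∀ v : L2 s × L2 s, ContinuousOn
      (fun τ => ξ (D₂ τ (controlIntegral v (fun _ => x₁) g τ))) (Icc 0 s) := fun v =>
    ξ.continuous.comp_continuousOn (cD v)
  have hv0 := hv
  rw [h.controlIntegral_eq hg v hss] at hv0
  obtain ⟨e1, e2, e3⟩ := eq_zero_of_triple hx hv0
  rw [map_add, controlIntegral_clm_comp (cM v') (cD v') hss, controlIntegral_clm_comp (cM v) (cD v) hss,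
    controlIntegral, controlIntegral, ← intervalIntegral.integral_add
      (controlIntegrable (cM' v') (cD' v') hss v) (controlIntegrable (cM' v) (cD' v) hss v')]
  -- The numbers ξ(Mᵢ xⱼ) fail to be symmetric by ξ of a bracket. Two of the three brackets lie in
  -- the span killed by ξ; the third is `y`, the only defect.
  have n12 : ξ (M₂ x₁) = ξ (M₁ x₂) := by
    have := congrArg ξ h₁₂
    rw [map_sub, h₃] at this
    linarith
  have n13 : ξ (M₃ x₁) = ξ (M₁ x₃) := by
    have := congrArg ξ h₁₃
    simp only [map_sub, map_add, map_smul, h₁, h₂, h₃, smul_zero, add_zero] at this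
    linarith
  have n23 : ξ (M₂ x₃) = ξ (M₃ x₂) + ξ y := by
    have := congrArg ξ h₃₂
    rw [map_sub] at this
    linarith
  have key := h.secondVariation_eq hs (ξ (M₁ x₁)) (ξ (M₁ x₂)) (ξ (M₁ x₃)) (ξ (M₂ x₂)) (ξ (M₃ x₂))
    (ξ (M₃ x₃)) (ξ y) (v := v) (v' := v') rfl rfl rfl rfl rfl rfl e1 e2 e3 rfl rfl
  have hJ : ∫ t in (0 : ℝ)..s, ((wronskian B C b c t * (∫ σ in (0 : ℝ)..t, v.2 σ) +
      c t * (∫ τ in (0 : ℝ)..t, b τ * ∫ σ in (0 : ℝ)..τ, v.2 σ) -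
      b t * ∫ τ in (0 : ℝ)..t, c τ * ∫ σ in (0 : ℝ)..τ, v.2 σ) * ∫ σ in (0 : ℝ)..t, v'.2 σ) =
      inner ℝ (T z.2.2) z'.2.2 := by
    rw [inner_eq_intervalIntegral hs.le]
    refine integral_congr_L2 hss ?_
    filter_upwards [hT z.2.2, hz.2.2, hz'.2.2, ae_restrict_mem measurableSet_Icc] with t i1 i2 i3 ht
    have hw : ∀ f : ℝ → ℝ, ∫ τ in (0 : ℝ)..t, f τ * z.2.2 τ =
        ∫ τ in (0 : ℝ)..t, f τ * ∫ σ in (0 : ℝ)..τ, v.2 σ := fun f =>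
      integral_congr_L2 ht (by filter_upwards [hz.2.2] with τ hτ; rw [hτ])
    rw [i1, i2, i3, hw, hw]
  rw [← hJ, ← key]
  refine intervalIntegral.integral_congr fun t ht => ?_
  rw [uIcc_of_le hs.le] at ht
  simp only [smul_eq_mul, hD₂ t ht, h.controlIntegral_eq hg _ ht, map_add, map_smul, n12, n13, n23]
  ring

variable (x₁ x₂ x₃) in
/-- The continuous extension of the first variation to the completed space of controls. -/
theorem IsJacobi.exists_extension (h : IsJacobi s β α₀ α₁ A B C a b c) [CompleteSpace E]
    (hs : 0 < s) : ∃ D : CompletedControl s →L[ℝ] E,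
      (∀ z, D z = ((∫ t in (0 : ℝ)..s, z.1 t) - inner ℝ (toL2 a h.continuousOn_a) z.2.2) • x₁ +
        (z.2.1 - inner ℝ (toL2 b h.continuousOn_b) z.2.2) • x₂ +
        (-inner ℝ (toL2 c h.continuousOn_c) z.2.2) • x₃) ∧
      ∀ (g : ℝ → E), (∀ t ∈ Icc 0 s, g t = A t • x₁ + B t • x₂ + C t • x₃) →
        ∀ v z, Represents v z → D z = controlIntegral v (fun _ => x₁) g s := by
  have hss : s ∈ Icc 0 s := ⟨hs.le, le_rfl⟩
  let π₁ := ContinuousLinearMap.fst ℝ (L2 s) (ℝ × L2 s)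
  let π₂ := (ContinuousLinearMap.fst ℝ ℝ (L2 s)).comp (ContinuousLinearMap.snd ℝ (L2 s) (ℝ × L2 s))
  let π₃ := (ContinuousLinearMap.snd ℝ ℝ (L2 s)).comp (ContinuousLinearMap.snd ℝ (L2 s) (ℝ × L2 s))
  have hm : ∀ u : L2 s, inner ℝ (toL2 (fun _ => 1) continuousOn_const) u =
      ∫ t in (0 : ℝ)..s, u t := fun u => by
    rw [inner_toL2 hs.le]; simp
  have hD : ∀ z, (((innerSL ℝ (toL2 (fun _ => 1) continuousOn_const)).comp π₁ -
      (innerSL ℝ (toL2 a h.continuousOn_a)).comp π₃).smulRight x₁ +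
      (π₂ - (innerSL ℝ (toL2 b h.continuousOn_b)).comp π₃).smulRight x₂ +
      (-(innerSL ℝ (toL2 c h.continuousOn_c)).comp π₃).smulRight x₃) z =
      ((∫ t in (0 : ℝ)..s, z.1 t) - inner ℝ (toL2 a h.continuousOn_a) z.2.2) • x₁ +
        (z.2.1 - inner ℝ (toL2 b h.continuousOn_b) z.2.2) • x₂ +
        (-inner ℝ (toL2 c h.continuousOn_c) z.2.2) • x₃ := fun z => by
    rw [← hm]
    rfl
  refine ⟨_, hD, fun g hg v z hz => ?_⟩
  rw [hD, h.controlIntegral_eq hg v hss, intervalIntegral.integral_add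
    (L2.intervalIntegrable hs.le v.1)
    (intervalIntegrable_mul' hs.le (continuousOn_of_hasDerivAt h.deriv_A) v.2),
    hz.integral_mul hs.le h.deriv_A h.continuousOn_a, hz.integral_mul hs.le h.deriv_B h.continuousOn_b,
    hz.integral_mul hs.le h.deriv_C h.continuousOn_c, h.A_end, h.B_end, h.C_end, hz.1]
  congr 2
  · congr 1; ring
  · congr 1; ring
  · ring

end Frame

/-! ### The extended endpoint map -/

section Extended

variable {E : Type*} [NormedAddCommGroup E] [NormedSpace ℝ E]
  {H : Type*} [TopologicalSpace H] {I : ModelWithCorners ℝ E H}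
  {M : Type*} [TopologicalSpace M] [ChartedSpace H M]
  {X₁ X₂ : (x : M) → TangentSpace I x} {γ : ℝ → M} {s δ : ℝ} {U : Set E} {ψ : ℝ × E → M}
  {β α₀ α₁ : M → ℝ}

/-- Expanding the square shows a polynomial of degree two in the control, so the energy equals its
Taylor expansion, with differential ∫ v₁. -/
theorem energy_eq (hs : 0 ≤ s) (v : L2 s × L2 s) :
    energy s v = s / 2 + (∫ t in (0 : ℝ)..s, v.1 t) +
      1 / 2 * (inner ℝ v.1 v.1 + inner ℝ v.2 v.2) := by
  have hsq : ∀ u : L2 s, IntervalIntegrable (fun t => u t * u t) volume 0 s := fun u => by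
    rw [intervalIntegrable_iff_integrableOn_Icc_of_le hs]
    exact (Lp.memLp u).integrable_mul (Lp.memLp u)
  have h1 := L2.intervalIntegrable hs v.1
  have hc : IntervalIntegrable (fun _ : ℝ => (1 : ℝ)) volume 0 s := intervalIntegrable_const
  rw [energy, inner_eq_intervalIntegral hs, inner_eq_intervalIntegral hs,
    ← intervalIntegral.integral_add (hsq v.1) (hsq v.2)]
  have h2 : ∫ t in (0 : ℝ)..s, ((1 + v.1 t) ^ 2 + v.2 t ^ 2) =
      (∫ _ in (0 : ℝ)..s, (1 : ℝ)) + 2 * (∫ t in (0 : ℝ)..s, v.1 t) +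
        ∫ t in (0 : ℝ)..s, (v.1 t * v.1 t + v.2 t * v.2 t) := by
    rw [← intervalIntegral.integral_const_mul, ← intervalIntegral.integral_add hc (h1.const_mul 2),
      ← intervalIntegral.integral_add (hc.add (h1.const_mul 2)) ((hsq v.1).add (hsq v.2))]
    exact intervalIntegral.integral_congr fun t _ => by ring
  rw [h2, intervalIntegral.integral_const, smul_eq_mul]
  ring

/-- The energy adds no error term. Of the second derivative only the `E`-component is recorded,
since the relevant covectors have no energy component along a strictly singular curve. -/
theorem HasTaylorExpansion.extended (hs : 0 ≤ s) {x₀ : M} {L : L2 s × L2 s →L[ℝ] E}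
    {B : L2 s × L2 s →L[ℝ] L2 s × L2 s →L[ℝ] E}
    (hT : HasTaylorExpansion I (endpointMap I X₁ X₂ x₀ s) L B) :
    ∃ (L' : L2 s × L2 s →L[ℝ] E × ℝ) (B' : L2 s × L2 s →L[ℝ] L2 s × L2 s →L[ℝ] E × ℝ),
      HasTaylorExpansion (I.prod 𝓘(ℝ, ℝ)) (extendedEndpointMap I X₁ X₂ x₀ s) L' B' ∧
      (∀ v, L' v = (L v, ∫ t in (0 : ℝ)..s, v.1 t)) ∧
      ∀ v v', (B' v v').1 = B v v' := by
  let π₁ := ContinuousLinearMap.fst ℝ (L2 s) (L2 s)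
  let π₂ := ContinuousLinearMap.snd ℝ (L2 s) (L2 s)
  obtain ⟨m, hm⟩ : ∃ m : L2 s →L[ℝ] ℝ, ∀ u, m u = ∫ t in (0 : ℝ)..s, u t :=
    ⟨innerSL ℝ (toL2 (fun _ => 1) continuousOn_const), fun u => by
      rw [innerSL_apply_apply, inner_toL2 hs]; simp⟩
  obtain ⟨b₁, hb₁⟩ : ∃ b : L2 s × L2 s →L[ℝ] L2 s × L2 s →L[ℝ] ℝ,
      ∀ v v', b v v' = inner ℝ v.1 v'.1 :=
    ⟨(innerSL ℝ (E := L2 s)).bilinearComp π₁ π₁, fun v v' => rfl⟩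
  obtain ⟨b₂, hb₂⟩ : ∃ b : L2 s × L2 s →L[ℝ] L2 s × L2 s →L[ℝ] ℝ,
      ∀ v v', b v v' = inner ℝ v.2 v'.2 :=
    ⟨(innerSL ℝ (E := L2 s)).bilinearComp π₂ π₂, fun v v' => rfl⟩
  let b := b₁ + b₂
  have hb : ∀ v v', b v v' = inner ℝ v.1 v'.1 + inner ℝ v.2 v'.2 := fun v v' => by
    rw [← hb₁, ← hb₂]; rfl
  obtain ⟨B', hB'⟩ : ∃ B' : L2 s × L2 s →L[ℝ] L2 s × L2 s →L[ℝ] E × ℝ,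
      ∀ v v', B' v v' = (B v v', b v v') := by
    refine ⟨(ContinuousLinearMap.compL ℝ (L2 s × L2 s) E (E × ℝ)
      (ContinuousLinearMap.inl ℝ E ℝ)).comp B + (ContinuousLinearMap.compL ℝ (L2 s × L2 s) ℝ (E × ℝ)
      (ContinuousLinearMap.inr ℝ E ℝ)).comp b, fun v v' => ?_⟩
    simp
  have hen : ∀ v, energy s v = s / 2 + m v.1 + 1 / 2 * b v v := fun v => by
    rw [energy_eq hs, hm, hb]
  have hen0 : energy s 0 = s / 2 := by rw [hen]; simp
  refine ⟨L.prod (m.comp π₁), B', ⟨?_, fun v v' => ?_, ?_⟩, fun v => ?_, fun v v' => ?_⟩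
  · refine hT.continuousAt.prodMk (Continuous.continuousAt ?_)
    have hc : Continuous fun v : L2 s × L2 s => s / 2 + m v.1 + 1 / 2 * b v v := by fun_prop
    exact hc.congr fun v => (hen v).symm
  · rw [hB', hB', hT.symm, hb, hb, real_inner_comm, real_inner_comm v.2]
  · have h0 : (fun _ : L2 s × L2 s => (0 : ℝ)) =o[𝓝 0] fun v : L2 s × L2 s => ‖v‖ ^ 2 :=
      isLittleO_zero _ _
    refine (hT.expansion.prod_left h0).congr_left fun v => ?_
    rw [hB']
    refine Prod.ext rfl ?_
    have h2 : energy s v - energy s 0 - m v.1 - (1 / 2 : ℝ) * b v v = 0 := by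
      rw [hen, hen0]; ring
    exact h2.symm
  · rw [← hm]; rfl
  · rw [hB']

variable [IsManifold I ∞ M] [I.Boundaryless] [T2Space M] [FiniteDimensional ℝ E]

/-- The second-order expansion in terms of the pulled back frame. -/
theorem IsEndTube.exists_expansion
    (hX₁ : ContMDiff I I.tangent ∞ fun x => (⟨x, X₁ x⟩ : TangentBundle I M))
    (hX₂ : ContMDiff I I.tangent ∞ fun x => (⟨x, X₂ x⟩ : TangentBundle I M))
    (h : IsEndTube I X₁ γ s δ U ψ) {z₀ x₁ : E} (hz₀ : z₀ = extChartAt I (γ s) (γ s))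
    (hx₁ : x₁ = X₁ (γ s)) {M₁ : E →L[ℝ] E} (hM₁ : M₁ = fderiv ℝ (chartField I (γ s) X₁) z₀)
    {g : ℝ → E} (hg : g = fun t => pullField I ψ X₂ (t, z₀)) {D₂ : ℝ → E →L[ℝ] E}
    (hD₂ : D₂ = fun t => fderiv ℝ (fun z => pullField I ψ X₂ (t, z)) z₀) :
    ContinuousOn D₂ (Icc 0 s) ∧
      ∃ (L : L2 s × L2 s →L[ℝ] E) (B : L2 s × L2 s →L[ℝ] L2 s × L2 s →L[ℝ] E),
        endpointMap I X₁ X₂ (γ 0) s 0 = γ s ∧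
        HasTaylorExpansion I (endpointMap I X₁ X₂ (γ 0) s) L B ∧
        (∀ v, L v = controlIntegral v (fun _ => x₁) g s) ∧
        ∀ v v', B v v' = controlIntegral v (fun τ => M₁ (controlIntegral v' (fun _ => x₁) g τ))
            (fun τ => D₂ τ (controlIntegral v' (fun _ => x₁) g τ)) s +
          controlIntegral v' (fun τ => M₁ (controlIntegral v (fun _ => x₁) g τ))
            (fun τ => D₂ τ (controlIntegral v (fun _ => x₁) g τ)) s := by
  have := FiniteDimensional.complete ℝ E
  have hs := h.s_pos.le
  have hss : s ∈ Icc 0 s := ⟨hs, le_rfl⟩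
  obtain ⟨R, hR, hRU⟩ := Metric.nhds_basis_closedBall.mem_iff.1 (h.isOpen.mem_nhds h.mem)
  rw [← hz₀] at hRU
  have hu : ∀ Y : (x : M) → TangentSpace I x,
      ContMDiff I I.tangent ∞ (fun x => (⟨x, Y x⟩ : TangentBundle I M)) →
      IsUniformlyDifferentiable s R z₀ (pullField I ψ Y)
        (fun t => fderiv ℝ (fun z => pullField I ψ Y (t, z)) z₀) := fun Y hY =>
    isUniformlyDifferentiable_of_contDiffOn isOpen_Ioo h.isOpen
      ((h.tube.contDiffOn_pullField (n := 2) isOpen_Ioo h.isOpen hY).of_le (by norm_num))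
      h.Icc_subset hR hRU
  have hcf : ∀ Y : (x : M) → TangentSpace I x,
      ContMDiff I I.tangent ∞ (fun x => (⟨x, Y x⟩ : TangentBundle I M)) →
      ContinuousOn (fun t => pullField I ψ Y (t, z₀)) (Icc 0 s) := fun Y hY =>
    (hu Y hY).continuousOn.comp (continuousOn_id.prodMk continuousOn_const) fun t ht =>
      ⟨ht, Metric.mem_closedBall_self hR.le⟩
  have c₁ := hcf X₁ hX₁
  have c₂ := hcf X₂ hX₂
  have e₁ := (hu X₁ hX₁).continuousOn_deriv
  have e₂ := (hu X₂ hX₂).continuousOn_deriv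
  have hU : z₀ ∈ U := by rw [hz₀]; exact h.mem
  have hf₁ : ∀ t ∈ Icc 0 s, pullField I ψ X₁ (t, z₀) = x₁ := fun t ht => by
    rw [h.pullField_self hX₁ (h.Icc_subset ht) hU, hz₀, hx₁]
    exact h.pullField_end_self X₁
  have hd₁ : ∀ t ∈ Icc 0 s, fderiv ℝ (fun z => pullField I ψ X₁ (t, z)) z₀ = M₁ := fun t ht => by
    rw [hM₁]
    refine Filter.EventuallyEq.fderiv_eq ?_
    filter_upwards [h.isOpen.mem_nhds hU] with z hz
    rw [h.pullField_self hX₁ (h.Icc_subset ht) hz]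
    exact h.pullField_end X₁ hz
  obtain ⟨L, hL⟩ := exists_firstVariation hs c₁ c₂
  obtain ⟨B, hB⟩ := exists_secondVariation hs c₁ c₂ e₁ e₂
  obtain ⟨h0, hT⟩ := h.hasTaylorExpansion hX₁ hX₂ hz₀ rfl rfl rfl rfl hL hB
  have hδ : ∀ v : L2 s × L2 s, ∀ t ∈ Icc 0 s,
      controlIntegral v (fun t => pullField I ψ X₁ (t, z₀)) (fun t => pullField I ψ X₂ (t, z₀)) t =
        controlIntegral v (fun _ => x₁) g t := fun v t ht => by
    rw [hg]
    exact controlIntegral_congr v ht hf₁ fun _ _ => rfl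
  refine ⟨by rw [hD₂]; exact e₂, L, B, h0, hT, fun v => by rw [hL, hδ v s hss], fun v v' => ?_⟩
  rw [hB]
  congr 1
  · refine controlIntegral_congr v hss (fun t ht => ?_) fun t ht => ?_
    · rw [hd₁ t ht, hδ v' t ht]
    · rw [hδ v' t ht, hD₂]
  · refine controlIntegral_congr v' hss (fun t ht => ?_) fun t ht => ?_
    · rw [hd₁ t ht, hδ v t ht]
    · rw [hδ v t ht, hD₂]

/-- Conjugate points and strict singularity in terms of the coefficients of `g_t^s`. -/
theorem IsEndTube.conjugate_iff (hE : IsRegularEngel I X₁ X₂ β α₀ α₁)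
    (h : IsEndTube I X₁ γ s δ U ψ) {e : ℝ → ℝ}
    (he : ∀ t ∈ Icc 0 s, HasDerivAt e (-α₁ (γ t) * e t) t) (he₀ : ∀ t, e t ≠ 0) :
    ∃ A B C a b c : ℝ → ℝ,
      IsJacobi s (fun t => β (γ t)) (fun t => α₀ (γ t)) (fun t => α₁ (γ t)) A B C a b c ∧
      (∀ t ∈ Icc 0 s, (gField I X₁ X₂ s t (γ s) : E) =
        A t • (X₁ (γ s) : E) + B t • (X₂ (γ s) : E) +
          C t • (VectorField.mlieBracket I X₁ X₂ (γ s) : E)) ∧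
      (IsConjugate I (endpointMap I X₁ X₂ (γ 0) s) ↔ C 0 = 0) ∧
      (IsStrictlySingular I X₁ X₂ (γ 0) s ↔ ∃ t ∈ Icc 0 s, a t ≠ 0) ∧
      ((∃ t ∈ Icc 0 s, a t ≠ 0) →
        (IsConjugate (I.prod 𝓘(ℝ, ℝ)) (extendedEndpointMap I X₁ X₂ (γ 0) s) ↔
          C 0 * (∫ t in (0 : ℝ)..s, β (γ t) * e t * A t) -
            A 0 * (∫ t in (0 : ℝ)..s, β (γ t) * e t * C t) = 0)) := by
  have := FiniteDimensional.complete ℝ E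
  have hM : IsManifold I 2 M := IsManifold.of_le (n := ∞) two_le_infty
  have hs := h.s_pos
  have hss : s ∈ Icc 0 s := ⟨hs.le, le_rfl⟩
  have hX₁ := hE.smooth_X₁
  have hX₂ := hE.smooth_X₂
  have hX₃ := contMDiff_mlieBracket hX₁ hX₂
  obtain ⟨A, B, C, a, b, c, hJ, hg, hξD⟩ := h.exists_jacobi hE
  refine ⟨A, B, C, a, b, c, hJ, fun t ht => (h.gField_eq hX₁ ht).trans (hg t ht), ?_⟩
  obtain ⟨x₁, hx₁⟩ : ∃ x : E, x = X₁ (γ s) := ⟨_, rfl⟩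
  obtain ⟨x₂, hx₂⟩ : ∃ x : E, x = X₂ (γ s) := ⟨_, rfl⟩
  obtain ⟨x₃, hx₃⟩ : ∃ x : E, x = VectorField.mlieBracket I X₁ X₂ (γ s) := ⟨_, rfl⟩
  obtain ⟨y, hy⟩ : ∃ x : E, x = VectorField.mlieBracket I (VectorField.mlieBracket I X₁ X₂) X₂ (γ s) :=
    ⟨_, rfl⟩
  obtain ⟨z₀, hz₀⟩ : ∃ z : E, z = extChartAt I (γ s) (γ s) := ⟨_, rfl⟩
  obtain ⟨M₁, hM₁⟩ : ∃ L : E →L[ℝ] E, L = fderiv ℝ (chartField I (γ s) X₁) z₀ := ⟨_, rfl⟩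
  obtain ⟨M₂, hM₂⟩ : ∃ L : E →L[ℝ] E, L = fderiv ℝ (chartField I (γ s) X₂) z₀ := ⟨_, rfl⟩
  obtain ⟨M₃, hM₃⟩ : ∃ L : E →L[ℝ] E,
      L = fderiv ℝ (chartField I (γ s) (VectorField.mlieBracket I X₁ X₂)) z₀ := ⟨_, rfl⟩
  obtain ⟨g, hgd⟩ : ∃ g : ℝ → E, g = fun t => pullField I ψ X₂ (t, z₀) := ⟨_, rfl⟩
  obtain ⟨D₂, hD₂⟩ : ∃ D₂ : ℝ → E →L[ℝ] E,
      D₂ = fun t => fderiv ℝ (fun z => pullField I ψ X₂ (t, z)) z₀ := ⟨_, rfl⟩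
  have hind : LinearIndependent ℝ ![x₁, x₂, x₃] := by
    rw [hx₁, hx₂, hx₃]; exact hE.independent (γ s)
  have hyS : y ∉ Submodule.span ℝ {x₁, x₂, x₃} := by
    rw [hx₁, hx₂, hx₃, hy]; exact hE.transversal (γ s)
  have hgx : ∀ t ∈ Icc 0 s, g t = A t • x₁ + B t • x₂ + C t • x₃ := fun t ht => by
    rw [hgd, hz₀, hx₁, hx₂, hx₃]; exact hg t ht
  -- The coordinate formula [Y, Z] = DZ(Y) − DY(Z) at the centre of the chart, where fields agree
  -- with their readings in the chart.
  have hbr : ∀ {Y Z : (x : M) → TangentSpace I x},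
      ContMDiff I I.tangent ∞ (fun x => (⟨x, Y x⟩ : TangentBundle I M)) →
      ContMDiff I I.tangent ∞ (fun x => (⟨x, Z x⟩ : TangentBundle I M)) → ∀ {p q w : E},
      p = Y (γ s) → q = Z (γ s) → w = VectorField.mlieBracket I Y Z (γ s) →
      fderiv ℝ (chartField I (γ s) Z) z₀ p - fderiv ℝ (chartField I (γ s) Y) z₀ q = w := by
    intro Y Z hY hZ p q w hp hq hw
    have e1 := chartField_mlieBracket (γ s) hY hZ (mem_extChartAt_target (I := I) (γ s))
    have e2 := (chartField_self (γ s) (VectorField.mlieBracket I Y Z)).symm.trans e1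
    have e3 : (Y (γ s) : E) = chartField I (γ s) Y z₀ := by
      rw [hz₀]; exact (chartField_self (γ s) Y).symm
    have e4 : (Z (γ s) : E) = chartField I (γ s) Z z₀ := by
      rw [hz₀]; exact (chartField_self (γ s) Z).symm
    rw [hw, hp.trans e3, hq.trans e4]
    refine Eq.trans ?_ e2.symm
    rw [VectorField.lieBracket_eq, hz₀]
  have h₁₂ : M₂ x₁ - M₁ x₂ = x₃ := by rw [hM₁, hM₂]; exact hbr hX₁ hX₂ hx₁ hx₂ hx₃
  have h₁₃ : M₃ x₁ - M₁ x₃ = β (γ s) • x₁ + α₀ (γ s) • x₂ + α₁ (γ s) • x₃ := by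
    rw [hM₁, hM₃]
    refine (hbr hX₁ hX₃ hx₁ hx₃ rfl).trans ?_
    rw [hx₁, hx₂, hx₃]
    exact hE.structure_eq (γ s)
  have h₃₂ : M₂ x₃ - M₃ x₂ = y := by rw [hM₂, hM₃]; exact hbr hX₃ hX₂ hx₃ hx₂ hy
  obtain ⟨hD₂c, L, BB, hend, hT, hL, hBB⟩ :=
    h.exists_expansion hX₁ hX₂ hz₀ hx₁ hM₁ hgd hD₂
  have hξD' : ∀ ξ : E →L[ℝ] ℝ, ξ x₁ = 0 → ξ x₂ = 0 → ξ x₃ = 0 → ∀ t ∈ Icc 0 s, ∀ w,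
      ξ (D₂ t w) = A t * ξ (M₁ w) + B t * ξ (M₂ w) + C t * ξ (M₃ w) := by
    intro ξ e1 e2 e3 t ht w
    rw [hx₁] at e1
    rw [hx₂] at e2
    rw [hx₃] at e3
    have := hξD ξ e1 e2 e3 t ht w
    rw [← hz₀] at this
    rw [hD₂, hM₁, hM₂, hM₃]
    exact this
  obtain ⟨⟨ξ₀, hξ₀, k1, k2, k3⟩, hκ⟩ := exists_annihilator hE.dim hind hyS
  obtain ⟨T, hTop⟩ := hJ.exists_operator hs
  obtain ⟨D, hD, hDL⟩ := hJ.exists_extension x₁ x₂ x₃ hs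
  have hDL' : ∀ v z, Represents v z → D z = L v := fun v z hz => by
    rw [hL]; exact hDL g hgx v z hz
  let π₃ := (ContinuousLinearMap.snd ℝ ℝ (L2 s)).comp (ContinuousLinearMap.snd ℝ (L2 s) (ℝ × L2 s))
  obtain ⟨q, hq⟩ : ∃ q : CompletedControl s →L[ℝ] CompletedControl s →L[ℝ] ℝ,
      ∀ z z', q z z' = inner ℝ (T z.2.2) z'.2.2 :=
    ⟨(innerSL ℝ (E := L2 s)).bilinearComp (T.comp π₃) π₃, fun z z' => rfl⟩
  have hLv : ∀ v : L2 s × L2 s, L v = ((∫ t in (0 : ℝ)..s, v.1 t) + ∫ t in (0 : ℝ)..s, v.2 t * A t) • x₁ +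
      (∫ t in (0 : ℝ)..s, v.2 t * B t) • x₂ + (∫ t in (0 : ℝ)..s, v.2 t * C t) • x₃ := fun v => by
    rw [hL, hJ.controlIntegral_eq hgx v hss, intervalIntegral.integral_add
      (L2.intervalIntegrable hs.le v.1)
      (intervalIntegrable_mul' hs.le (continuousOn_of_hasDerivAt hJ.deriv_A) v.2)]
  have hann : ∀ (ξ : E →L[ℝ] ℝ) (ξ' : ℝ), (∀ v, ξ (L v) + ξ' * (∫ t in (0 : ℝ)..s, v.1 t) = 0) →
      ξ x₁ + ξ' = 0 ∧ ξ x₂ = 0 ∧ ξ x₃ = 0 ∧ ∀ t ∈ Icc 0 s, a t * ξ x₁ = 0 := by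
    intro ξ ξ' hξ
    refine hJ.annihilator hs fun v => ?_
    have h1 := hξ v
    have iA := intervalIntegrable_mul' hs.le (continuousOn_of_hasDerivAt hJ.deriv_A) v.2
    have iB := intervalIntegrable_mul' hs.le (continuousOn_of_hasDerivAt hJ.deriv_B) v.2
    have iC := intervalIntegrable_mul' hs.le (continuousOn_of_hasDerivAt hJ.deriv_C) v.2
    have h2 : ∫ t in (0 : ℝ)..s, v.2 t * (A t * ξ x₁ + B t * ξ x₂ + C t * ξ x₃) =
        (∫ t in (0 : ℝ)..s, v.2 t * A t) * ξ x₁ + (∫ t in (0 : ℝ)..s, v.2 t * B t) * ξ x₂ +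
          (∫ t in (0 : ℝ)..s, v.2 t * C t) * ξ x₃ := by
      rw [← intervalIntegral.integral_mul_const, ← intervalIntegral.integral_mul_const,
        ← intervalIntegral.integral_mul_const, ← intervalIntegral.integral_add
          (iA.mul_const _) (iB.mul_const _), ← intervalIntegral.integral_add
          ((iA.mul_const _).add (iB.mul_const _)) (iC.mul_const _)]
      exact intervalIntegral.integral_congr fun t _ => by ring
    rw [hLv] at h1
    simp only [map_add, map_smul, smul_eq_mul] at h1
    rw [h2]
    linear_combination h1
  have hkill : ∀ ξ : E →L[ℝ] ℝ, ξ x₁ = 0 → ξ x₂ = 0 → ξ x₃ = 0 → ∀ v, ξ (L v) = 0 := by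
    intro ξ e1 e2 e3 v
    rw [hLv]
    simp [e1, e2, e3]
  have hhess : ∀ ξ : E →L[ℝ] ℝ, ξ x₁ = 0 → ξ x₂ = 0 → ξ x₃ = 0 → ∀ v v' z z', Represents v z →
      Represents v' z' → D z = 0 → ξ (BB v v') = -ξ y * q z z' := by
    intro ξ e1 e2 e3 v v' z z' hz hz' hDz
    rw [hBB, hq]
    exact hJ.hessian_eq hs hind hgx hD₂c e1 e2 e3 (hξD' ξ e1 e2 e3) h₁₂ h₁₃ h₃₂ hTop hz hz'
      (by rw [← hL, ← hDL' v z hz, hDz])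
  have hDiff : ∀ z, D z = 0 ↔ ∫ t in (0 : ℝ)..s, z.1 t = innerSL ℝ (toL2 a hJ.continuousOn_a) z.2.2 ∧
      z.2.1 = innerSL ℝ (toL2 b hJ.continuousOn_b) z.2.2 ∧
      z.2.2 ∈ (Submodule.span ℝ {toL2 c hJ.continuousOn_c})ᗮ := by
    intro z
    rw [hD, Submodule.mem_orthogonal_singleton_iff_inner_right, innerSL_apply_apply,
      innerSL_apply_apply]
    constructor
    · intro h0
      obtain ⟨e1, e2, e3⟩ := eq_zero_of_triple hind h0
      exact ⟨sub_eq_zero.1 e1, sub_eq_zero.1 e2, neg_eq_zero.1 e3⟩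
    · rintro ⟨e1, e2, e3⟩
      rw [e1, e2, e3]
      simp
  refine ⟨?_, ?_, fun ha => ?_⟩
  · rw [isConjugate_iff_form hs hT hDL' (q := q) ?_ ⟨ξ₀, hξ₀, hkill ξ₀ k1 k2 k3⟩,
      meanZero_ssubset_iff hs hDiff hq]
    · exact hJ.exists_kernel_iff hs he he₀ hTop
    · intro ξ hξ hξL
      obtain ⟨e1, e2, e3, -⟩ := hann ξ 0 fun v => by rw [hξL v]; simp
      rw [add_zero] at e1
      exact ⟨-ξ y, neg_ne_zero.2 (hκ ξ hξ e1 e2 e3), fun v v' z z' hz hz' hDz _ =>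
        hhess ξ e1 e2 e3 v v' z z' hz hz' hDz⟩
  · obtain ⟨L', B', hT', hL', -⟩ := hT.extended hs.le
    have hmf := hT'.hasMFDerivAt.mfderiv
    have hsing : IsStrictlySingular I X₁ X₂ (γ 0) s ↔ ∀ ξ : E × ℝ →L[ℝ] ℝ, (∀ v, ξ (L' v) = 0) →
        ∀ r : ℝ, ξ (0, r) = 0 := by
      unfold IsStrictlySingular
      rw [hmf]
      rfl
    rw [hsing]
    have hsplit : ∀ (ξ : E × ℝ →L[ℝ] ℝ) v, ξ (L' v) =
        ξ.comp (ContinuousLinearMap.inl ℝ E ℝ) (L v) + ξ (0, 1) * ∫ t in (0 : ℝ)..s, v.1 t := by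
      intro ξ v
      rw [hL', mul_comm, ← smul_eq_mul, ← map_smul, ContinuousLinearMap.comp_apply, ← map_add]
      simp
    constructor
    · intro hst
      -- If a ≡ 0 then A ≡ 0, and the X₁-component of the first variation is ∫ v₁, which is also the
      -- differential of the energy. The difference of the two coordinates then annihilates the
      -- image with a nonzero energy component.
      by_contra! ha
      have hA := hJ.A_eq_zero hs ha
      obtain ⟨φ, hφ⟩ := exists_dual_triple hind
      have p1 : φ 0 x₁ = 1 := hφ 0 0
      have p2 : φ 0 x₂ = 0 := hφ 0 1
      have p3 : φ 0 x₃ = 0 := hφ 0 2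
      have := hst ((φ 0).comp (ContinuousLinearMap.fst ℝ E ℝ) - ContinuousLinearMap.snd ℝ E ℝ)
        (fun v => ?_) 1
      · simp at this
      · have h0 : ∫ t in (0 : ℝ)..s, v.2 t * A t = 0 := by
          refine Eq.trans (intervalIntegral.integral_congr fun t ht => ?_)
            intervalIntegral.integral_zero
          rw [uIcc_of_le hs.le] at ht
          simp [hA t ht]
        rw [hL']
        show φ 0 (L v) - _ = 0
        rw [hLv, h0]
        simp [p1, p2, p3]
    · rintro ⟨t, ht, hat⟩ ξ hξ r
      obtain ⟨e1, -, -, e4⟩ := hann (ξ.comp (ContinuousLinearMap.inl ℝ E ℝ)) (ξ (0, 1))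
        fun v => by rw [← hsplit, hξ]
      have e5 := (mul_eq_zero.1 (e4 t ht)).resolve_left hat
      rw [e5, zero_add] at e1
      have : ((0 : E), r) = r • ((0 : E), (1 : ℝ)) := by simp
      rw [this, map_smul, e1, smul_zero]
  · obtain ⟨L', B', hT', hL', hB'⟩ := hT.extended hs.le
    obtain ⟨m, hm⟩ : ∃ m : L2 s →L[ℝ] ℝ, ∀ u, m u = ∫ t in (0 : ℝ)..s, u t :=
      ⟨innerSL ℝ (toL2 (fun _ => 1) continuousOn_const), fun u => by
        rw [innerSL_apply_apply, inner_toL2 hs.le]; simp⟩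
    obtain ⟨D', hD'⟩ : ∃ D' : CompletedControl s →L[ℝ] E × ℝ,
        ∀ z, D' z = (D z, ∫ t in (0 : ℝ)..s, z.1 t) :=
      ⟨D.prod (m.comp (ContinuousLinearMap.fst ℝ (L2 s) (ℝ × L2 s))), fun z => by rw [← hm]; rfl⟩
    have hD'L : ∀ v z, Represents v z → D' z = L' v := fun v z hz => by
      rw [hD', hL', hDL' v z hz, hz.1]
    -- On `ker D` the mean of v₁ equals ⟨a, w⟩, so the extra condition from the energy, mean zero,
    -- says that w ⟂ a.
    have hD'iff : ∀ z, D' z = 0 ↔ ∫ t in (0 : ℝ)..s, z.1 t = (0 : L2 s →L[ℝ] ℝ) z.2.2 ∧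
        z.2.1 = innerSL ℝ (toL2 b hJ.continuousOn_b) z.2.2 ∧
        z.2.2 ∈ (Submodule.span ℝ {toL2 c hJ.continuousOn_c} ⊔
          Submodule.span ℝ {toL2 a hJ.continuousOn_a})ᗮ := by
      intro z
      rw [hD', Prod.mk_eq_zero, hDiff, ← Submodule.inf_orthogonal, Submodule.mem_inf,
        Submodule.mem_orthogonal_singleton_iff_inner_right (u := toL2 a hJ.continuousOn_a),
        innerSL_apply_apply]
      constructor
      · rintro ⟨⟨e1, e2, e3⟩, e4⟩
        exact ⟨e4, e2, e3, by rw [← e1, e4]⟩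
      · rintro ⟨e4, e2, e3, e1⟩
        exact ⟨⟨by rw [e1]; exact e4, e2, e3⟩, e4⟩
    -- A nonzero value of `a` forces ξ x₁ = 0, and with it the energy component of ξ vanishes; ξ
    -- reduces to a covector on `E` that kills the frame.
    have hcomp : ∀ ξ : E × ℝ →L[ℝ] ℝ, (∀ v, ξ (L' v) = 0) → ξ (0, 1) = 0 ∧
        ξ.comp (ContinuousLinearMap.inl ℝ E ℝ) x₁ = 0 ∧
        ξ.comp (ContinuousLinearMap.inl ℝ E ℝ) x₂ = 0 ∧
        ξ.comp (ContinuousLinearMap.inl ℝ E ℝ) x₃ = 0 ∧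
        ∀ p : E × ℝ, ξ p = ξ.comp (ContinuousLinearMap.inl ℝ E ℝ) p.1 := by
      intro ξ hξ
      obtain ⟨t, ht, hat⟩ := ha
      obtain ⟨e1, e2, e3, e4⟩ := hann (ξ.comp (ContinuousLinearMap.inl ℝ E ℝ)) (ξ (0, 1)) fun v => by
        refine Eq.trans ?_ (hξ v)
        rw [hL', mul_comm, ← smul_eq_mul, ← map_smul, ContinuousLinearMap.comp_apply, ← map_add]
        simp
      have e5 := (mul_eq_zero.1 (e4 t ht)).resolve_left hat
      rw [e5, zero_add] at e1
      refine ⟨e1, e5, e2, e3, fun p => ?_⟩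
      have : p = (p.1, 0) + p.2 • ((0 : E), (1 : ℝ)) := by simp
      conv_lhs => rw [this, map_add, map_smul, e1, smul_zero, add_zero]
      rfl
    rw [isConjugate_iff_form hs hT' hD'L (q := q) ?_
      ⟨ξ₀.comp (ContinuousLinearMap.fst ℝ E ℝ), ?_, ?_⟩, meanZero_ssubset_iff hs hD'iff hq]
    · exact hJ.exists_extended_kernel_iff hs he he₀ hTop ha
    · intro ξ hξ hξL
      obtain ⟨e0, e1, e2, e3, hfac⟩ := hcomp ξ hξL
      refine ⟨-ξ.comp (ContinuousLinearMap.inl ℝ E ℝ) y, neg_ne_zero.2 (hκ _ (fun h0 => hξ ?_) e1 e2 e3),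
        fun v v' z z' hz hz' hDz _ => ?_⟩
      · refine ContinuousLinearMap.ext fun p => ?_
        rw [hfac, h0]; rfl
      · rw [hfac, hB']
        rw [hD'] at hDz
        exact hhess _ e1 e2 e3 v v' z z' hz hz' (congrArg Prod.fst hDz)
    · intro h0
      refine hξ₀ (ContinuousLinearMap.ext fun w => ?_)
      exact DFunLike.congr_fun h0 (w, (0 : ℝ))
    · intro v
      rw [hL']
      exact hkill ξ₀ k1 k2 k3 v

end Extended

/-! ### Conjugate points and wedge products -/

section Wedge

variable {E : Type*} [NormedAddCommGroup E] [NormedSpace ℝ E]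

/-- The determinant composed with functionals dual to `x` is an alternating form with value `N.det`
on `v`, so it detects the wedge. Conversely, a relation between the rows of `N` is a relation
between the vectors. -/
theorem ιMulti_eq_zero_iff_det [FiniteDimensional ℝ E] {x v : Fin 3 → E}
    (hx : LinearIndependent ℝ x) {N : Matrix (Fin 3) (Fin 3) ℝ}
    (hv : ∀ i, v i = N i 0 • x 0 + N i 1 • x 1 + N i 2 • x 2) :
    exteriorPower.ιMulti ℝ 3 v = 0 ↔ N.det = 0 := by
  constructor
  · intro h
    obtain ⟨φ, hφ⟩ := exists_dual_triple hx
    let f : E [⋀^Fin 3]→ₗ[ℝ] ℝ := Matrix.detRowAlternating.compLinearMap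
      (LinearMap.pi fun j => (φ j : E →ₗ[ℝ] ℝ))
    have h1 : f v = 0 := by
      rw [← exteriorPower.alternatingMapLinearEquiv_apply_ιMulti f v, h, map_zero]
    have h2 : f v = N.det := by
      show Matrix.det (fun i j => φ j (v i)) = N.det
      congr 1
      ext i j
      rw [hv i]
      simp only [map_add, map_smul, hφ, smul_eq_mul]
      fin_cases j <;> simp
    rw [← h2, h1]
  · intro h
    obtain ⟨u, hu, huN⟩ := Matrix.exists_vecMul_eq_zero_iff.2 h
    refine AlternatingMap.map_linearDependent _ v fun hli => hu ?_
    have h3 := fun j => congrFun huN j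
    simp only [Matrix.vecMul, dotProduct, Fin.sum_univ_three, Pi.zero_apply] at h3
    have h4 := Fintype.linearIndependent_iff.1 hli u (by
      rw [Fin.sum_univ_three, hv, hv, hv]
      have e : u 0 • (N 0 0 • x 0 + N 0 1 • x 1 + N 0 2 • x 2) +
          u 1 • (N 1 0 • x 0 + N 1 1 • x 1 + N 1 2 • x 2) +
          u 2 • (N 2 0 • x 0 + N 2 1 • x 1 + N 2 2 • x 2) =
          (u 0 * N 0 0 + u 1 * N 1 0 + u 2 * N 2 0) • x 0 +
          (u 0 * N 0 1 + u 1 * N 1 1 + u 2 * N 2 1) • x 1 +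
          (u 0 * N 0 2 + u 1 * N 1 2 + u 2 * N 2 2) • x 2 := by module
      rw [e, h3, h3, h3]
      simp)
    exact funext h4

variable {H : Type*} [TopologicalSpace H] {I : ModelWithCorners ℝ E H}
  {M : Type*} [TopologicalSpace M] [ChartedSpace H M]
  {X₁ X₂ : (x : M) → TangentSpace I x} {γ : ℝ → M} {s : ℝ}
  {β α₀ α₁ : M → ℝ} [IsManifold I ∞ M] [I.Boundaryless] [T2Space M]

omit [IsManifold I ∞ M] [I.Boundaryless] [T2Space M] in
-- The tangent space is `E` by definition but carries another type; this passes from one form of the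
-- wedge to the other.
theorem ιMulti_tangentSpace_iff {p : M} {u v w : TangentSpace I p} {u' v' w' : E} (hu : u' = u)
    (hv : v' = v) (hw : w' = w) :
    exteriorPower.ιMulti ℝ 3 ![u, v, w] = 0 ↔ exteriorPower.ιMulti ℝ 3 ![u', v', w'] = 0 := by
  subst hu hv hw
  exact Iff.rfl

/-- Conjugate points along an integral curve of `X₁` in terms of a Jacobi frame. -/
theorem exists_jacobi_conjugate (hE : IsRegularEngel I X₁ X₂ β α₀ α₁) (hs : 0 < s)
    (hγ : IsMIntegralCurveOn (I := I) γ X₁ (Icc 0 s)) :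
    ∃ A B C a b c e : ℝ → ℝ,
      IsJacobi s (fun t => β (γ t)) (fun t => α₀ (γ t)) (fun t => α₁ (γ t)) A B C a b c ∧
      (∀ t ∈ Icc 0 s, HasDerivAt e (-α₁ (γ t) * e t) t) ∧
      (∀ t ∈ Icc 0 s, e t = Real.exp (-∫ τ in (0 : ℝ)..t, α₁ (γ τ))) ∧
      (∀ t ∈ Icc 0 s, (gField I X₁ X₂ s t (γ s) : E) =
        A t • (X₁ (γ s) : E) + B t • (X₂ (γ s) : E) +
          C t • (VectorField.mlieBracket I X₁ X₂ (γ s) : E)) ∧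
      (IsConjugate I (endpointMap I X₁ X₂ (γ 0) s) ↔ C 0 = 0) ∧
      (IsStrictlySingular I X₁ X₂ (γ 0) s ↔ ∃ t ∈ Icc 0 s, a t ≠ 0) ∧
      (IsStrictlySingular I X₁ X₂ (γ 0) s →
        (IsConjugate (I.prod 𝓘(ℝ, ℝ)) (extendedEndpointMap I X₁ X₂ (γ 0) s) ↔
          C 0 * (∫ t in (0 : ℝ)..s, β (γ t) * e t * A t) -
            A 0 * (∫ t in (0 : ℝ)..s, β (γ t) * e t * C t) = 0)) := by
  have : FiniteDimensional ℝ E := FiniteDimensional.of_finrank_pos (by rw [hE.dim]; norm_num)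
  obtain ⟨δ, hδ, U, hU, hUo, hmem, ψ, htube, hend, hcurve⟩ :=
    exists_flowTube hE.smooth_X₁ (n := 3) (by norm_num) hs.le hγ
  have h : IsEndTube I X₁ γ s δ U ψ := ⟨hs, hδ, hUo, hU, hmem, htube, hend, hcurve⟩
  obtain ⟨F, hF⟩ := exists_antiderivative hs.le (h.continuousOn_comp hE.smooth_α₁)
  have he : ∀ t ∈ Icc 0 s, HasDerivAt (fun t => Real.exp (-F t)) (-α₁ (γ t) * Real.exp (-F t)) t :=
    fun t ht => ((hF t ht).1.neg.exp).congr_deriv (by simp only [Pi.neg_apply]; ring)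
  obtain ⟨A, B, C, a, b, c, hJ, hg, h1, h2, h3⟩ := h.conjugate_iff hE he fun t => (Real.exp_pos _).ne'
  exact ⟨A, B, C, a, b, c, _, hJ, he, fun t ht => by rw [(hF t ht).2], hg, h1, h2,
    fun hst => h3 (h2.1 hst)⟩

theorem conjugate_iff_wedge (hE : IsRegularEngel I X₁ X₂ β α₀ α₁) (hs : 0 < s)
    (hγ : IsMIntegralCurveOn (I := I) γ X₁ (Icc 0 s)) :
    (IsConjugate I (endpointMap I X₁ X₂ (γ 0) s) ↔
      exteriorPower.ιMulti ℝ 3 ![X₁ (γ s), X₂ (γ s), gField I X₁ X₂ s 0 (γ s)] = 0) ∧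
    (IsStrictlySingular I X₁ X₂ (γ 0) s →
      (IsConjugate (I.prod 𝓘(ℝ, ℝ)) (extendedEndpointMap I X₁ X₂ (γ 0) s) ↔
        exteriorPower.ιMulti ℝ 3
          ![X₂ (γ s), gField I X₁ X₂ s 0 (γ s), weightedIntegral I X₁ X₂ β α₁ γ s] = 0)) := by
  have : FiniteDimensional ℝ E := FiniteDimensional.of_finrank_pos (by rw [hE.dim]; norm_num)
  have := FiniteDimensional.complete ℝ E
  have h0s : (0 : ℝ) ∈ Icc 0 s := ⟨le_rfl, hs.le⟩
  obtain ⟨A, B, C, a, b, c, e, hJ, he, hexp, hg, h1, -, h3⟩ := exists_jacobi_conjugate hE hs hγ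
  obtain ⟨x₁, hx₁⟩ : ∃ x : E, x = X₁ (γ s) := ⟨_, rfl⟩
  obtain ⟨x₂, hx₂⟩ : ∃ x : E, x = X₂ (γ s) := ⟨_, rfl⟩
  obtain ⟨x₃, hx₃⟩ : ∃ x : E, x = VectorField.mlieBracket I X₁ X₂ (γ s) := ⟨_, rfl⟩
  obtain ⟨g, hgd⟩ : ∃ g : ℝ → E, g = fun t => gField I X₁ X₂ s t (γ s) := ⟨_, rfl⟩
  obtain ⟨W, hW⟩ : ∃ W : E, W = weightedIntegral I X₁ X₂ β α₁ γ s := ⟨_, rfl⟩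
  have hind : LinearIndependent ℝ ![x₁, x₂, x₃] := by
    rw [hx₁, hx₂, hx₃]; exact hE.independent (γ s)
  have hgx : ∀ t ∈ Icc 0 s, g t = A t • x₁ + B t • x₂ + C t • x₃ := fun t ht => by
    rw [hgd, hx₁, hx₂, hx₃]; exact hg t ht
  have cβ := hJ.cont_β.mul (continuousOn_of_hasDerivAt he)
  have hi : ∀ {F f : ℝ → ℝ}, (∀ t ∈ Icc 0 s, HasDerivAt F (f t) t) → ∀ x : E,
      IntervalIntegrable (fun t => (β (γ t) * e t * F t) • x) volume 0 s := fun hF x =>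
    ContinuousOn.intervalIntegrable (by
      rw [uIcc_of_le hs.le]
      exact (cβ.mul (continuousOn_of_hasDerivAt hF)).smul continuousOn_const)
  have hWx : W = (∫ t in (0 : ℝ)..s, β (γ t) * e t * A t) • x₁ +
      (∫ t in (0 : ℝ)..s, β (γ t) * e t * B t) • x₂ +
      (∫ t in (0 : ℝ)..s, β (γ t) * e t * C t) • x₃ := by
    have i₁ := hi hJ.deriv_A x₁
    have i₂ := hi hJ.deriv_B x₂
    have i₃ := hi hJ.deriv_C x₃
    rw [← intervalIntegral.integral_smul_const, ← intervalIntegral.integral_smul_const,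
      ← intervalIntegral.integral_smul_const, ← intervalIntegral.integral_add i₁ i₂,
      ← intervalIntegral.integral_add (i₁.add i₂) i₃]
    have hW' : W = ∫ t in (0 : ℝ)..s,
        (β (γ t) * Real.exp (-∫ τ in (0 : ℝ)..t, α₁ (γ τ))) • g t := by rw [hW, hgd]; rfl
    rw [hW']
    refine intervalIntegral.integral_congr fun t ht => ?_
    rw [uIcc_of_le hs.le] at ht
    simp only [hgx t ht, ← hexp t ht]
    module
  have e₁ : exteriorPower.ιMulti ℝ 3 ![X₁ (γ s), X₂ (γ s), gField I X₁ X₂ s 0 (γ s)] = 0 ↔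
      exteriorPower.ιMulti ℝ 3 ![x₁, x₂, g 0] = 0 := by
    rw [hgd]; exact ιMulti_tangentSpace_iff hx₁ hx₂ rfl
  have e₂ : exteriorPower.ιMulti ℝ 3
      ![X₂ (γ s), gField I X₁ X₂ s 0 (γ s), weightedIntegral I X₁ X₂ β α₁ γ s] = 0 ↔
      exteriorPower.ιMulti ℝ 3 ![x₂, g 0, W] = 0 := by
    rw [hgd]; exact ιMulti_tangentSpace_iff hx₂ rfl hW
  rw [e₁, e₂]
  refine ⟨h1.trans ?_, fun hst => (h3 hst).trans ?_⟩
  · rw [ιMulti_eq_zero_iff_det hind (N := !![1, 0, 0; 0, 1, 0; A 0, B 0, C 0]) fun i => by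
      fin_cases i <;> simp [hgx 0 h0s]]
    simp [Matrix.det_fin_three]
  -- The rows are the frame coordinates of X₂, g₀ and the weighted integral. Because of the first
  -- row only their X₁- and [X₁,X₂]-coordinates matter, and these form the determinant of the kernel
  -- equations.
  · rw [ιMulti_eq_zero_iff_det hind (N := !![0, 1, 0; A 0, B 0, C 0;
      ∫ t in (0 : ℝ)..s, β (γ t) * e t * A t, ∫ t in (0 : ℝ)..s, β (γ t) * e t * B t,
      ∫ t in (0 : ℝ)..s, β (γ t) * e t * C t]) fun i => by
      fin_cases i <;> simp [hgx 0 h0s, hWx]]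
    simp [Matrix.det_fin_three]
    constructor <;> intro h <;> linarith

end Wedge

/-! ### Left-invariant fields in Cayley charts -/

section Rotations

theorem cayleyMatrix_zero : cayleyMatrix 0 = 1 := by
  ext i j
  fin_cases i <;> fin_cases j <;> simp [cayleyMatrix, cayleyNum, cayleyDen]

theorem cayleyInv_one : cayleyInv 1 = 0 := by
  rw [← cayleyMatrix_zero, cayleyInv_cayley]

/-- Along the line, the defining relation of the Cayley transform reads Q = 1 + (t/2)(â + â Q) with
â = `hat a`; its derivative at t = 0, where Q = 1, is â. -/
theorem hasDerivAt_cayleyMatrix_line (a : Fin 3 → ℝ) (i j : Fin 3) :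
    HasDerivAt (fun t : ℝ => cayleyMatrix (t • ((1 / 2 : ℝ) • a)) i j) (hat a i j) 0 := by
  have hline : HasDerivAt (fun t : ℝ => t • ((1 / 2 : ℝ) • a)) ((1 / 2 : ℝ) • a) 0 := by
    simpa using (hasDerivAt_id (0 : ℝ)).smul_const ((1 / 2 : ℝ) • a)
  have hC : ∀ i j, DifferentiableAt ℝ (fun t : ℝ => cayleyMatrix (t • ((1 / 2 : ℝ) • a)) i j) 0 :=
    fun i j => (((contDiff_cayleyMatrix i j).differentiable (by simp)) _).comp (0 : ℝ)
      hline.differentiableAt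
  have heq : ∀ t : ℝ, cayleyMatrix (t • ((1 / 2 : ℝ) • a)) i j = (1 : Matrix (Fin 3) (Fin 3) ℝ) i j +
      (t / 2) * (hat a i j + ∑ k, hat a i k * cayleyMatrix (t • ((1 / 2 : ℝ) • a)) k j) := by
    intro t
    have h := congrFun (congrFun (cayleyMatrix_spec (t • ((1 / 2 : ℝ) • a))) i) j
    have hh : hat (t • ((1 / 2 : ℝ) • a)) = (t / 2) • hat a := by
      ext i j
      fin_cases i <;> fin_cases j <;> simp [hat] <;> ring
    rw [hh, sub_mul, one_mul, Matrix.smul_mul] at h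
    simp only [Matrix.sub_apply, Matrix.add_apply, Matrix.smul_apply, smul_eq_mul,
      Matrix.mul_apply] at h
    linear_combination h
  have hS : DifferentiableAt ℝ
      (fun t : ℝ => hat a i j + ∑ k, hat a i k * cayleyMatrix (t • ((1 / 2 : ℝ) • a)) k j) 0 :=
    (differentiableAt_const _).add (DifferentiableAt.fun_sum fun k _ => (hC k j).const_mul _)
  have hd := (((hasDerivAt_id (0 : ℝ)).div_const 2).mul hS.hasDerivAt).const_add
    ((1 : Matrix (Fin 3) (Fin 3) ℝ) i j)
  refine (hd.congr_of_eventuallyEq (Eventually.of_forall heq)).congr_deriv ?_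
  simp [cayleyMatrix_zero, Matrix.one_apply]
  ring

/-- The left-invariant field `hat a` in a Cayley chart. -/
noncomputable def rotField (a b : Fin 3 → ℝ) : Fin 3 → ℝ :=
  ![(a 0 + (b 1 * a 2 - b 2 * a 1) + (a 0 * b 0 + a 1 * b 1 + a 2 * b 2) * b 0) / 2,
    (a 1 + (b 2 * a 0 - b 0 * a 2) + (a 0 * b 0 + a 1 * b 1 + a 2 * b 2) * b 1) / 2,
    (a 2 + (b 0 * a 1 - b 1 * a 0) + (a 0 * b 0 + a 1 * b 1 + a 2 * b 2) * b 2) / 2]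

/-- A left-invariant field has constant coordinates at the centre of each chart; seen from another
chart it becomes the polynomial (a + q × a + (a · q) q)/2. The quotient rule produces a polynomial
because 1 + trace equals 4 / `cayleyDen q`. -/
theorem hasDerivAt_transition_line (a q : Fin 3 → ℝ) :
    HasDerivAt (fun t : ℝ => cayleyInv (cayleyMatrix q * cayleyMatrix (t • ((1 / 2 : ℝ) • a))))
      (rotField a q) 0 := by
  have hent : ∀ i j, HasDerivAt
      (fun t : ℝ => (cayleyMatrix q * cayleyMatrix (t • ((1 / 2 : ℝ) • a))) i j)
      ((cayleyMatrix q * hat a) i j) 0 := by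
    intro i j
    simp only [Matrix.mul_apply]
    exact HasDerivAt.fun_sum fun k _ => (hasDerivAt_cayleyMatrix_line a k j).const_mul _
  have htr : HasDerivAt
      (fun t : ℝ => 1 + (cayleyMatrix q * cayleyMatrix (t • ((1 / 2 : ℝ) • a))).trace)
      (cayleyMatrix q * hat a).trace 0 := by
    simp only [Matrix.trace_fin_three]
    exact (((hent 0 0).add (hent 1 1)).add (hent 2 2)).const_add 1
  have hd := cayleyDen_pos q
  have h0 : cayleyMatrix q * cayleyMatrix ((0 : ℝ) • ((1 / 2 : ℝ) • a)) = cayleyMatrix q := by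
    rw [zero_smul, cayleyMatrix_zero, mul_one]
  have htr0 : 1 + (cayleyMatrix q * cayleyMatrix ((0 : ℝ) • ((1 / 2 : ℝ) • a))).trace ≠ 0 := by
    rw [h0, one_add_trace_cayley]; positivity
  have hmul : ∀ i j, (cayleyMatrix q * hat a) i j = (cayleyDen q)⁻¹ * (cayleyNum q * hat a) i j := by
    intro i j
    rw [cayleyMatrix, Matrix.smul_mul]; rfl
  have hsmul : ∀ i j, cayleyMatrix q i j = (cayleyDen q)⁻¹ * cayleyNum q i j := fun i j => rfl
  rw [hasDerivAt_pi]
  intro k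
  fin_cases k
  · refine (((hent 2 1).sub (hent 1 2)).div htr htr0).congr_deriv ?_
    simp only [Pi.sub_apply, h0]
    rw [one_add_trace_cayley]
    simp only [Matrix.trace_fin_three, hmul, hsmul]
    generalize cayleyDen q = d at hd ⊢
    have hd' := hd.ne'
    field_simp
    simp [Matrix.mul_apply, Fin.sum_univ_three, cayleyNum, hat, rotField]
    ring
  · refine (((hent 0 2).sub (hent 2 0)).div htr htr0).congr_deriv ?_
    simp only [Pi.sub_apply, h0]
    rw [one_add_trace_cayley]
    simp only [Matrix.trace_fin_three, hmul, hsmul]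
    generalize cayleyDen q = d at hd ⊢
    have hd' := hd.ne'
    field_simp
    simp [Matrix.mul_apply, Fin.sum_univ_three, cayleyNum, hat, rotField]
    ring
  · refine (((hent 1 0).sub (hent 0 1)).div htr htr0).congr_deriv ?_
    simp only [Pi.sub_apply, h0]
    rw [one_add_trace_cayley]
    simp only [Matrix.trace_fin_three, hmul, hsmul]
    generalize cayleyDen q = d at hd ⊢
    have hd' := hd.ne'
    field_simp
    simp [Matrix.mul_apply, Fin.sum_univ_three, cayleyNum, hat, rotField]
    ring

theorem differentiableAt_transition (q : Fin 3 → ℝ) :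
    DifferentiableAt ℝ (fun b => cayleyInv (cayleyMatrix q * cayleyMatrix b)) 0 := by
  have hent : ∀ i j, DifferentiableAt ℝ (fun b => (cayleyMatrix q * cayleyMatrix b) i j) 0 := by
    intro i j
    simp only [Matrix.mul_apply]
    exact DifferentiableAt.fun_sum fun k _ =>
      (((contDiff_cayleyMatrix k j).differentiable (by simp)) _).const_mul _
  have htr : DifferentiableAt ℝ (fun b => 1 + (cayleyMatrix q * cayleyMatrix b).trace) 0 := by
    simp only [Matrix.trace_fin_three]
    exact (differentiableAt_const _).add (((hent 0 0).add (hent 1 1)).add (hent 2 2))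
  have htr0 : 1 + (cayleyMatrix q * cayleyMatrix 0).trace ≠ 0 := by
    rw [cayleyMatrix_zero, mul_one, one_add_trace_cayley]
    have := cayleyDen_pos q
    positivity
  have hdiv : ∀ i j i' j', DifferentiableAt ℝ (fun b => ((cayleyMatrix q * cayleyMatrix b) i j -
      (cayleyMatrix q * cayleyMatrix b) i' j') /
        (1 + (cayleyMatrix q * cayleyMatrix b).trace)) 0 :=
    fun i j i' j' => by
      simp only [div_eq_mul_inv]
      exact ((hent i j).fun_sub (hent i' j')).fun_mul (htr.fun_inv htr0)
  rw [differentiableAt_pi]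
  intro k
  fin_cases k
  · exact hdiv 2 1 1 2
  · exact hdiv 0 2 2 0
  · exact hdiv 1 0 0 1

theorem fderiv_transition (a q : Fin 3 → ℝ) :
    fderiv ℝ (fun b => cayleyInv (cayleyMatrix q * cayleyMatrix b)) 0 ((1 / 2 : ℝ) • a) =
      rotField a q := by
  have hline : HasDerivAt (fun t : ℝ => t • ((1 / 2 : ℝ) • a)) ((1 / 2 : ℝ) • a) 0 := by
    simpa using (hasDerivAt_id (0 : ℝ)).smul_const ((1 / 2 : ℝ) • a)
  have h := (differentiableAt_transition q).hasFDerivAt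
  exact (HasFDerivAt.comp_hasDerivAt
    (l := fun b => cayleyInv (cayleyMatrix q * cayleyMatrix b)) (0 : ℝ)
    (by simpa using h) hline).unique (hasDerivAt_transition_line a q)

/-- A left-invariant field has constant coordinates in the preferred charts. -/
theorem mulInvariantVectorField_so3 (v : Fin 3 → ℝ) (g : SO3) :
    (mulInvariantVectorField (I := 𝓘(ℝ, Fin 3 → ℝ)) (G := SO3) v g : Fin 3 → ℝ) = v := by
  have hc : Continuous fun x : SO3 => g * x := by
    refine Continuous.subtype_mk ?_ _
    exact continuous_const.matrix_mul continuous_subtype_val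
  have hmain : HasMFDerivAt 𝓘(ℝ, Fin 3 → ℝ) 𝓘(ℝ, Fin 3 → ℝ) (fun x : SO3 => g * x) 1
      (ContinuousLinearMap.id ℝ (Fin 3 → ℝ)) := by
    refine ⟨hc.continuousAt, ?_⟩
    have hw : writtenInExtChartAt 𝓘(ℝ, Fin 3 → ℝ) 𝓘(ℝ, Fin 3 → ℝ) (1 : SO3) (fun x : SO3 => g * x) =
        id := by
      funext b
      change cayleyInv ((g * 1)⁻¹ * (g * (1 * cayley b)) : SO3).1 = b
      rw [mul_one, one_mul, inv_mul_cancel_left]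
      exact cayleyInv_cayley b
    rw [hw]
    exact hasFDerivWithinAt_id _ _
  exact congrArg (fun L : (Fin 3 → ℝ) →L[ℝ] (Fin 3 → ℝ) => L v) hmain.mfderiv

end Rotations

/-! ### Left-invariant fields on SO(3) × ℝ and their brackets. -/

section LeftInvariant

theorem leftInvariant_apply (a : Fin 3 → ℝ) (r : ℝ) (p : SO3 × ℝ) :
    (leftInvariant a r p : (Fin 3 → ℝ) × ℝ) = ((1 / 2 : ℝ) • a, r) :=
  congrArg (fun u : Fin 3 → ℝ => (u, r)) (mulInvariantVectorField_so3 ((1 / 2 : ℝ) • a) p.1)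

theorem extChartAt_so3_prod (p z : SO3 × ℝ) :
    extChartAt (𝓘(ℝ, Fin 3 → ℝ).prod 𝓘(ℝ, ℝ)) p z = (cayleyInv (p.1⁻¹ * z.1 : SO3).1, z.2) :=
  rfl

/-- A left-invariant field in the chart at `p`. -/
noncomputable def leftInvariantChart (a : Fin 3 → ℝ) (r : ℝ) (y : (Fin 3 → ℝ) × ℝ) :
    (Fin 3 → ℝ) × ℝ :=
  (rotField a y.1, r)

theorem contDiff_leftInvariantChart (a : Fin 3 → ℝ) (r : ℝ) :
    ContDiff ℝ ∞ (leftInvariantChart a r) := by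
  refine ContDiff.prodMk (contDiff_pi.2 fun k => ?_) contDiff_const
  fin_cases k <;> simp [rotField] <;> fun_prop

/-- All charts of SO(3) are left translates of one Cayley chart, so the change from the chart at `z`
to the chart at `p` is left multiplication by the rotation with coordinate `q`, and its derivative
is the one already computed. -/
theorem trivializationAt_leftInvariant (a : Fin 3 → ℝ) (r : ℝ) (p z : SO3 × ℝ)
    (hz : z ∈ (extChartAt (𝓘(ℝ, Fin 3 → ℝ).prod 𝓘(ℝ, ℝ)) p).source) :
    fderivWithin ℝ (extChartAt (𝓘(ℝ, Fin 3 → ℝ).prod 𝓘(ℝ, ℝ)) p ∘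
        (extChartAt (𝓘(ℝ, Fin 3 → ℝ).prod 𝓘(ℝ, ℝ)) z).symm)
      (range (𝓘(ℝ, Fin 3 → ℝ).prod 𝓘(ℝ, ℝ)))
      (extChartAt (𝓘(ℝ, Fin 3 → ℝ).prod 𝓘(ℝ, ℝ)) z z) ((1 / 2 : ℝ) • a, r) =
    leftInvariantChart a r (extChartAt (𝓘(ℝ, Fin 3 → ℝ).prod 𝓘(ℝ, ℝ)) p z) := by
  have hz' : 1 + (p.1⁻¹ * z.1 : SO3).1.trace ≠ 0 := by
    rw [extChartAt_source] at hz
    exact hz.1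
  have hq := cayley_cayleyInv _ hz'
  have hp : extChartAt (𝓘(ℝ, Fin 3 → ℝ).prod 𝓘(ℝ, ℝ)) z z = (0, z.2) := by
    rw [extChartAt_so3_prod, inv_mul_cancel]
    exact congrArg (fun u : Fin 3 → ℝ => (u, z.2)) cayleyInv_one
  set q := cayleyInv (p.1⁻¹ * z.1 : SO3).1 with hqdef
  have hfun : extChartAt (𝓘(ℝ, Fin 3 → ℝ).prod 𝓘(ℝ, ℝ)) p ∘
      (extChartAt (𝓘(ℝ, Fin 3 → ℝ).prod 𝓘(ℝ, ℝ)) z).symm =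
      fun y : (Fin 3 → ℝ) × ℝ => (cayleyInv (cayleyMatrix q * cayleyMatrix y.1), y.2) := by
    funext y
    change (cayleyInv (p.1⁻¹ * (z.1 * cayley y.1) : SO3).1, y.2) = _
    rw [← mul_assoc, ← hq]
    rfl
  rw [hfun, hp, ModelWithCorners.range_eq_univ, fderivWithin_univ]
  have h1 : HasFDerivAt (fun y : (Fin 3 → ℝ) × ℝ => cayleyInv (cayleyMatrix q * cayleyMatrix y.1))
      ((fderiv ℝ (fun b => cayleyInv (cayleyMatrix q * cayleyMatrix b)) 0).comp
        (ContinuousLinearMap.fst ℝ (Fin 3 → ℝ) ℝ)) (0, z.2) :=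
    HasFDerivAt.comp (g := fun b => cayleyInv (cayleyMatrix q * cayleyMatrix b)) (0, z.2)
      (differentiableAt_transition q).hasFDerivAt hasFDerivAt_fst
  rw [(h1.prodMk hasFDerivAt_snd).fderiv]
  exact congrArg (fun u : Fin 3 → ℝ => (u, r)) (fderiv_transition a q)

/-- In the trivialization at `p` the field is polynomial in the chart coordinates. -/
theorem contMDiff_leftInvariant (a : Fin 3 → ℝ) (r : ℝ) :
    ContMDiff (𝓘(ℝ, Fin 3 → ℝ).prod 𝓘(ℝ, ℝ)) (𝓘(ℝ, Fin 3 → ℝ).prod 𝓘(ℝ, ℝ)).tangent ∞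
      fun p => (⟨p, leftInvariant a r p⟩ :
        TangentBundle (𝓘(ℝ, Fin 3 → ℝ).prod 𝓘(ℝ, ℝ)) (SO3 × ℝ)) := by
  intro p
  have hsrc := extChartAt_source_mem_nhds (I := 𝓘(ℝ, Fin 3 → ℝ).prod 𝓘(ℝ, ℝ)) p
  have h1 : ContMDiffAt (𝓘(ℝ, Fin 3 → ℝ).prod 𝓘(ℝ, ℝ)) 𝓘(ℝ, (Fin 3 → ℝ) × ℝ) ∞
      (fun z => leftInvariantChart a r (extChartAt (𝓘(ℝ, Fin 3 → ℝ).prod 𝓘(ℝ, ℝ)) p z)) p :=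
    (contDiff_leftInvariantChart a r).contMDiff.contMDiffAt.comp p contMDiffAt_extChartAt
  refine (Bundle.contMDiffAt_section p).2 (h1.congr_of_eventuallyEq ?_)
  filter_upwards [hsrc] with z hz
  refine Eq.trans ?_ (trivializationAt_leftInvariant a r p z hz)
  rw [← leftInvariant_apply a r z]
  rfl

theorem chartField_leftInvariant (a : Fin 3 → ℝ) (r : ℝ) (p : SO3 × ℝ)
    (y : (Fin 3 → ℝ) × ℝ) :
    chartField (𝓘(ℝ, Fin 3 → ℝ).prod 𝓘(ℝ, ℝ)) p (leftInvariant a r) y =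
      leftInvariantChart a r y := by
  have hy : y ∈ (extChartAt (𝓘(ℝ, Fin 3 → ℝ).prod 𝓘(ℝ, ℝ)) p).target := by
    rw [extChartAt_target, ModelWithCorners.range_eq_univ, inter_univ]
    exact ⟨mem_univ _, mem_univ _⟩
  have hr := (extChartAt (𝓘(ℝ, Fin 3 → ℝ).prod 𝓘(ℝ, ℝ)) p).right_inv hy
  have hz := (extChartAt (𝓘(ℝ, Fin 3 → ℝ).prod 𝓘(ℝ, ℝ)) p).map_target hy
  set z := (extChartAt (𝓘(ℝ, Fin 3 → ℝ).prod 𝓘(ℝ, ℝ)) p).symm y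
  have h1 := mfderiv_extChartAt_apply p (leftInvariant a r) hz
  rw [hr] at h1
  refine h1.symm.trans ?_
  have h2 := trivializationAt_leftInvariant a r p z hz
  rw [hr] at h2
  refine Eq.trans ?_ h2
  have h3 : mfderiv (𝓘(ℝ, Fin 3 → ℝ).prod 𝓘(ℝ, ℝ)) 𝓘(ℝ, (Fin 3 → ℝ) × ℝ)
      (extChartAt (𝓘(ℝ, Fin 3 → ℝ).prod 𝓘(ℝ, ℝ)) p) z = _ :=
    ((contMDiffAt_extChartAt_of_mem p hz).mdifferentiableAt (by simp)).mfderiv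
  rw [h3, ← leftInvariant_apply a r z]
  rfl

/-- The derivative at the centre of the chart. -/
theorem fderiv_leftInvariantChart (a : Fin 3 → ℝ) (r t : ℝ) (w : (Fin 3 → ℝ) × ℝ) :
    fderiv ℝ (leftInvariantChart a r) (0, t) w = ((1 / 2 : ℝ) • crossProduct w.1 a, 0) := by
  have hl : HasDerivAt (fun τ : ℝ => ((0 : Fin 3 → ℝ), t) + τ • w) w 0 := by
    simpa using ((hasDerivAt_id (0 : ℝ)).smul_const w).const_add ((0 : Fin 3 → ℝ), t)
  have hd := ((contDiff_leftInvariantChart a r).differentiable (by simp)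
    ((0 : Fin 3 → ℝ), t)).hasFDerivAt
  have h1 : HasDerivAt (fun τ : ℝ => leftInvariantChart a r (((0 : Fin 3 → ℝ), t) + τ • w))
      (fderiv ℝ (leftInvariantChart a r) (0, t) w) 0 :=
    HasFDerivAt.comp_hasDerivAt (l := leftInvariantChart a r) (0 : ℝ) (by simpa using hd) hl
  refine h1.unique ?_
  have hq : ∀ p q m : ℝ, HasDerivAt (fun τ : ℝ => p + q * τ + m * τ ^ 2) q 0 := by
    intro p q m
    have h := (((hasDerivAt_id (0 : ℝ)).const_mul q).const_add p).add
      (((hasDerivAt_id (0 : ℝ)).pow 2).const_mul m)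
    exact h.congr_deriv (by simp)
  refine HasDerivAt.prodMk (hasDerivAt_pi.2 fun k => ?_) (hasDerivAt_const _ _)
  have hk : (fun τ : ℝ => rotField a (((0 : Fin 3 → ℝ), t) + τ • w).1 k) = fun τ : ℝ =>
      a k / 2 + ((1 / 2 : ℝ) • crossProduct w.1 a) k * τ +
        ((a 0 * w.1 0 + a 1 * w.1 1 + a 2 * w.1 2) * w.1 k / 2) * τ ^ 2 := by
    funext τ
    fin_cases k <;> simp [rotField, cross_apply] <;> ring
  exact hk ▸ hq _ _ _

/-- At the centre of the chart the field of a is a/2 with derivative w ↦ (w × a)/2. The coordinate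
formula gives (a × a')/4 − (a' × a)/4 = (a × a')/2, the field of a × a'; the ℝ-component is constant
and drops out. -/
theorem mlieBracket_leftInvariant (a a' : Fin 3 → ℝ) (r r' : ℝ) :
    VectorField.mlieBracket (𝓘(ℝ, Fin 3 → ℝ).prod 𝓘(ℝ, ℝ)) (leftInvariant a r)
      (leftInvariant a' r') = leftInvariant (crossProduct a a') 0 := by
  funext p
  have hp : extChartAt (𝓘(ℝ, Fin 3 → ℝ).prod 𝓘(ℝ, ℝ)) p p = (0, p.2) := by
    rw [extChartAt_so3_prod, inv_mul_cancel]
    exact congrArg (fun u : Fin 3 → ℝ => (u, p.2)) cayleyInv_one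
  have h1 := chartField_mlieBracket p (contMDiff_leftInvariant a r) (contMDiff_leftInvariant a' r')
    (mem_extChartAt_target p)
  have h2 := chartField_self p (VectorField.mlieBracket (𝓘(ℝ, Fin 3 → ℝ).prod 𝓘(ℝ, ℝ))
    (leftInvariant a r) (leftInvariant a' r'))
  refine Eq.trans (α := (Fin 3 → ℝ) × ℝ) (h2.symm.trans h1) ?_
  refine Eq.trans ?_ (leftInvariant_apply (crossProduct a a') 0 p).symm
  have h3 : ∀ (a : Fin 3 → ℝ) (r : ℝ), chartField (𝓘(ℝ, Fin 3 → ℝ).prod 𝓘(ℝ, ℝ)) p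
      (leftInvariant a r) = leftInvariantChart a r :=
    fun a r => funext fun y => chartField_leftInvariant a r p y
  rw [h3, h3, hp, VectorField.lieBracket, fderiv_leftInvariantChart, fderiv_leftInvariantChart]
  refine Prod.ext ?_ (sub_self _)
  funext k
  fin_cases k <;> simp [leftInvariantChart, rotField, cross_apply] <;> ring

end LeftInvariant

/-! ### The structure equations of the example. -/

section Example

theorem exampleX1_eq : exampleX1 = leftInvariant ((1 / √2) • ![1, 1, 0]) ((1 / √2) * 2) := rfl

theorem exampleX2_eq : exampleX2 = leftInvariant ((1 / √2) • ![1, 0, 0]) ((1 / √2) * 1) := rfl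

theorem inv_sqrt_two_mul_self : (1 / √2 : ℝ) * (1 / √2) = 1 / 2 := by
  rw [div_mul_div_comm, Real.mul_self_sqrt (by norm_num), one_mul]

theorem mlieBracket_example :
    VectorField.mlieBracket (𝓘(ℝ, Fin 3 → ℝ).prod 𝓘(ℝ, ℝ)) exampleX1 exampleX2 =
      leftInvariant ![0, 0, -1 / 2] 0 := by
  have h := inv_sqrt_two_mul_self
  rw [exampleX1_eq, exampleX2_eq, mlieBracket_leftInvariant]
  congr 1
  generalize 1 / √2 = κ at h ⊢
  funext k
  fin_cases k <;> simp [cross_apply]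
  linarith

/-- All fields have constant coordinates (a/2, r), so each axiom is a computation with cross
products in ℝ³ × ℝ. For transversality, comparing the ℝ-components and the first coordinates gives
2x + y = 0 and x + y = 0, so x = 0; the second coordinate then gives a contradiction. -/
theorem isRegularEngel_example :
    IsRegularEngel (𝓘(ℝ, Fin 3 → ℝ).prod 𝓘(ℝ, ℝ)) exampleX1 exampleX2
      (fun _ => 1 / 2) (fun _ => -1) (fun _ => 0) where
  dim := by simp
  smooth_X₁ := contMDiff_leftInvariant _ _
  smooth_X₂ := contMDiff_leftInvariant _ _
  smooth_β := contMDiff_const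
  smooth_α₀ := contMDiff_const
  smooth_α₁ := contMDiff_const
  independent := by
    intro p
    have hκ : (1 / √2 : ℝ) ≠ 0 := by positivity
    have key : LinearIndependent ℝ ![(((1 / 2 : ℝ) • ((1 / √2) • ![1, 1, 0]), (1 / √2) * 2) :
        (Fin 3 → ℝ) × ℝ), ((1 / 2 : ℝ) • ((1 / √2) • ![1, 0, 0]), (1 / √2) * 1),
        ((1 / 2 : ℝ) • ![0, 0, -1 / 2], 0)] := by
      generalize 1 / √2 = κ at hκ ⊢
      rw [Fintype.linearIndependent_iff]
      intro g hg
      rw [Fin.sum_univ_three] at hg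
      have e0 := congrFun (congrArg Prod.fst hg) 0
      have e1 := congrFun (congrArg Prod.fst hg) 1
      have e2 := congrFun (congrArg Prod.fst hg) 2
      simp at e0 e1 e2
      have g0 : g 0 = 0 := e1.resolve_right hκ
      have g1 : g 1 = 0 := by simpa [g0, hκ] using e0
      intro i
      fin_cases i
      exacts [g0, g1, e2]
    rw [mlieBracket_example]
    have h1 := leftInvariant_apply ((1 / √2) • ![1, 1, 0]) ((1 / √2) * 2) p
    have h2 := leftInvariant_apply ((1 / √2) • ![1, 0, 0]) ((1 / √2) * 1) p
    have h3 := leftInvariant_apply ![0, 0, -1 / 2] 0 p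
    rw [← h1, ← h2, ← h3] at key
    exact key
  structure_eq := by
    intro p
    have h := inv_sqrt_two_mul_self
    rw [mlieBracket_example]
    have h1 := leftInvariant_apply ((1 / √2) • ![1, 1, 0]) ((1 / √2) * 2) p
    have h2 := leftInvariant_apply ((1 / √2) • ![1, 0, 0]) ((1 / √2) * 1) p
    have h3 := leftInvariant_apply ![0, 0, -1 / 2] 0 p
    rw [exampleX1_eq, exampleX2_eq, mlieBracket_leftInvariant]
    have h4 := leftInvariant_apply
      (crossProduct ((1 / √2) • ![1, 1, 0]) ![0, 0, -1 / 2]) 0 p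
    have key : (((1 / 2 : ℝ) • crossProduct ((1 / √2) • ![1, 1, 0]) ![0, 0, -1 / 2], 0) :
        (Fin 3 → ℝ) × ℝ) =
        (1 / 2 : ℝ) • ((1 / 2 : ℝ) • ((1 / √2) • ![1, 1, 0]), (1 / √2) * 2) +
        (-1 : ℝ) • ((1 / 2 : ℝ) • ((1 / √2) • ![1, 0, 0]), (1 / √2) * 1) +
        (0 : ℝ) • ((1 / 2 : ℝ) • ![0, 0, -1 / 2], 0) := by
      generalize 1 / √2 = κ at h ⊢
      refine Prod.ext ?_ ?_
      · funext k
        fin_cases k <;> simp [cross_apply] <;> ring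
      · simp
        ring
    rw [← h1, ← h2, ← h3, ← h4] at key
    exact key
  transversal := by
    intro p hmem
    have hκ : (1 / √2 : ℝ) ≠ 0 := by positivity
    rw [mlieBracket_example] at hmem
    have h1 := leftInvariant_apply ((1 / √2) • ![1, 1, 0]) ((1 / √2) * 2) p
    have h2 := leftInvariant_apply ((1 / √2) • ![1, 0, 0]) ((1 / √2) * 1) p
    have h3 := leftInvariant_apply ![0, 0, -1 / 2] 0 p
    rw [exampleX1_eq, exampleX2_eq, mlieBracket_leftInvariant] at hmem
    have h4 := leftInvariant_apply
      (crossProduct ![0, 0, -1 / 2] ((1 / √2) • ![1, 0, 0])) 0 p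
    have key : ¬ (((1 / 2 : ℝ) • crossProduct ![0, 0, -1 / 2] ((1 / √2) • ![1, 0, 0]), 0) :
        (Fin 3 → ℝ) × ℝ) ∈ Submodule.span ℝ {(((1 / 2 : ℝ) • ((1 / √2) • ![1, 1, 0]),
          (1 / √2) * 2) : (Fin 3 → ℝ) × ℝ), ((1 / 2 : ℝ) • ((1 / √2) • ![1, 0, 0]), (1 / √2) * 1),
        ((1 / 2 : ℝ) • ![0, 0, -1 / 2], 0)} := by
      generalize 1 / √2 = κ at hκ ⊢
      rw [Submodule.mem_span_triple]
      rintro ⟨x, y, z, h⟩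
      have e0 := congrFun (congrArg Prod.fst h) 0
      have e1 := congrFun (congrArg Prod.fst h) 1
      have e3 := congrArg Prod.snd h
      simp [cross_apply] at e0 e1 e3
      have f0 : (x + y) * κ = 0 := by linear_combination 2 * e0
      have f3 : (2 * x + y) * κ = 0 := by linear_combination e3
      have f0' := (mul_eq_zero.1 f0).resolve_right hκ
      have f3' := (mul_eq_zero.1 f3).resolve_right hκ
      have hx : x = 0 := by linarith
      rw [hx] at e1
      exact hκ (by linear_combination 4 * e1)
    rw [← h1, ← h2, ← h3, ← h4] at key
    exact key hmem

end Example

/-! ### Explicit Jacobi functions and conjugate points of the example. -/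

section ExampleConjugate

/-- The equation is y'' = x/2 − y. The two explicit functions solve it with x = 1 and x = 0 and have
the end data of `A` and `C`, so `IsJacobi.eq_combination` identifies them. -/
theorem IsJacobi.eq_sin_cos {s : ℝ} {A B C a b c : ℝ → ℝ}
    (h : IsJacobi s (fun _ => 1 / 2) (fun _ => -1) (fun _ => 0) A B C a b c) {t : ℝ}
    (ht : t ∈ Icc 0 s) :
    A t = (1 - Real.cos (t - s)) / 2 ∧ a t = Real.sin (t - s) / 2 ∧ C t = Real.sin (t - s) := by
  have hsin : ∀ t, HasDerivAt (fun t => Real.sin (t - s)) (Real.cos (t - s)) t := fun t => by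
    simpa using ((hasDerivAt_id t).sub_const s).sin
  have hcos : ∀ t, HasDerivAt (fun t => Real.cos (t - s)) (-Real.sin (t - s)) t := fun t => by
    simpa using ((hasDerivAt_id t).sub_const s).cos
  have h1 := h.eq_combination (y := fun t => (1 - Real.cos (t - s)) / 2)
    (w := fun t => Real.sin (t - s) / 2) (x := (1 : ℝ))
    (fun t _ => (((hcos t).const_sub 1).div_const 2).congr_deriv (by ring))
    (fun t _ => ((hsin t).div_const 2).congr_deriv (by simp only [smul_eq_mul]; ring)) t ht
  have h2 := h.eq_combination (y := fun t => Real.sin (t - s))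
    (w := fun t => Real.cos (t - s)) (x := (0 : ℝ)) (fun t _ => hsin t)
    (fun t _ => (hcos t).congr_deriv (by simp only [smul_eq_mul]; ring)) t ht
  simp only [sub_self, Real.cos_zero, Real.sin_zero, zero_div, smul_eq_mul, mul_one, mul_zero,
    add_zero, zero_add] at h1 h2
  exact ⟨h1.1.symm, h1.2.symm, h2.1.symm⟩

theorem conjugate_example {s : ℝ} (hs : 0 < s) {γ : ℝ → SO3 × ℝ}
    (hγ : IsMIntegralCurveOn (I := 𝓘(ℝ, Fin 3 → ℝ).prod 𝓘(ℝ, ℝ)) γ exampleX1 (Icc 0 s)) :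
    IsStrictlySingular (𝓘(ℝ, Fin 3 → ℝ).prod 𝓘(ℝ, ℝ)) exampleX1 exampleX2 (γ 0) s ∧
    (IsConjugate (𝓘(ℝ, Fin 3 → ℝ).prod 𝓘(ℝ, ℝ))
      (endpointMap (𝓘(ℝ, Fin 3 → ℝ).prod 𝓘(ℝ, ℝ)) exampleX1 exampleX2 (γ 0) s) ↔
        Real.sin s = 0) ∧
    (IsConjugate ((𝓘(ℝ, Fin 3 → ℝ).prod 𝓘(ℝ, ℝ)).prod 𝓘(ℝ, ℝ))
      (extendedEndpointMap (𝓘(ℝ, Fin 3 → ℝ).prod 𝓘(ℝ, ℝ)) exampleX1 exampleX2 (γ 0) s) ↔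
        s * Real.sin s + 2 * (Real.cos s - 1) = 0) := by
  obtain ⟨A, B, C, a, b, c, e, hJ, -, he, -, hF, hst, hFF⟩ :=
    exists_jacobi_conjugate isRegularEngel_example hs hγ
  have h0 : (0 : ℝ) ∈ Icc 0 s := ⟨le_rfl, hs.le⟩
  have hsing : IsStrictlySingular (𝓘(ℝ, Fin 3 → ℝ).prod 𝓘(ℝ, ℝ)) exampleX1 exampleX2 (γ 0) s := by
    -- At this time `a` equals −sin(min s 1)/2, nonzero because 0 < min s 1 < π.
    refine hst.2 ⟨s - min s 1, ⟨by linarith [min_le_left s 1], by linarith [lt_min hs one_pos]⟩, ?_⟩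
    have hpos := lt_min hs one_pos
    rw [(hJ.eq_sin_cos ⟨by linarith [min_le_left s 1], by linarith⟩).2.1, sub_sub_cancel_left,
      Real.sin_neg]
    have := Real.sin_pos_of_pos_of_lt_pi hpos (by linarith [min_le_right s 1, Real.pi_gt_three])
    linarith
  have hsin : ∀ t, HasDerivAt (fun t => Real.sin (t - s)) (Real.cos (t - s)) t := fun t => by
    simpa using ((hasDerivAt_id t).sub_const s).sin
  have hcos : ∀ t, HasDerivAt (fun t => Real.cos (t - s)) (-Real.sin (t - s)) t := fun t => by
    simpa using ((hasDerivAt_id t).sub_const s).cos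
  have he1 : ∀ t ∈ Icc 0 s, e t = 1 := fun t ht => by rw [he t ht]; simp
  have hA : ∫ t in (0 : ℝ)..s, (1 / 2) * e t * A t = (s - Real.sin s) / 4 := by
    have h1 : ∫ t in (0 : ℝ)..s, (1 / 2) * e t * A t =
        ∫ t in (0 : ℝ)..s, (1 - Real.cos (t - s)) / 4 := by
      refine intervalIntegral.integral_congr fun t ht => ?_
      rw [uIcc_of_le hs.le] at ht
      simp only [he1 t ht, (hJ.eq_sin_cos ht).1]
      ring
    rw [h1, intervalIntegral.integral_eq_sub_of_hasDerivAt
      (fun t _ => ((hasDerivAt_id t).sub (hsin t)).div_const 4)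
      (Continuous.intervalIntegrable (by fun_prop) _ _)]
    simp
    ring
  have hC : ∫ t in (0 : ℝ)..s, (1 / 2) * e t * C t = (Real.cos s - 1) / 2 := by
    have h1 : ∫ t in (0 : ℝ)..s, (1 / 2) * e t * C t =
        ∫ t in (0 : ℝ)..s, - -Real.sin (t - s) / 2 := by
      refine intervalIntegral.integral_congr fun t ht => ?_
      rw [uIcc_of_le hs.le] at ht
      simp only [he1 t ht, (hJ.eq_sin_cos ht).2.2]
      ring
    rw [h1, intervalIntegral.integral_eq_sub_of_hasDerivAt
      (fun t _ => (hcos t).neg.div_const 2)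
      (Continuous.intervalIntegrable (by fun_prop) _ _)]
    simp
    ring
  refine ⟨hsing, ?_, ?_⟩
  · rw [hF, (hJ.eq_sin_cos h0).2.2, zero_sub, Real.sin_neg, neg_eq_zero]
  · rw [hFF hsing, hA, hC, (hJ.eq_sin_cos h0).1, (hJ.eq_sin_cos h0).2.2, zero_sub, Real.sin_neg,
      Real.cos_neg]
    -- The kernel determinant with the explicit integrals; sin² + cos² = 1 leaves the stated
    -- function up to the factor −1/4.
    have hid : -Real.sin s * ((s - Real.sin s) / 4) -
        (1 - Real.cos s) / 2 * ((Real.cos s - 1) / 2) =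
        -(s * Real.sin s + 2 * (Real.cos s - 1)) / 4 := by
      linear_combination (1 / 4) * Real.sin_sq_add_cos_sq s
    rw [hid]
    constructor <;> intro h <;> linarith

end ExampleConjugate

end RankTwo

theorem mainTheorem6 :
    (∀ (E : Type*) [NormedAddCommGroup E] [NormedSpace ℝ E]
      (H : Type*) [TopologicalSpace H] (I : ModelWithCorners ℝ E H) [I.Boundaryless]
      (M : Type*) [TopologicalSpace M] [ChartedSpace H M] [IsManifold I ∞ M] [T2Space M]
      (X₁ X₂ : (x : M) → TangentSpace I x) (β α₀ α₁ : M → ℝ)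
      (_ : RankTwo.IsRegularEngel I X₁ X₂ β α₀ α₁)
      (s : ℝ) (_ : 0 < s) (γ : ℝ → M) (_ : IsMIntegralCurveOn (I := I) γ X₁ (Icc 0 s)),
      (RankTwo.IsConjugate I (RankTwo.endpointMap I X₁ X₂ (γ 0) s) ↔
        exteriorPower.ιMulti ℝ 3
          ![X₁ (γ s), X₂ (γ s), RankTwo.gField I X₁ X₂ s 0 (γ s)] = 0) ∧
      (RankTwo.IsStrictlySingular I X₁ X₂ (γ 0) s →
        (RankTwo.IsConjugate (I.prod 𝓘(ℝ, ℝ)) (RankTwo.extendedEndpointMap I X₁ X₂ (γ 0) s) ↔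
          exteriorPower.ιMulti ℝ 3
            ![X₂ (γ s), RankTwo.gField I X₁ X₂ s 0 (γ s),
              RankTwo.weightedIntegral I X₁ X₂ β α₁ γ s] = 0))) ∧
    RankTwo.IsRegularEngel (𝓘(ℝ, Fin 3 → ℝ).prod 𝓘(ℝ, ℝ)) RankTwo.exampleX1 RankTwo.exampleX2
      (fun _ => 1 / 2) (fun _ => -1) (fun _ => 0) ∧
    ∀ (s : ℝ) (_ : 0 < s) (γ : ℝ → RankTwo.SO3 × ℝ)
      (_ : IsMIntegralCurveOn (I := 𝓘(ℝ, Fin 3 → ℝ).prod 𝓘(ℝ, ℝ)) γ RankTwo.exampleX1 (Icc 0 s)),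
      RankTwo.IsStrictlySingular (𝓘(ℝ, Fin 3 → ℝ).prod 𝓘(ℝ, ℝ)) RankTwo.exampleX1
        RankTwo.exampleX2 (γ 0) s ∧
      (RankTwo.IsConjugate (𝓘(ℝ, Fin 3 → ℝ).prod 𝓘(ℝ, ℝ))
          (RankTwo.endpointMap (𝓘(ℝ, Fin 3 → ℝ).prod 𝓘(ℝ, ℝ)) RankTwo.exampleX1
            RankTwo.exampleX2 (γ 0) s) ↔
        Real.sin s = 0) ∧
      (RankTwo.IsConjugate ((𝓘(ℝ, Fin 3 → ℝ).prod 𝓘(ℝ, ℝ)).prod 𝓘(ℝ, ℝ))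
          (RankTwo.extendedEndpointMap (𝓘(ℝ, Fin 3 → ℝ).prod 𝓘(ℝ, ℝ)) RankTwo.exampleX1
            RankTwo.exampleX2 (γ 0) s) ↔
        s * Real.sin s + 2 * (Real.cos s - 1) = 0) :=
  ⟨fun _ _ _ _ _ _ _ _ _ _ _ _ _ _ _ _ _ hE _ hs _ hγ =>
      RankTwo.conjugate_iff_wedge hE hs hγ,
    RankTwo.isRegularEngel_example,
    fun _ hs _ hγ => RankTwo.conjugate_example hs hγ⟩
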